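/- **Setting.** A layered arithmetic circuit $C$ of fan-in two over a finite field $\mathbb F$ has layers $1,\dots,d$ with $d\ge 2$; layer $1$ consists of the outputs and layer $d$ of the inputs. Layer $i$ has $S_i=2^{s_i}$ gates, labelled by the bit strings in $\{0,1\}^{s_i}$. Every gate of a layer $i<d$ is an addition or a multiplication gate and has two in-neighbours in layer $i+1$. Let $S=\sum_i S_i$ be the size of $C$, $n=S_d$ the number of inputs and $|\mathcal O|=S_1$ the number of outputs. For $1\le i<d$ let $\mathrm{in}_1^{(i)},\mathrm{in}_2^{(i)}:\{0,1\}^{s_i}\to\{0,1\}^{s_{i+1}}$ map the label of a gate to the labels of its first and second in-neighbour, and let $\mathrm{type}^{(i)}:\{0,1\}^{s_i}\to\{0,1\}$ tell addition gates from multiplication gates. Fix a constant $c$. A function $f:\{0,1\}^v\to\{0,1\}^{v'}$ is *regular* if it can be evaluated in constant time and there is a set $\mathcal S$ of at most $c$ input bits such that (1) every input bit outside $\mathcal S$ affects at most $c$ output bits, and these can be enumerated in constant time, and (2) every output bit depends on at most one input bit. The functions $\mathrm{in}_1^{(i)}$ and $\mathrm{in}_2^{(i)}$ are *similar* if, outside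 some set of at most $c$ output bits, they agree in every output bit on all inputs. The input $a\in\mathbb F^n$ is given as a stream of at most $cn$ updates $(j,\delta)$, $\delta\in\mathbb F$, in any order; $a_j$ is the sum of all $\delta$ that come with $j$. A prover $\mathcal P$ and a verifier $\mathcal V$ observe the stream and then exchange messages; $\mathcal V$ uses random bits and outputs a value or $\perp$. The pair is a *valid interactive proof protocol* for a function $f$ if on every input $\mathcal V$ outputs the value of $f$ with probability $1$ when it interacts with $\mathcal P$, and outputs something other than the value of $f$ and $\perp$ with probability at most $1/3$ when it interacts with any prover. Costs refer to a word RAM with words of $w$ bits that also stores field elements; word operations, field operations, memory accesses, sending or receiving or drawing a field element, evaluating $\mathrm{in}_1^{(i)}$, $\mathrm{in}_2^{(i)}$, $\mathrm{type}^{(i)}$, and each step of the enumerations above take unit time. **Theorem.** For every $c$ there are a constant $K$ and programs $\mathcal V$, $\mathcal P$, depending only on $c$, such that the following holds for every finite field $\mathbb F$ and every circuit $C$ as above with $|\mathbb F|\ge K\,d\log S$, and every word length $w\ge K\log S$. Suppose that $\mathrm{in}_1^{(i)}$, $\mathrm{in}_2^{(i)}$ and $\mathrm{type}^{(i)}$ are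 regular for all layers $1\le i<d$, and that $\mathrm{in}_1^{(i)}$ is similar to $\mathrm{in}_2^{(i)}$ for all but at most $c$ of these layers. Then $(\mathcal P,\mathcal V)$ is a valid interactive proof protocol for the function computed by $C$, with the following costs. - The total communication is at most $|\mathcal O|+K\,d\log S$ field elements. - $\mathcal V$ runs in time at most $K\,(n\log n+|\mathcal O|+d\log S)$, against every prover. - $\mathcal V$ makes a single pass over the input stream, before the interaction, and uses a fixed number (depending only on $c$) of arrays of $K\log S$ field elements or words, that is, $O(\log S)$ space. (Messages are received one field element at a time, and the output is written to a write-only tape.) - $\mathcal P$ runs in time at most $K S$. (Logarithms are to base $2$ and rounded down.) -/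

import Mathlib

universe u

/-! ### Layered arithmetic circuits -/

/-- The three functions that describe the wiring of a layer. -/
inductive Wiring
  | in₁
  | in₂
  | type

/-- A layered arithmetic circuit of fan-in two. The layers are numbered `1` (outputs) to `depth`
(inputs), and layer `i` has `2 ^ logSize i` gates, labelled by the bit strings of length
`logSize i`. The in-neighbours of a gate of layer `i` lie in layer `i + 1`. Only the values of the
fields at `1 ≤ i ≤ depth` (for `logSize`) and `1 ≤ i < depth` (for the others) matter. -/
structure Circuit where
  depth : ℕ
  two_le_depth : 2 ≤ depth
  logSize : ℕ → ℕ
  in₁ : ∀ i, BitVec (logSize i) → BitVec (logSize (i + 1))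
  in₂ : ∀ i, BitVec (logSize i) → BitVec (logSize (i + 1))
  /-- `false` for an addition gate and `true` for a multiplication gate. -/
  type : ∀ i, BitVec (logSize i) → Bool

namespace Circuit

/-- The number `S` of gates (input gates included). -/
def size (C : Circuit) : ℕ := ∑ i ∈ Finset.Icc 1 C.depth, 2 ^ C.logSize i

/-- The number `n` of inputs. -/
def numInputs (C : Circuit) : ℕ := 2 ^ C.logSize C.depth

/-- The number `|O|` of outputs. -/
def numOutputs (C : Circuit) : ℕ := 2 ^ C.logSize 1

/-- An input of the circuit: a field element for every label of the input layer. -/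
abbrev Input (C : Circuit) (F : Type u) : Type u := BitVec (C.logSize C.depth) → F

/-- `C.value a k i h p` is the value of gate `p` of layer `i` on input `a`; here `k` is the distance
of layer `i` from the input layer. -/
def value {F : Type u} [Add F] [Mul F] (C : Circuit) (a : C.Input F) :
    ∀ (k i : ℕ), i + k = C.depth → BitVec (C.logSize i) → F
  | 0, _, h => fun p => a (p.cast (congrArg C.logSize h))
  | k + 1, i, h => fun p =>
      let x := C.value a k (i + 1) (by omega) (C.in₁ i p)
      let y := C.value a k (i + 1) (by omega) (C.in₂ i p)
      if C.type i p then x * y else x + y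

/-- The function computed by the circuit: the values of the gates of layer `1`, in the order of
their labels. -/
def outputs {F : Type u} [Add F] [Mul F] (C : Circuit) (a : C.Input F) : List F :=
  List.ofFn fun p : Fin (2 ^ C.logSize 1) =>
    C.value a (C.depth - 1) 1 (by have := C.two_le_depth; omega) (BitVec.ofFin p)

/-- The number of output bits of a wiring function of layer `i`. -/
def outWidth (C : Circuit) (i : ℕ) : Wiring → ℕ
  | .in₁ => C.logSize (i + 1)
  | .in₂ => C.logSize (i + 1)
  | .type => 1

/-- The wiring functions of layer `i` as functions from bit strings to bit strings. -/
def wiring (C : Circuit) (i : ℕ) :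
    ∀ f : Wiring, BitVec (C.logSize i) → BitVec (C.outWidth i f)
  | .in₁ => C.in₁ i
  | .in₂ => C.in₂ i
  | .type => fun p => BitVec.ofBool (C.type i p)

end Circuit

/-! ### Regular and similar wiring functions -/

section Regular

variable {v v' : ℕ}

/-- The output bit `k` of `f` depends on the input bit `j` (equivalently, `j` affects `k`). -/
def OutputDependsOn (f : BitVec v → BitVec v') (k : Fin v') (j : Fin v) : Prop :=
  ∃ x y : BitVec v, (∀ l, l ≠ j → x.getLsb l = y.getLsb l) ∧ (f x).getLsb k ≠ (f y).getLsb k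

open Classical in
/-- The set of the output bits of `f` that the input bit `j` affects. -/
noncomputable def affectedBits (f : BitVec v → BitVec v') (j : Fin v) : Finset (Fin v') :=
  Finset.univ.filter fun k => OutputDependsOn f k j

/-- The combinatorial part of regularity of `f`, with the set `S` of exceptional input bits and with
`c` in place of every `O(1)`. (That `f` can be evaluated, and that the sets of affected output bits
can be enumerated, in constant time is built into the machine below, whose unit-cost instructions
include these evaluations and enumerations.) -/
structure IsRegularWith (c : ℕ) (f : BitVec v → BitVec v') (S : Finset (Fin v)) : Prop where
  card_le : S.card ≤ c
  affected_le : ∀ j, j ∉ S → (affectedBits f j).card ≤ c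
  depends_le_one : ∀ k j₁ j₂, OutputDependsOn f k j₁ → OutputDependsOn f k j₂ → j₁ = j₂

/-- `f` and `g` agree in all but at most `c` fixed output bits. -/
def IsSimilar (c : ℕ) (f g : BitVec v → BitVec v') : Prop :=
  ∃ T : Finset (Fin v'), T.card ≤ c ∧ ∀ x k, k ∉ T → (f x).getLsb k = (g x).getLsb k

end Regular

/-- For every layer and every wiring function, a set of (exceptional) input bits. -/
abbrev Circuit.Exceptions (C : Circuit) : Type :=
  ∀ (i : ℕ), Wiring → Finset (Fin (C.logSize i))

open Classical in
/-- The layers (other than the input layer) at which `in₁` is not similar to `in₂`. -/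
noncomputable def Circuit.dissimilarLayers (C : Circuit) (c : ℕ) : Finset ℕ :=
  (Finset.Ico 1 C.depth).filter fun i => ¬ IsSimilar c (C.in₁ i) (C.in₂ i)

/-! ### The machine

A word RAM with two memories, one for words of `w` bits and one for field elements. Each memory
consists of arrays; the name of an array is a constant of the program, so that a program uses a fixed
number of arrays, and every array has `memSize` cells. Every operation on words, every field
operation, every memory access, every wiring instruction and every input or output instruction takes
one unit of time. Programs are finite, and the machine learns about the circuit only through its
wiring instructions. -/

/-- The wiring instructions. -/
inductive Query
  /-- the depth of the circuit -/
  | depth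
  /-- `i ↦ logSize i` -/
  | logSize
  /-- `i, p ↦` the value of the wiring function of layer `i` at the bit string `p` -/
  | eval (f : Wiring)
  /-- `i ↦` the number of exceptional input bits of the wiring function of layer `i` -/
  | numExceptions (f : Wiring)
  /-- `i, k ↦` the `k`-th exceptional input bit of the wiring function of layer `i` -/
  | exception (f : Wiring)
  /-- `i, j ↦` the number of output bits that the non-exceptional input bit `j` affects -/
  | numAffected (f : Wiring)
  /-- `i, j, k ↦` the `k`-th output bit that the non-exceptional input bit `j` affects -/
  | affected (f : Wiring)

/-- The answers to the wiring instructions; bit strings are read as numbers in binary, and bits are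
numbered from `0`. -/
noncomputable def Circuit.answer (C : Circuit) (S : C.Exceptions) : Query → ℕ → ℕ → ℕ → ℕ
  | .depth, _, _, _ => C.depth
  | .logSize, i, _, _ => C.logSize i
  | .eval f, i, p, _ => (C.wiring i f (BitVec.ofNat _ p)).toNat
  | .numExceptions f, i, _, _ => (S i f).card
  | .exception f, i, k, _ => ((S i f).sort.map Fin.val).getD k 0
  | .numAffected f, i, j, _ =>
      if h : j < C.logSize i then
        if ⟨j, h⟩ ∈ S i f then 0 else (affectedBits (C.wiring i f) ⟨j, h⟩).card
      else 0
  | .affected f, i, j, k =>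
      if h : j < C.logSize i then
        if ⟨j, h⟩ ∈ S i f then 0
        else ((affectedBits (C.wiring i f) ⟨j, h⟩).sort.map Fin.val).getD k 0
      else 0

/-- Binary operations on words. -/
inductive WordOp
  | add | sub | mul | div | mod | and | or | xor | shl | shr | lt | eq

/-- The operations before the reduction to `w` bits (`sub` is truncated at `0`). -/
def WordOp.eval : WordOp → ℕ → ℕ → ℕ
  | .add, x, y => x + y
  | .sub, x, y => x - y
  | .mul, x, y => x * y
  | .div, x, y => x / y
  | .mod, x, y => x % y
  | .and, x, y => x &&& y
  | .or, x, y => x ||| y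
  | .xor, x, y => x ^^^ y
  | .shl, x, y => x <<< y
  | .shr, x, y => x >>> y
  | .lt, x, y => if x < y then 1 else 0
  | .eq, x, y => if x = y then 1 else 0

/-- Word-valued expressions. -/
inductive WExp
  | const (m : ℕ)
  /-- cell `i` of the word array `a` -/
  | get (a : ℕ) (i : WExp)
  | op (o : WordOp) (x y : WExp)
  | query (q : Query) (x y z : WExp)

/-- Field-valued expressions. -/
inductive FExp
  | zero
  | one
  /-- cell `i` of the field array `a` -/
  | get (a : ℕ) (i : WExp)
  | add (x y : FExp)
  | sub (x y : FExp)
  | mul (x y : FExp)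

/-- Programs. -/
inductive Cmd
  | skip
  /-- cell `i` of the word array `a` becomes `e` -/
  | setW (a : ℕ) (i e : WExp)
  /-- cell `i` of the field array `a` becomes `e` -/
  | setF (a : ℕ) (i : WExp) (e : FExp)
  | seq (c₁ c₂ : Cmd)
  /-- execute `c₁` if the word `e` is not zero, otherwise `c₂` -/
  | ifW (e : WExp) (c₁ c₂ : Cmd)
  /-- execute `c₁` if the field element `e` is zero, otherwise `c₂` -/
  | ifZ (e : FExp) (c₁ c₂ : Cmd)
  /-- execute `c` as many times as the word `e` says -/
  | loop (e : WExp) (c : Cmd)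
  /-- send `e` to the other party -/
  | send (e : FExp)
  /-- receive the next field element from the other party into cell `i` of the field array `a` -/
  | recv (a : ℕ) (i : WExp)
  /-- draw a random field element into cell `i` of the field array `a` -/
  | rand (a : ℕ) (i : WExp)
  /-- append `e` to the (write-only) list of outputs -/
  | emit (e : FExp)
  /-- output `⊥` in the end -/
  | reject

/-- The number of operations in an expression. -/
def WExp.cost : WExp → ℕ
  | .const _ => 1
  | .get _ i => i.cost + 1
  | .op _ x y => x.cost + y.cost + 1
  | .query _ x y z => x.cost + y.cost + z.cost + 1

/-- The number of operations in an expression. -/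
def FExp.cost : FExp → ℕ
  | .zero => 1
  | .one => 1
  | .get _ i => i.cost + 1
  | .add x y => x.cost + y.cost + 1
  | .sub x y => x.cost + y.cost + 1
  | .mul x y => x.cost + y.cost + 1

/-- The state of a machine. -/
structure State (F : Type u) where
  word : ℕ → ℕ → ℕ
  fld : ℕ → ℕ → F
  time : ℕ
  /-- the messages sent so far, oldest first -/
  sent : List F
  /-- the number of field elements received so far -/
  received : ℕ
  /-- the number of random field elements drawn so far -/
  drawn : ℕ
  output : List F
  rejected : Bool
  /-- the machine waits for a message that does not come -/
  blocked : Bool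

/-- What a machine runs in: its word length, its memory size, the answers to the wiring
instructions, the incoming messages and the random tape. The incoming message number `k` may depend
on what the machine has sent before it receives it. -/
structure Env (F : Type u) where
  wordSize : ℕ
  memSize : ℕ
  answer : Query → ℕ → ℕ → ℕ → ℕ
  inbox : List F → ℕ → Option F
  coin : ℕ → F

/-- All memory cells are `0`. -/
def State.start (F : Type u) [Zero F] : State F where
  word := fun _ _ => 0
  fld := fun _ _ => 0
  time := 0
  sent := []
  received := 0
  drawn := 0
  output := []
  rejected := false
  blocked := false

section Semantics

variable {F : Type u}

/-- Let time pass. -/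
def State.tick (s : State F) (t : ℕ) : State F := { s with time := s.time + t }

/-- Write to a word array; writing outside the memory has no effect. -/
def State.writeW (s : State F) (E : Env F) (a i x : ℕ) : State F :=
  if i < E.memSize then { s with word := Function.update s.word a (Function.update (s.word a) i x) }
  else s

/-- Write to a field array; writing outside the memory has no effect. -/
def State.writeF (s : State F) (E : Env F) (a i : ℕ) (x : F) : State F :=
  if i < E.memSize then { s with fld := Function.update s.fld a (Function.update (s.fld a) i x) }
  else s

/-- The value of a word expression; reading outside the memory gives `0`, and every result is reduced
to `w` bits. -/
def WExp.eval (E : Env F) (s : State F) : WExp → ℕ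
  | .const m => m % 2 ^ E.wordSize
  | .get a i => if i.eval E s < E.memSize then s.word a (i.eval E s) % 2 ^ E.wordSize else 0
  | .op o x y => o.eval (x.eval E s) (y.eval E s) % 2 ^ E.wordSize
  | .query q x y z => E.answer q (x.eval E s) (y.eval E s) (z.eval E s) % 2 ^ E.wordSize

variable [Field F]

/-- The value of a field expression; reading outside the memory gives `0`. -/
def FExp.eval (E : Env F) (s : State F) : FExp → F
  | .zero => 0
  | .one => 1
  | .get a i => if i.eval E s < E.memSize then s.fld a (i.eval E s) else 0
  | .add x y => x.eval E s + y.eval E s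
  | .sub x y => x.eval E s - y.eval E s
  | .mul x y => x.eval E s * y.eval E s

variable [DecidableEq F]

/-- The execution of a program. A blocked machine does nothing any more. -/
def Cmd.run (E : Env F) : Cmd → State F → State F
  | .skip, s => if s.blocked then s else s.tick 1
  | .setW a i e, s =>
      if s.blocked then s
      else (s.writeW E a (i.eval E s) (e.eval E s)).tick (i.cost + e.cost + 1)
  | .setF a i e, s =>
      if s.blocked then s
      else (s.writeF E a (i.eval E s) (e.eval E s)).tick (i.cost + e.cost + 1)
  | .seq c₁ c₂, s => c₂.run E (c₁.run E s)
  | .ifW e c₁ c₂, s =>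
      if s.blocked then s
      else if e.eval E s ≠ 0 then c₁.run E (s.tick (e.cost + 1))
      else c₂.run E (s.tick (e.cost + 1))
  | .ifZ e c₁ c₂, s =>
      if s.blocked then s
      else if e.eval E s = 0 then c₁.run E (s.tick (e.cost + 1))
      else c₂.run E (s.tick (e.cost + 1))
  | .loop e c, s =>
      if s.blocked then s
      else (fun t => c.run E t)^[e.eval E s] (s.tick (e.cost + 1))
  | .send e, s =>
      if s.blocked then s
      else { s with sent := s.sent ++ [e.eval E s], time := s.time + (e.cost + 1) }
  | .recv a i, s =>
      if s.blocked then s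
      else match E.inbox s.sent s.received with
        | none => { s with blocked := true }
        | some x =>
            { (s.writeF E a (i.eval E s) x) with
              received := s.received + 1, time := s.time + (i.cost + 1) }
  | .rand a i, s =>
      if s.blocked then s
      else { (s.writeF E a (i.eval E s) (E.coin s.drawn)) with
              drawn := s.drawn + 1, time := s.time + (i.cost + 1) }
  | .emit e, s =>
      if s.blocked then s
      else { s with output := s.output ++ [e.eval E s], time := s.time + (e.cost + 1) }
  | .reject, s =>
      if s.blocked then s else { s with rejected := true, time := s.time + 1 }

end Semantics

/-! ### Streaming interactive protocols -/

/-- The program of a prover or a verifier: `init` is executed first, then `update` once for every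
element of the input stream in turn, and then `main`, which interacts with the other party. -/
structure Party where
  init : Cmd
  update : Cmd
  main : Cmd

/-- A data stream that defines an input of the circuit `C`. -/
abbrev Circuit.Stream (C : Circuit) (F : Type u) : Type u :=
  List (BitVec (C.logSize C.depth) × F)

/-- The input that a stream of updates `(i, δ)` defines: entry `i` is the sum of the values `δ` that
come with `i`. -/
def Circuit.frequency {F : Type u} [AddMonoid F] (C : Circuit) (σ : C.Stream F) : C.Input F :=
  fun i => ((σ.filter fun u => u.1 = i).map Prod.snd).sum

section Protocol

variable {F : Type u} [Field F] [DecidableEq F]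

/-- The next stream element `(i, δ)` is read, in two units of time, into cell `0` of word array `0`
and cell `0` of field array `0`. -/
def State.read (s : State F) (E : Env F) (i : ℕ) (δ : F) : State F :=
  ((s.writeW E 0 0 i).writeF E 0 0 δ).tick 2

/-- The run of a party on a stream. There is no communication before the stream has ended. -/
def Party.run (Q : Party) {C : Circuit} (E : Env F) (σ : C.Stream F) : State F :=
  let E₀ : Env F := { E with inbox := fun _ _ => none }
  let s := σ.foldl (fun s u => Q.update.run E₀ (s.read E₀ u.1.toNat u.2))
    (Q.init.run E₀ (State.start F))
  Q.main.run E { s with sent := [], received := 0 }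

/-- What a machine outputs in the end; `none` is `⊥`. -/
def State.outcome (s : State F) : Option (List F) :=
  if s.rejected || s.blocked then none else some s.output

/-- A prover, as the verifier sees it: the field element that the verifier receives as number `k`, as
a function of all that the verifier has sent to the prover before. -/
abbrev Strategy (F : Type u) : Type u := List F → ℕ → F

/-- The run of the verifier `V`, with word length `w` and arrays of `M` cells, on the stream `σ` and
the random tape `R`, with an arbitrary prover. -/
noncomputable def Party.runVerifier (V : Party) (C : Circuit) (S : C.Exceptions) (w M : ℕ)
    (σ : C.Stream F) {N : ℕ} (R : Fin N → F) (P' : Strategy F) : State F :=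
  V.run { wordSize := w, memSize := M, answer := C.answer S,
          inbox := fun sent k => some (P' sent k),
          coin := fun k => if h : k < N then R ⟨k, h⟩ else 0 } σ

/-- The run of the prover `P`, with word length `w`, on the stream `σ`, when the field elements in
`inbox` are all that it receives. The prover has no random bits, and its memory is bounded only by
the length of an address. -/
noncomputable def Party.runProver (P : Party) (C : Circuit) (S : C.Exceptions) (w : ℕ)
    (σ : C.Stream F) (inbox : List F) : State F :=
  P.run { wordSize := w, memSize := 2 ^ w, answer := C.answer S,
          inbox := fun _ k => inbox[k]?,
          coin := fun _ => 0 } σ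

/-- The strategy that the program `P` carries out on the stream `σ`. -/
noncomputable def Party.strategy (P : Party) (C : Circuit) (S : C.Exceptions) (w : ℕ)
    (σ : C.Stream F) : Strategy F :=
  fun inbox k => (P.runProver C S w σ inbox).sent.getD k 0

end Protocol

open Classical in
/-- `P` and a verifier form a valid interactive proof protocol for the function `f`; here
`out x R P'` is the output of the verifier on input `x` with random tape `R` (drawn uniformly) and
prover `P'`, and `none` is `⊥`. -/
structure IsValidProtocol {X Ω T Y : Type*} [Fintype Ω] (f : X → Y) (out : X → Ω → T → Option Y)
    (P : X → T) : Prop where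
  complete : ∀ x R, out x R (P x) = some (f x)
  sound : ∀ x P',
    ((Finset.univ.filter fun R => out x R P' ≠ some (f x) ∧ out x R P' ≠ none).card : ℚ)
      / Fintype.card Ω ≤ 1 / 3

/-!
The protocol replaces a claim about the values of one layer by a claim about the values of the
next layer, until the claim concerns the input. A claim on layer `i` is an alleged value of
`scale * mle (layer i) x` at a random point `x`, where `mle` is the multilinear extension of the
values of the gates. For the first claim the verifier extends the alleged outputs to a random
point.

Two sum-checks pass from layer `i` to layer `i + 1`. The first one is over the labels `p` of the
gates of layer `i`: with `t` for the type, `a` and `c` for the values of the two in-neighbours of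
gate `p`, and the weight of `p` at `x`, times the scale, for `b`, the value of layer `i` is
`∑ p, b * (t * (a * c) + (1 - t) * (a + c))` (`Circuit.sum_tables₁`). At its end the multilinear
extensions of `a` and `c` at a random point are needed; the prover sends them, and their
combination with a random coefficient is a linear combination of the values of layer `i + 1`,
because every in-neighbour is a gate of that layer (`Circuit.sum_tables₂`). The second sum-check
is about this linear combination, and ends with a claim on layer `i + 1` at the point formed by
its challenges; the new scale is the multilinear extension of the coefficients at that point.

*The prover* keeps the tables of a sum-check and fixes one bit of the index in every round
(`folds`). The tables for layer `i` have as many entries as layers `i` and `i + 1` have gates, and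
they shrink by a factor of two in every round, so that the total time is linear in the size of the
circuit. As a strategy, the prover is run on the challenges sent so far only; `runProver_spec`
describes these runs, on the basis of `Cmd.run_truncated`.

*The verifier* needs the multilinear extensions of the wiring functions: the sum of
`wt x p * wt z (f p)` over all `p`. Every bit of `f p` depends on at most one bit of `p`, its
source, so the sum is a product over the bits of `p`, and a bit contributes the factors of the
output bits of which it is the source (`sum_wt_mul_wt_wire`). The sources of the output bits are
found by enumerating the output bits affected by the nonexceptional input bits, and by evaluating
`f` at bit strings with a single `1` for the at most `c` others. This takes time
`O((c + 1) log S)` per layer. The point of the last claim is drawn before the stream, and the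
value of the multilinear extension of the input at this point is updated in time `O(log n)` per
element of the stream. The multilinear extension of the outputs is evaluated while they arrive,
with a stack of values for subcubes of increasing dimension (`Cmd.merge`), hence in time `O(|𝒪|)`
and space `O(log S)`.

*Soundness.* Every round consists of at most five field elements, the coefficients of a polynomial
of degree at most four, and one challenge. If the final claim is right although the outputs are
wrong, then in some round two different polynomials agree at the challenge, or the difference
between the alleged and the true outputs is hidden by a coordinate of the first random point
(`exists_lucky`). Given the earlier challenges, each of these events has probability at most
`4 / |F|` (`Strategy.rare_lucky`); a union bound over the `O(d log S)` rounds (`card_rare_le`)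
yields the bound `1 / 3`.
-/

/-! ### Basic facts on the machine -/

section Machine

variable {F : Type u}

/-- Write to a word array without a bound check. -/
def State.putW (s : State F) (a i x : ℕ) : State F :=
  { s with word := Function.update s.word a (Function.update (s.word a) i x) }

/-- Write to a field array without a bound check. -/
def State.putF (s : State F) (a i : ℕ) (x : F) : State F :=
  { s with fld := Function.update s.fld a (Function.update (s.fld a) i x) }

/-- The state with the word array `i` and the clock erased. Loop invariants are stated about it, so
that they do not speak about the counter. -/
@[reducible] def State.forget (s : State F) (i : ℕ) : State F :=
  { s with word := Function.update s.word i (fun _ => 0), time := 0 }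

namespace State

variable (s : State F) (a i b j x t : ℕ) (y : F)

@[simp] theorem putW_word : (s.putW a i x).word b j = if b = a ∧ j = i then x else s.word b j := by
  unfold putW
  by_cases h : b = a
  · subst h; by_cases h' : j = i <;> simp [h']
  · simp [h]
@[simp] theorem putW_fld : (s.putW a i x).fld = s.fld := rfl
@[simp] theorem putW_time : (s.putW a i x).time = s.time := rfl
@[simp] theorem putW_blocked : (s.putW a i x).blocked = s.blocked := rfl
@[simp] theorem putW_sent : (s.putW a i x).sent = s.sent := rfl
@[simp] theorem putW_output : (s.putW a i x).output = s.output := rfl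

@[simp] theorem putF_fld : (s.putF a i y).fld b j = if b = a ∧ j = i then y else s.fld b j := by
  unfold putF
  by_cases h : b = a
  · subst h; by_cases h' : j = i <;> simp [h']
  · simp [h]
@[simp] theorem putF_word : (s.putF a i y).word = s.word := rfl
@[simp] theorem putF_time : (s.putF a i y).time = s.time := rfl
@[simp] theorem putF_sent : (s.putF a i y).sent = s.sent := rfl
@[simp] theorem putF_received : (s.putF a i y).received = s.received := rfl
@[simp] theorem putF_blocked : (s.putF a i y).blocked = s.blocked := rfl
@[simp] theorem putF_drawn : (s.putF a i y).drawn = s.drawn := rfl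
@[simp] theorem putF_output : (s.putF a i y).output = s.output := rfl

@[simp] theorem tick_word : (s.tick t).word = s.word := rfl
@[simp] theorem tick_fld : (s.tick t).fld = s.fld := rfl
@[simp] theorem tick_time : (s.tick t).time = s.time + t := rfl
@[simp] theorem tick_sent : (s.tick t).sent = s.sent := rfl
@[simp] theorem tick_received : (s.tick t).received = s.received := rfl
@[simp] theorem tick_blocked : (s.tick t).blocked = s.blocked := rfl
@[simp] theorem tick_drawn : (s.tick t).drawn = s.drawn := rfl
@[simp] theorem tick_output : (s.tick t).output = s.output := rfl

theorem putW_word_ne {a b : ℕ} (h : b ≠ a) : (s.putW a i x).word b = s.word b := by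
  simp [putW, h]

theorem putF_fld_ne {a b : ℕ} (h : b ≠ a) : (s.putF a i y).fld b = s.fld b := by
  simp [putF, h]

theorem forget_word_ne {i b : ℕ} (h : b ≠ i) : (s.forget i).word b = s.word b := by
  simp [h]

end State

theorem State.writeW_eq (s : State F) {E : Env F} {a i x : ℕ} (h : i < E.memSize) :
    s.writeW E a i x = s.putW a i x := if_pos h

theorem State.writeF_eq (s : State F) {E : Env F} {a i : ℕ} {x : F} (h : i < E.memSize) :
    s.writeF E a i x = s.putF a i x := if_pos h

theorem WExp.eval_congr {E : Env F} {s s' : State F} (h : s.word = s'.word) (e : WExp) :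
    e.eval E s = e.eval E s' := by
  induction e with
  | const m => rfl
  | get a i ih => simp only [WExp.eval, ih, h]
  | op o x y hx hy => simp only [WExp.eval, hx, hy]
  | query q x y z hx hy hz => simp only [WExp.eval, hx, hy, hz]

@[simp] theorem WExp.eval_tick (E : Env F) (s : State F) (t : ℕ) (e : WExp) :
    e.eval E (s.tick t) = e.eval E s :=
  WExp.eval_congr (s := s.tick t) (s' := s) rfl e

theorem WExp.eval_lt (E : Env F) (s : State F) (e : WExp) : e.eval E s < 2 ^ E.wordSize := by
  have h : 0 < 2 ^ E.wordSize := by positivity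
  cases e <;> simp only [WExp.eval]
  · exact Nat.mod_lt _ h
  · split_ifs
    · exact Nat.mod_lt _ h
    · exact h
  · exact Nat.mod_lt _ h
  · exact Nat.mod_lt _ h

/-- Two environments that differ only in what comes from outside. -/
structure Env.SameMachine (E E' : Env F) : Prop where
  wordSize : E.wordSize = E'.wordSize
  memSize : E.memSize = E'.memSize
  answer : E.answer = E'.answer

theorem WExp.eval_env {E E' : Env F} (h : E.SameMachine E') (s : State F) (e : WExp) :
    e.eval E s = e.eval E' s := by
  obtain ⟨h1, h2, h3⟩ := h
  induction e with
  | const m => simp only [WExp.eval, h1]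
  | get a i ih => simp only [WExp.eval, ih, h1, h2]
  | op o x y hx hy => simp only [WExp.eval, hx, hy, h1]
  | query q x y z hx hy hz => simp only [WExp.eval, hx, hy, hz, h1, h3]

theorem State.writeW_env {E E' : Env F} (h : E.SameMachine E') (s : State F) (a i x : ℕ) :
    s.writeW E a i x = s.writeW E' a i x := by
  simp only [State.writeW, h.memSize]

theorem State.writeF_env {E E' : Env F} (h : E.SameMachine E') (s : State F) (a i : ℕ) (x : F) :
    s.writeF E a i x = s.writeF E' a i x := by
  simp only [State.writeF, h.memSize]

theorem State.writeW_word_ne (E : Env F) (s : State F) {a b : ℕ} (i x : ℕ) (h : b ≠ a) :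
    (s.writeW E a i x).word b = s.word b := by
  unfold State.writeW; split_ifs <;> simp [h]

theorem State.writeF_fld_ne (E : Env F) (s : State F) {a b : ℕ} (i : ℕ) (x : F) (h : b ≠ a) :
    (s.writeF E a i x).fld b = s.fld b := by
  unfold State.writeF; split_ifs <;> simp [h]

@[simp] theorem State.writeW_fld (E : Env F) (s : State F) (a i x : ℕ) :
    (s.writeW E a i x).fld = s.fld := by
  unfold State.writeW; split_ifs <;> rfl

@[simp] theorem State.writeF_word (E : Env F) (s : State F) (a i : ℕ) (x : F) :
    (s.writeF E a i x).word = s.word := by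
  unfold State.writeF; split_ifs <;> rfl

/-- Nothing but the memory and the clock differs. -/
structure State.SameChannels (s s' : State F) : Prop where
  sent : s.sent = s'.sent
  received : s.received = s'.received
  drawn : s.drawn = s'.drawn
  output : s.output = s'.output
  rejected : s.rejected = s'.rejected
  blocked : s.blocked = s'.blocked

theorem State.SameChannels.refl (s : State F) : s.SameChannels s := ⟨rfl, rfl, rfl, rfl, rfl, rfl⟩

theorem State.SameChannels.trans {s s' s'' : State F} (h : s.SameChannels s') (h' : s'.SameChannels s'') :
    s.SameChannels s'' :=
  ⟨h.1.trans h'.1, h.2.trans h'.2, h.3.trans h'.3, h.4.trans h'.4, h.5.trans h'.5, h.6.trans h'.6⟩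

/-- The word variable `a` (cell `0` of the word array `a`). -/
abbrev wv (a : ℕ) : WExp := .get a (.const 0)

/-- The field variable `a` (cell `0` of the field array `a`). -/
abbrev fv (a : ℕ) : FExp := .get a (.const 0)

theorem WExp.eval_wv {E : Env F} {s : State F} {a : ℕ} (hM : 0 < E.memSize)
    (h : s.word a 0 < 2 ^ E.wordSize) : (wv a).eval E s = s.word a 0 := by
  simp [WExp.eval, hM, Nat.mod_eq_of_lt h]

variable [Field F]

theorem FExp.eval_congr {E : Env F} {s s' : State F} (h : s.word = s'.word) (h' : s.fld = s'.fld)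
    (e : FExp) : e.eval E s = e.eval E s' := by
  induction e with
  | zero => rfl
  | one => rfl
  | get a i => simp only [FExp.eval, WExp.eval_congr h, h']
  | add x y hx hy => simp only [FExp.eval, hx, hy]
  | sub x y hx hy => simp only [FExp.eval, hx, hy]
  | mul x y hx hy => simp only [FExp.eval, hx, hy]

@[simp] theorem FExp.eval_tick (E : Env F) (s : State F) (t : ℕ) (e : FExp) :
    e.eval E (s.tick t) = e.eval E s :=
  FExp.eval_congr (s := s.tick t) (s' := s) rfl rfl e

theorem FExp.eval_env {E E' : Env F} (h : E.SameMachine E') (s : State F) (e : FExp) :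
    e.eval E s = e.eval E' s := by
  induction e with
  | zero => rfl
  | one => rfl
  | get a i => simp only [FExp.eval, WExp.eval_env h, h.memSize]
  | add x y hx hy => simp only [FExp.eval, hx, hy]
  | sub x y hx hy => simp only [FExp.eval, hx, hy]
  | mul x y hx hy => simp only [FExp.eval, hx, hy]

variable [DecidableEq F]

theorem Function.iterate_induct {α : Type*} {f : α → α} {p : α → Prop} (h : ∀ x, p x → p (f x)) :
    ∀ (n : ℕ) (x : α), p x → p (f^[n] x)
  | 0, _, hx => hx
  | n + 1, _, hx => Function.iterate_induct h n _ (h _ hx)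

theorem Cmd.run_of_blocked (E : Env F) (c : Cmd) {s : State F} (h : s.blocked = true) :
    c.run E s = s := by
  induction c with
  | seq c₁ c₂ h₁ h₂ => simp only [Cmd.run, h₁, h₂]
  | _ => simp [Cmd.run, h]

/-! #### Which arrays a program writes, and whether it communicates -/

/-- The word arrays that a program may write. -/
def Cmd.wordArrays : Cmd → List ℕ
  | .setW a _ _ => [a]
  | .seq c₁ c₂ => c₁.wordArrays ++ c₂.wordArrays
  | .ifW _ c₁ c₂ => c₁.wordArrays ++ c₂.wordArrays
  | .ifZ _ c₁ c₂ => c₁.wordArrays ++ c₂.wordArrays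
  | .loop _ c => c.wordArrays
  | _ => []

/-- The field arrays that a program may write. -/
def Cmd.fldArrays : Cmd → List ℕ
  | .setF a _ _ => [a]
  | .recv a _ => [a]
  | .rand a _ => [a]
  | .seq c₁ c₂ => c₁.fldArrays ++ c₂.fldArrays
  | .ifW _ c₁ c₂ => c₁.fldArrays ++ c₂.fldArrays
  | .ifZ _ c₁ c₂ => c₁.fldArrays ++ c₂.fldArrays
  | .loop _ c => c.fldArrays
  | _ => []

/-- The program only computes: it neither communicates, draws random bits, writes output, nor
rejects. -/
def Cmd.quiet : Cmd → Bool
  | .skip => true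
  | .setW _ _ _ => true
  | .setF _ _ _ => true
  | .seq c₁ c₂ => c₁.quiet && c₂.quiet
  | .ifW _ c₁ c₂ => c₁.quiet && c₂.quiet
  | .ifZ _ c₁ c₂ => c₁.quiet && c₂.quiet
  | .loop _ c => c.quiet
  | _ => false

theorem Cmd.run_word (E : Env F) (c : Cmd) (s : State F) {b : ℕ} (h : b ∉ c.wordArrays) :
    (c.run E s).word b = s.word b := by
  induction c generalizing s with
  | setW a i e =>
    simp only [wordArrays, List.mem_singleton] at h
    simp only [Cmd.run]; split_ifs
    · rfl
    · exact s.writeW_word_ne E _ _ h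
  | seq c₁ c₂ h₁ h₂ =>
    simp only [wordArrays, List.mem_append, not_or] at h
    simp only [Cmd.run, h₂ _ h.2, h₁ _ h.1]
  | ifW e c₁ c₂ h₁ h₂ =>
    simp only [wordArrays, List.mem_append, not_or] at h
    simp only [Cmd.run]; split_ifs <;> simp [h₂ _ h.2, h₁ _ h.1]
  | ifZ e c₁ c₂ h₁ h₂ =>
    simp only [wordArrays, List.mem_append, not_or] at h
    simp only [Cmd.run]; split_ifs <;> simp [h₂ _ h.2, h₁ _ h.1]
  | loop e c ih =>
    simp only [Cmd.run]; split_ifs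
    · rfl
    · exact Function.iterate_induct (f := fun t => c.run E t)
        (p := fun s' => s'.word b = s.word b)
        (fun x hx => (ih x h).trans hx) _ _ rfl
  | recv a i =>
    simp only [Cmd.run]; split_ifs
    · rfl
    · split <;> simp
  | rand a i => simp only [Cmd.run]; split_ifs <;> simp
  | setF a i e => simp only [Cmd.run]; split_ifs <;> simp
  | _ => simp only [Cmd.run]; split_ifs <;> rfl

theorem Cmd.run_fld (E : Env F) (c : Cmd) (s : State F) {b : ℕ} (h : b ∉ c.fldArrays) :
    (c.run E s).fld b = s.fld b := by
  induction c generalizing s with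
  | setW a i e =>
    simp only [Cmd.run]; split_ifs <;> simp
  | setF a i e =>
    simp only [fldArrays, List.mem_singleton] at h
    simp only [Cmd.run]; split_ifs
    · rfl
    · simpa using s.writeF_fld_ne E _ _ h
  | seq c₁ c₂ h₁ h₂ =>
    simp only [fldArrays, List.mem_append, not_or] at h
    simp only [Cmd.run, h₂ _ h.2, h₁ _ h.1]
  | ifW e c₁ c₂ h₁ h₂ =>
    simp only [fldArrays, List.mem_append, not_or] at h
    simp only [Cmd.run]; split_ifs <;> simp [h₂ _ h.2, h₁ _ h.1]
  | ifZ e c₁ c₂ h₁ h₂ =>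
    simp only [fldArrays, List.mem_append, not_or] at h
    simp only [Cmd.run]; split_ifs <;> simp [h₂ _ h.2, h₁ _ h.1]
  | loop e c ih =>
    simp only [Cmd.run]; split_ifs
    · rfl
    · exact Function.iterate_induct (f := fun t => c.run E t)
        (p := fun s' => s'.fld b = s.fld b)
        (fun x hx => (ih x h).trans hx) _ _ rfl
  | recv a i =>
    simp only [fldArrays, List.mem_singleton] at h
    simp only [Cmd.run]; split_ifs
    · rfl
    · split
      · rfl
      · exact s.writeF_fld_ne E _ _ h
  | rand a i =>
    simp only [fldArrays, List.mem_singleton] at h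
    simp only [Cmd.run]; split_ifs
    · rfl
    · exact s.writeF_fld_ne E _ _ h
  | _ => simp only [Cmd.run]; split_ifs <;> rfl

theorem Cmd.run_quiet (E : Env F) (c : Cmd) (s : State F) (h : c.quiet = true) :
    (c.run E s).SameChannels s := by
  induction c generalizing s with
  | skip => simp only [Cmd.run]; split_ifs <;> exact ⟨rfl, rfl, rfl, rfl, rfl, rfl⟩
  | setW a i e =>
    simp only [Cmd.run]; split_ifs
    · exact .refl s
    · unfold State.writeW; split_ifs <;> exact ⟨rfl, rfl, rfl, rfl, rfl, rfl⟩
  | setF a i e =>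
    simp only [Cmd.run]; split_ifs
    · exact .refl s
    · unfold State.writeF; split_ifs <;> exact ⟨rfl, rfl, rfl, rfl, rfl, rfl⟩
  | seq c₁ c₂ h₁ h₂ =>
    simp only [quiet, Bool.and_eq_true] at h
    exact (h₂ _ h.2).trans (h₁ _ h.1)
  | ifW e c₁ c₂ h₁ h₂ =>
    simp only [quiet, Bool.and_eq_true] at h
    simp only [Cmd.run]; split_ifs
    · exact .refl s
    · exact (h₁ _ h.1).trans ⟨rfl, rfl, rfl, rfl, rfl, rfl⟩
    · exact (h₂ _ h.2).trans ⟨rfl, rfl, rfl, rfl, rfl, rfl⟩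
  | ifZ e c₁ c₂ h₁ h₂ =>
    simp only [quiet, Bool.and_eq_true] at h
    simp only [Cmd.run]; split_ifs
    · exact .refl s
    · exact (h₁ _ h.1).trans ⟨rfl, rfl, rfl, rfl, rfl, rfl⟩
    · exact (h₂ _ h.2).trans ⟨rfl, rfl, rfl, rfl, rfl, rfl⟩
  | loop e c ih =>
    simp only [Cmd.run]; split_ifs
    · exact .refl s
    · exact Function.iterate_induct (f := fun t => c.run E t)
        (p := fun s' => s'.SameChannels s)
        (fun x hx => (ih x h).trans hx) _ _ ⟨rfl, rfl, rfl, rfl, rfl, rfl⟩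
  | _ => simp [quiet] at h

/-! #### Single instructions -/

section Step

variable {E : Env F} {s : State F}

theorem Cmd.run_setW (hb : s.blocked = false) {a : ℕ} {i e : WExp} (hi : i.eval E s < E.memSize) :
    (Cmd.setW a i e).run E s
      = (s.putW a (i.eval E s) (e.eval E s)).tick (i.cost + e.cost + 1) := by
  simp [Cmd.run, hb, State.writeW_eq _ hi]

theorem Cmd.run_setF (hb : s.blocked = false) {a : ℕ} {i : WExp} {e : FExp}
    (hi : i.eval E s < E.memSize) :
    (Cmd.setF a i e).run E s
      = (s.putF a (i.eval E s) (e.eval E s)).tick (i.cost + e.cost + 1) := by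
  simp [Cmd.run, hb, State.writeF_eq _ hi]

theorem Cmd.run_seq (c₁ c₂ : Cmd) : (Cmd.seq c₁ c₂).run E s = c₂.run E (c₁.run E s) := rfl

theorem Cmd.run_ifW (hb : s.blocked = false) {e : WExp} {c₁ c₂ : Cmd} :
    (Cmd.ifW e c₁ c₂).run E s
      = (if e.eval E s ≠ 0 then c₁ else c₂).run E (s.tick (e.cost + 1)) := by
  simp only [Cmd.run, hb]; split_ifs <;> simp_all

theorem Cmd.run_ifZ (hb : s.blocked = false) {e : FExp} {c₁ c₂ : Cmd} :
    (Cmd.ifZ e c₁ c₂).run E s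
      = (if e.eval E s = 0 then c₁ else c₂).run E (s.tick (e.cost + 1)) := by
  simp only [Cmd.run, hb]; split_ifs <;> simp_all

theorem Cmd.run_loop (hb : s.blocked = false) {e : WExp} {c : Cmd} :
    (Cmd.loop e c).run E s = (fun t => c.run E t)^[e.eval E s] (s.tick (e.cost + 1)) := by
  simp [Cmd.run, hb]

theorem Cmd.run_skip (hb : s.blocked = false) : Cmd.skip.run E s = s.tick 1 := by
  simp [Cmd.run, hb]

theorem Cmd.run_reject (hb : s.blocked = false) :
    Cmd.reject.run E s = { s with rejected := true, time := s.time + 1 } := by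
  simp [Cmd.run, hb]

theorem Cmd.run_send (hb : s.blocked = false) {e : FExp} :
    (Cmd.send e).run E s
      = { s with sent := s.sent ++ [e.eval E s], time := s.time + (e.cost + 1) } := by
  simp [Cmd.run, hb]

theorem Cmd.run_emit (hb : s.blocked = false) {e : FExp} :
    (Cmd.emit e).run E s
      = { s with output := s.output ++ [e.eval E s], time := s.time + (e.cost + 1) } := by
  simp [Cmd.run, hb]

theorem Cmd.run_recv (hb : s.blocked = false) {a : ℕ} {i : WExp} (hi : i.eval E s < E.memSize)
    {x : F} (hx : E.inbox s.sent s.received = some x) :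
    (Cmd.recv a i).run E s = { s.putF a (i.eval E s) x with
      received := s.received + 1, time := s.time + (i.cost + 1) } := by
  simp [Cmd.run, hb, State.writeF_eq _ hi, hx]

theorem Cmd.run_rand (hb : s.blocked = false) {a : ℕ} {i : WExp} (hi : i.eval E s < E.memSize) :
    (Cmd.rand a i).run E s = { s.putF a (i.eval E s) (E.coin s.drawn) with
      drawn := s.drawn + 1, time := s.time + (i.cost + 1) } := by
  simp [Cmd.run, hb, State.writeF_eq _ hi]

end Step

/-! #### Counting loops -/

/-- Execute `body` for the values `0, …, n - 1` of the word variable `i`. -/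
def Cmd.count (i : ℕ) (n : WExp) (body : Cmd) : Cmd :=
  .seq (.setW i (.const 0) (.const 0))
    (.loop n (.seq body (.setW i (.const 0) (.op .add (wv i) (.const 1)))))

/-- The invariant rule for counting loops. The invariant may not mention the counter or the clock;
`t k` bounds the time of round `k` of the loop. -/
theorem Cmd.run_count {E : Env F} {s : State F} {i : ℕ} {n : WExp} {body : Cmd} {N : ℕ}
    (hM : 0 < E.memSize) (hi : i ∉ body.wordArrays) (hb : s.blocked = false)
    (hn : n.eval E (s.putW i 0 0) = N) (I : ℕ → State F → Prop) (t : ℕ → ℕ)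
    (h0 : I 0 (s.forget i))
    (hs : ∀ k < N, ∀ s' : State F, s'.blocked = false → s'.word i 0 = k →
      (∀ a, a ≠ i → a ∉ body.wordArrays → s'.word a = s.word a) →
      (∀ a, a ∉ body.fldArrays → s'.fld a = s.fld a) → I k (s'.forget i) →
      (body.run E s').blocked = false ∧ (body.run E s').time ≤ s'.time + t k ∧
        I (k + 1) ((body.run E s').forget i)) :
    ((Cmd.count i n body).run E s).blocked = false ∧
      I N (((Cmd.count i n body).run E s).forget i) ∧
      ((Cmd.count i n body).run E s).time
        ≤ s.time + (n.cost + 4 + ∑ k ∈ Finset.range N, (t k + 6)) := by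
  have hN : N < 2 ^ E.wordSize := hn ▸ WExp.eval_lt _ _ _
  have h1 : 1 ≤ 2 ^ E.wordSize := Nat.one_le_two_pow
  have hc0 : (WExp.const 0).eval E s = 0 := by simp [WExp.eval]
  have hstart : (Cmd.count i n body).run E s =
      (fun t => (Cmd.seq body (.setW i (.const 0) (.op .add (wv i) (.const 1)))).run E t)^[N]
        ((s.putW i 0 0).tick (3 + (n.cost + 1))) := by
    rw [Cmd.count, Cmd.run_seq, Cmd.run_setW hb (by rw [hc0]; exact hM), hc0,
      Cmd.run_loop (by simpa using hb)]
    rw [WExp.eval_tick, hn]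
    rw [show 3 + (n.cost + 1) = 1 + (1 + (1 + (n.cost + 1))) by omega]
    simp only [State.tick, WExp.cost, State.putW, Nat.add_assoc]
  have key : ∀ m ≤ N,
      let s' := (fun t => (Cmd.seq body (.setW i (.const 0) (.op .add (wv i) (.const 1)))).run E t)^[m]
        ((s.putW i 0 0).tick (3 + (n.cost + 1)))
      s'.blocked = false ∧ s'.word i 0 = m ∧
      (∀ a, a ≠ i → a ∉ body.wordArrays → s'.word a = s.word a) ∧
      (∀ a, a ∉ body.fldArrays → s'.fld a = s.fld a) ∧ I m (s'.forget i) ∧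
      s'.time ≤ s.time + (n.cost + 4 + ∑ k ∈ Finset.range m, (t k + 6)) := by
    intro m
    induction m with
    | zero =>
      intro _
      refine ⟨by simpa using hb, by simp, fun a ha _ => by simpa using s.putW_word_ne _ _ ha,
        fun a _ => by simp, ?_, by simp; omega⟩
      have : (((s.putW i 0 0).tick (3 + (n.cost + 1))).forget i) = s.forget i := by
        simp [State.tick, State.putW]
      simpa [this] using h0
    | succ m ih =>
      intro hm
      obtain ⟨g1, g2, g3, g4, g5, g6⟩ := ih (by omega)
      rw [Function.iterate_succ_apply']
      set s' := (fun t => (Cmd.seq body (.setW i (.const 0)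
        (.op .add (wv i) (.const 1)))).run E t)^[m] ((s.putW i 0 0).tick (3 + (n.cost + 1)))
      obtain ⟨e1, e2, e3⟩ := hs m (by omega) s' g1 g2 g3 g4 g5
      have hwi : (body.run E s').word i = s'.word i := Cmd.run_word E body s' hi
      have hev : (WExp.op .add (wv i) (.const 1)).eval E (body.run E s') = m + 1 := by
        have hz : (wv i).eval E (body.run E s') = m := by
          rw [WExp.eval_wv hM] <;> rw [hwi, g2]; omega
        have h1' : (WExp.const 1).eval E (body.run E s') = 1 := by
          simp only [WExp.eval]; exact Nat.mod_eq_of_lt (by omega)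
        rw [WExp.eval, hz, h1']
        simp only [WordOp.eval]
        exact Nat.mod_eq_of_lt (by omega)
      have hc : (WExp.const 0).eval E (body.run E s') = 0 := by simp [WExp.eval]
      have hrun : (Cmd.seq body (.setW i (.const 0) (.op .add (wv i) (.const 1)))).run E s'
          = ((body.run E s').putW i 0 (m + 1)).tick 6 := by
        rw [Cmd.run_seq, Cmd.run_setW e1 (by rw [hc]; exact hM), hc, hev]
        rfl
      simp only [hrun]
      refine ⟨by simpa using e1, by simp, fun a ha hab => ?_, fun a ha => ?_, ?_, ?_⟩
      · rw [State.tick_word, State.putW_word_ne _ _ _ ha, Cmd.run_word E body s' hab, g3 a ha hab]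
      · rw [State.tick_fld, State.putW_fld, Cmd.run_fld E body s' ha, g4 a ha]
      · have : ((((body.run E s').putW i 0 (m + 1)).tick 6).forget i)
            = (body.run E s').forget i := by
          simp [State.tick, State.putW]
        simpa [this] using e3
      · rw [Finset.sum_range_succ]
        simp only [State.tick_time, State.putW_time]
        omega
  obtain ⟨g1, _, _, _, g5, g6⟩ := key N le_rfl
  rw [hstart]
  exact ⟨g1, g5, g6⟩

/-- The invariant rule for counting loops whose rounds all take time at most `t`. -/
theorem Cmd.run_count_const {E : Env F} {s : State F} {i : ℕ} {n : WExp} {body : Cmd} {N : ℕ}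
    (hM : 0 < E.memSize) (hi : i ∉ body.wordArrays) (hb : s.blocked = false)
    (hn : n.eval E (s.putW i 0 0) = N) (I : ℕ → State F → Prop) (t : ℕ)
    (h0 : I 0 (s.forget i))
    (hs : ∀ k < N, ∀ s' : State F, s'.blocked = false → s'.word i 0 = k →
      (∀ a, a ≠ i → a ∉ body.wordArrays → s'.word a = s.word a) →
      (∀ a, a ∉ body.fldArrays → s'.fld a = s.fld a) → I k (s'.forget i) →
      (body.run E s').blocked = false ∧ (body.run E s').time ≤ s'.time + t ∧
        I (k + 1) ((body.run E s').forget i)) :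
    ((Cmd.count i n body).run E s).blocked = false ∧
      I N (((Cmd.count i n body).run E s).forget i) ∧
      ((Cmd.count i n body).run E s).time ≤ s.time + (n.cost + 4 + N * (t + 6)) := by
  have := Cmd.run_count hM hi hb hn I (fun _ => t) h0 hs
  simpa using this

/-- A counting loop whose body is a single assignment to a field array: `A k` is the content of the
array before round `k` of the loop. -/
theorem Cmd.run_count_setF {E : Env F} {s : State F} {i a : ℕ} {n idx : WExp} {e : FExp} {N : ℕ}
    (hM : 0 < E.memSize) (hb : s.blocked = false)
    (hn : n.eval E (s.putW i 0 0) = N) (A : ℕ → ℕ → F) (h0 : A 0 = s.fld a)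
    (hs : ∀ k < N, ∀ s' : State F, s'.word i 0 = k → (∀ b, b ≠ i → s'.word b = s.word b) →
      (∀ b, b ≠ a → s'.fld b = s.fld b) → s'.fld a = A k →
      idx.eval E s' < E.memSize ∧
        ∀ j, A (k + 1) j = if j = idx.eval E s' then e.eval E s' else A k j) :
    ((Cmd.count i n (.setF a idx e)).run E s).blocked = false ∧
      ((Cmd.count i n (.setF a idx e)).run E s).fld a = A N ∧
      ((Cmd.count i n (.setF a idx e)).run E s).time
        ≤ s.time + (n.cost + 4 + N * (idx.cost + e.cost + 7)) := by
  have := Cmd.run_count_const (s := s) (i := i) (n := n) (body := .setF a idx e) (N := N) hM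
    (by simp [wordArrays]) hb hn (fun k s' => s'.fld a = A k) (idx.cost + e.cost + 1) (by simp [h0])
    (by
      intro k hk s' hb' hk' hw hf hI
      obtain ⟨h1, h2⟩ := hs k hk s' hk' (fun b hb => hw b hb (by simp [wordArrays]))
        (fun b hb => hf b (by simpa [fldArrays] using hb)) hI
      rw [Cmd.run_setF hb' h1]
      refine ⟨by simpa using hb', by simp, ?_⟩
      funext j
      have hI' : s'.fld a j = A k j := congrFun hI j
      simp [h2, hI'])
  simpa using this

end Machine

section Machine

variable {F : Type u} [Field F] [DecidableEq F]

/-! #### Runs on a truncated list of incoming messages -/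

theorem Cmd.sent_prefix_run (E : Env F) (c : Cmd) (s : State F) :
    s.sent <+: (c.run E s).sent := by
  induction c generalizing s with
  | setW a i e =>
    simp only [Cmd.run, State.writeW]; split_ifs <;> exact List.prefix_rfl
  | setF a i e =>
    simp only [Cmd.run, State.writeF]; split_ifs <;> exact List.prefix_rfl
  | seq c₁ c₂ h₁ h₂ => exact (h₁ s).trans (h₂ _)
  | ifW e c₁ c₂ h₁ h₂ =>
    simp only [Cmd.run]; split_ifs
    exacts [List.prefix_rfl, h₁ (s.tick _), h₂ (s.tick _)]
  | ifZ e c₁ c₂ h₁ h₂ =>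
    simp only [Cmd.run]; split_ifs
    exacts [List.prefix_rfl, h₁ (s.tick _), h₂ (s.tick _)]
  | loop e c ih =>
    simp only [Cmd.run]; split_ifs
    · exact List.prefix_rfl
    · exact Function.iterate_induct (f := fun t => c.run E t) (p := fun s' => s.sent <+: s'.sent)
        (fun x hx => hx.trans (ih x)) _ _ List.prefix_rfl
  | send e =>
    simp only [Cmd.run]; split_ifs
    · exact List.prefix_rfl
    · exact List.prefix_append _ _
  | recv a i =>
    simp only [Cmd.run, State.writeF]; split_ifs
    · exact List.prefix_rfl
    · split <;> exact List.prefix_rfl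
    · split <;> exact List.prefix_rfl
  | rand a i =>
    simp only [Cmd.run, State.writeF]; split_ifs <;> exact List.prefix_rfl
  | _ => simp only [Cmd.run]; split_ifs <;> exact List.prefix_rfl

theorem Cmd.received_le_run (E : Env F) (c : Cmd) (s : State F) :
    s.received ≤ (c.run E s).received := by
  induction c generalizing s with
  | setW a i e => simp only [Cmd.run, State.writeW]; split_ifs <;> simp
  | setF a i e => simp only [Cmd.run, State.writeF]; split_ifs <;> simp
  | seq c₁ c₂ h₁ h₂ => exact (h₁ s).trans (h₂ _)
  | ifW e c₁ c₂ h₁ h₂ =>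
    simp only [Cmd.run]; split_ifs
    exacts [le_rfl, h₁ (s.tick _), h₂ (s.tick _)]
  | ifZ e c₁ c₂ h₁ h₂ =>
    simp only [Cmd.run]; split_ifs
    exacts [le_rfl, h₁ (s.tick _), h₂ (s.tick _)]
  | loop e c ih =>
    simp only [Cmd.run]; split_ifs
    · exact le_rfl
    · exact Function.iterate_induct (f := fun t => c.run E t)
        (p := fun s' => s.received ≤ s'.received) (fun x hx => hx.trans (ih x)) _ _ le_rfl
  | recv a i =>
    simp only [Cmd.run, State.writeF]; split_ifs
    · exact le_rfl
    · split <;> simp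
    · split <;> simp
  | rand a i => simp only [Cmd.run, State.writeF]; split_ifs <;> simp
  | _ => simp only [Cmd.run]; split_ifs <;> simp

theorem Cmd.not_blocked_of_run {E : Env F} {c : Cmd} {s : State F}
    (h : (c.run E s).blocked = false) : s.blocked = false := by
  by_contra hb
  rw [Bool.not_eq_false] at hb
  rw [c.run_of_blocked E hb, hb] at h
  exact absurd h (by simp)

/-- Suppose that, with the incoming messages `chal 0, chal 1, …`, a program runs to its end and that
it always sends its messages number `0, …, B k - 1` before it receives its message number `k`. If
only the messages `chal 0, …, chal (m - 1)` come, then the run is the same, or it stops after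
sending the first `B m` messages. -/
theorem Cmd.run_truncated {E E' : Env F} (hE : E'.SameMachine E) {chal : ℕ → F} {B : ℕ → ℕ}
    (hin : ∀ l k, E.inbox l k = if l.length = B k then some (chal k) else none) {m : ℕ}
    (hin' : ∀ l k, E'.inbox l k = if k < m then some (chal k) else none)
    (hcoin : E'.coin = E.coin) (c : Cmd) (s : State F) (hs : s.received ≤ m)
    (hr : (c.run E s).blocked = false) :
    (c.run E' s = c.run E s ∧ (c.run E s).received ≤ m) ∨
    ((c.run E' s).blocked = true ∧ (c.run E' s).sent <+: (c.run E s).sent ∧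
      (c.run E' s).sent.length = B m ∧ m < (c.run E s).received) := by
  induction c generalizing s with
  | setW a i e =>
    left; simp only [Cmd.run, WExp.eval_env hE, State.writeW_env hE, true_and]
    split_ifs <;> (try simp only [State.writeW]) <;> (try split_ifs) <;> exact hs
  | setF a i e =>
    left; simp only [Cmd.run, WExp.eval_env hE, FExp.eval_env hE, State.writeF_env hE, true_and]
    split_ifs <;> (try simp only [State.writeF]) <;> (try split_ifs) <;> exact hs
  | skip => left; simp only [Cmd.run, true_and]; split_ifs <;> exact hs
  | send e => left; simp only [Cmd.run, FExp.eval_env hE, true_and]; split_ifs <;> exact hs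
  | emit e => left; simp only [Cmd.run, FExp.eval_env hE, true_and]; split_ifs <;> exact hs
  | reject => left; simp only [Cmd.run, true_and]; split_ifs <;> exact hs
  | rand a i =>
    left; simp only [Cmd.run, WExp.eval_env hE, State.writeF_env hE, hcoin, true_and]
    split_ifs <;> (try simp only [State.writeF]) <;> (try split_ifs) <;> exact hs
  | seq c₁ c₂ h₁ h₂ =>
    have hb₁ := Cmd.not_blocked_of_run (c := c₂) hr
    rcases h₁ s hs hb₁ with ⟨e1, e2⟩ | ⟨e1, e2, e3, e4⟩
    · simp only [Cmd.run, e1]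
      exact h₂ _ e2 hr
    · right
      simp only [Cmd.run, Cmd.run_of_blocked E' c₂ e1]
      exact ⟨e1, e2.trans (c₂.sent_prefix_run E _), e3, e4.trans_le (c₂.received_le_run E _)⟩
  | ifW e c₁ c₂ h₁ h₂ =>
    have hb := Cmd.not_blocked_of_run hr
    rw [Cmd.run_ifW hb] at hr ⊢
    rw [Cmd.run_ifW hb, WExp.eval_env hE]
    split_ifs at hr ⊢
    · exact h₁ _ hs hr
    · exact h₂ _ hs hr
  | ifZ e c₁ c₂ h₁ h₂ =>
    have hb := Cmd.not_blocked_of_run hr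
    rw [Cmd.run_ifZ hb] at hr ⊢
    rw [Cmd.run_ifZ hb, FExp.eval_env hE]
    split_ifs at hr ⊢
    · exact h₁ _ hs hr
    · exact h₂ _ hs hr
  | loop e c ih =>
    have hb := Cmd.not_blocked_of_run hr
    rw [Cmd.run_loop hb] at hr ⊢
    rw [Cmd.run_loop hb, WExp.eval_env hE]
    have key : ∀ (n : ℕ) (s : State F), s.received ≤ m →
        ((fun t => c.run E t)^[n] s).blocked = false →
        ((fun t => c.run E' t)^[n] s = (fun t => c.run E t)^[n] s ∧
          ((fun t => c.run E t)^[n] s).received ≤ m) ∨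
        (((fun t => c.run E' t)^[n] s).blocked = true ∧
          ((fun t => c.run E' t)^[n] s).sent <+: ((fun t => c.run E t)^[n] s).sent ∧
          ((fun t => c.run E' t)^[n] s).sent.length = B m ∧
          m < ((fun t => c.run E t)^[n] s).received) := by
      intro n
      induction n with
      | zero => exact fun s h _ => .inl ⟨rfl, h⟩
      | succ n ihn =>
        intro s hs hr
        rw [Function.iterate_succ_apply'] at hr
        rw [Function.iterate_succ_apply', Function.iterate_succ_apply']
        rcases ihn s hs (Cmd.not_blocked_of_run (c := c) hr) with ⟨e1, e2⟩ | ⟨e1, e2, e3, e4⟩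
        · rw [e1]
          exact ih _ e2 hr
        · right
          rw [Cmd.run_of_blocked E' c e1]
          exact ⟨e1, e2.trans (c.sent_prefix_run E _), e3, e4.trans_le (c.received_le_run E _)⟩
    exact key _ _ hs hr
  | recv a i =>
    have hb := Cmd.not_blocked_of_run hr
    simp only [Cmd.run, hb, hin, hin', WExp.eval_env hE, State.writeF_env hE] at hr ⊢
    by_cases hl : s.sent.length = B s.received
    · simp only [hl, if_true] at hr ⊢
      by_cases hk : s.received < m
      · left
        simp only [hk, if_true]
        exact ⟨trivial, hk⟩
      · right
        have : s.received = m := by omega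
        subst this
        simp [State.writeF]
        split_ifs <;> simp [hl]
    · simp [hl] at hr

end Machine

/-! ### Multilinear extensions -/

section Multilinear

variable {F : Type u} [Field F]

/-- The factor of a bit in a weight of the multilinear extension. -/
def bw (x : F) (b : Bool) : F := if b then x else 1 - x

/-- The weight of `p` in the multilinear extension at the point `x 0, …, x (m - 1)`; coordinate `j`
belongs to bit `j` of `p`. -/
def wt (m : ℕ) (x : ℕ → F) (p : ℕ) : F := ∏ j ∈ Finset.range m, bw (x j) (p.testBit j)

/-- Fix the lowest bit of the index of a table to `x`. -/
def fold (x : F) (T : ℕ → F) (p : ℕ) : F := T (2 * p) + x * (T (2 * p + 1) - T (2 * p))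

/-- Fix the `m` lowest bits of the index of a table. -/
def folds (x : ℕ → F) (T : ℕ → F) : ℕ → ℕ → F
  | 0 => T
  | m + 1 => fold (x m) (folds x T m)

/-- The multilinear extension of a table with `2 ^ m` entries. -/
def mle (m : ℕ) (x : ℕ → F) (T : ℕ → F) : F := ∑ p ∈ Finset.range (2 ^ m), wt m x p * T p

theorem wt_zero (x : ℕ → F) (p : ℕ) : wt 0 x p = 1 := by simp [wt]

theorem wt_succ (m : ℕ) (x : ℕ → F) (p : ℕ) : wt (m + 1) x p = wt m x p * bw (x m) (p.testBit m) :=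
  Finset.prod_range_succ _ _

theorem wt_add_two_pow (m : ℕ) (x : ℕ → F) (p q : ℕ) : wt m x (p + 2 ^ m * q) = wt m x p := by
  refine Finset.prod_congr rfl fun j hj => ?_
  rw [Finset.mem_range] at hj
  congr 1
  have h : ∀ r : ℕ, (r % 2 ^ m).testBit j = r.testBit j := fun r => by
    rw [Nat.testBit_mod_two_pow]; simp [hj]
  rw [← h (p + 2 ^ m * q), Nat.add_mul_mod_self_left, h]

theorem wt_succ_low {m : ℕ} (x : ℕ → F) {p : ℕ} (hp : p < 2 ^ m) :
    wt (m + 1) x p = wt m x p * (1 - x m) := by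
  rw [wt_succ, Nat.testBit_lt_two_pow hp]; rfl

theorem wt_succ_high {m : ℕ} (x : ℕ → F) {p : ℕ} (hp : p < 2 ^ m) :
    wt (m + 1) x (p + 2 ^ m) = wt m x p * x m := by
  rw [wt_succ]
  congr 1
  · simpa using wt_add_two_pow m x p 1
  · rw [add_comm, Nat.testBit_two_pow_add_eq, Nat.testBit_lt_two_pow hp]; rfl

theorem sum_two_pow_succ {M : Type*} [AddCommMonoid M] (m : ℕ) (f : ℕ → M) :
    ∑ p ∈ Finset.range (2 ^ (m + 1)), f p
      = ∑ p ∈ Finset.range (2 ^ m), f p + ∑ p ∈ Finset.range (2 ^ m), f (p + 2 ^ m) := by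
  rw [pow_succ, mul_two, Finset.sum_range_add]
  simp only [add_comm]

theorem sum_range_two_mul {M : Type*} [AddCommMonoid M] (m : ℕ) (f : ℕ → M) :
    ∑ p ∈ Finset.range (2 * m), f p
      = ∑ p ∈ Finset.range m, (f (2 * p) + f (2 * p + 1)) := by
  induction m with
  | zero => simp
  | succ m ih =>
    rw [mul_add, mul_one, Finset.sum_range_succ, Finset.sum_range_succ, ih,
      Finset.sum_range_succ, add_assoc]

theorem folds_eq_sum (x : ℕ → F) (T : ℕ → F) (m q : ℕ) :
    folds x T m q = ∑ p ∈ Finset.range (2 ^ m), wt m x p * T (p + 2 ^ m * q) := by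
  induction m generalizing q with
  | zero => simp [folds, wt_zero]
  | succ m ih =>
    rw [folds, fold, ih, ih, sum_two_pow_succ]
    have e1 : ∀ p, p + 2 ^ m * (2 * q) = p + 2 ^ (m + 1) * q := fun p => by ring
    have e2 : ∀ p, p + 2 ^ m * (2 * q + 1) = p + 2 ^ m + 2 ^ (m + 1) * q := fun p => by ring
    simp only [e1, e2]
    have l : ∑ p ∈ Finset.range (2 ^ m), wt (m + 1) x p * T (p + 2 ^ (m + 1) * q)
        = (1 - x m) * ∑ p ∈ Finset.range (2 ^ m), wt m x p * T (p + 2 ^ (m + 1) * q) := by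
      rw [Finset.mul_sum]
      refine Finset.sum_congr rfl fun p hp => ?_
      rw [wt_succ_low x (Finset.mem_range.1 hp)]; ring
    have h : ∑ p ∈ Finset.range (2 ^ m),
          wt (m + 1) x (p + 2 ^ m) * T (p + 2 ^ m + 2 ^ (m + 1) * q)
        = x m * ∑ p ∈ Finset.range (2 ^ m), wt m x p * T (p + 2 ^ m + 2 ^ (m + 1) * q) := by
      rw [Finset.mul_sum]
      refine Finset.sum_congr rfl fun p hp => ?_
      rw [wt_succ_high x (Finset.mem_range.1 hp)]; ring
    rw [l, h]; ring

theorem folds_zero_eq_mle (x : ℕ → F) (T : ℕ → F) (m : ℕ) : folds x T m 0 = mle m x T := by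
  simp [folds_eq_sum, mle]

theorem mle_congr {m : ℕ} {x y : ℕ → F} {T U : ℕ → F} (hx : ∀ j < m, x j = y j)
    (hT : ∀ p < 2 ^ m, T p = U p) : mle m x T = mle m y U := by
  refine Finset.sum_congr rfl fun p hp => ?_
  rw [hT p (Finset.mem_range.1 hp)]
  congr 1
  exact Finset.prod_congr rfl fun j hj => by rw [hx j (Finset.mem_range.1 hj)]

/-- A product of functions of the bits, summed over all bit strings. -/
theorem sum_prod_bits (m : ℕ) (g : ℕ → Bool → F) :
    ∑ p ∈ Finset.range (2 ^ m), ∏ j ∈ Finset.range m, g j (p.testBit j)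
      = ∏ j ∈ Finset.range m, (g j false + g j true) := by
  induction m with
  | zero => simp
  | succ m ih =>
    rw [sum_two_pow_succ, Finset.prod_range_succ, ← ih, mul_add, Finset.sum_mul, Finset.sum_mul]
    congr 1 <;> refine Finset.sum_congr rfl fun p hp => ?_ <;> rw [Finset.mem_range] at hp <;>
      rw [Finset.prod_range_succ]
    · rw [Nat.testBit_lt_two_pow hp]
    · congr 1
      · refine Finset.prod_congr rfl fun j hj => ?_
        rw [Finset.mem_range] at hj
        rw [add_comm, Nat.testBit_two_pow_add_gt hj]
      · rw [add_comm, Nat.testBit_two_pow_add_eq, Nat.testBit_lt_two_pow hp]; rfl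

/-- The multilinear extension of the equality predicate. -/
theorem mle_wt (m : ℕ) (x y : ℕ → F) :
    mle m x (wt m y) = ∏ j ∈ Finset.range m, ((1 - x j) * (1 - y j) + x j * y j) := by
  simp only [mle, wt, ← Finset.prod_mul_distrib]
  rw [sum_prod_bits m fun j b => bw (x j) b * bw (y j) b]
  simp [bw]

theorem sum_wt (m : ℕ) (x : ℕ → F) : ∑ p ∈ Finset.range (2 ^ m), wt m x p = 1 := by
  simp only [wt]
  rw [sum_prod_bits m fun j b => bw (x j) b]
  simp [bw]

theorem mle_add (m : ℕ) (x T U : ℕ → F) : mle m x (fun p => T p + U p) = mle m x T + mle m x U := by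
  simp [mle, mul_add, Finset.sum_add_distrib]

theorem mle_const_mul (m : ℕ) (x T : ℕ → F) (c : F) :
    mle m x (fun p => c * T p) = c * mle m x T := by
  simp only [mle, Finset.mul_sum]
  exact Finset.sum_congr rfl fun p _ => by ring

theorem mle_const (m : ℕ) (x : ℕ → F) (c : F) : mle m x (fun _ => c) = c := by
  rw [mle, ← Finset.sum_mul, sum_wt, one_mul]

end Multilinear

/-! ### The sum-check protocol -/

section SumCheck

variable {F : Type u} [Field F]

/-- The polynomial in the four tables of a sum-check: `b` times the value of a gate with inputs `a`
and `c`, where `t` is `1` for a multiplication gate and `0` for an addition gate. -/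
def gate {R : Type*} [Add R] [Sub R] [Mul R] [One R] (b t a c : R) : R :=
  b * (t * (a * c) + (1 - t) * (a + c))

/-- The coefficient of `X ^ k` in
`gate (b₀ + b₁ X) (t₀ + t₁ X) (a₀ + a₁ X) (c₀ + c₁ X)`. -/
def gateCoeff {R : Type*} [Add R] [Sub R] [Mul R] [One R] (b₀ b₁ t₀ t₁ a₀ a₁ c₀ c₁ : R) : ℕ → R
  | 0 => b₀ * (t₀ * (a₀ * c₀) + (1 - t₀) * (a₀ + c₀))
  | 1 => b₀ * (t₁ * (a₀ * c₀) + t₀ * (a₁ * c₀ + a₀ * c₁) + (1 - t₀) * (a₁ + c₁) - t₁ * (a₀ + c₀))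
      + b₁ * (t₀ * (a₀ * c₀) + (1 - t₀) * (a₀ + c₀))
  | 2 => b₀ * (t₁ * (a₁ * c₀ + a₀ * c₁) + t₀ * (a₁ * c₁) - t₁ * (a₁ + c₁))
      + b₁ * (t₁ * (a₀ * c₀) + t₀ * (a₁ * c₀ + a₀ * c₁) + (1 - t₀) * (a₁ + c₁) - t₁ * (a₀ + c₀))
  | 3 => b₀ * (t₁ * (a₁ * c₁))
      + b₁ * (t₁ * (a₁ * c₀ + a₀ * c₁) + t₀ * (a₁ * c₁) - t₁ * (a₁ + c₁))
  | _ => b₁ * (t₁ * (a₁ * c₁))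

/-- The value at `x` of the polynomial of degree at most `4` with the coefficients `c 0, …, c 4`. -/
def horner {R : Type*} [Add R] [Mul R] (c : ℕ → R) (x : R) : R :=
  c 0 + x * (c 1 + x * (c 2 + x * (c 3 + x * c 4)))

/-- The sum of the values at `0` and `1` of the polynomial with the coefficients `c 0, …, c 4`. -/
def endSum {R : Type*} [Add R] (c : ℕ → R) : R := c 0 + (c 0 + (c 1 + (c 2 + (c 3 + c 4))))

/-- The four tables of a sum-check. -/
structure Tables (F : Type u) where
  b : ℕ → F
  t : ℕ → F
  a : ℕ → F
  c : ℕ → F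

/-- Fix the `m` lowest bits of the index in all tables. -/
def Tables.folds (x : ℕ → F) (T : Tables F) (m : ℕ) : Tables F :=
  ⟨_root_.folds x T.b m, _root_.folds x T.t m, _root_.folds x T.a m, _root_.folds x T.c m⟩

/-- The sum that is checked, over the first `m` indices. -/
def Tables.sum (T : Tables F) (m : ℕ) : F :=
  ∑ p ∈ Finset.range m, gate (T.b p) (T.t p) (T.a p) (T.c p)

/-- The coefficients of the univariate polynomial that the honest prover sends, if `2 * m` indices
are left. -/
def Tables.message (T : Tables F) (m k : ℕ) : F :=
  ∑ p ∈ Finset.range m, gateCoeff (T.b (2 * p)) (T.b (2 * p + 1) - T.b (2 * p))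
    (T.t (2 * p)) (T.t (2 * p + 1) - T.t (2 * p)) (T.a (2 * p)) (T.a (2 * p + 1) - T.a (2 * p))
    (T.c (2 * p)) (T.c (2 * p + 1) - T.c (2 * p)) k

theorem horner_sum {ι : Type*} (s : Finset ι) (f : ι → ℕ → F) (x : F) :
    horner (fun k => ∑ i ∈ s, f i k) x = ∑ i ∈ s, horner (f i) x := by
  simp only [horner, Finset.sum_add_distrib, ← Finset.mul_sum]

theorem endSum_eq (c : ℕ → F) : endSum c = horner c 0 + horner c 1 := by
  simp [endSum, horner]

theorem horner_gateCoeff (b₀ b₁ t₀ t₁ a₀ a₁ c₀ c₁ x : F) :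
    horner (gateCoeff b₀ b₁ t₀ t₁ a₀ a₁ c₀ c₁) x
      = gate (b₀ + x * b₁) (t₀ + x * t₁) (a₀ + x * a₁) (c₀ + x * c₁) := by
  simp only [horner, gateCoeff, gate]; ring

theorem Tables.horner_message (T : Tables F) (m : ℕ) (x : F) :
    horner (T.message m) x = ∑ p ∈ Finset.range m,
      gate (fold x T.b p) (fold x T.t p) (fold x T.a p) (fold x T.c p) := by
  unfold Tables.message
  rw [horner_sum]
  exact Finset.sum_congr rfl fun p _ => horner_gateCoeff _ _ _ _ _ _ _ _ _

theorem Tables.endSum_message (T : Tables F) (m : ℕ) : endSum (T.message m) = T.sum (2 * m) := by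
  rw [endSum_eq, T.horner_message, T.horner_message, Tables.sum, sum_range_two_mul,
    ← Finset.sum_add_distrib]
  simp [fold]

theorem Tables.horner_message_folds (T : Tables F) (x : ℕ → F) (m j : ℕ) :
    horner ((T.folds x j).message m) (x j) = (T.folds x (j + 1)).sum m := by
  rw [Tables.horner_message]; rfl

theorem horner_congr {c c' : ℕ → F} (h : ∀ k < 5, c k = c' k) (x : F) :
    horner c x = horner c' x := by
  simp [horner, h]

theorem endSum_congr {c c' : ℕ → F} (h : ∀ k < 5, c k = c' k) : endSum c = endSum c' := by
  simp [endSum, h]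

/-- Two different polynomials of degree at most `4` agree in at most `4` points. -/
theorem card_horner_eq_le [Fintype F] [DecidableEq F] {c c' : ℕ → F} (h : ∃ k < 5, c k ≠ c' k) :
    (Finset.univ.filter fun x => horner c x = horner c' x).card ≤ 4 := by
  let p : Polynomial F := ∑ k ∈ Finset.range 5, Polynomial.monomial k (c k - c' k)
  have hcoef : ∀ k < 5, p.coeff k = c k - c' k := by
    intro k hk
    simp only [p, Polynomial.finsetSum_coeff, Polynomial.coeff_monomial]
    rw [Finset.sum_ite_eq' (Finset.range 5) k]
    simp [hk]
  have hp : p ≠ 0 := by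
    obtain ⟨k, hk, hne⟩ := h
    intro h0
    have := hcoef k hk
    rw [h0, Polynomial.coeff_zero] at this
    exact hne (sub_eq_zero.1 this.symm)
  have hdeg : p.natDegree ≤ 4 := by
    refine Polynomial.natDegree_sum_le_of_forall_le _ _ fun k hk => ?_
    exact (Polynomial.natDegree_monomial_le _).trans (by rw [Finset.mem_range] at hk; omega)
  have hsub : (Finset.univ.filter fun x => horner c x = horner c' x) ⊆ p.roots.toFinset := by
    intro x hx
    rw [Finset.mem_filter] at hx
    rw [Multiset.mem_toFinset, Polynomial.mem_roots hp, Polynomial.IsRoot.def]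
    have : horner c x - horner c' x = 0 := sub_eq_zero.2 hx.2
    rw [← this]
    simp only [p, Finset.sum_range_succ, Finset.sum_range_zero, Polynomial.eval_add,
      Polynomial.eval_zero, Polynomial.eval_monomial, horner]
    ring
  exact (Finset.card_le_card hsub).trans ((Multiset.toFinset_card_le _).trans
    ((Polynomial.card_roots' p).trans hdeg))

end SumCheck

/-! ### The protocol -/

section Protocol

variable {F : Type u} [Field F] (C : Circuit)

namespace Circuit

/-- The value of a wiring function at the bit string with the number `p`, as a number. -/
def wire (i : ℕ) (f : Wiring) (p : ℕ) : ℕ := (C.wiring i f (BitVec.ofNat _ p)).toNat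

/-- The type of the gate `p` of layer `i` as a field element. -/
def typeF (F : Type u) [Field F] (i p : ℕ) : F := if C.wire i .type p = 0 then 0 else 1

/-- The value of gate number `p` of layer `i` on input `a`. -/
def layer (a : C.Input F) (i p : ℕ) : F :=
  if h : i ≤ C.depth then C.value a (C.depth - i) i (by omega) (BitVec.ofNat _ p) else 0

theorem layer_depth (a : C.Input F) (p : ℕ) : C.layer a C.depth p = a (BitVec.ofNat _ p) := by
  have : ∀ (k : ℕ) (h : C.depth + k = C.depth),
      C.value a k C.depth h (BitVec.ofNat _ p) = a (BitVec.ofNat _ p) := by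
    intro k h
    obtain rfl : k = 0 := by omega
    rfl
  rw [layer, dif_pos le_rfl, this]

theorem layer_of_lt (a : C.Input F) {i : ℕ} (hi : i < C.depth) (p : ℕ) :
    C.layer a i p = gate 1 (C.typeF F i p) (C.layer a (i + 1) (C.wire i .in₁ p))
      (C.layer a (i + 1) (C.wire i .in₂ p)) := by
  have key : ∀ (k : ℕ) (h : i + (k + 1) = C.depth) (k' : ℕ) (h' : i + k' = C.depth),
      C.value a k' i h' (BitVec.ofNat _ p) = gate 1 (C.typeF F i p)
        (C.value a k (i + 1) (by omega) (C.in₁ i (BitVec.ofNat _ p)))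
        (C.value a k (i + 1) (by omega) (C.in₂ i (BitVec.ofNat _ p))) := by
    intro k h k' h'
    obtain rfl : k' = k + 1 := by omega
    simp only [value, gate, typeF, wire, wiring]
    by_cases hty : C.type i (BitVec.ofNat _ p) = true <;> simp [hty]
  have e : ∀ q : BitVec (C.logSize (i + 1)), C.layer a (i + 1) q.toNat
      = C.value a (C.depth - (i + 1)) (i + 1) (by omega) q := by
    intro q
    rw [layer, dif_pos (by omega)]
    congr 1
    simp
  rw [layer, dif_pos hi.le, key (C.depth - (i + 1)) (by omega) _ _]
  simp only [wire]
  rw [show (C.wiring i .in₁ (BitVec.ofNat _ p)) = C.in₁ i (BitVec.ofNat _ p) from rfl,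
    show (C.wiring i .in₂ (BitVec.ofNat _ p)) = C.in₂ i (BitVec.ofNat _ p) from rfl]
  rw [← e, ← e]
  rfl

theorem wire_lt (i : ℕ) (f : Wiring) (p : ℕ) : C.wire i f p < 2 ^ C.outWidth i f :=
  BitVec.isLt _

theorem outputs_eq (a : C.Input F) :
    C.outputs a = (List.range C.numOutputs).map (C.layer a 1) := by
  have hd := C.two_le_depth
  apply List.ext_getElem
  · simp [outputs, numOutputs]
  · intro p h₁ h₂
    simp only [outputs, List.getElem_ofFn, List.getElem_map, List.getElem_range]
    rw [layer, dif_pos (by omega)]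
    congr 1
    apply BitVec.eq_of_toNat_eq
    simp only [outputs, List.length_ofFn] at h₁
    simp [Nat.mod_eq_of_lt h₁]

/-- The number of the challenge at which the point begins to which the claim on layer `k + 1`
refers. -/
def pos : ℕ → ℕ
  | 0 => 0
  | k + 1 => pos k + (2 * C.logSize (k + 1) + 1)

/-- The number of rounds of the protocol. -/
def rounds : ℕ := C.pos (C.depth - 1) + C.logSize C.depth

end Circuit

/-- The sequence `x` from number `n` on. -/
def shift {F : Type u} (x : ℕ → F) (n j : ℕ) : F := x (n + j)

namespace Circuit

theorem shift_zero {F : Type u} (chal : ℕ → F) : shift chal 0 = chal := by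
  funext j; simp [shift]

/-- The number of the first challenge of the first sum-check of a layer. -/
def start₁ (k : ℕ) : ℕ := C.pos k + C.logSize (k + 1)

/-- The number of the challenge between the two sum-checks of a layer. -/
def mid (k : ℕ) : ℕ := C.pos k + 2 * C.logSize (k + 1)

theorem start₁_add (k : ℕ) : C.start₁ k + C.logSize (k + 1) = C.mid k := by
  simp only [start₁, mid]; omega

theorem mid_add_one (k : ℕ) : C.mid k + 1 = C.pos (k + 1) := by
  simp only [pos, mid]; omega

theorem pos_mono : Monotone C.pos := monotone_nat_of_le_succ fun k => by simp [pos]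

variable (chal : ℕ → F) (a : C.Input F)

/-- Entry `q` is the coefficient of the value of gate `q` in the linear combination of the values of
the in-neighbours that the second sum-check of a layer is about. -/
def combine (k q : ℕ) : F :=
  ∑ p ∈ Finset.range (2 ^ C.logSize (k + 1)),
    wt (C.logSize (k + 1)) (shift chal (C.start₁ k)) p *
      ((if C.wire (k + 1) .in₁ p = q then 1 else 0)
        + chal (C.mid k) * (if C.wire (k + 1) .in₂ p = q then 1 else 0))

/-- The factor in front of the multilinear extension of layer `k + 1` in the claim on this layer. -/
def scale : ℕ → F
  | 0 => 1
  | k + 1 => mle (C.logSize (k + 2)) (shift chal (C.pos (k + 1))) (C.combine chal k)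

/-- The tables of the first sum-check of a layer. -/
def tables₁ (k : ℕ) : Tables F where
  b p := C.scale chal k * wt (C.logSize (k + 1)) (shift chal (C.pos k)) p
  t := C.typeF F (k + 1)
  a p := C.layer a (k + 2) (C.wire (k + 1) .in₁ p)
  c p := C.layer a (k + 2) (C.wire (k + 1) .in₂ p)

/-- The tables of the second sum-check of a layer. -/
def tables₂ (k : ℕ) : Tables F where
  b := C.combine chal k
  t _ := 1
  a := C.layer a (k + 2)
  c _ := 1

/-- The true value in the claim on layer `k + 1`. -/
def truth (k : ℕ) : F :=
  C.scale chal k * mle (C.logSize (k + 1)) (shift chal (C.pos k)) (C.layer a (k + 1))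

/-- The honest value in the first component of the message between the two sum-checks. -/
def mid₁ (k : ℕ) : F := mle (C.logSize (k + 1)) (shift chal (C.start₁ k)) (C.tables₁ chal a k).a

/-- The honest value in the second component of the message between the two sum-checks. -/
def mid₂ (k : ℕ) : F := mle (C.logSize (k + 1)) (shift chal (C.start₁ k)) (C.tables₁ chal a k).c

/-- What the verifier expects as claim after the first sum-check, if the prover sends `x` and `y`. -/
def midValue (k : ℕ) (x y : F) : F :=
  gate (C.scale chal k * mle (C.logSize (k + 1)) (shift chal (C.start₁ k))
      (wt (C.logSize (k + 1)) (shift chal (C.pos k))))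
    (mle (C.logSize (k + 1)) (shift chal (C.start₁ k)) (C.typeF F (k + 1))) x y

theorem sum_tables₁ {k : ℕ} (hk : k + 1 < C.depth) :
    (C.tables₁ chal a k).sum (2 ^ C.logSize (k + 1)) = C.truth chal a k := by
  rw [truth, mle, Finset.mul_sum, Tables.sum]
  refine Finset.sum_congr rfl fun p _ => ?_
  rw [C.layer_of_lt a hk]
  simp only [tables₁, gate]; ring

theorem sum_tables₁_folds (k : ℕ) :
    ((C.tables₁ chal a k).folds (shift chal (C.start₁ k)) (C.logSize (k + 1))).sum 1
      = C.midValue chal k (C.mid₁ chal a k) (C.mid₂ chal a k) := by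
  simp only [Tables.sum, Finset.sum_range_one, Tables.folds, folds_zero_eq_mle, midValue]
  congr 1
  exact mle_const_mul _ _ _ _

theorem sum_combine (k : ℕ) (g : ℕ → F) :
    ∑ q ∈ Finset.range (2 ^ C.logSize (k + 2)), C.combine chal k q * g q
      = ∑ p ∈ Finset.range (2 ^ C.logSize (k + 1)),
          wt (C.logSize (k + 1)) (shift chal (C.start₁ k)) p *
            (g (C.wire (k + 1) .in₁ p) + chal (C.mid k) * g (C.wire (k + 1) .in₂ p)) := by
  simp only [combine, Finset.sum_mul]
  rw [Finset.sum_comm]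
  refine Finset.sum_congr rfl fun p _ => ?_
  have h₁ : C.wire (k + 1) .in₁ p ∈ Finset.range (2 ^ C.logSize (k + 2)) :=
    Finset.mem_range.2 (C.wire_lt (k + 1) .in₁ p)
  have h₂ : C.wire (k + 1) .in₂ p ∈ Finset.range (2 ^ C.logSize (k + 2)) :=
    Finset.mem_range.2 (C.wire_lt (k + 1) .in₂ p)
  simp only [mul_add, add_mul, Finset.sum_add_distrib, mul_ite, ite_mul, mul_one, mul_zero,
    zero_mul]
  rw [Finset.sum_ite_eq, Finset.sum_ite_eq, if_pos h₁, if_pos h₂]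
  ring

theorem sum_tables₂ (k : ℕ) :
    (C.tables₂ chal a k).sum (2 ^ C.logSize (k + 2))
      = C.mid₁ chal a k + chal (C.mid k) * C.mid₂ chal a k := by
  have : (C.tables₂ chal a k).sum (2 ^ C.logSize (k + 2))
      = ∑ q ∈ Finset.range (2 ^ C.logSize (k + 2)), C.combine chal k q * C.layer a (k + 2) q :=
    Finset.sum_congr rfl fun q _ => by simp [tables₂, gate]
  rw [this, sum_combine, mid₁, mid₂, mle, mle, Finset.mul_sum, ← Finset.sum_add_distrib]
  refine Finset.sum_congr rfl fun p _ => ?_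
  simp only [tables₁]; ring

theorem sum_tables₂_folds (k : ℕ) :
    ((C.tables₂ chal a k).folds (shift chal (C.pos (k + 1))) (C.logSize (k + 2))).sum 1
      = C.truth chal a (k + 1) := by
  simp [Tables.sum, Tables.folds, folds_zero_eq_mle, tables₂, mle_const, gate, truth, scale]

theorem scale_succ (k : ℕ) :
    C.scale chal (k + 1) = ∑ p ∈ Finset.range (2 ^ C.logSize (k + 1)),
      wt (C.logSize (k + 1)) (shift chal (C.start₁ k)) p *
        (wt (C.logSize (k + 2)) (shift chal (C.pos (k + 1))) (C.wire (k + 1) .in₁ p)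
          + chal (C.mid k) *
            wt (C.logSize (k + 2)) (shift chal (C.pos (k + 1))) (C.wire (k + 1) .in₂ p)) := by
  rw [← sum_combine, scale, mle]
  exact Finset.sum_congr rfl fun q _ => mul_comm _ _

/-! #### Messages and checks -/

/-- The messages of a sum-check with `2 ^ m` indices and challenges `x 0, x 1, …`. -/
def sumCheckMessages (T : Tables F) (x : ℕ → F) (m : ℕ) : ℕ → List F
  | 0 => []
  | j + 1 => sumCheckMessages T x m j ++
      (List.range 5).map ((T.folds x j).message (2 ^ (m - j - 1)))

/-- The messages of the honest prover for a layer. -/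
def layerMessages (k : ℕ) : List F :=
  sumCheckMessages (C.tables₁ chal a k) (shift chal (C.start₁ k)) (C.logSize (k + 1))
    (C.logSize (k + 1)) ++ [C.mid₁ chal a k, C.mid₂ chal a k, 0, 0, 0] ++
  sumCheckMessages (C.tables₂ chal a k) (shift chal (C.pos (k + 1))) (C.logSize (k + 2))
    (C.logSize (k + 2))

/-- The messages of the honest prover up to the claim on layer `k + 1`: the outputs, zeros while the
verifier sends the point to which the claim on the outputs refers, and the messages of the layers. -/
def messages : ℕ → List F
  | 0 => (List.range C.numOutputs).map (C.layer a 1) ++ List.replicate (5 * C.logSize 1) 0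
  | k + 1 => messages k ++ C.layerMessages chal a k

theorem length_sumCheckMessages (T : Tables F) (x : ℕ → F) (m j : ℕ) :
    (sumCheckMessages T x m j).length = 5 * j := by
  induction j with
  | zero => rfl
  | succ j ih => simp [sumCheckMessages, ih]; omega

theorem length_messages (k : ℕ) :
    (C.messages chal a k).length = C.numOutputs + 5 * (C.pos k + C.logSize (k + 1)) := by
  induction k with
  | zero => simp [messages, pos]
  | succ k ih =>
    have h2 : C.logSize (k + 1 + 1) = C.logSize (k + 2) := rfl
    simp only [messages, layerMessages, List.length_append, ih, length_sumCheckMessages, pos]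
    simp only [List.length_cons, List.length_nil]
    omega

theorem sumCheckMessages_getD (T : Tables F) (x : ℕ → F) (m n j c : ℕ) (hj : j < n) (hc : c < 5) :
    (sumCheckMessages T x m n).getD (5 * j + c) 0
      = (T.folds x j).message (2 ^ (m - j - 1)) c := by
  induction n with
  | zero => omega
  | succ n ih =>
    rw [sumCheckMessages]
    rcases Nat.lt_or_ge j n with h | h
    · rw [List.getD_append _ _ _ _ (by rw [length_sumCheckMessages]; omega), ih h]
    · obtain rfl : j = n := by omega
      rw [List.getD_append_right _ _ _ _ (by rw [length_sumCheckMessages]; omega),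
        length_sumCheckMessages]
      simp [List.getD_eq_getElem?_getD, hc]

theorem messages_prefix {k l : ℕ} (h : k ≤ l) : C.messages chal a k <+: C.messages chal a l := by
  induction h with
  | refl => exact List.prefix_rfl
  | step _ ih => exact ih.trans (List.prefix_append _ _)

/-- Component `c` of the message of the honest prover in round `t`. -/
def honest (t c : ℕ) : F :=
  (C.messages chal a (C.depth - 1)).getD (C.numOutputs + 5 * t + c) 0

theorem _root_.List.IsPrefix.getD_eq {α : Type*} {l l' : List α} (h : l <+: l') {n : ℕ}
    (hn : n < l.length) (d : α) : l'.getD n d = l.getD n d := by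
  obtain ⟨m, rfl⟩ := h
  exact List.getD_append _ _ _ _ hn

theorem honest_eq {k t c : ℕ} (hk : k < C.depth - 1) (ht : C.start₁ k ≤ t)
    (ht' : t < C.start₁ (k + 1)) (hc : c < 5) :
    C.honest chal a t c = (C.layerMessages chal a k).getD (5 * (t - C.start₁ k) + c) 0 := by
  have hl := C.length_messages chal a k
  have hl' := C.length_messages chal a (k + 1)
  have h2 : C.logSize (k + 1 + 1) = C.logSize (k + 2) := rfl
  simp only [start₁] at ht ht' ⊢
  rw [honest, (C.messages_prefix chal a (show k + 1 ≤ C.depth - 1 from hk)).getD_eq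
    (by rw [hl']; omega), messages, List.getD_append_right _ _ _ _ (by omega)]
  congr 1
  omega

theorem honest_first {k j c : ℕ} (hk : k < C.depth - 1) (hj : j < C.logSize (k + 1)) (hc : c < 5) :
    C.honest chal a (C.start₁ k + j) c
      = ((C.tables₁ chal a k).folds (shift chal (C.start₁ k)) j).message
          (2 ^ (C.logSize (k + 1) - j - 1)) c := by
  have h1 := C.start₁_add k
  have h2 := C.mid_add_one k
  have h3 : C.start₁ (k + 1) = C.pos (k + 1) + C.logSize (k + 2) := rfl
  rw [C.honest_eq chal a hk (by omega) (by omega) hc, layerMessages, List.append_assoc,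
    List.getD_append _ _ _ _ (by rw [length_sumCheckMessages]; omega), Nat.add_sub_cancel_left,
    sumCheckMessages_getD _ _ _ _ _ _ hj hc]

theorem honest_mid {k c : ℕ} (hk : k < C.depth - 1) (hc : c < 5) :
    C.honest chal a (C.mid k) c = [C.mid₁ chal a k, C.mid₂ chal a k, 0, 0, 0].getD c 0 := by
  have h1 := C.start₁_add k
  have h2 := C.mid_add_one k
  have h3 : C.start₁ (k + 1) = C.pos (k + 1) + C.logSize (k + 2) := rfl
  rw [C.honest_eq chal a hk (by omega) (by omega) hc, layerMessages, List.append_assoc,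
    List.getD_append_right _ _ _ _ (by rw [length_sumCheckMessages]; omega),
    List.getD_append _ _ _ _ (by rw [length_sumCheckMessages]; simp; omega),
    length_sumCheckMessages]
  congr 1
  omega

theorem honest_second {k j c : ℕ} (hk : k < C.depth - 1) (hj : j < C.logSize (k + 2))
    (hc : c < 5) :
    C.honest chal a (C.pos (k + 1) + j) c
      = ((C.tables₂ chal a k).folds (shift chal (C.pos (k + 1))) j).message
          (2 ^ (C.logSize (k + 2) - j - 1)) c := by
  have h1 := C.start₁_add k
  have h2 := C.mid_add_one k
  have h3 : C.start₁ (k + 1) = C.pos (k + 1) + C.logSize (k + 2) := rfl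
  rw [C.honest_eq chal a hk (by omega) (by omega) hc, layerMessages,
    List.getD_append_right _ _ _ _ (by
      rw [List.length_append, length_sumCheckMessages]; simp; omega),
    List.length_append, length_sumCheckMessages, ← sumCheckMessages_getD _ _ _ _ _ _ hj hc]
  congr 1
  simp; omega

/-- The claim before round `t`: in the beginning a value of the multilinear extension of the alleged
outputs `out`, and later the value of the last polynomial at the last challenge. -/
def claim (out : ℕ → F) (msg : ℕ → ℕ → F) (t : ℕ) : F :=
  if t = C.logSize 1 then mle (C.logSize 1) chal out else horner (msg (t - 1)) (chal (t - 1))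

/-- The checks of the verifier that belong to layer `k + 1` succeed. -/
structure LayerAccepts (out : ℕ → F) (msg : ℕ → ℕ → F) (k : ℕ) : Prop where
  first : ∀ j < C.logSize (k + 1),
    endSum (msg (C.start₁ k + j)) = C.claim chal out msg (C.start₁ k + j)
  mid : C.midValue chal k (msg (C.mid k) 0) (msg (C.mid k) 1) = C.claim chal out msg (C.mid k)
  second : ∀ j < C.logSize (k + 2),
    endSum (msg (C.pos (k + 1) + j)) = C.claim chal out msg (C.pos (k + 1) + j)

/-- All checks of the verifier succeed. -/
structure Accepts (out : ℕ → F) (msg : ℕ → ℕ → F) : Prop where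
  layer : ∀ k < C.depth - 1, C.LayerAccepts chal out msg k
  last : C.scale chal (C.depth - 1) * mle (C.logSize C.depth) (shift chal (C.pos (C.depth - 1)))
    (C.layer a C.depth) = C.claim chal out msg C.rounds

variable {chal a} {out : ℕ → F} {msg : ℕ → ℕ → F}

theorem claim_succ {t : ℕ} (h : C.logSize 1 ≤ t) :
    C.claim chal out msg (t + 1) = horner (msg t) (chal t) := by
  rw [claim, if_neg (by omega)]; rfl

theorem claim_start : C.claim chal out msg (C.start₁ 0) = mle (C.logSize 1) chal out := by
  rw [claim, if_pos (by simp [start₁, pos])]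

theorem logSize_one_le_start₁ (k : ℕ) : C.logSize 1 ≤ C.start₁ k := by
  cases k with
  | zero => simp [start₁, pos]
  | succ k =>
    have := C.pos_mono (show 1 ≤ k + 1 by omega)
    have e : C.pos 1 = 2 * C.logSize 1 + 1 := by simp [pos]
    simp only [start₁]
    omega

theorem truth_zero : C.truth chal a 0 = mle (C.logSize 1) chal (C.layer a 1) := by
  simp [truth, scale, pos, shift_zero]

section Chain

/-! The following lemmas pass from round to round. The alternative is between messages that are
honest and messages whose deviation from the honest ones is not hidden by the challenge. -/

/-- A sum-check with honest messages. -/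
theorem sumCheck_complete {T : Tables F} {t₀ m : ℕ} (ht : C.logSize 1 ≤ t₀)
    (hh : ∀ j < m, ∀ c < 5, msg (t₀ + j) c
      = (T.folds (shift chal t₀) j).message (2 ^ (m - j - 1)) c)
    (h : C.claim chal out msg t₀ = T.sum (2 ^ m)) :
    (∀ j < m, endSum (msg (t₀ + j)) = C.claim chal out msg (t₀ + j)) ∧
      C.claim chal out msg (t₀ + m) = (T.folds (shift chal t₀) m).sum 1 := by
  have key : ∀ j ≤ m, C.claim chal out msg (t₀ + j)
      = (T.folds (shift chal t₀) j).sum (2 ^ (m - j)) := by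
    intro j hj
    induction j with
    | zero => exact h
    | succ j ih =>
      rw [← add_assoc, C.claim_succ (by omega), horner_congr (hh j (by omega)),
        show m - (j + 1) = m - j - 1 by omega]
      exact Tables.horner_message_folds T (shift chal t₀) _ j
  refine ⟨fun j hj => ?_, by simpa using key m le_rfl⟩
  rw [key j hj.le, endSum_congr (hh j hj), Tables.endSum_message, ← pow_succ',
    show m - j - 1 + 1 = m - j by omega]

/-- A sum-check with a wrong claim. -/
theorem sumCheck_sound {T : Tables F} {t₀ m : ℕ} (ht : C.logSize 1 ≤ t₀) {hon : ℕ → ℕ → F}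
    (hh : ∀ j < m, ∀ c < 5, hon (t₀ + j) c
      = (T.folds (shift chal t₀) j).message (2 ^ (m - j - 1)) c)
    (hl : ∀ j < m, (∃ c < 5, msg (t₀ + j) c ≠ hon (t₀ + j) c) →
      horner (msg (t₀ + j)) (chal (t₀ + j)) ≠ horner (hon (t₀ + j)) (chal (t₀ + j)))
    (hc : ∀ j < m, endSum (msg (t₀ + j)) = C.claim chal out msg (t₀ + j))
    (h : C.claim chal out msg t₀ ≠ T.sum (2 ^ m)) :
    C.claim chal out msg (t₀ + m) ≠ (T.folds (shift chal t₀) m).sum 1 := by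
  have key : ∀ j ≤ m, C.claim chal out msg (t₀ + j)
      ≠ (T.folds (shift chal t₀) j).sum (2 ^ (m - j)) := by
    intro j hj
    induction j with
    | zero => exact h
    | succ j ih =>
      have hne : ∃ c < 5, msg (t₀ + j) c ≠ hon (t₀ + j) c := by
        by_contra! hcon
        refine ih (by omega) ?_
        rw [← hc j (by omega), endSum_congr hcon, endSum_congr (hh j (by omega)),
          Tables.endSum_message, ← pow_succ', show m - j - 1 + 1 = m - j by omega]
      rw [← add_assoc, C.claim_succ (by omega)]
      refine (hl j (by omega) hne).trans_eq ?_
      rw [horner_congr (hh j (by omega)), show m - (j + 1) = m - j - 1 by omega]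
      exact Tables.horner_message_folds T (shift chal t₀) _ j
  simpa using key m le_rfl

end Chain

variable (chal a)

theorem accepts_honest {msg : ℕ → ℕ → F}
    (hmsg : ∀ t < C.rounds, ∀ c < 5, msg t c = C.honest chal a t c) (out : ℕ → F)
    (hout : ∀ p < C.numOutputs, out p = C.layer a 1 p) : C.Accepts chal a out msg := by
  have hd := C.two_le_depth
  have hr : C.start₁ (C.depth - 1) = C.rounds := by
    rw [start₁, rounds, show C.depth - 1 + 1 = C.depth by omega]
  have hmono : Monotone C.start₁ := monotone_nat_of_le_succ fun k => by
    have := C.start₁_add k; have := C.mid_add_one k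
    simp only [start₁] at *; omega
  have step : ∀ k < C.depth - 1, C.claim chal out msg (C.start₁ k) = C.truth chal a k →
      C.LayerAccepts chal out msg k ∧
        C.claim chal out msg (C.start₁ (k + 1)) = C.truth chal a (k + 1) := by
    intro k hk h
    have h1 := C.start₁_add k
    have h2 := C.mid_add_one k
    have h3 : C.start₁ (k + 1) = C.pos (k + 1) + C.logSize (k + 2) := rfl
    have h4 := C.logSize_one_le_start₁ k
    have h5 : C.start₁ (k + 1) ≤ C.rounds := hr ▸ hmono (show k + 1 ≤ C.depth - 1 by omega)
    obtain ⟨f1, f2⟩ := C.sumCheck_complete (msg := msg) (out := out) h4 (fun j hj c hc => by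
      rw [hmsg _ (by omega) c hc, C.honest_first chal a hk hj hc])
      (h.trans (C.sum_tables₁ chal a (by omega)).symm)
    rw [h1, sum_tables₁_folds] at f2
    have e : ∀ c < 5, msg (C.mid k) c = [C.mid₁ chal a k, C.mid₂ chal a k, 0, 0, 0].getD c 0 :=
      fun c hc => by rw [hmsg _ (by omega) c hc, C.honest_mid chal a hk hc]
    have f3 : C.claim chal out msg (C.pos (k + 1))
        = (C.tables₂ chal a k).sum (2 ^ C.logSize (k + 2)) := by
      rw [← h2, C.claim_succ (by omega), horner_congr e, C.sum_tables₂]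
      simp [horner]
    obtain ⟨g1, g2⟩ := C.sumCheck_complete (msg := msg) (out := out)
      (show C.logSize 1 ≤ C.pos (k + 1) by omega) (fun j hj c hc => by
      rw [hmsg _ (by omega) c hc, C.honest_second chal a hk hj hc]) f3
    rw [sum_tables₂_folds, ← h3] at g2
    refine ⟨⟨f1, ?_, g1⟩, g2⟩
    rw [f2, e 0 (by omega), e 1 (by omega)]
    rfl
  have all : ∀ k ≤ C.depth - 1, C.claim chal out msg (C.start₁ k) = C.truth chal a k := by
    intro k hk
    induction k with
    | zero =>
      rw [claim_start, truth_zero]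
      exact mle_congr (fun _ _ => rfl) hout
    | succ k ih => exact (step k (by omega) (ih (by omega))).2
  refine ⟨fun k hk => (step k hk (all k hk.le)).1, ?_⟩
  have := all (C.depth - 1) le_rfl
  rw [hr] at this
  rw [this, truth, show C.depth - 1 + 1 = C.depth by omega]

theorem sound_of_accepts {out : ℕ → F} {msg : ℕ → ℕ → F} (hacc : C.Accepts chal a out msg)
    (hl : ∀ t, C.logSize 1 ≤ t → t < C.rounds → (∃ c < 5, msg t c ≠ C.honest chal a t c) →
      horner (msg t) (chal t) ≠ horner (C.honest chal a t) (chal t)) :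
    mle (C.logSize 1) chal out = mle (C.logSize 1) chal (C.layer a 1) := by
  have hd := C.two_le_depth
  have hr : C.start₁ (C.depth - 1) = C.rounds := by
    rw [start₁, rounds, show C.depth - 1 + 1 = C.depth by omega]
  have hmono : Monotone C.start₁ := monotone_nat_of_le_succ fun k => by
    have := C.start₁_add k; have := C.mid_add_one k
    simp only [start₁] at *; omega
  have step : ∀ k < C.depth - 1, C.claim chal out msg (C.start₁ k) ≠ C.truth chal a k →
      C.claim chal out msg (C.start₁ (k + 1)) ≠ C.truth chal a (k + 1) := by
    intro k hk h
    have h1 := C.start₁_add k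
    have h2 := C.mid_add_one k
    have h3 : C.start₁ (k + 1) = C.pos (k + 1) + C.logSize (k + 2) := rfl
    have h4 := C.logSize_one_le_start₁ k
    have h5 : C.start₁ (k + 1) ≤ C.rounds := hr ▸ hmono (show k + 1 ≤ C.depth - 1 by omega)
    obtain ⟨c1, c2, c3⟩ := hacc.layer k hk
    have f2 := C.sumCheck_sound (msg := msg) (out := out) h4
      (fun j hj c hc => C.honest_first chal a hk hj hc)
      (fun j hj => hl _ (by omega) (by omega)) c1
      (h.trans_eq (C.sum_tables₁ chal a (by omega)).symm)
    rw [h1, sum_tables₁_folds] at f2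
    have hne : ∃ c < 5, msg (C.mid k) c ≠ C.honest chal a (C.mid k) c := by
      by_contra! hcon
      refine f2 ?_
      rw [← c2, hcon 0 (by omega), hcon 1 (by omega), C.honest_mid chal a hk (by omega),
        C.honest_mid chal a hk (by omega)]
      rfl
    have f3 : C.claim chal out msg (C.pos (k + 1))
        ≠ (C.tables₂ chal a k).sum (2 ^ C.logSize (k + 2)) := by
      rw [← h2, C.claim_succ (by omega)]
      refine (hl _ (by omega) (by omega) hne).trans_eq ?_
      rw [horner_congr (fun c hc => C.honest_mid chal a hk hc), C.sum_tables₂]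
      simp [horner]
    have g2 := C.sumCheck_sound (msg := msg) (out := out)
      (show C.logSize 1 ≤ C.pos (k + 1) by omega)
      (fun j hj c hc => C.honest_second chal a hk hj hc)
      (fun j hj => hl _ (by omega) (by omega)) c3 f3
    rwa [sum_tables₂_folds, ← h3] at g2
  by_contra hne
  have all : ∀ k ≤ C.depth - 1, C.claim chal out msg (C.start₁ k) ≠ C.truth chal a k := by
    intro k hk
    induction k with
    | zero => rwa [claim_start, truth_zero]
    | succ k ih => exact step k (by omega) (ih (by omega))
  refine all (C.depth - 1) le_rfl ?_
  rw [hr, ← hacc.last, truth, show C.depth - 1 + 1 = C.depth by omega]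

end Circuit

end Protocol

/-! ### Expressions and simple loops -/

section Programs

variable {F : Type u}

section Expressions

variable {E : Env F} {s : State F}

theorem WExp.eval_const {m : ℕ} (h : m < 2 ^ E.wordSize) : (WExp.const m).eval E s = m :=
  Nat.mod_eq_of_lt h

theorem WExp.eval_const_zero : (WExp.const 0).eval E s = 0 := Nat.zero_mod _

theorem WExp.eval_get {a j v : ℕ} {i : WExp} (hi : i.eval E s = j) (hj : j < E.memSize)
    (hv : s.word a j = v) (h : v < 2 ^ E.wordSize) : (WExp.get a i).eval E s = v := by
  simp only [WExp.eval, hi, hj, if_true, hv]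
  exact Nat.mod_eq_of_lt h

theorem WExp.eval_var {a v : ℕ} (hM : 0 < E.memSize) (hv : s.word a 0 = v)
    (h : v < 2 ^ E.wordSize) : (wv a).eval E s = v :=
  WExp.eval_get WExp.eval_const_zero hM hv h

theorem WExp.eval_op {o : WordOp} {x y : WExp} {a b : ℕ} (hx : x.eval E s = a)
    (hy : y.eval E s = b) (h : o.eval a b < 2 ^ E.wordSize) :
    (WExp.op o x y).eval E s = o.eval a b := by
  simp only [WExp.eval, hx, hy]
  exact Nat.mod_eq_of_lt h

/-- The sum of a word and a constant. -/
abbrev WExp.plus (e : WExp) (m : ℕ) : WExp := .op .add e (.const m)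

theorem WExp.eval_plus {e : WExp} {a m : ℕ} (he : e.eval E s = a) (h : a + m < 2 ^ E.wordSize) :
    (e.plus m).eval E s = a + m :=
  WExp.eval_op he (WExp.eval_const (by omega)) h

/-- A power of two. -/
abbrev WExp.twoPow (e : WExp) : WExp := .op .shl (.const 1) e

theorem WExp.eval_twoPow {e : WExp} {m : ℕ} (he : e.eval E s = m) (h : 2 ^ m < 2 ^ E.wordSize) :
    e.twoPow.eval E s = 2 ^ m := by
  have h1 : 1 < 2 ^ E.wordSize := lt_of_le_of_lt Nat.one_le_two_pow h
  have := WExp.eval_op (o := .shl) (WExp.eval_const (E := E) (s := s) h1) he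
    (by simpa [WordOp.eval, Nat.shiftLeft_eq] using h)
  simpa [WordOp.eval, Nat.shiftLeft_eq] using this

/-- The depth of the circuit. -/
abbrev WExp.depth : WExp := .query .depth (.const 0) (.const 0) (.const 0)

/-- The logarithm of the size of a layer. -/
abbrev WExp.logSize (i : WExp) : WExp := .query .logSize i (.const 0) (.const 0)

/-- The value of a wiring function of a layer at a bit string. -/
abbrev WExp.wire (f : Wiring) (i p : WExp) : WExp := .query (.eval f) i p (.const 0)

variable {C : Circuit} {S : C.Exceptions}

theorem WExp.eval_depth (hE : E.answer = C.answer S) (h : C.depth < 2 ^ E.wordSize) :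
    WExp.depth.eval E s = C.depth := by
  simp only [WExp.eval, hE]
  exact Nat.mod_eq_of_lt h

theorem WExp.eval_logSize (hE : E.answer = C.answer S) {e : WExp} {i : ℕ} (he : e.eval E s = i)
    (h : C.logSize i < 2 ^ E.wordSize) : (WExp.logSize e).eval E s = C.logSize i := by
  simp only [WExp.eval, hE, he]
  exact Nat.mod_eq_of_lt h

theorem WExp.eval_wire (hE : E.answer = C.answer S) {f : Wiring} {e e' : WExp} {i p : ℕ}
    (he : e.eval E s = i) (he' : e'.eval E s = p) (h : C.wire i f p < 2 ^ E.wordSize) :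
    (WExp.wire f e e').eval E s = C.wire i f p := by
  simp only [WExp.eval, hE, he, he']
  exact Nat.mod_eq_of_lt h

instance : Add FExp := ⟨.add⟩
instance : Sub FExp := ⟨.sub⟩
instance : Mul FExp := ⟨.mul⟩
instance : Zero FExp := ⟨.zero⟩
instance : One FExp := ⟨.one⟩

theorem FExp.cost_add (x y : FExp) : (x + y).cost = x.cost + y.cost + 1 := rfl
theorem FExp.cost_sub (x y : FExp) : (x - y).cost = x.cost + y.cost + 1 := rfl
theorem FExp.cost_mul (x y : FExp) : (x * y).cost = x.cost + y.cost + 1 := rfl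
theorem FExp.cost_zero : (0 : FExp).cost = 1 := rfl
theorem FExp.cost_one : (1 : FExp).cost = 1 := rfl

variable [Field F]

@[simp] theorem FExp.eval_add (x y : FExp) : (x + y).eval E s = x.eval E s + y.eval E s := rfl
@[simp] theorem FExp.eval_sub (x y : FExp) : (x - y).eval E s = x.eval E s - y.eval E s := rfl
@[simp] theorem FExp.eval_mul (x y : FExp) : (x * y).eval E s = x.eval E s * y.eval E s := rfl
@[simp] theorem FExp.eval_zero : (0 : FExp).eval E s = 0 := rfl
@[simp] theorem FExp.eval_one : (1 : FExp).eval E s = 1 := rfl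

theorem FExp.eval_get {a j : ℕ} {i : WExp} (hi : i.eval E s = j) (hj : j < E.memSize) :
    (FExp.get a i).eval E s = s.fld a j := by
  simp only [FExp.eval, hi, hj, if_true]

theorem FExp.eval_var {a : ℕ} (hM : 0 < E.memSize) : (fv a).eval E s = s.fld a 0 :=
  FExp.eval_get WExp.eval_const_zero hM

theorem FExp.eval_gate (b t a c : FExp) :
    (gate b t a c).eval E s = gate (b.eval E s) (t.eval E s) (a.eval E s) (c.eval E s) := rfl

theorem FExp.eval_gateCoeff (b₀ b₁ t₀ t₁ a₀ a₁ c₀ c₁ : FExp) (k : ℕ) :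
    (gateCoeff b₀ b₁ t₀ t₁ a₀ a₁ c₀ c₁ k).eval E s
      = gateCoeff (b₀.eval E s) (b₁.eval E s) (t₀.eval E s) (t₁.eval E s) (a₀.eval E s)
          (a₁.eval E s) (c₀.eval E s) (c₁.eval E s) k := by
  match k with
  | 0 => rfl
  | 1 => rfl
  | 2 => rfl
  | 3 => rfl
  | _ + 4 => rfl

end Expressions

variable [Field F] [DecidableEq F] {E : Env F} {s : State F}

/-- A loop that writes the values `val k` to different cells `ix k` of a field array. -/
theorem Cmd.run_fill {i a : ℕ} {n idx : WExp} {e : FExp} {N : ℕ} (hM : 0 < E.memSize)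
    (hb : s.blocked = false) (hn : n.eval E (s.putW i 0 0) = N) (ix : ℕ → ℕ) (val : ℕ → F)
    (hix : ∀ k < N, ∀ k' < k, ix k ≠ ix k')
    (hs : ∀ k < N, ∀ s' : State F, s'.word i 0 = k → (∀ b, b ≠ i → s'.word b = s.word b) →
      (∀ b, b ≠ a → s'.fld b = s.fld b) →
      (∀ q, (∀ k' < k, q ≠ ix k') → s'.fld a q = s.fld a q) →
      idx.eval E s' = ix k ∧ ix k < E.memSize ∧ e.eval E s' = val k) :
    ((Cmd.count i n (.setF a idx e)).run E s).blocked = false ∧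
      (∀ k < N, ((Cmd.count i n (.setF a idx e)).run E s).fld a (ix k) = val k) ∧
      (∀ q, (∀ k < N, q ≠ ix k) →
        ((Cmd.count i n (.setF a idx e)).run E s).fld a q = s.fld a q) ∧
      ((Cmd.count i n (.setF a idx e)).run E s).time
        ≤ s.time + (n.cost + 4 + N * (idx.cost + e.cost + 7)) := by
  -- The content of the array before round `k`.
  let A : ℕ → ℕ → F := Nat.rec (s.fld a) fun k T => Function.update T (ix k) (val k)
  have hA : ∀ k, A (k + 1) = Function.update (A k) (ix k) (val k) := fun k => rfl
  have h₁ : ∀ k q, (∀ k' < k, q ≠ ix k') → A k q = s.fld a q := by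
    intro k q
    induction k with
    | zero => intro _; rfl
    | succ k ih =>
      intro h
      rw [hA, Function.update_of_ne (h k (by omega)), ih fun k' hk' => h k' (by omega)]
  have h₂ : ∀ m ≤ N, ∀ k < m, A m (ix k) = val k := by
    intro m
    induction m with
    | zero => intro _ k hk; omega
    | succ m ih =>
      intro hm k hk
      rw [hA]
      rcases Nat.lt_or_ge k m with h | h
      · rw [Function.update_of_ne (hix m (by omega) k h).symm, ih (by omega) k h]
      · obtain rfl : k = m := by omega
        simp
  obtain ⟨g1, g2, g3⟩ := Cmd.run_count_setF (a := a) (idx := idx) (e := e) hM hb hn A rfl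
    (by
      intro k hk s' hk' hw hf hI
      obtain ⟨e1, e2, e3⟩ := hs k hk s' hk' hw hf (fun q hq => by rw [hI, h₁ k q hq])
      refine ⟨by rwa [e1], fun j => ?_⟩
      rw [hA, e1, e3]
      by_cases hj : j = ix k
      · subst hj; simp
      · simp [hj])
  exact ⟨g1, fun k hk => by rw [g2, h₂ N le_rfl k hk], fun q hq => by rw [g2, h₁ N q hq], g3⟩

/-- A loop that adds the values `val k` to the cells `ix k` of a field array. -/
theorem Cmd.run_accumulate {i a : ℕ} {n idx : WExp} {e : FExp} {N : ℕ} (hM : 0 < E.memSize)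
    (hb : s.blocked = false) (hn : n.eval E (s.putW i 0 0) = N) (ix : ℕ → ℕ) (val : ℕ → F)
    (hs : ∀ k < N, ∀ s' : State F, s'.word i 0 = k → (∀ b, b ≠ i → s'.word b = s.word b) →
      (∀ b, b ≠ a → s'.fld b = s.fld b) →
      idx.eval E s' = ix k ∧ ix k < E.memSize ∧ e.eval E s' = s'.fld a (ix k) + val k) :
    ((Cmd.count i n (.setF a idx e)).run E s).blocked = false ∧
      (∀ q, ((Cmd.count i n (.setF a idx e)).run E s).fld a q
        = s.fld a q + ∑ k ∈ Finset.range N, if ix k = q then val k else 0) ∧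
      ((Cmd.count i n (.setF a idx e)).run E s).time
        ≤ s.time + (n.cost + 4 + N * (idx.cost + e.cost + 7)) := by
  obtain ⟨g1, g2, g3⟩ := Cmd.run_count_setF (a := a) (idx := idx) (e := e) hM hb hn
    (fun m q => s.fld a q + ∑ k ∈ Finset.range m, if ix k = q then val k else 0) (by simp)
    (by
      intro k hk s' hk' hw hf hI
      obtain ⟨e1, e2, e3⟩ := hs k hk s' hk' hw hf
      refine ⟨by rwa [e1], fun j => ?_⟩
      rw [e1, e3, hI, Finset.sum_range_succ]
      by_cases hj : j = ix k
      · subst hj; simp [add_assoc]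
      · simp [hj, Ne.symm hj])
  exact ⟨g1, fun q => by rw [g2], g3⟩

theorem sum_two_pow_reverse (m : ℕ) : ∑ j ∈ Finset.range m, 2 ^ (m - j - 1) + 1 = 2 ^ m := by
  induction m with
  | zero => rfl
  | succ m ih =>
    rw [Finset.sum_range_succ']
    have : ∀ j, m + 1 - (j + 1) - 1 = m - j - 1 := fun j => by omega
    simp only [this, pow_succ]
    simp only [Nat.sub_zero, Nat.add_sub_cancel]
    omega

theorem sum_two_pow (m : ℕ) : ∑ j ∈ Finset.range m, 2 ^ j + 1 = 2 ^ m := by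
  induction m with
  | zero => rfl
  | succ m ih => rw [Finset.sum_range_succ, pow_succ]; omega

end Programs

/-! ### The prover -/

section Prover

variable {F : Type u} [Field F] [DecidableEq F] {E : Env F} {s : State F}

/-- Double the number of entries in a table of weights of the multilinear extension. -/
def Cmd.weightsStep (t pt : ℕ) : Cmd :=
  .seq
    (.count 3 (.twoPow (wv 2)) (.setF t (.op .add (wv 3) (.twoPow (wv 2)))
      (.get t (wv 3) * .get pt (wv 2))))
    (.count 3 (.twoPow (wv 2)) (.setF t (wv 3)
      (.get t (wv 3) - .get t (.op .add (wv 3) (.twoPow (wv 2))))))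

/-- Fill the table `t` with `2 ^ m` multiples of weights of the multilinear extension at the point
in the array `pt`; the factor is `sc`. -/
def Cmd.weights (t : ℕ) (sc : FExp) (pt : ℕ) (m : WExp) : Cmd :=
  .seq (.setF t (.const 0) sc) (.count 2 m (.weightsStep t pt))

theorem Cmd.run_weights {t pt : ℕ} {sc : FExp} {mE : WExp} {m : ℕ} {x : ℕ → F} {c : F}
    (hpt : pt ≠ t) (hM : E.memSize = 2 ^ E.wordSize) (hm : 2 ^ m < 2 ^ E.wordSize)
    (hb : s.blocked = false)
    (hmE : ∀ s' : State F, (∀ b, b ≠ 2 → b ≠ 3 → s'.word b = s.word b) → mE.eval E s' = m)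
    (hsc : sc.eval E s = c) (hx : ∀ j < m, s.fld pt j = x j) :
    ((Cmd.weights t sc pt mE).run E s).blocked = false ∧
      (∀ p < 2 ^ m, ((Cmd.weights t sc pt mE).run E s).fld t p = c * wt m x p) ∧
      ((Cmd.weights t sc pt mE).run E s).time
        ≤ s.time + (sc.cost + mE.cost + 100 * 2 ^ m) := by
  have h0 : 0 < E.memSize := by rw [hM]; positivity
  have hc0 : (WExp.const 0).eval E s = 0 := WExp.eval_const_zero
  have hmlt : m < 2 ^ E.wordSize := m.lt_two_pow_self.trans hm
  rw [Cmd.weights, Cmd.run_seq, Cmd.run_setF hb (by rw [hc0]; exact h0), hc0, hsc]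
  set s₁ := (s.putF t 0 c).tick ((WExp.const 0).cost + sc.cost + 1) with hs₁
  have hb₁ : s₁.blocked = false := hb
  obtain ⟨g1, g2, g3⟩ := Cmd.run_count (E := E) (s := s₁) (i := 2) (n := mE) (N := m)
    (body := .weightsStep t pt) h0 (by simp [Cmd.wordArrays, Cmd.count, Cmd.weightsStep]) hb₁
    (hmE _ fun b hb2 _ => by simp [hs₁, State.putW_word_ne _ _ _ hb2])
    (fun j s' => ∀ p < 2 ^ j, s'.fld t p = c * wt j x p)
    (fun j => 100 * 2 ^ j - 6)
    (by
      intro p hp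
      obtain rfl : p = 0 := by simpa using hp
      simp [hs₁, wt_zero])
    (by
      intro j hj s' hb' hk' hw hf hI
      have hjm : 2 ^ (j + 1) ≤ 2 ^ m := Nat.pow_le_pow_right (by norm_num) hj
      have hjj : j < 2 ^ E.wordSize := by omega
      have hptj : s'.fld pt j = x j := by
        rw [hf pt (by simp [Cmd.fldArrays, Cmd.count, Cmd.weightsStep, hpt])]
        simp [hs₁, hpt, hx j hj]
      rw [pow_succ] at hjm
      have hv2 : ∀ s'' : State F, s''.word 2 0 = j →
          (wv 2).eval E s'' = j ∧ (WExp.twoPow (wv 2)).eval E s'' = 2 ^ j := fun s'' h => by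
        have h2 := WExp.eval_var (E := E) h0 h hjj
        exact ⟨h2, WExp.eval_twoPow h2 (by omega)⟩
      obtain ⟨a1, a2, a3, a4⟩ := Cmd.run_fill (E := E) (s := s') (i := 3) (a := t)
        (n := .twoPow (wv 2)) (idx := .op .add (wv 3) (.twoPow (wv 2)))
        (e := .get t (wv 3) * .get pt (wv 2)) (N := 2 ^ j) h0 hb'
        (hv2 _ (by simpa using hk')).2 (fun p => p + 2 ^ j) (fun p => c * wt j x p * x j)
        (fun p hp p' hp' => by simp; omega)
        (by
          intro p hp s'' hp' hw' hf' hu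
          obtain ⟨e1, e2⟩ := hv2 s'' (by rw [hw' 2 (by norm_num), hk'])
          have e3 : (wv 3).eval E s'' = p := WExp.eval_var h0 hp' (by omega)
          refine ⟨WExp.eval_op e3 e2 (by simp only [WordOp.eval]; omega), by omega, ?_⟩
          rw [FExp.eval_mul, FExp.eval_get e3 (by omega), FExp.eval_get e1 (by omega),
            hf' pt hpt, hptj, hu p (fun p' _ => by omega), hI p hp])
      have hk₂ := (Cmd.run_word E (.count 3 (.twoPow (wv 2)) (.setF t (.op .add (wv 3)
        (.twoPow (wv 2))) (.get t (wv 3) * .get pt (wv 2)))) s' (b := 2)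
        (by simp [Cmd.wordArrays, Cmd.count]))
      rw [Cmd.weightsStep, Cmd.run_seq]
      set s₂ := (Cmd.count 3 (.twoPow (wv 2)) (.setF t (.op .add (wv 3) (.twoPow (wv 2)))
        (.get t (wv 3) * .get pt (wv 2)))).run E s'
      obtain ⟨b1, b2, b3, b4⟩ := Cmd.run_fill (E := E) (s := s₂) (i := 3) (a := t)
        (n := .twoPow (wv 2)) (idx := wv 3)
        (e := .get t (wv 3) - .get t (.op .add (wv 3) (.twoPow (wv 2)))) (N := 2 ^ j) h0 a1
        (hv2 _ (by simp [hk₂, hk'])).2 (fun p => p)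
        (fun p => c * wt j x p - c * wt j x p * x j)
        (fun p hp p' hp' => by simp; omega)
        (by
          intro p hp s'' hp' hw' hf' hu
          obtain ⟨e1, e2⟩ := hv2 s'' (by rw [hw' 2 (by norm_num), hk₂, hk'])
          have e3 : (wv 3).eval E s'' = p := WExp.eval_var h0 hp' (by omega)
          have e4 : (WExp.op .add (wv 3) (.twoPow (wv 2))).eval E s'' = p + 2 ^ j :=
            WExp.eval_op e3 e2 (by simp only [WordOp.eval]; omega)
          refine ⟨e3, by omega, ?_⟩
          rw [FExp.eval_sub, FExp.eval_get e3 (by omega), FExp.eval_get e4 (by omega),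
            hu p (fun p' _ => by omega), hu (p + 2 ^ j) (fun p' _ => by omega), a2 p hp,
            a3 p (fun p' _ => by omega), hI p hp])
      refine ⟨b1, ?_, ?_⟩
      · have hpos : 1 ≤ 2 ^ j := Nat.one_le_two_pow
        simp only [FExp.cost_sub, WExp.cost, FExp.cost] at a4 b4
        omega
      · intro p hp
        rw [pow_succ] at hp
        rcases Nat.lt_or_ge p (2 ^ j) with h | h
        · rw [wt_succ_low x h]
          exact (b2 p h).trans (by ring)
        · obtain ⟨q, rfl⟩ : ∃ q, p = q + 2 ^ j := ⟨p - 2 ^ j, by omega⟩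
          rw [wt_succ_high x (by omega)]
          have := b3 (q + 2 ^ j) (fun p' _ => by omega)
          exact this.trans ((a2 q (by omega)).trans (by ring)))
  refine ⟨g1, g2, ?_⟩
  have hsum : ∑ j ∈ Finset.range m, (100 * 2 ^ j - 6 + 6) + 100 = 100 * 2 ^ m := by
    rw [← sum_two_pow m, mul_add, Finset.mul_sum]
    congr 1
    refine Finset.sum_congr rfl fun j _ => ?_
    have : 1 ≤ 2 ^ j := Nat.one_le_two_pow
    omega
  have ht : s₁.time = s.time + (sc.cost + 2) := by
    simp [hs₁, WExp.cost]; omega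
  omega

/-- Fix the lowest bit of the index of the table `a` to the challenge in cell `wv 2` of `pt`, if
`half` entries remain. -/
def Cmd.foldTable (pt : ℕ) (half : WExp) (a : ℕ) : Cmd :=
  .count 3 half (.setF a (wv 3) (.get a (.op .mul (.const 2) (wv 3)) + .get pt (wv 2) *
    (.get a (.plus (.op .mul (.const 2) (wv 3)) 1) - .get a (.op .mul (.const 2) (wv 3)))))

theorem Cmd.run_foldTable {pt a : ℕ} {hE : WExp} {h j : ℕ} (hpt : pt ≠ a)
    (hM : E.memSize = 2 ^ E.wordSize) (hh : 2 * h < 2 ^ E.wordSize) (hb : s.blocked = false)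
    (hhE : ∀ s' : State F, (∀ b, b ≠ 3 → s'.word b = s.word b) → hE.eval E s' = h)
    (hj : s.word 2 0 = j) (hj' : j < 2 ^ E.wordSize) :
    ((Cmd.foldTable pt hE a).run E s).blocked = false ∧
      (∀ p < h, ((Cmd.foldTable pt hE a).run E s).fld a p = fold (s.fld pt j) (s.fld a) p) ∧
      ((Cmd.foldTable pt hE a).run E s).time ≤ s.time + (hE.cost + 4 + 50 * h) := by
  have h0 : 0 < E.memSize := by rw [hM]; positivity
  obtain ⟨b1, b2, b3, b4⟩ := Cmd.run_fill (E := E) (s := s) (i := 3) (a := a)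
    (n := hE) (idx := wv 3)
    (e := .get a (.op .mul (.const 2) (wv 3)) + .get pt (wv 2) *
    (.get a (.plus (.op .mul (.const 2) (wv 3)) 1) - .get a (.op .mul (.const 2) (wv 3))))
    (N := h) h0 hb (hhE _ fun b hb => State.putW_word_ne _ _ _ hb) (fun p => p)
    (fun p => fold (s.fld pt j) (s.fld a) p) (fun p hp p' hp' => by simp; omega)
    (by
      intro p hp s'' hp' hw' hf' hu
      have e3 : (wv 3).eval E s'' = p := WExp.eval_var h0 hp' (by omega)
      have e2 : (wv 2).eval E s'' = j := WExp.eval_var h0 (by rw [hw' 2 (by norm_num), hj]) hj'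
      have e4 : (WExp.op .mul (.const 2) (wv 3)).eval E s'' = 2 * p :=
        WExp.eval_op (WExp.eval_const (by omega)) e3 (by simp only [WordOp.eval]; omega)
      have e5 := WExp.eval_plus e4 (m := 1) (by omega)
      refine ⟨e3, by omega, ?_⟩
      rw [FExp.eval_add, FExp.eval_mul, FExp.eval_sub, FExp.eval_get e4 (by omega),
        FExp.eval_get e5 (by omega), FExp.eval_get e2 (by omega), hf' pt hpt,
        hu (2 * p) (fun p' _ => by omega), hu (2 * p + 1) (fun p' _ => by omega)]
      rfl)
  refine ⟨b1, b2, b4.trans ?_⟩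
  simp only [FExp.cost_sub, WExp.cost, FExp.cost]
  omega

/-- The coefficient `k` of the message, in the cell `k` of the array `11`, from the four tables. -/
def Cmd.coefficient (half : WExp) (k : ℕ) : Cmd :=
  .seq (.setF 11 (.const k) 0) (.count 3 half (.setF 11 (.const k) (.get 11 (.const k) +
    gateCoeff (.get 6 (.op .mul (.const 2) (wv 3)))
      (.get 6 (.plus (.op .mul (.const 2) (wv 3)) 1) - .get 6 (.op .mul (.const 2) (wv 3)))
      (.get 7 (.op .mul (.const 2) (wv 3)))
      (.get 7 (.plus (.op .mul (.const 2) (wv 3)) 1) - .get 7 (.op .mul (.const 2) (wv 3)))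
      (.get 8 (.op .mul (.const 2) (wv 3)))
      (.get 8 (.plus (.op .mul (.const 2) (wv 3)) 1) - .get 8 (.op .mul (.const 2) (wv 3)))
      (.get 9 (.op .mul (.const 2) (wv 3)))
      (.get 9 (.plus (.op .mul (.const 2) (wv 3)) 1) - .get 9 (.op .mul (.const 2) (wv 3))) k)))

theorem gateCoeff_cost_le {b₀ b₁ t₀ t₁ a₀ a₁ c₀ c₁ : FExp} {m : ℕ} (k : ℕ)
    (h : b₀.cost ≤ m ∧ b₁.cost ≤ m ∧ t₀.cost ≤ m ∧ t₁.cost ≤ m ∧ a₀.cost ≤ m ∧ a₁.cost ≤ m ∧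
      c₀.cost ≤ m ∧ c₁.cost ≤ m) :
    (gateCoeff b₀ b₁ t₀ t₁ a₀ a₁ c₀ c₁ k).cost ≤ 30 * m + 30 := by
  match k with
  | 0 | 1 | 2 | 3 | _ + 4 =>
    simp only [gateCoeff, FExp.cost_add, FExp.cost_sub, FExp.cost_mul, FExp.cost_one]
    omega

theorem Cmd.run_coefficient {hE : WExp} {h k : ℕ}
    (hM : E.memSize = 2 ^ E.wordSize) (hh : 2 * h < 2 ^ E.wordSize) (hb : s.blocked = false)
    (hhE : ∀ s' : State F, (∀ b, b ≠ 3 → s'.word b = s.word b) → hE.eval E s' = h)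
    (hk : k < 2 ^ E.wordSize) :
    ((Cmd.coefficient hE k).run E s).blocked = false ∧
      ((Cmd.coefficient hE k).run E s).fld 11 k
        = Tables.message ⟨s.fld 6, s.fld 7, s.fld 8, s.fld 9⟩ h k ∧
      (∀ q, q ≠ k → ((Cmd.coefficient hE k).run E s).fld 11 q = s.fld 11 q) ∧
      ((Cmd.coefficient hE k).run E s).time ≤ s.time + (hE.cost + 7 + 600 * h) := by
  have h0 : 0 < E.memSize := by rw [hM]; positivity
  have hk0 : ∀ s' : State F, (WExp.const k).eval E s' = k := fun s' => WExp.eval_const hk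
  rw [Cmd.coefficient, Cmd.run_seq, Cmd.run_setF hb (by rw [hk0]; omega), hk0, FExp.eval_zero]
  set s₁ := (s.putF 11 k 0).tick ((WExp.const k).cost + (0 : FExp).cost + 1) with hs₁
  obtain ⟨b1, b2, b4⟩ := Cmd.run_accumulate (E := E) (s := s₁) (i := 3) (a := 11)
    (n := hE) (idx := .const k)
    (e := .get 11 (.const k) +
      gateCoeff (.get 6 (.op .mul (.const 2) (wv 3)))
      (.get 6 (.plus (.op .mul (.const 2) (wv 3)) 1) - .get 6 (.op .mul (.const 2) (wv 3)))
      (.get 7 (.op .mul (.const 2) (wv 3)))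
      (.get 7 (.plus (.op .mul (.const 2) (wv 3)) 1) - .get 7 (.op .mul (.const 2) (wv 3)))
      (.get 8 (.op .mul (.const 2) (wv 3)))
      (.get 8 (.plus (.op .mul (.const 2) (wv 3)) 1) - .get 8 (.op .mul (.const 2) (wv 3)))
      (.get 9 (.op .mul (.const 2) (wv 3)))
      (.get 9 (.plus (.op .mul (.const 2) (wv 3)) 1) - .get 9 (.op .mul (.const 2) (wv 3))) k)
    (N := h) h0 (by simpa [hs₁] using hb)
    (hhE _ fun b hb => by simp [hs₁, State.putW_word_ne _ _ _ hb]) (fun p => k)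
    (fun p => gateCoeff (s.fld 6 (2 * p)) (s.fld 6 (2 * p + 1) - s.fld 6 (2 * p))
      (s.fld 7 (2 * p)) (s.fld 7 (2 * p + 1) - s.fld 7 (2 * p))
      (s.fld 8 (2 * p)) (s.fld 8 (2 * p + 1) - s.fld 8 (2 * p))
      (s.fld 9 (2 * p)) (s.fld 9 (2 * p + 1) - s.fld 9 (2 * p)) k)
    (by
      intro p hp s'' hp' hw' hf'
      have e3 : (wv 3).eval E s'' = p := WExp.eval_var h0 hp' (by omega)
      have e4 : (WExp.op .mul (.const 2) (wv 3)).eval E s'' = 2 * p :=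
        WExp.eval_op (WExp.eval_const (by omega)) e3 (by simp only [WordOp.eval]; omega)
      have e5 := WExp.eval_plus e4 (m := 1) (by omega)
      have f4 : ∀ a, a ≠ 11 →
          (FExp.get a (.op .mul (.const 2) (wv 3))).eval E s'' = s.fld a (2 * p) := fun a ha => by
        rw [FExp.eval_get e4 (by omega), hf' a ha, hs₁, State.tick_fld, State.putF_fld_ne _ _ _ ha]
      have f5 : ∀ a, a ≠ 11 →
          (FExp.get a (.plus (.op .mul (.const 2) (wv 3)) 1)).eval E s'' = s.fld a (2 * p + 1) :=
        fun a ha => by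
        rw [FExp.eval_get e5 (by omega), hf' a ha, hs₁, State.tick_fld, State.putF_fld_ne _ _ _ ha]
      refine ⟨hk0 _, by omega, ?_⟩
      rw [FExp.eval_add, FExp.eval_gateCoeff, FExp.eval_get (hk0 _) (by omega)]
      simp only [FExp.eval_sub]
      rw [f4 6 (by norm_num), f4 7 (by norm_num), f4 8 (by norm_num), f4 9 (by norm_num),
        f5 6 (by norm_num), f5 7 (by norm_num), f5 8 (by norm_num), f5 9 (by norm_num)])
  refine ⟨b1, ?_, fun q hq => ?_, b4.trans ?_⟩
  · rw [b2]; simp [hs₁, Tables.message]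
  · rw [b2]; simp [hs₁, hq, Ne.symm hq]
  · have hcost : ∀ i : WExp, (FExp.get 11 i).cost = i.cost + 1 := fun _ => rfl
    rw [FExp.cost_add, hcost]
    have := gateCoeff_cost_le (m := 15) k (b₀ := .get 6 (.op .mul (.const 2) (wv 3)))
      (b₁ := .get 6 (.plus (.op .mul (.const 2) (wv 3)) 1) - .get 6 (.op .mul (.const 2) (wv 3)))
      (t₀ := .get 7 (.op .mul (.const 2) (wv 3)))
      (t₁ := .get 7 (.plus (.op .mul (.const 2) (wv 3)) 1) - .get 7 (.op .mul (.const 2) (wv 3)))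
      (a₀ := .get 8 (.op .mul (.const 2) (wv 3)))
      (a₁ := .get 8 (.plus (.op .mul (.const 2) (wv 3)) 1) - .get 8 (.op .mul (.const 2) (wv 3)))
      (c₀ := .get 9 (.op .mul (.const 2) (wv 3)))
      (c₁ := .get 9 (.plus (.op .mul (.const 2) (wv 3)) 1) - .get 9 (.op .mul (.const 2) (wv 3)))
      (by decide)
    have ht : s₁.time = s.time + 3 := rfl
    have h2 := Nat.mul_le_mul_left h this
    simp only [WExp.cost, mul_add] at h2 ⊢
    rw [ht]
    omega

end Prover

section SumCheck

variable {F : Type u} [Field F]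

theorem Tables.message_congr {T U : Tables F} {h : ℕ} (hb : ∀ p < 2 * h, T.b p = U.b p)
    (ht : ∀ p < 2 * h, T.t p = U.t p) (ha : ∀ p < 2 * h, T.a p = U.a p)
    (hc : ∀ p < 2 * h, T.c p = U.c p) (k : ℕ) : T.message h k = U.message h k := by
  refine Finset.sum_congr rfl fun p hp => ?_
  rw [Finset.mem_range] at hp
  rw [hb _ (by omega), ht _ (by omega), ha _ (by omega), hc _ (by omega), hb (2 * p + 1) (by omega),
    ht (2 * p + 1) (by omega), ha (2 * p + 1) (by omega), hc (2 * p + 1) (by omega)]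

theorem fold_congr {T U : ℕ → F} {h p : ℕ} (hT : ∀ p < 2 * h, T p = U p) (hp : p < h) (x : F) :
    fold x T p = fold x U p := by
  rw [fold, fold, hT _ (by omega), hT _ (by omega)]

end SumCheck

section Prover

variable {F : Type u} [Field F] [DecidableEq F] {E : Env F} {s : State F}

/-- Send five field elements. -/
def Cmd.send₅ (e : ℕ → FExp) : Cmd :=
  .seq (.send (e 0)) (.seq (.send (e 1)) (.seq (.send (e 2)) (.seq (.send (e 3)) (.send (e 4)))))

theorem Cmd.run_send₅ (hb : s.blocked = false) (e : ℕ → FExp) :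
    (Cmd.send₅ e).run E s = { s with
      sent := s.sent ++ (List.range 5).map fun k => (e k).eval E s
      time := s.time + ((e 0).cost + (e 1).cost + (e 2).cost + (e 3).cost + (e 4).cost + 5) } := by
  have hev : ∀ (l : List F) (t : ℕ) (b : Bool) (x : FExp),
      x.eval E { s with sent := l, time := t, blocked := b } = x.eval E s := fun l t b x =>
    FExp.eval_congr (s := { s with sent := l, time := t, blocked := b }) (s' := s) rfl rfl x
  simp only [Cmd.send₅, Cmd.run, hb, Bool.false_eq_true, if_false, hev]
  congr 1
  · omega
  · simp [List.range_succ]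

/-- The first `n` entries of the arrays `6, 7, 8, 9` are the tables `T`. -/
structure State.HasTables (s : State F) (T : Tables F) (n : ℕ) : Prop where
  b : ∀ p < n, s.fld 6 p = T.b p
  t : ∀ p < n, s.fld 7 p = T.t p
  a : ∀ p < n, s.fld 8 p = T.a p
  c : ∀ p < n, s.fld 9 p = T.c p

/-- All coefficients of the message. -/
def Cmd.coefficients (half : WExp) : Cmd :=
  .seq (.coefficient half 0) (.seq (.coefficient half 1) (.seq (.coefficient half 2)
    (.seq (.coefficient half 3) (.coefficient half 4))))

theorem Cmd.run_coefficients {hE : WExp} {h : ℕ} {T : Tables F}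
    (hM : E.memSize = 2 ^ E.wordSize) (hh : 2 * h < 2 ^ E.wordSize) (h5 : 5 < 2 ^ E.wordSize)
    (hb : s.blocked = false)
    (hhE : ∀ s' : State F, (∀ b, b ≠ 3 → s'.word b = s.word b) → hE.eval E s' = h)
    (hT : s.HasTables T (2 * h)) :
    ((Cmd.coefficients hE).run E s).blocked = false ∧
      (∀ k < 5, ((Cmd.coefficients hE).run E s).fld 11 k = T.message h k) ∧
      ((Cmd.coefficients hE).run E s).time ≤ s.time + (5 * hE.cost + 35 + 3000 * h) := by
  have frF : ∀ k a, a ≠ 11 → ∀ s : State F, ((Cmd.coefficient hE k).run E s).fld a = s.fld a :=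
    fun k a ha s => Cmd.run_fld E _ s (by simp [Cmd.coefficient, Cmd.count, Cmd.fldArrays, ha])
  have frW : ∀ k a, a ≠ 3 → ∀ s : State F, ((Cmd.coefficient hE k).run E s).word a = s.word a :=
    fun k a ha s => Cmd.run_word E _ s (by simp [Cmd.coefficient, Cmd.count, Cmd.wordArrays, ha])
  have step : ∀ k < 5, ∀ s' : State F, s'.blocked = false → s'.HasTables T (2 * h) →
      (∀ b, b ≠ 3 → s'.word b = s.word b) →
      ((Cmd.coefficient hE k).run E s').blocked = false ∧
      ((Cmd.coefficient hE k).run E s').HasTables T (2 * h) ∧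
      (∀ b, b ≠ 3 → ((Cmd.coefficient hE k).run E s').word b = s.word b) ∧
      ((Cmd.coefficient hE k).run E s').fld 11 k = T.message h k ∧
      (∀ q, q ≠ k → ((Cmd.coefficient hE k).run E s').fld 11 q = s'.fld 11 q) ∧
      ((Cmd.coefficient hE k).run E s').time ≤ s'.time + (hE.cost + 7 + 600 * h) := by
    intro k hk s' hb' hT' hw
    obtain ⟨a1, a2, a3, a4⟩ := Cmd.run_coefficient (k := k) hM hh hb'
      (fun s'' hw' => hhE s'' fun b hb => (hw' b hb).trans (hw b hb)) (by omega)
    refine ⟨a1, ⟨?_, ?_, ?_, ?_⟩, fun b hb => (frW k b hb s').trans (hw b hb), ?_, a3, a4⟩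
    · intro p hp; rw [frF k 6 (by norm_num)]; exact hT'.b p hp
    · intro p hp; rw [frF k 7 (by norm_num)]; exact hT'.t p hp
    · intro p hp; rw [frF k 8 (by norm_num)]; exact hT'.a p hp
    · intro p hp; rw [frF k 9 (by norm_num)]; exact hT'.c p hp
    · exact a2.trans (Tables.message_congr hT'.b hT'.t hT'.a hT'.c k)
  simp only [Cmd.coefficients, Cmd.run_seq]
  obtain ⟨a1, a2, a3, a4, a5, a6⟩ := step 0 (by omega) s hb hT fun _ _ => rfl
  obtain ⟨b1, b2, b3, b4, b5, b6⟩ := step 1 (by omega) _ a1 a2 a3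
  obtain ⟨c1, c2, c3, c4, c5, c6⟩ := step 2 (by omega) _ b1 b2 b3
  obtain ⟨d1, d2, d3, d4, d5, d6⟩ := step 3 (by omega) _ c1 c2 c3
  obtain ⟨e1, e2, e3, e4, e5, e6⟩ := step 4 (by omega) _ d1 d2 d3
  refine ⟨e1, fun k hk => ?_, by omega⟩
  interval_cases k
  · rw [e5 0 (by norm_num), d5 0 (by norm_num), c5 0 (by norm_num), b5 0 (by norm_num), a4]
  · rw [e5 1 (by norm_num), d5 1 (by norm_num), c5 1 (by norm_num), b4]
  · rw [e5 2 (by norm_num), d5 2 (by norm_num), c4]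
  · rw [e5 3 (by norm_num), d4]
  · exact e4

/-- Fix the lowest bit of the index in all four tables. -/
def Cmd.foldTables (pt : ℕ) (half : WExp) : Cmd :=
  .seq (.foldTable pt half 6) (.seq (.foldTable pt half 7) (.seq (.foldTable pt half 8)
    (.foldTable pt half 9)))

theorem Cmd.run_foldTables {pt : ℕ} {hE : WExp} {h j : ℕ} {T : Tables F}
    (hpt : pt ≠ 6 ∧ pt ≠ 7 ∧ pt ≠ 8 ∧ pt ≠ 9)
    (hM : E.memSize = 2 ^ E.wordSize) (hh : 2 * h < 2 ^ E.wordSize) (hb : s.blocked = false)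
    (hhE : ∀ s' : State F, (∀ b, b ≠ 3 → s'.word b = s.word b) → hE.eval E s' = h)
    (hj : s.word 2 0 = j) (hj' : j < 2 ^ E.wordSize) (hT : s.HasTables T (2 * h)) :
    ((Cmd.foldTables pt hE).run E s).blocked = false ∧
      ((Cmd.foldTables pt hE).run E s).HasTables
        ⟨fold (s.fld pt j) T.b, fold (s.fld pt j) T.t, fold (s.fld pt j) T.a,
          fold (s.fld pt j) T.c⟩ h ∧
      ((Cmd.foldTables pt hE).run E s).time ≤ s.time + (4 * hE.cost + 16 + 200 * h) := by
  have frF : ∀ k a, a ≠ k → ∀ s : State F, ((Cmd.foldTable pt hE k).run E s).fld a = s.fld a :=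
    fun k a ha s => Cmd.run_fld E _ s (by simp [Cmd.foldTable, Cmd.count, Cmd.fldArrays, ha])
  have frW : ∀ k a, a ≠ 3 → ∀ s : State F, ((Cmd.foldTable pt hE k).run E s).word a = s.word a :=
    fun k a ha s => Cmd.run_word E _ s (by simp [Cmd.foldTable, Cmd.count, Cmd.wordArrays, ha])
  have step : ∀ k, pt ≠ k → ∀ s' : State F, s'.blocked = false →
      (∀ b, b ≠ 3 → s'.word b = s.word b) → s'.fld pt = s.fld pt → s'.fld k = s.fld k →
      ((Cmd.foldTable pt hE k).run E s').blocked = false ∧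
      (∀ b, b ≠ 3 → ((Cmd.foldTable pt hE k).run E s').word b = s.word b) ∧
      ((Cmd.foldTable pt hE k).run E s').fld pt = s.fld pt ∧
      (∀ p < h, ((Cmd.foldTable pt hE k).run E s').fld k p
        = fold (s.fld pt j) (s.fld k) p) ∧
      ((Cmd.foldTable pt hE k).run E s').time ≤ s'.time + (hE.cost + 4 + 50 * h) := by
    intro k hk s' hb' hw hp hsk
    obtain ⟨a1, a2, a3⟩ := Cmd.run_foldTable (j := j) hk hM hh hb'
      (fun s'' hw' => hhE s'' fun b hb => (hw' b hb).trans (hw b hb))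
      (by rw [hw 2 (by norm_num), hj]) hj'
    refine ⟨a1, fun b hb => (frW k b hb s').trans (hw b hb), (frF k pt hk s').trans hp,
      fun p hp' => ?_, a3⟩
    rw [a2 p hp', hp, hsk]
  simp only [Cmd.foldTables, Cmd.run_seq]
  obtain ⟨a1, a2, a3, a4, a5⟩ := step 6 hpt.1 s hb (fun _ _ => rfl) rfl rfl
  obtain ⟨b1, b2, b3, b4, b5⟩ := step 7 hpt.2.1 _ a1 a2 a3 (frF _ _ (by norm_num) _)
  obtain ⟨c1, c2, c3, c4, c5⟩ := step 8 hpt.2.2.1 _ b1 b2 b3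
    (by rw [frF _ _ (by norm_num), frF _ _ (by norm_num)])
  obtain ⟨d1, d2, d3, d4, d5⟩ := step 9 hpt.2.2.2 _ c1 c2 c3
    (by rw [frF _ _ (by norm_num), frF _ _ (by norm_num), frF _ _ (by norm_num)])
  refine ⟨d1, ⟨fun p hp => ?_, fun p hp => ?_, fun p hp => ?_, fun p hp => ?_⟩, by omega⟩
  · rw [frF _ _ (by norm_num), frF _ _ (by norm_num), frF _ _ (by norm_num), a4 p hp]
    exact fold_congr hT.b hp _
  · rw [frF _ _ (by norm_num), frF _ _ (by norm_num), b4 p hp]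
    exact fold_congr hT.t hp _
  · rw [frF _ _ (by norm_num), c4 p hp]
    exact fold_congr hT.a hp _
  · rw [d4 p hp]
    exact fold_congr hT.c hp _

/-- The number of pairs of table entries in round `wv 2` of a sum-check with `m` rounds. -/
abbrev WExp.half (m : WExp) : WExp := .twoPow (.op .sub (.op .sub m (wv 2)) (.const 1))

/-- A round of the sum-check protocol. -/
def Cmd.proverRound (pt : ℕ) (m : WExp) : Cmd :=
  .seq (.coefficients m.half) (.seq (.send₅ fun k => .get 11 (.const k))
    (.seq (.recv pt (wv 2)) (.foldTables pt m.half)))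

/-- The sum-check protocol with `2 ^ m` indices. -/
def Cmd.proverSumCheck (pt : ℕ) (m : WExp) : Cmd := .count 2 m (.proverRound pt m)

/-- The messages that the prover receives are `chal 0, chal 1, …`; they come only if the prover has
sent its `O` outputs and five field elements for every round so far. -/
def Env.Synchronous (E : Env F) (O : ℕ) (chal : ℕ → F) : Prop :=
  ∀ l k, E.inbox l k = if l.length = O + 5 * (k + 1) then some (chal k) else none

theorem Cmd.run_proverRound {pt : ℕ} {mE : WExp} {h j m O : ℕ} {T : Tables F} {chal : ℕ → F}
    (hpt : pt ≠ 6 ∧ pt ≠ 7 ∧ pt ≠ 8 ∧ pt ≠ 9) (hpt' : pt ≠ 11)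
    (hM : E.memSize = 2 ^ E.wordSize) (h5 : 5 < 2 ^ E.wordSize)
    (hm : 2 ^ m < 2 ^ E.wordSize) (hin : E.Synchronous O chal) (hb : s.blocked = false)
    (hmE : ∀ s' : State F, (∀ b, b ≠ 2 → b ≠ 3 → s'.word b = s.word b) → mE.eval E s' = m)
    (hj : s.word 2 0 = j) (hjm : j < m) (hh : h = 2 ^ (m - j - 1)) (hT : s.HasTables T (2 * h))
    (hsent : s.sent.length = O + 5 * s.received) :
    ((Cmd.proverRound pt mE).run E s).blocked = false ∧
      ((Cmd.proverRound pt mE).run E s).HasTables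
        ⟨fold (chal s.received) T.b, fold (chal s.received) T.t, fold (chal s.received) T.a,
          fold (chal s.received) T.c⟩ h ∧
      ((Cmd.proverRound pt mE).run E s).sent = s.sent ++ (List.range 5).map (T.message h) ∧
      ((Cmd.proverRound pt mE).run E s).received = s.received + 1 ∧
      (∀ q, ((Cmd.proverRound pt mE).run E s).fld pt q
        = if q = j then chal s.received else s.fld pt q) ∧
      ((Cmd.proverRound pt mE).run E s).time ≤ s.time + (9 * mE.cost + 200 + 3200 * h) := by
  have hmlt : m < 2 ^ E.wordSize := m.lt_two_pow_self.trans hm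
  have hh2 : 2 * h ≤ 2 ^ m := by
    rw [hh, ← pow_succ']; exact Nat.pow_le_pow_right (by norm_num) (by omega)
  have h0 : 0 < E.memSize := by rw [hM]; positivity
  have hhE : ∀ s' : State F, (∀ b, b ≠ 3 → s'.word b = s.word b) → mE.half.eval E s' = h := by
    intro s' hw
    have e1 := hmE s' fun b _ hb => hw b hb
    have e2 : (wv 2).eval E s' = j := WExp.eval_var h0 (by rw [hw 2 (by norm_num), hj]) (by omega)
    have e3 : (WExp.op .sub mE (wv 2)).eval E s' = m - j :=
      WExp.eval_op e1 e2 (by simp only [WordOp.eval]; omega)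
    have e4 : (WExp.op .sub (.op .sub mE (wv 2)) (.const 1)).eval E s' = m - j - 1 :=
      WExp.eval_op e3 (WExp.eval_const (by omega)) (by simp only [WordOp.eval]; omega)
    rw [WExp.eval_twoPow e4 (by omega), hh]
  obtain ⟨a1, a2, a3⟩ := Cmd.run_coefficients hM (by omega) h5 hb hhE hT
  have frF : ∀ a, a ≠ 11 → ((Cmd.coefficients mE.half).run E s).fld a = s.fld a :=
    fun a ha => Cmd.run_fld E _ s
      (by simp [Cmd.coefficients, Cmd.coefficient, Cmd.count, Cmd.fldArrays, ha])
  have frW : ∀ a, a ≠ 3 → ((Cmd.coefficients mE.half).run E s).word a = s.word a :=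
    fun a ha => Cmd.run_word E _ s
      (by simp [Cmd.coefficients, Cmd.coefficient, Cmd.count, Cmd.wordArrays, ha])
  have frQ := Cmd.run_quiet E (Cmd.coefficients mE.half) s
    (by simp [Cmd.coefficients, Cmd.coefficient, Cmd.count, Cmd.quiet])
  rw [Cmd.proverRound, Cmd.run_seq, Cmd.run_seq, Cmd.run_seq, Cmd.run_send₅ a1]
  set s₁ := (Cmd.coefficients mE.half).run E s
  have hev : (List.range 5).map (fun k => (FExp.get 11 (.const k)).eval E s₁)
      = (List.range 5).map (T.message h) := by
    refine List.map_congr_left fun k hk => ?_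
    rw [List.mem_range] at hk
    rw [FExp.eval_get (WExp.eval_const (by omega)) (by omega), a2 k hk]
  rw [hev, frQ.sent]
  set s₂ : State F := { s₁ with
    sent := s.sent ++ (List.range 5).map (T.message h)
    time := s₁.time + ((FExp.get 11 (.const 0)).cost + (FExp.get 11 (.const 1)).cost
      + (FExp.get 11 (.const 2)).cost + (FExp.get 11 (.const 3)).cost
      + (FExp.get 11 (.const 4)).cost + 5) } with hs₂
  have hw2 : (wv 2).eval E s₂ = j :=
    WExp.eval_var h0 (show s₁.word 2 0 = j by rw [frW 2 (by norm_num), hj]) (by omega)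
  have hbox : E.inbox s₂.sent s₂.received = some (chal s.received) := by
    rw [hin, if_pos]
    · show some (chal s₁.received) = _
      rw [frQ.received]
    · show (s.sent ++ (List.range 5).map (T.message h)).length = O + 5 * (s₁.received + 1)
      rw [frQ.received, List.length_append, hsent]
      simp; omega
  rw [Cmd.run_recv (a := pt) (i := wv 2) (show s₂.blocked = false from a1)
    (by rw [hw2]; omega) hbox, hw2]
  set s₃ : State F := { s₂.putF pt j (chal s.received) with
    received := s₂.received + 1, time := s₂.time + ((wv 2).cost + 1) } with hs₃
  have hf₃ : ∀ a, a ≠ 11 → a ≠ pt → s₃.fld a = s.fld a := fun a ha hap => by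
    rw [hs₃]; simp only [State.putF_fld_ne _ _ _ hap]; exact frF a ha
  have hptj : s₃.fld pt j = chal s.received := by simp [hs₃]
  obtain ⟨d1, d2, d3⟩ := Cmd.run_foldTables (s := s₃) (T := T) (j := j) hpt hM (by omega) a1
    (fun s' hw => hhE s' fun b hb => (hw b hb).trans (frW b hb))
    (show s₁.word 2 0 = j by rw [frW 2 (by norm_num), hj]) (by omega)
    (by
      refine ⟨?_, ?_, ?_, ?_⟩
      · rw [hf₃ 6 (by norm_num) hpt.1.symm]; exact hT.b
      · rw [hf₃ 7 (by norm_num) hpt.2.1.symm]; exact hT.t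
      · rw [hf₃ 8 (by norm_num) hpt.2.2.1.symm]; exact hT.a
      · rw [hf₃ 9 (by norm_num) hpt.2.2.2.symm]; exact hT.c)
  have frQ' := Cmd.run_quiet E (Cmd.foldTables pt mE.half) s₃
    (by simp [Cmd.foldTables, Cmd.foldTable, Cmd.count, Cmd.quiet])
  rw [hptj] at d2
  refine ⟨d1, d2, ?_, ?_, fun q => ?_, ?_⟩
  · rw [frQ'.sent]
    rfl
  · rw [frQ'.received]
    show s₁.received + 1 = _
    rw [frQ.received]
  · rw [Cmd.run_fld E _ s₃ (by
      simp [Cmd.foldTables, Cmd.foldTable, Cmd.count, Cmd.fldArrays, hpt])]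
    have : s₃.fld pt q = if q = j then chal s.received else s₁.fld pt q :=
      (State.putF_fld s₂ pt j pt q _).trans (by simp only [true_and]; rfl)
    rw [this, frF pt hpt']
  · have ht : s₃.time = s₁.time + 15 + 3 := rfl
    simp only [WExp.cost] at a3 d3
    omega

theorem Cmd.run_proverSumCheck {pt : ℕ} {mE : WExp} {m O : ℕ} {T : Tables F} {chal : ℕ → F}
    (hpt : pt ≠ 6 ∧ pt ≠ 7 ∧ pt ≠ 8 ∧ pt ≠ 9) (hpt' : pt ≠ 11)
    (hM : E.memSize = 2 ^ E.wordSize) (h5 : 5 < 2 ^ E.wordSize)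
    (hm : 2 ^ m < 2 ^ E.wordSize) (hin : E.Synchronous O chal) (hb : s.blocked = false)
    (hmE : ∀ s' : State F, (∀ b, b ≠ 2 → b ≠ 3 → s'.word b = s.word b) → mE.eval E s' = m)
    (hmc : mE.cost ≤ 10) (hT : s.HasTables T (2 ^ m)) {t₀ : ℕ} (ht₀ : s.received = t₀)
    (hsent : s.sent.length = O + 5 * t₀) :
    ((Cmd.proverSumCheck pt mE).run E s).blocked = false ∧
      ((Cmd.proverSumCheck pt mE).run E s).HasTables (T.folds (shift chal t₀) m) 1 ∧
      ((Cmd.proverSumCheck pt mE).run E s).sent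
        = s.sent ++ Circuit.sumCheckMessages T (shift chal t₀) m m ∧
      ((Cmd.proverSumCheck pt mE).run E s).received = t₀ + m ∧
      (∀ q < m, ((Cmd.proverSumCheck pt mE).run E s).fld pt q = shift chal t₀ q) ∧
      ((Cmd.proverSumCheck pt mE).run E s).time ≤ s.time + 4000 * 2 ^ m := by
  have h0 : 0 < E.memSize := by rw [hM]; positivity
  obtain ⟨g1, ⟨g2, g3, g4, g5⟩, g6⟩ := Cmd.run_count (E := E) (s := s) (i := 2) (n := mE) (N := m)
    (body := .proverRound pt mE) h0
    (by simp [Cmd.wordArrays, Cmd.count, Cmd.proverRound, Cmd.coefficients, Cmd.coefficient,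
      Cmd.send₅, Cmd.foldTables, Cmd.foldTable]) hb
    (hmE _ fun b hb2 _ => State.putW_word_ne _ _ _ hb2)
    (fun j s' => s'.HasTables (T.folds (shift chal t₀) j) (2 ^ (m - j)) ∧
      s'.sent = s.sent ++ Circuit.sumCheckMessages T (shift chal t₀) m j ∧
      s'.received = t₀ + j ∧ ∀ q < j, s'.fld pt q = shift chal t₀ q)
    (fun j => 290 + 3200 * 2 ^ (m - j - 1))
    ⟨⟨hT.b, hT.t, hT.a, hT.c⟩, by simp [Circuit.sumCheckMessages], by simpa using ht₀,
      fun q hq => by omega⟩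
    (by
      rintro j hj s' hb' hk' hw hf ⟨⟨i1, i2, i3, i4⟩, i5, i6, i7⟩
      have hpow : 2 ^ (m - j) = 2 * 2 ^ (m - j - 1) := by
        rw [← pow_succ']; congr 1; omega
      have i5' : s'.sent = s.sent ++ Circuit.sumCheckMessages T (shift chal t₀) m j := i5
      have i6' : s'.received = t₀ + j := i6
      obtain ⟨a1, a2, a3, a4, a5, a6⟩ := Cmd.run_proverRound (s := s') (pt := pt) (mE := mE)
        (T := T.folds (shift chal t₀) j) hpt hpt' hM h5 hm hin hb'
        (fun s'' hw' => hmE s'' fun b hb2 hb3 => by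
          rw [hw' b hb2 hb3, hw b hb2 (by
            simp [Cmd.wordArrays, Cmd.count, Cmd.proverRound, Cmd.coefficients, Cmd.coefficient,
              Cmd.send₅, Cmd.foldTables, Cmd.foldTable, hb3])]) hk' hj rfl
        (by rw [← hpow]; exact ⟨i1, i2, i3, i4⟩)
        (by rw [i5', i6', List.length_append, Circuit.length_sumCheckMessages, hsent]; omega)
      rw [i6'] at a2 a4 a5
      refine ⟨a1, by omega, ?_, ?_, a4, fun q hq => ?_⟩
      · rw [show m - (j + 1) = m - j - 1 by omega]
        exact ⟨a2.b, a2.t, a2.a, a2.c⟩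
      · refine a3.trans ?_
        rw [i5', Circuit.sumCheckMessages, List.append_assoc]
      · refine (a5 q).trans ?_
        split_ifs with h
        · rw [h]; rfl
        · exact i7 q (by omega))
  refine ⟨g1, ?_, g3, g4, g5, g6.trans ?_⟩
  · rw [Nat.sub_self, pow_zero] at g2
    exact ⟨g2.b, g2.t, g2.a, g2.c⟩
  · have h1 := sum_two_pow_reverse m
    have h2 := m.lt_two_pow_self
    have : ∑ j ∈ Finset.range m, (290 + 3200 * 2 ^ (m - j - 1) + 6)
        = 296 * m + 3200 * ∑ j ∈ Finset.range m, 2 ^ (m - j - 1) := by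
      rw [Finset.mul_sum]
      simp only [Finset.sum_add_distrib, Finset.sum_const, Finset.card_range, smul_eq_mul]
      ring
    rw [this]
    omega

end Prover

section Prover

variable {F : Type u} {E : Env F} {s : State F} {C : Circuit} {S : C.Exceptions}

/-- The machine of the prover has enough memory and long enough words for the circuit. -/
structure Env.ForProver (E : Env F) (C : Circuit) (S : C.Exceptions) : Prop where
  answer : E.answer = C.answer S
  memSize : E.memSize = 2 ^ E.wordSize
  five_lt : 5 < 2 ^ E.wordSize
  address_lt : ∀ i, 1 ≤ i → i ≤ C.depth →
    2 ^ C.logSize i * (C.depth + 1) + C.depth < 2 ^ E.wordSize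

namespace Env.ForProver

variable (h : E.ForProver C S)
include h

theorem mem_pos : 0 < E.memSize := by rw [h.memSize]; positivity

theorem depth_lt : C.depth < 2 ^ E.wordSize := by
  have := h.address_lt 1 le_rfl (by have := C.two_le_depth; omega)
  omega

theorem two_pow_lt {i : ℕ} (h₁ : 1 ≤ i) (h₂ : i ≤ C.depth) :
    2 ^ C.logSize i + i < 2 ^ E.wordSize := by
  have := h.address_lt i h₁ h₂
  have := Nat.le_mul_of_pos_right (2 ^ C.logSize i) (show 0 < C.depth + 1 by omega)
  omega

theorem logSize_lt {i : ℕ} (h₁ : 1 ≤ i) (h₂ : i ≤ C.depth) : C.logSize i < 2 ^ E.wordSize := by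
  have := h.two_pow_lt h₁ h₂
  have := (C.logSize i).lt_two_pow_self
  omega

end Env.ForProver

/-- The address of the value of the gate `p` of layer `i` in the field array `1`. -/
abbrev WExp.address (p i : WExp) : WExp := .op .add (.op .mul p (.plus .depth 1)) i

theorem Env.ForProver.eval_address (h : E.ForProver C S) {p i : WExp} {x y l : ℕ}
    (hp : p.eval E s = x) (hi : i.eval E s = y) (hl : 1 ≤ l) (hl' : l ≤ C.depth)
    (hx : x < 2 ^ C.logSize l) (hy : y ≤ C.depth) :
    (WExp.address p i).eval E s = x * (C.depth + 1) + y ∧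
      x * (C.depth + 1) + y < E.memSize := by
  have h1 := h.address_lt l hl hl'
  have h2 : (x + 1) * (C.depth + 1) ≤ 2 ^ C.logSize l * (C.depth + 1) :=
    Nat.mul_le_mul_right _ hx
  have h4 : C.depth + 1 ≤ 2 ^ C.logSize l * (C.depth + 1) :=
    Nat.le_mul_of_pos_left _ (by positivity)
  have h3 : (x + 1) * (C.depth + 1) = x * (C.depth + 1) + (C.depth + 1) := by ring
  rw [h.memSize]
  have e1 : (WExp.plus .depth 1).eval E s = C.depth + 1 :=
    WExp.eval_plus (WExp.eval_depth h.answer h.depth_lt) (by omega)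
  have e2 : (WExp.op .mul p (.plus .depth 1)).eval E s = x * (C.depth + 1) :=
    WExp.eval_op hp e1 (by simp only [WordOp.eval]; omega)
  exact ⟨WExp.eval_op e2 hi (by simp only [WordOp.eval]; omega), by omega⟩

theorem Circuit.address_inj {d p i p' i' : ℕ} (hi : i ≤ d) (hi' : i' ≤ d)
    (h : p * (d + 1) + i = p' * (d + 1) + i') : p = p' ∧ i = i' := by
  have h1 : (p * (d + 1) + i) / (d + 1) = p := by
    rw [mul_comm, Nat.mul_add_div (by omega), Nat.div_eq_of_lt (by omega), add_zero]
  have h2 : (p' * (d + 1) + i') / (d + 1) = p' := by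
    rw [mul_comm, Nat.mul_add_div (by omega), Nat.div_eq_of_lt (by omega), add_zero]
  have h3 : p = p' := by rw [← h1, h, h2]
  subst h3
  exact ⟨rfl, by omega⟩

variable [Field F]

/-- The field array `1` contains the values of all gates in the layers from number `l` on, and the
field array `12` contains the field elements `0` and `1`. -/
structure State.HasValues (s : State F) (C : Circuit) (a : C.Input F) (l : ℕ) : Prop where
  value : ∀ i, l ≤ i → i ≤ C.depth → ∀ p < 2 ^ C.logSize i,
    s.fld 1 (p * (C.depth + 1) + i) = C.layer a i p
  zero : s.fld 12 0 = 0
  one : s.fld 12 1 = 1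

theorem State.HasValues.congr {s s' : State F} {a : C.Input F} {l : ℕ} (h : s.HasValues C a l)
    (h₁ : s'.fld 1 = s.fld 1) (h₂ : s'.fld 12 = s.fld 12) : s'.HasValues C a l :=
  ⟨fun i hi hi' p hp => by rw [h₁, h.value i hi hi' p hp], by rw [h₂, h.zero], by rw [h₂, h.one]⟩

theorem State.HasValues.type {a : C.Input F} {l : ℕ} (h : s.HasValues C a l) (i p : ℕ) :
    s.fld 12 (C.wire i .type p) = C.typeF F i p := by
  have := C.wire_lt i .type p
  rw [Circuit.outWidth] at this
  unfold Circuit.typeF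
  rcases Nat.eq_zero_or_pos (C.wire i .type p) with h0 | h0
  · rw [h0, h.zero, if_pos rfl]
  · rw [if_neg (by omega), show C.wire i .type p = 1 by omega, h.one]

variable [DecidableEq F]

/-- Compute the values of the gates of a layer other than the input layer. -/
def Cmd.evalLayer : Cmd :=
  .count 3 (.twoPow (.logSize (.op .sub (.op .sub .depth (.const 1)) (wv 2))))
    (.setF 1 (.address (wv 3) (.op .sub (.op .sub .depth (.const 1)) (wv 2)))
      (gate 1 (.get 12 (.wire .type (.op .sub (.op .sub .depth (.const 1)) (wv 2)) (wv 3)))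
        (.get 1 (.address (.wire .in₁ (.op .sub (.op .sub .depth (.const 1)) (wv 2)) (wv 3))
          (.plus (.op .sub (.op .sub .depth (.const 1)) (wv 2)) 1)))
        (.get 1 (.address (.wire .in₂ (.op .sub (.op .sub .depth (.const 1)) (wv 2)) (wv 3))
          (.plus (.op .sub (.op .sub .depth (.const 1)) (wv 2)) 1)))))

/-- Compute the values of all gates. -/
def Cmd.evalCircuit : Cmd := .count 2 (.op .sub .depth (.const 1)) .evalLayer

theorem Cmd.run_evalLayer (h : E.ForProver C S) {a : C.Input F} {i j : ℕ}
    (hb : s.blocked = false) (hi : 1 ≤ i) (hij : i + j + 1 = C.depth) (hj : s.word 2 0 = j)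
    (hv : s.HasValues C a (i + 1)) :
    (Cmd.evalLayer.run E s).blocked = false ∧ (Cmd.evalLayer.run E s).HasValues C a i ∧
      (Cmd.evalLayer.run E s).time ≤ s.time + 400 * 2 ^ C.logSize i := by
  have hd := h.depth_lt
  have hiE : ∀ s' : State F, s'.word 2 0 = j →
      (WExp.op .sub (.op .sub .depth (.const 1)) (wv 2)).eval E s' = i := fun s' hs' => by
    have e0 := WExp.eval_depth (s := s') h.answer hd
    have e1 : (WExp.op .sub .depth (.const 1)).eval E s' = C.depth - 1 :=
      WExp.eval_op e0 (WExp.eval_const (by omega)) (by simp only [WordOp.eval]; omega)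
    have e2 : (wv 2).eval E s' = j := WExp.eval_var h.mem_pos hs' (by omega)
    rw [WExp.eval_op e1 e2 (by simp only [WordOp.eval]; omega)]
    simp only [WordOp.eval]; omega
  have h2 := h.two_pow_lt hi (by omega)
  have h3 := h.two_pow_lt (i := i + 1) (by omega) (by omega)
  obtain ⟨b1, b2, b3, b4⟩ := Cmd.run_fill (E := E) (s := s) (i := 3) (a := 1)
    (n := .twoPow (.logSize (.op .sub (.op .sub .depth (.const 1)) (wv 2))))
    (idx := .address (wv 3) (.op .sub (.op .sub .depth (.const 1)) (wv 2)))
    (e := gate 1 (.get 12 (.wire .type (.op .sub (.op .sub .depth (.const 1)) (wv 2)) (wv 3)))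
        (.get 1 (.address (.wire .in₁ (.op .sub (.op .sub .depth (.const 1)) (wv 2)) (wv 3))
          (.plus (.op .sub (.op .sub .depth (.const 1)) (wv 2)) 1)))
        (.get 1 (.address (.wire .in₂ (.op .sub (.op .sub .depth (.const 1)) (wv 2)) (wv 3))
          (.plus (.op .sub (.op .sub .depth (.const 1)) (wv 2)) 1))))
    (N := 2 ^ C.logSize i) h.mem_pos hb
    (WExp.eval_twoPow (WExp.eval_logSize h.answer (hiE _ (by simpa using hj))
      (h.logSize_lt hi (by omega))) (by omega))
    (fun p => p * (C.depth + 1) + i) (fun p => C.layer a i p)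
    (fun p hp p' hp' he => by
      have := (Circuit.address_inj (by omega) (by omega) he).1; omega)
    (by
      intro p hp s' hp' hw hf hu
      have e1 := hiE s' (by rw [hw 2 (by norm_num), hj])
      have e2 : (wv 3).eval E s' = p := WExp.eval_var h.mem_pos hp' (by omega)
      have e3 : (WExp.plus (.op .sub (.op .sub .depth (.const 1)) (wv 2)) 1).eval E s' = i + 1 :=
        WExp.eval_plus e1 (by omega)
      obtain ⟨f1, f2⟩ := h.eval_address e2 e1 hi (by omega) hp (by omega)
      have k1 := C.wire_lt i .in₁ p
      have k2 := C.wire_lt i .in₂ p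
      have k3 := C.wire_lt i .type p
      simp only [Circuit.outWidth] at k1 k2 k3
      obtain ⟨f3, f4⟩ := h.eval_address (WExp.eval_wire h.answer e1 e2 (by omega)) e3
        (by omega) (by omega) k1 (by omega)
      obtain ⟨f5, f6⟩ := h.eval_address (WExp.eval_wire h.answer e1 e2 (by omega)) e3
        (by omega) (by omega) k2 (by omega)
      refine ⟨f1, f2, ?_⟩
      have hmem := h.memSize
      have h5 := h.five_lt
      rw [FExp.eval_gate, FExp.eval_get f3 f4, FExp.eval_get f5 f6,
        FExp.eval_get (WExp.eval_wire h.answer e1 e2 (by omega)) (by omega), FExp.eval_one,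
        hf 12 (by norm_num), hv.type, C.layer_of_lt a (by omega), hu, hu, hv.value _ le_rfl
        (by omega) _ k1, hv.value _ le_rfl (by omega) _ k2]
      all_goals
        intro p' _ he
        have := (Circuit.address_inj (by omega) (by omega) he).2
        omega)
  refine ⟨b1, ⟨fun i' hi' hi'' p hp => ?_, ?_, ?_⟩, b4.trans ?_⟩
  · rcases Nat.lt_or_ge i i' with hlt | hge
    · rw [Cmd.evalLayer, b3, hv.value i' hlt hi'' p hp]
      intro p' _ he
      have := (Circuit.address_inj (by omega) (by omega) he).2
      omega
    · obtain rfl : i' = i := by omega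
      exact b2 p hp
  · rw [Cmd.run_fld E _ s (by decide)]; exact hv.zero
  · rw [Cmd.run_fld E _ s (by decide)]; exact hv.one
  · have hpos : 1 ≤ 2 ^ C.logSize i := Nat.one_le_two_pow
    simp only [gate, FExp.cost_sub, FExp.cost_mul, WExp.cost, FExp.cost]
    omega

theorem sum_layers (C : Circuit) :
    ∑ k ∈ Finset.range (C.depth - 1), 2 ^ C.logSize (k + 1) + 2 ^ C.logSize C.depth = C.size := by
  have hd := C.two_le_depth
  rw [Circuit.size, Finset.range_eq_Ico, Finset.sum_Ico_add' (fun i => 2 ^ C.logSize i) 0 _ 1,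
    show C.depth - 1 + 1 = C.depth by omega, zero_add, ← Finset.sum_Ico_succ_top (by omega)]
  rfl

theorem depth_le_size (C : Circuit) : C.depth ≤ C.size := by
  have : ∑ i ∈ Finset.Icc 1 C.depth, 1 ≤ C.size :=
    Finset.sum_le_sum fun i _ => Nat.one_le_two_pow
  simpa using this

theorem Cmd.run_evalCircuit (h : E.ForProver C S) {a : C.Input F} (hb : s.blocked = false)
    (hv : s.HasValues C a C.depth) :
    (Cmd.evalCircuit.run E s).blocked = false ∧ (Cmd.evalCircuit.run E s).HasValues C a 1 ∧
      (Cmd.evalCircuit.run E s).time ≤ s.time + 500 * C.size := by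
  have hd := C.two_le_depth
  have hdlt := h.depth_lt
  obtain ⟨g1, ⟨g2, g3, g4⟩, g5⟩ := Cmd.run_count (E := E) (s := s) (i := 2)
    (n := .op .sub .depth (.const 1)) (N := C.depth - 1) (body := .evalLayer) h.mem_pos
    (by decide) hb
    (WExp.eval_op (WExp.eval_depth h.answer hdlt) (WExp.eval_const (by omega))
      (by simp only [WordOp.eval]; omega))
    (fun j s' => s'.HasValues C a (C.depth - j))
    (fun j => 400 * 2 ^ C.logSize (C.depth - 1 - 1 - j + 1)) ⟨hv.value, hv.zero, hv.one⟩
    (by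
      rintro j hj s' hb' hk' hw hf ⟨i1, i2, i3⟩
      obtain ⟨a1, a2, a3⟩ := Cmd.run_evalLayer (i := C.depth - 1 - j) h (a := a) hb' (by omega)
        (by omega) hk' ⟨by rw [show C.depth - 1 - j + 1 = C.depth - j by omega]; exact i1, i2, i3⟩
      rw [show C.depth - 1 - 1 - j + 1 = C.depth - 1 - j by omega]
      refine ⟨a1, a3, ?_⟩
      rw [show C.depth - (j + 1) = C.depth - 1 - j by omega]
      exact ⟨a2.value, a2.zero, a2.one⟩)
  rw [show C.depth - (C.depth - 1) = 1 by omega] at g2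
  refine ⟨g1, ⟨g2, g3, g4⟩, g5.trans ?_⟩
  have h1 := Finset.sum_range_reflect (fun k => 400 * 2 ^ C.logSize (k + 1) + 6) (C.depth - 1)
  rw [h1, Finset.sum_add_distrib, ← Finset.mul_sum]
  have h2 := sum_layers C
  have h3 := depth_le_size C
  simp only [Finset.sum_const, Finset.card_range, smul_eq_mul, WExp.cost]
  have hpos : 1 ≤ 2 ^ C.logSize C.depth := Nat.one_le_two_pow
  omega

/-- Send the outputs. -/
def Cmd.sendOutputs : Cmd :=
  .count 3 (.twoPow (.logSize (.const 1))) (.send (.get 1 (.address (wv 3) (.const 1))))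

theorem Cmd.run_sendOutputs (h : E.ForProver C S) {a : C.Input F} (hb : s.blocked = false)
    (hv : s.HasValues C a 1) (hsent : s.sent = []) :
    (Cmd.sendOutputs.run E s).blocked = false ∧
      (Cmd.sendOutputs.run E s).sent = (List.range C.numOutputs).map (C.layer a 1) ∧
      (Cmd.sendOutputs.run E s).received = s.received ∧
      (Cmd.sendOutputs.run E s).time ≤ s.time + 100 * 2 ^ C.logSize 1 := by
  have hd := C.two_le_depth
  have h1 := h.two_pow_lt le_rfl (by omega)
  have h5 := h.five_lt
  obtain ⟨g1, ⟨g2, g3⟩, g5⟩ := Cmd.run_count_const (E := E) (s := s) (i := 3)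
    (n := .twoPow (.logSize (.const 1))) (N := 2 ^ C.logSize 1)
    (body := .send (.get 1 (.address (wv 3) (.const 1)))) h.mem_pos (by decide) hb
    (WExp.eval_twoPow (WExp.eval_logSize h.answer (WExp.eval_const (by omega))
      (h.logSize_lt le_rfl (by omega))) (by omega))
    (fun j s' => s'.sent = (List.range j).map (C.layer a 1) ∧ s'.received = s.received) 20
    (by simpa using hsent)
    (by
      rintro p hp s' hb' hk' hw hf ⟨i1, i2⟩
      have e2 : (wv 3).eval E s' = p := WExp.eval_var h.mem_pos hk' (by omega)
      obtain ⟨f1, f2⟩ := h.eval_address e2 (WExp.eval_const (m := 1) (by omega)) le_rfl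
        (by omega) hp (by omega)
      rw [Cmd.run_send hb', FExp.eval_get f1 f2, hf 1 (by decide),
        hv.value 1 le_rfl (by omega) p hp]
      refine ⟨hb', ?_, ?_, i2⟩
      · simp [FExp.cost, WExp.cost]
      · simp [List.range_succ, show s'.sent = _ from i1])
  refine ⟨g1, g2, g3, g5.trans ?_⟩
  have hpos : 1 ≤ 2 ^ C.logSize 1 := Nat.one_le_two_pow
  simp only [WExp.cost]
  omega

/-- Send five zeros and receive a coordinate of the point to which the claim on the outputs
refers. -/
def Cmd.receiveCoordinate : Cmd := .seq (.send₅ fun _ => 0) (.recv 2 (wv 2))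

/-- Receive the point to which the claim on the outputs refers. -/
def Cmd.receivePoint : Cmd := .count 2 (.logSize (.const 1)) .receiveCoordinate

theorem Cmd.run_receivePoint (h : E.ForProver C S) {O : ℕ} {chal : ℕ → F}
    (hin : E.Synchronous O chal) (hb : s.blocked = false)
    (hsent : s.sent.length = O) (hrec : s.received = 0) :
    (Cmd.receivePoint.run E s).blocked = false ∧
      (Cmd.receivePoint.run E s).sent = s.sent ++ List.replicate (5 * C.logSize 1) 0 ∧
      (Cmd.receivePoint.run E s).received = C.logSize 1 ∧
      (∀ q < C.logSize 1, (Cmd.receivePoint.run E s).fld 2 q = chal q) ∧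
      (Cmd.receivePoint.run E s).time ≤ s.time + 100 * 2 ^ C.logSize 1 := by
  have hd := C.two_le_depth
  have h1 := h.logSize_lt le_rfl (show 1 ≤ C.depth by omega)
  have hmem := h.memSize
  have h5 := h.five_lt
  obtain ⟨g1, ⟨g2, g3, g4⟩, g5⟩ := Cmd.run_count_const (E := E) (s := s) (i := 2)
    (n := .logSize (.const 1)) (N := C.logSize 1)
    (body := .receiveCoordinate) h.mem_pos (by decide) hb
    (WExp.eval_logSize h.answer (WExp.eval_const (by omega)) h1)
    (fun j s' => s'.sent = s.sent ++ List.replicate (5 * j) 0 ∧ s'.received = j ∧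
      ∀ q < j, s'.fld 2 q = chal q) 20
    (by simpa using hrec)
    (by
      rintro j hj s' hb' hk' hw hf ⟨i1, i2, i3⟩
      have i1' : s'.sent = s.sent ++ List.replicate (5 * j) 0 := i1
      have i2' : s'.received = j := i2
      rw [Cmd.receiveCoordinate, Cmd.run_seq, Cmd.run_send₅ hb']
      have hz : (List.range 5).map (fun _ => (0 : FExp).eval E s') = List.replicate 5 (0 : F) := by
        simp
      rw [hz]
      set s₁ : State F := { s' with
        sent := s'.sent ++ List.replicate 5 0
        time := s'.time + ((0 : FExp).cost + (0 : FExp).cost + (0 : FExp).cost + (0 : FExp).cost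
          + (0 : FExp).cost + 5) } with hs₁
      have e2 : (wv 2).eval E s₁ = j := WExp.eval_var h.mem_pos hk' (by omega)
      have hbox : E.inbox s₁.sent s₁.received = some (chal j) := by
        rw [hin, if_pos]
        · rw [show s₁.received = j from i2]
        · rw [show s₁.received = j from i2]
          show (s'.sent ++ List.replicate 5 0).length = _
          rw [i1', List.length_append, List.length_append, hsent]
          simp; omega
      rw [Cmd.run_recv (show s₁.blocked = false from hb') (by rw [e2]; omega) hbox, e2]
      refine ⟨hb', ?_, ?_, ?_, fun q hq => ?_⟩
      · show s'.time + 10 + 3 ≤ s'.time + 20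
        omega
      · show s'.sent ++ List.replicate 5 0 = _
        rw [i1', List.append_assoc, ← List.replicate_add]
        rfl
      · show s'.received + 1 = _
        rw [i2']
      · refine (State.putF_fld s₁ 2 j 2 q _).trans ?_
        split_ifs with hqj
        · rw [hqj.2]
        · exact i3 q (by simp at hqj; omega))
  refine ⟨g1, g2, g3, g4, g5.trans ?_⟩
  have hpos := (C.logSize 1).lt_two_pow_self
  simp only [WExp.cost]
  omega

end Prover

section Prover

variable {F : Type u} [Field F] [DecidableEq F] {E : Env F} {s : State F}
variable {C : Circuit} {S : C.Exceptions}

/-- Fill the table `t`. -/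
def Cmd.fillTable (t : ℕ) (n : WExp) (e : FExp) : Cmd := .count 3 n (.setF t (wv 3) e)

theorem Cmd.run_fillTable (h : E.ForProver C S) {t N : ℕ} {n : WExp} {e : FExp} {val : ℕ → F}
    (hb : s.blocked = false) (hn : n.eval E (s.putW 3 0 0) = N)
    (he : ∀ p < N, ∀ s' : State F, (wv 3).eval E s' = p → (∀ b, b ≠ 3 → s'.word b = s.word b) →
      (∀ b, b ≠ t → s'.fld b = s.fld b) → e.eval E s' = val p) :
    ((Cmd.fillTable t n e).run E s).blocked = false ∧
      (∀ p < N, ((Cmd.fillTable t n e).run E s).fld t p = val p) ∧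
      ((Cmd.fillTable t n e).run E s).time ≤ s.time + (n.cost + 4 + N * (e.cost + 9)) := by
  have hN : N < 2 ^ E.wordSize := hn ▸ WExp.eval_lt _ _ _
  have hmem := h.memSize
  obtain ⟨b1, b2, b3, b4⟩ := Cmd.run_fill (E := E) (s := s) (i := 3) (a := t) (n := n)
    (idx := wv 3) (e := e) (N := N) h.mem_pos hb hn (fun p => p) val
    (fun p _ p' hp' => by omega)
    (fun p hp s' hp' hw hf _ => by
      have e3 : (wv 3).eval E s' = p := WExp.eval_var h.mem_pos hp' (by omega)
      exact ⟨e3, by omega, he p hp s' e3 hw hf⟩)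
  refine ⟨b1, b2, b4.trans ?_⟩
  have : N * ((wv 3).cost + e.cost + 7) = N * (e.cost + 9) := by
    congr 1; simp only [WExp.cost]; omega
  omega

/-- The number of the layer `wv 1 + 1` whose claim is treated. -/
abbrev WExp.cur : WExp := .plus (wv 1) 1

/-- The number of the next layer. -/
abbrev WExp.next : WExp := .plus (wv 1) 2

/-- The variable `wv 1` is `k`, and the arrays contain the values of all gates. -/
structure State.AtLayer (s : State F) (C : Circuit) (a : C.Input F) (k : ℕ) : Prop where
  word : s.word 1 0 = k
  values : s.HasValues C a 1

omit [DecidableEq F] in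
theorem State.AtLayer.congr {s s' : State F} {a : C.Input F} {k : ℕ} (h : s.AtLayer C a k)
    (h₀ : s'.word 1 = s.word 1) (h₁ : s'.fld 1 = s.fld 1) (h₂ : s'.fld 12 = s.fld 12) :
    s'.AtLayer C a k :=
  ⟨by rw [h₀, h.word], h.values.congr h₁ h₂⟩

omit [Field F] [DecidableEq F] in
/-- The expressions for the current and the next layer evaluate as they should. -/
theorem Env.ForProver.eval_layer (h : E.ForProver C S) {k : ℕ} (hk : k + 1 < C.depth)
    (hw : s.word 1 0 = k) :
    WExp.cur.eval E s = k + 1 ∧ WExp.next.eval E s = k + 2 ∧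
      (WExp.logSize .cur).eval E s = C.logSize (k + 1) ∧
      (WExp.logSize .next).eval E s = C.logSize (k + 2) ∧
      (WExp.logSize .cur).twoPow.eval E s = 2 ^ C.logSize (k + 1) ∧
      (WExp.logSize .next).twoPow.eval E s = 2 ^ C.logSize (k + 2) := by
  have h1 := h.two_pow_lt (i := k + 1) (by omega) hk.le
  have h2 := h.two_pow_lt (i := k + 2) (by omega) hk
  have h3 := h.depth_lt
  have e0 : (wv 1).eval E s = k := WExp.eval_var h.mem_pos hw (by omega)
  have e1 : WExp.cur.eval E s = k + 1 := WExp.eval_plus e0 (by omega)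
  have e2 : WExp.next.eval E s = k + 2 := WExp.eval_plus e0 (by omega)
  have e3 := WExp.eval_logSize h.answer e1 (h.logSize_lt (by omega) (by omega))
  have e4 := WExp.eval_logSize h.answer e2 (h.logSize_lt (by omega) (by omega))
  exact ⟨e1, e2, e3, e4, WExp.eval_twoPow e3 (by omega), WExp.eval_twoPow e4 (by omega)⟩

/-- The value of an in-neighbour of the gate `wv 3` of the current layer. -/
abbrev FExp.neighbour (f : Wiring) : FExp := .get 1 (.address (.wire f .cur (wv 3)) .next)

omit [DecidableEq F] in
theorem Env.ForProver.eval_neighbour (h : E.ForProver C S) {a : C.Input F} {k p : ℕ} {f : Wiring}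
    (hf : C.outWidth (k + 1) f = C.logSize (k + 2)) (hk : k + 1 < C.depth) (hs : s.AtLayer C a k)
    (hp : (wv 3).eval E s = p) :
    (WExp.wire f .cur (wv 3)).eval E s = C.wire (k + 1) f p ∧
    (FExp.neighbour f).eval E s = C.layer a (k + 2) (C.wire (k + 1) f p) := by
  obtain ⟨e1, e2, -⟩ := h.eval_layer hk hs.word
  have k1 := C.wire_lt (k + 1) f p
  rw [hf] at k1
  have h2 := h.two_pow_lt (i := k + 2) (by omega) hk
  have e3 := WExp.eval_wire h.answer e1 hp (f := f) (by omega)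
  obtain ⟨f3, f4⟩ := h.eval_address e3 e2 (by omega) hk k1 hk
  exact ⟨e3, by rw [FExp.eval_get f3 f4, hs.values.value _ (by omega) hk _ k1]⟩

/-- Set up the tables of the first sum-check of a layer. -/
def Cmd.layerTables₁ : Cmd :=
  .seq (.weights 6 (fv 4) 2 (.logSize .cur))
    (.seq (.fillTable 7 (.twoPow (.logSize .cur)) (.get 12 (.wire .type .cur (wv 3))))
      (.seq (.fillTable 8 (.twoPow (.logSize .cur)) (.neighbour .in₁))
        (.fillTable 9 (.twoPow (.logSize .cur)) (.neighbour .in₂))))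

theorem Cmd.run_layerTables₁ (h : E.ForProver C S) {a : C.Input F} {k : ℕ} {chal : ℕ → F}
    (hk : k + 1 < C.depth) (hb : s.blocked = false) (hs : s.AtLayer C a k)
    (hsc : s.fld 4 0 = C.scale chal k)
    (hpt : ∀ q < C.logSize (k + 1), s.fld 2 q = shift chal (C.pos k) q) :
    (Cmd.layerTables₁.run E s).blocked = false ∧
      (Cmd.layerTables₁.run E s).HasTables (C.tables₁ chal a k) (2 ^ C.logSize (k + 1)) ∧
      (Cmd.layerTables₁.run E s).time ≤ s.time + 500 * 2 ^ C.logSize (k + 1) := by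
  have h1 := h.two_pow_lt (i := k + 1) (by omega) hk.le
  have h2 := h.two_pow_lt (i := k + 2) (by omega) hk
  have h5 := h.five_lt
  have hmem := h.memSize
  simp only [Cmd.layerTables₁, Cmd.run_seq]
  obtain ⟨a1, a2, a3⟩ := Cmd.run_weights (E := E) (s := s) (t := 6) (pt := 2) (sc := fv 4)
    (mE := .logSize .cur) (by norm_num) h.memSize (by omega) hb
    (fun s' hw => (h.eval_layer hk (by rw [hw 1 (by norm_num) (by norm_num), hs.word])).2.2.1)
    (FExp.eval_var h.mem_pos) hpt
  have aF : ∀ b, b ≠ 6 → ((Cmd.weights 6 (fv 4) 2 (.logSize .cur)).run E s).fld b = s.fld b :=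
    fun b hb => Cmd.run_fld E _ s
      (by simp [Cmd.weights, Cmd.weightsStep, Cmd.count, Cmd.fldArrays, hb])
  have aL := hs.congr (s' := (Cmd.weights 6 (fv 4) 2 (.logSize .cur)).run E s)
    (Cmd.run_word E _ s (by decide)) (aF 1 (by norm_num)) (aF 12 (by norm_num))
  set s₁ := (Cmd.weights 6 (fv 4) 2 (.logSize .cur)).run E s
  have fill : ∀ (t : ℕ) (e : FExp) (val : ℕ → F) (s' : State F), t ≠ 1 → t ≠ 12 →
      s'.blocked = false → s'.AtLayer C a k →
      (∀ p < 2 ^ C.logSize (k + 1), ∀ s'' : State F, (wv 3).eval E s'' = p → s''.AtLayer C a k →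
        e.eval E s'' = val p) →
      ((Cmd.fillTable t (.twoPow (.logSize .cur)) e).run E s').blocked = false ∧
      ((Cmd.fillTable t (.twoPow (.logSize .cur)) e).run E s').AtLayer C a k ∧
      (∀ b, b ≠ t → ((Cmd.fillTable t (.twoPow (.logSize .cur)) e).run E s').fld b = s'.fld b) ∧
      (∀ p < 2 ^ C.logSize (k + 1),
        ((Cmd.fillTable t (.twoPow (.logSize .cur)) e).run E s').fld t p = val p) ∧
      ((Cmd.fillTable t (.twoPow (.logSize .cur)) e).run E s').time
        ≤ s'.time + (WExp.cost (.twoPow (.logSize .cur)) + 4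
          + 2 ^ C.logSize (k + 1) * (e.cost + 9)) := by
    intro t e val s' ht1 ht12 hb' hs' he
    have fr : ∀ b, b ≠ t →
        ((Cmd.fillTable t (.twoPow (.logSize .cur)) e).run E s').fld b = s'.fld b :=
      fun b hb => Cmd.run_fld E _ s' (by simp [Cmd.fillTable, Cmd.count, Cmd.fldArrays, hb])
    obtain ⟨c1, c2, c3⟩ := Cmd.run_fillTable h hb' (t := t) (e := e) (val := val)
      (h.eval_layer hk (by simpa using hs'.word)).2.2.2.2.1
      (fun p hp s'' hp' hw hf => he p hp s'' hp'
        (hs'.congr (hw 1 (by norm_num)) (hf 1 ht1.symm) (hf 12 ht12.symm)))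
    exact ⟨c1, hs'.congr (Cmd.run_word E _ s' (by
      simp [Cmd.fillTable, Cmd.count, Cmd.wordArrays])) (fr 1 ht1.symm) (fr 12 ht12.symm), fr, c2,
      c3⟩
  obtain ⟨b1, b2, b3, b4, b5⟩ := fill 7 (.get 12 (.wire .type .cur (wv 3)))
    (C.typeF F (k + 1)) s₁ (by norm_num) (by norm_num) a1 aL (by
      intro p hp s'' hp' hs''
      have k3 := C.wire_lt (k + 1) .type p
      simp only [Circuit.outWidth] at k3
      rw [FExp.eval_get (WExp.eval_wire h.answer (h.eval_layer hk hs''.word).1 hp' (by omega))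
        (by omega), hs''.values.type])
  obtain ⟨c1, c2, c3, c4, c5⟩ := fill 8 (.neighbour .in₁) (C.tables₁ chal a k).a _
    (by norm_num) (by norm_num) b1 b2 (fun p hp s'' hp' hs'' =>
      (h.eval_neighbour rfl hk hs'' hp').2)
  obtain ⟨d1, d2, d3, d4, d5⟩ := fill 9 (.neighbour .in₂) (C.tables₁ chal a k).c _
    (by norm_num) (by norm_num) c1 c2 (fun p hp s'' hp' hs'' =>
      (h.eval_neighbour rfl hk hs'' hp').2)
  refine ⟨d1, ⟨fun p hp => ?_, fun p hp => ?_, fun p hp => ?_, d4⟩, ?_⟩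
  · rw [d3 _ (by norm_num), c3 _ (by norm_num), b3 _ (by norm_num), a2 p hp, hsc]; rfl
  · rw [d3 _ (by norm_num), c3 _ (by norm_num), b4 p hp]; rfl
  · rw [d3 _ (by norm_num), c4 p hp]
  · have hpos : 1 ≤ 2 ^ C.logSize (k + 1) := Nat.one_le_two_pow
    simp only [WExp.cost, FExp.cost] at a3 b5 c5 d5
    omega

/-- Set up the tables of the second sum-check of a layer. -/
def Cmd.layerTables₂ : Cmd :=
  .seq (.weights 10 1 3 (.logSize .cur))
    (.seq (.fillTable 6 (.twoPow (.logSize .next)) 0)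
      (.seq (.count 3 (.twoPow (.logSize .cur)) (.setF 6 (.wire .in₁ .cur (wv 3))
          (.get 6 (.wire .in₁ .cur (wv 3)) + .get 10 (wv 3))))
        (.seq (.count 3 (.twoPow (.logSize .cur)) (.setF 6 (.wire .in₂ .cur (wv 3))
            (.get 6 (.wire .in₂ .cur (wv 3)) + fv 5 * .get 10 (wv 3))))
          (.seq (.fillTable 7 (.twoPow (.logSize .next)) 1)
            (.seq (.fillTable 8 (.twoPow (.logSize .next)) (.get 1 (.address (wv 3) .next)))
              (.fillTable 9 (.twoPow (.logSize .next)) 1))))))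

theorem Cmd.run_layerTables₂ (h : E.ForProver C S) {a : C.Input F} {k : ℕ} {chal : ℕ → F}
    (hk : k + 1 < C.depth) (hb : s.blocked = false) (hs : s.AtLayer C a k)
    (hmid : s.fld 5 0 = chal (C.mid k))
    (hpt : ∀ q < C.logSize (k + 1), s.fld 3 q = shift chal (C.start₁ k) q) :
    (Cmd.layerTables₂.run E s).blocked = false ∧
      (Cmd.layerTables₂.run E s).HasTables (C.tables₂ chal a k) (2 ^ C.logSize (k + 2)) ∧
      (Cmd.layerTables₂.run E s).time
        ≤ s.time + (500 * 2 ^ C.logSize (k + 1) + 500 * 2 ^ C.logSize (k + 2)) := by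
  have h1 := h.two_pow_lt (i := k + 1) (by omega) hk.le
  have h2 := h.two_pow_lt (i := k + 2) (by omega) hk
  have h5 := h.five_lt
  have hmem := h.memSize
  simp only [Cmd.layerTables₂, Cmd.run_seq]
  obtain ⟨a1, a2, a3⟩ := Cmd.run_weights (E := E) (s := s) (t := 10) (pt := 3) (sc := 1) (c := 1)
    (mE := .logSize .cur) (by norm_num) h.memSize (by omega) hb
    (fun s' hw => (h.eval_layer hk (by rw [hw 1 (by norm_num) (by norm_num), hs.word])).2.2.1)
    FExp.eval_one hpt
  have aF : ∀ b, b ≠ 10 → ((Cmd.weights 10 1 3 (.logSize .cur)).run E s).fld b = s.fld b :=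
    fun b hb => Cmd.run_fld E _ s
      (by simp [Cmd.weights, Cmd.weightsStep, Cmd.count, Cmd.fldArrays, hb])
  have aL := hs.congr (s' := (Cmd.weights 10 1 3 (.logSize .cur)).run E s)
    (Cmd.run_word E _ s (by decide)) (aF 1 (by norm_num)) (aF 12 (by norm_num))
  set s₁ := (Cmd.weights 10 1 3 (.logSize .cur)).run E s
  have fill : ∀ (t : ℕ) (e : FExp) (val : ℕ → F) (s' : State F), t ≠ 1 → t ≠ 12 →
      s'.blocked = false → s'.AtLayer C a k →
      (∀ p < 2 ^ C.logSize (k + 2), ∀ s'' : State F, (wv 3).eval E s'' = p → s''.AtLayer C a k →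
        e.eval E s'' = val p) →
      ((Cmd.fillTable t (.twoPow (.logSize .next)) e).run E s').blocked = false ∧
      ((Cmd.fillTable t (.twoPow (.logSize .next)) e).run E s').AtLayer C a k ∧
      (∀ b, b ≠ t → ((Cmd.fillTable t (.twoPow (.logSize .next)) e).run E s').fld b = s'.fld b) ∧
      (∀ p < 2 ^ C.logSize (k + 2),
        ((Cmd.fillTable t (.twoPow (.logSize .next)) e).run E s').fld t p = val p) ∧
      ((Cmd.fillTable t (.twoPow (.logSize .next)) e).run E s').time
        ≤ s'.time + (WExp.cost (.twoPow (.logSize .next)) + 4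
          + 2 ^ C.logSize (k + 2) * (e.cost + 9)) := by
    intro t e val s' ht1 ht12 hb' hs' he
    have fr : ∀ b, b ≠ t →
        ((Cmd.fillTable t (.twoPow (.logSize .next)) e).run E s').fld b = s'.fld b :=
      fun b hb => Cmd.run_fld E _ s' (by simp [Cmd.fillTable, Cmd.count, Cmd.fldArrays, hb])
    obtain ⟨c1, c2, c3⟩ := Cmd.run_fillTable h hb' (t := t) (e := e) (val := val)
      (h.eval_layer hk (by simpa using hs'.word)).2.2.2.2.2
      (fun p hp s'' hp' hw hf => he p hp s'' hp'
        (hs'.congr (hw 1 (by norm_num)) (hf 1 ht1.symm) (hf 12 ht12.symm)))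
    exact ⟨c1, hs'.congr (Cmd.run_word E _ s' (by
      simp [Cmd.fillTable, Cmd.count, Cmd.wordArrays])) (fr 1 ht1.symm) (fr 12 ht12.symm), fr, c2,
      c3⟩
  obtain ⟨b1, b2, b3, b4, b5⟩ := fill 6 0 (fun _ => 0) s₁ (by norm_num) (by norm_num) a1 aL
    (fun _ _ _ _ _ => rfl)
  set s₂ := (Cmd.fillTable 6 (.twoPow (.logSize .next)) 0).run E s₁
  -- The two loops that compute the table `Circuit.combine`.
  have acc : ∀ (f : Wiring) (x : FExp) (c : F) (s' : State F),
      C.outWidth (k + 1) f = C.logSize (k + 2) → s'.blocked = false → s'.AtLayer C a k →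
      s'.fld 10 = s₁.fld 10 →
      (∀ p < 2 ^ C.logSize (k + 1), ∀ s'' : State F, (wv 3).eval E s'' = p →
        (∀ b, b ≠ 6 → s''.fld b = s'.fld b) → x.eval E s'' = c * s₁.fld 10 p) →
      ((Cmd.count 3 (.twoPow (.logSize .cur)) (.setF 6 (.wire f .cur (wv 3))
          (.get 6 (.wire f .cur (wv 3)) + x))).run E s').blocked = false ∧
      ((Cmd.count 3 (.twoPow (.logSize .cur)) (.setF 6 (.wire f .cur (wv 3))
          (.get 6 (.wire f .cur (wv 3)) + x))).run E s').AtLayer C a k ∧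
      (∀ b, b ≠ 6 → ((Cmd.count 3 (.twoPow (.logSize .cur)) (.setF 6 (.wire f .cur (wv 3))
          (.get 6 (.wire f .cur (wv 3)) + x))).run E s').fld b = s'.fld b) ∧
      (∀ q, ((Cmd.count 3 (.twoPow (.logSize .cur)) (.setF 6 (.wire f .cur (wv 3))
          (.get 6 (.wire f .cur (wv 3)) + x))).run E s').fld 6 q = s'.fld 6 q +
          ∑ p ∈ Finset.range (2 ^ C.logSize (k + 1)), if C.wire (k + 1) f p = q then
            c * wt (C.logSize (k + 1)) (shift chal (C.start₁ k)) p else 0) ∧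
      ((Cmd.count 3 (.twoPow (.logSize .cur)) (.setF 6 (.wire f .cur (wv 3))
          (.get 6 (.wire f .cur (wv 3)) + x))).run E s').time
        ≤ s'.time + (20 + 2 ^ C.logSize (k + 1) * (x.cost + 50)) := by
    intro f x c s' hf hb' hs' h10 hx
    have fr : ∀ b, b ≠ 6 → ((Cmd.count 3 (.twoPow (.logSize .cur)) (.setF 6 (.wire f .cur (wv 3))
          (.get 6 (.wire f .cur (wv 3)) + x))).run E s').fld b = s'.fld b :=
      fun b hb => Cmd.run_fld E _ s' (by simp [Cmd.count, Cmd.fldArrays, hb])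
    obtain ⟨c1, c2, c3⟩ := Cmd.run_accumulate (E := E) (s := s') (i := 3) (a := 6)
      (n := .twoPow (.logSize .cur)) (idx := .wire f .cur (wv 3))
      (e := .get 6 (.wire f .cur (wv 3)) + x) h.mem_pos hb'
      (h.eval_layer hk (by simpa using hs'.word)).2.2.2.2.1 (C.wire (k + 1) f)
      (fun p => c * wt (C.logSize (k + 1)) (shift chal (C.start₁ k)) p) (by
        intro p hp s'' hp' hw hf'
        have e3 : (wv 3).eval E s'' = p := WExp.eval_var h.mem_pos hp' (by omega)
        have e4 := (h.eval_neighbour hf hk (hs'.congr (hw 1 (by norm_num)) (hf' 1 (by norm_num))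
          (hf' 12 (by norm_num))) e3).1
        have k1 := C.wire_lt (k + 1) f p
        rw [hf] at k1
        refine ⟨e4, by omega, ?_⟩
        rw [FExp.eval_add, FExp.eval_get e4 (by omega), hx p hp s'' e3 hf', a2 p hp, one_mul])
    refine ⟨c1, hs'.congr (Cmd.run_word E _ s' (by simp [Cmd.count, Cmd.wordArrays]))
      (fr 1 (by norm_num)) (fr 12 (by norm_num)), fr, c2, c3.trans ?_⟩
    have : ∀ y : FExp, ((.get 6 (.wire f .cur (wv 3)) : FExp) + y).cost = y.cost + 10 := fun y => by
      rw [FExp.cost_add]; simp only [FExp.cost, WExp.cost]; omega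
    rw [this, show (WExp.wire f .cur (wv 3)).cost + (x.cost + 10) + 7 = x.cost + 25 by
      simp only [WExp.cost]; omega]
    have h3 := Nat.mul_le_mul_left (2 ^ C.logSize (k + 1)) (show x.cost + 25 ≤ x.cost + 50 by omega)
    simp only [WExp.cost]
    omega
  have h10 : s₂.fld 10 = s₁.fld 10 := b3 10 (by norm_num)
  obtain ⟨c1, c2, c3, c4, c5⟩ := acc .in₁ (.get 10 (wv 3)) 1 s₂ rfl b1 b2 h10 (by
    intro p hp s'' hp' hf'
    rw [FExp.eval_get hp' (by omega), hf' 10 (by norm_num), h10, one_mul])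
  set s₃ := (Cmd.count 3 (.twoPow (.logSize .cur)) (.setF 6 (.wire .in₁ .cur (wv 3))
          (.get 6 (.wire .in₁ .cur (wv 3)) + .get 10 (wv 3)))).run E s₂
  have h10' : s₃.fld 10 = s₁.fld 10 := (c3 10 (by norm_num)).trans h10
  have h5' : s₃.fld 5 0 = chal (C.mid k) := by
    rw [c3 5 (by norm_num), b3 5 (by norm_num), aF 5 (by norm_num), hmid]
  obtain ⟨d1, d2, d3, d4, d5⟩ := acc .in₂ (fv 5 * .get 10 (wv 3)) (chal (C.mid k)) s₃ rfl c1 c2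
    h10' (by
    intro p hp s'' hp' hf'
    rw [FExp.eval_mul, FExp.eval_get hp' (by omega), hf' 10 (by norm_num), h10',
      FExp.eval_var h.mem_pos, hf' 5 (by norm_num), h5'])
  set s₄ := (Cmd.count 3 (.twoPow (.logSize .cur)) (.setF 6 (.wire .in₂ .cur (wv 3))
          (.get 6 (.wire .in₂ .cur (wv 3)) + fv 5 * .get 10 (wv 3)))).run E s₃
  obtain ⟨e1, e2, e3, e4, e5⟩ := fill 7 1 (fun _ => 1) s₄ (by norm_num) (by norm_num) d1 d2
    (fun _ _ _ _ _ => rfl)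
  obtain ⟨f1, f2, f3, f4, f5⟩ := fill 8 (.get 1 (.address (wv 3) .next)) (C.layer a (k + 2)) _
    (by norm_num) (by norm_num) e1 e2 (by
      intro p hp s'' hp' hs''
      obtain ⟨g3, g4⟩ := h.eval_address hp' (h.eval_layer hk hs''.word).2.1 (by omega) hk hp hk
      rw [FExp.eval_get g3 g4, hs''.values.value _ (by omega) hk _ hp])
  obtain ⟨g1, g2, g3, g4, g5⟩ := fill 9 1 (fun _ => 1) _ (by norm_num) (by norm_num) f1 f2
    (fun _ _ _ _ _ => rfl)
  refine ⟨g1, ⟨fun q hq => ?_, fun p hp => ?_, fun p hp => ?_, g4⟩, ?_⟩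
  · rw [g3 _ (by norm_num), f3 _ (by norm_num), e3 _ (by norm_num), d4, c4, b4 q hq, zero_add,
      ← Finset.sum_add_distrib]
    refine Finset.sum_congr rfl fun p _ => ?_
    split_ifs <;> ring
  · rw [g3 _ (by norm_num), f3 _ (by norm_num), e4 p hp]; rfl
  · rw [g3 _ (by norm_num), f4 p hp]; rfl
  · have hpos : 1 ≤ 2 ^ C.logSize (k + 1) := Nat.one_le_two_pow
    have hpos' : 1 ≤ 2 ^ C.logSize (k + 2) := Nat.one_le_two_pow
    rw [FExp.cost_mul] at d5
    rw [FExp.cost_one] at a3 e5 g5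
    rw [FExp.cost_zero] at b5
    simp only [WExp.cost, FExp.cost] at a3 b5 c5 d5 e5 f5 g5
    omega

end Prover

section Prover

variable {F : Type u} [Field F] [DecidableEq F] {E : Env F} {s : State F}
variable {C : Circuit} {S : C.Exceptions}

/-- The part of the prover's program that treats a layer. -/
def Cmd.proverLayer : Cmd :=
  .seq .layerTables₁ (.seq (.proverSumCheck 3 (.logSize .cur))
    (.seq (.send₅ fun k => [fv 8, fv 9].getD k 0) (.seq (.recv 5 (.const 0))
      (.seq .layerTables₂ (.seq (.proverSumCheck 2 (.logSize .next))
        (.setF 4 (.const 0) (fv 6)))))))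

/-- The state of the prover before it treats layer `k + 1`. -/
structure State.ProverAt (s : State F) (C : Circuit) (a : C.Input F) (chal : ℕ → F) (k : ℕ) :
    Prop where
  values : s.HasValues C a 1
  scale : s.fld 4 0 = C.scale chal k
  point : ∀ q < C.logSize (k + 1), s.fld 2 q = shift chal (C.pos k) q
  sent : s.sent = C.messages chal a k
  received : s.received = C.start₁ k

theorem Cmd.run_proverLayer (h : E.ForProver C S) {a : C.Input F} {k : ℕ} {chal : ℕ → F}
    (hin : E.Synchronous C.numOutputs chal) (hk : k + 1 < C.depth) (hb : s.blocked = false)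
    (hw : s.word 1 0 = k) (hs : s.ProverAt C a chal k) :
    (Cmd.proverLayer.run E s).blocked = false ∧
      (Cmd.proverLayer.run E s).ProverAt C a chal (k + 1) ∧
      (Cmd.proverLayer.run E s).time
        ≤ s.time + (5100 * 2 ^ C.logSize (k + 1) + 5100 * 2 ^ C.logSize (k + 2)) := by
  have p1 := h.two_pow_lt (i := k + 1) (by omega) hk.le
  have p2 := h.two_pow_lt (i := k + 2) (by omega) hk
  have h5 := h.five_lt
  have hM := h.memSize
  have m1 := C.start₁_add k
  have m2 := C.mid_add_one k
  have hw1 : ∀ {s' : State F}, s'.word 1 = s.word 1 → s'.word 1 0 = k := fun e => by rw [e, hw]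
  simp only [Cmd.proverLayer, Cmd.run_seq]
  -- the tables of the first sum-check
  obtain ⟨a1, a2, a3⟩ := Cmd.run_layerTables₁ h hk hb ⟨hw, hs.values⟩ hs.scale hs.point
  have aW : (Cmd.layerTables₁.run E s).word 1 = s.word 1 := Cmd.run_word E _ s (by decide)
  have aF : ∀ b ∈ [1, 2, 4, 12], (Cmd.layerTables₁.run E s).fld b = s.fld b := fun b hb =>
    Cmd.run_fld E _ s (by revert b; decide)
  have aQ := Cmd.run_quiet E .layerTables₁ s (by decide)
  set s₁ := Cmd.layerTables₁.run E s
  -- the first sum-check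
  obtain ⟨b1, b2, b3, b4, b5, b6⟩ := Cmd.run_proverSumCheck (s := s₁) (pt := 3)
    (mE := .logSize .cur) (m := C.logSize (k + 1)) (by norm_num) (by norm_num) hM h5 (by omega) hin a1
    (fun s' hw' => (h.eval_layer hk (hw1 ((hw' 1 (by norm_num) (by norm_num)).trans aW))).2.2.1)
    (by decide) a2 (t₀ := C.start₁ k) (by rw [aQ.received, hs.received])
    (by rw [aQ.sent, hs.sent, C.length_messages]; rfl)
  have bW : ((Cmd.proverSumCheck 3 (.logSize .cur)).run E s₁).word 1 = s.word 1 :=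
    (Cmd.run_word E _ s₁ (by decide)).trans aW
  have bF : ∀ b ∈ [1, 12], ((Cmd.proverSumCheck 3 (.logSize .cur)).run E s₁).fld b = s.fld b :=
    fun b hb => (Cmd.run_fld E _ s₁ (by revert b; decide)).trans (aF b (by revert b; decide))
  rw [aQ.sent, hs.sent] at b3
  rw [m1] at b4
  set s₂ := (Cmd.proverSumCheck 3 (.logSize .cur)).run E s₁
  -- the message and the challenge between the sum-checks
  have q8 : s₂.fld 8 0 = C.mid₁ chal a k := (b2.a 0 one_pos).trans (folds_zero_eq_mle _ _ _)
  have q9 : s₂.fld 9 0 = C.mid₂ chal a k := (b2.c 0 one_pos).trans (folds_zero_eq_mle _ _ _)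
  rw [Cmd.run_send₅ b1]
  have hev : (List.range 5).map (fun k => ([fv 8, fv 9].getD k 0).eval E s₂)
      = [C.mid₁ chal a k, C.mid₂ chal a k, 0, 0, 0] := by
    simp [List.range_succ, FExp.eval_var h.mem_pos, q8, q9]
  rw [hev]
  set s₃ : State F := { s₂ with
    sent := s₂.sent ++ [C.mid₁ chal a k, C.mid₂ chal a k, 0, 0, 0]
    time := s₂.time + (([fv 8, fv 9].getD 0 0).cost + ([fv 8, fv 9].getD 1 0).cost
      + ([fv 8, fv 9].getD 2 0).cost + ([fv 8, fv 9].getD 3 0).cost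
      + ([fv 8, fv 9].getD 4 0).cost + 5) } with hs₃
  have hlen : s₃.sent.length = C.numOutputs + 5 * (C.mid k + 1) := by
    simp only [hs₃, b3, List.length_append, C.length_messages, Circuit.length_sumCheckMessages]
    have : C.mid k = C.pos k + C.logSize (k + 1) + C.logSize (k + 1) := m1.symm
    simp only [List.length_cons, List.length_nil]
    omega
  have hbox : E.inbox s₃.sent s₃.received = some (chal (C.mid k)) := by
    rw [hin, if_pos]
    · rw [show s₃.received = C.mid k from b4]
    · rw [show s₃.received = C.mid k from b4, hlen]
  rw [Cmd.run_recv (a := 5) (i := .const 0) (show s₃.blocked = false from b1)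
    (by rw [WExp.eval_const_zero]; exact h.mem_pos) hbox, WExp.eval_const_zero]
  set s₄ : State F := { s₃.putF 5 0 (chal (C.mid k)) with
    received := s₃.received + 1, time := s₃.time + ((WExp.const 0).cost + 1) } with hs₄
  have dF : ∀ b, b ≠ 5 → s₄.fld b = s₂.fld b := fun b hb => State.putF_fld_ne _ _ _ hb
  have d5 : s₄.fld 5 0 = chal (C.mid k) := by simp [hs₄]
  -- the tables of the second sum-check
  have dL : s₄.AtLayer C a k := ⟨hw1 bW, hs.values.congr
    ((dF 1 (by norm_num)).trans (bF 1 (by decide))) ((dF 12 (by norm_num)).trans (bF 12 (by decide)))⟩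
  obtain ⟨e1, e2, e3⟩ := Cmd.run_layerTables₂ (s := s₄) h hk b1 dL d5
    (fun q hq => by rw [dF 3 (by norm_num), b5 q hq])
  have eW : (Cmd.layerTables₂.run E s₄).word 1 = s.word 1 :=
    (Cmd.run_word E _ s₄ (by decide)).trans bW
  have eF : ∀ b ∈ [1, 12], (Cmd.layerTables₂.run E s₄).fld b = s.fld b := fun b hb =>
    ((Cmd.run_fld E _ s₄ (by revert b; decide)).trans (dF b (by revert b; decide))).trans (bF b hb)
  have eQ := Cmd.run_quiet E .layerTables₂ s₄ (by decide)
  have eR : (Cmd.layerTables₂.run E s₄).received = C.pos (k + 1) := by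
    rw [eQ.received, ← m2, ← b4]
  have eS : (Cmd.layerTables₂.run E s₄).sent = s₃.sent := eQ.sent
  set s₅ := Cmd.layerTables₂.run E s₄
  -- the second sum-check
  obtain ⟨f1, f2, f3, f4, f5, f6⟩ := Cmd.run_proverSumCheck (s := s₅) (pt := 2)
    (mE := .logSize .next) (m := C.logSize (k + 2)) (by norm_num) (by norm_num) hM h5 (by omega) hin
    e1
    (fun s' hw' => (h.eval_layer hk (hw1 ((hw' 1 (by norm_num) (by norm_num)).trans eW))).2.2.2.1)
    (by decide) e2 (t₀ := C.pos (k + 1)) eR (by rw [eS, hlen, m2])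
  have fF : ∀ b ∈ [1, 12], ((Cmd.proverSumCheck 2 (.logSize .next)).run E s₅).fld b = s.fld b :=
    fun b hb => (Cmd.run_fld E _ s₅ (by revert b; decide)).trans (eF b hb)
  set s₆ := (Cmd.proverSumCheck 2 (.logSize .next)).run E s₅
  have q6 : s₆.fld 6 0 = C.scale chal (k + 1) := (f2.b 0 one_pos).trans (folds_zero_eq_mle _ _ _)
  rw [Cmd.run_setF f1 (by rw [WExp.eval_const_zero]; exact h.mem_pos), WExp.eval_const_zero,
    FExp.eval_var h.mem_pos, q6]
  refine ⟨f1, ⟨hs.values.congr ?_ ?_, by simp, fun q hq => ?_, ?_, ?_⟩, ?_⟩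
  · rw [State.tick_fld, State.putF_fld_ne _ _ _ (by norm_num)]; exact fF 1 (by decide)
  · rw [State.tick_fld, State.putF_fld_ne _ _ _ (by norm_num)]; exact fF 12 (by decide)
  · rw [State.tick_fld, State.putF_fld_ne _ _ _ (by norm_num)]; exact f5 q hq
  · rw [State.tick_sent, State.putF_sent, f3, eS]
    simp only [hs₃, b3, Circuit.messages, Circuit.layerMessages, List.append_assoc]
  · rw [State.tick_received, State.putF_received, f4]; rfl
  · have t3 : s₃.time = s₂.time + 12 := rfl
    have t4 : s₄.time = s₃.time + 2 := rfl
    have hpos : 1 ≤ 2 ^ C.logSize (k + 1) := Nat.one_le_two_pow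
    have hpos' : 1 ≤ 2 ^ C.logSize (k + 2) := Nat.one_le_two_pow
    simp only [State.tick_time, State.putF_time, WExp.cost, FExp.cost]
    omega

/-- The program of the prover. -/
def prover : Party where
  init := .setF 12 (.const 1) 1
  update := .setF 1 (.address (wv 0) .depth) (.get 1 (.address (wv 0) .depth) + fv 0)
  main := .seq .evalCircuit (.seq .sendOutputs (.seq .receivePoint
    (.seq (.setF 4 (.const 0) 1) (.count 1 (.op .sub .depth (.const 1)) .proverLayer))))

theorem run_prover_main (h : E.ForProver C S) {a : C.Input F} {chal : ℕ → F}
    (hin : E.Synchronous C.numOutputs chal) (hb : s.blocked = false)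
    (hv : s.HasValues C a C.depth) (hsent : s.sent = []) (hrec : s.received = 0) :
    (prover.main.run E s).blocked = false ∧
      (prover.main.run E s).sent = C.messages chal a (C.depth - 1) ∧
      (prover.main.run E s).received = C.rounds ∧
      (prover.main.run E s).time ≤ s.time + 12000 * C.size := by
  have hd := C.two_le_depth
  have hdl := h.depth_lt
  simp only [prover, Cmd.run_seq]
  obtain ⟨a1, a2, a3⟩ := Cmd.run_evalCircuit h hb hv
  have aQ := Cmd.run_quiet E .evalCircuit s (by decide)
  set s₁ := Cmd.evalCircuit.run E s
  obtain ⟨b1, b2, b3, b4⟩ := Cmd.run_sendOutputs h a1 a2 (aQ.sent.trans hsent)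
  have bV := a2.congr (s' := Cmd.sendOutputs.run E s₁) (Cmd.run_fld E _ s₁ (by decide))
    (Cmd.run_fld E _ s₁ (by decide))
  rw [aQ.received, hrec] at b3
  set s₂ := Cmd.sendOutputs.run E s₁
  obtain ⟨c1, c2, c3, c4, c5⟩ := Cmd.run_receivePoint h hin b1 (by rw [b2]; simp) b3
  have cV := bV.congr (s' := Cmd.receivePoint.run E s₂) (Cmd.run_fld E _ s₂ (by decide))
    (Cmd.run_fld E _ s₂ (by decide))
  rw [b2] at c2
  set s₃ := Cmd.receivePoint.run E s₂
  rw [Cmd.run_setF c1 (by rw [WExp.eval_const_zero]; exact h.mem_pos), WExp.eval_const_zero,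
    FExp.eval_one]
  set s₄ := (s₃.putF 4 0 1).tick ((WExp.const 0).cost + (1 : FExp).cost + 1)
  have dF : ∀ b, b ≠ 4 → s₄.fld b = s₃.fld b := fun b hb => State.putF_fld_ne _ _ _ hb
  have dP : s₄.ProverAt C a chal 0 :=
    ⟨cV.congr (dF 1 (by norm_num)) (dF 12 (by norm_num)), by simp [s₄, Circuit.scale],
      fun q hq => by rw [dF 2 (by norm_num), c4 q hq]; simp [shift, Circuit.pos], c2,
      by rw [Circuit.start₁, Circuit.pos, zero_add]; exact c3⟩
  obtain ⟨g1, g2, g3⟩ := Cmd.run_count (E := E) (s := s₄) (i := 1)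
    (n := .op .sub .depth (.const 1)) (N := C.depth - 1) (body := .proverLayer) h.mem_pos
    (by decide) c1
    (WExp.eval_op (WExp.eval_depth h.answer hdl) (WExp.eval_const (by omega))
      (by simp only [WordOp.eval]; omega))
    (fun k s' => s'.ProverAt C a chal k)
    (fun k => 5100 * 2 ^ C.logSize (k + 1) + 5100 * 2 ^ C.logSize (k + 2))
    ⟨dP.values.congr rfl rfl, dP.scale, dP.point, dP.sent, dP.received⟩
    (by
      rintro k hk s' hb' hk' hw hf i1
      obtain ⟨e1, e2, e3⟩ := Cmd.run_proverLayer h hin (by omega) hb' hk' (s := s') (a := a)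
        (chal := chal) ⟨i1.values.congr rfl rfl, i1.scale, i1.point, i1.sent, i1.received⟩
      exact ⟨e1, e3, e2.values.congr rfl rfl, e2.scale, e2.point, e2.sent, e2.received⟩)
  refine ⟨g1, g2.sent, ?_, g3.trans ?_⟩
  · rw [show (Cmd.run E _ s₄).received = _ from g2.received, Circuit.start₁, Circuit.rounds,
      show C.depth - 1 + 1 = C.depth by omega]
  · have k1 := sum_layers C
    have k2 := depth_le_size C
    have k3 : ∑ k ∈ Finset.range (C.depth - 1), 2 ^ C.logSize (k + 2) + 2 ^ C.logSize 1
        = C.size := by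
      rw [← k1, show C.logSize C.depth = C.logSize (C.depth - 1 + 1) by
        congr 1; omega, ← Finset.sum_range_succ (fun k => 2 ^ C.logSize (k + 1)),
        Finset.sum_range_succ']
    have hpos : 1 ≤ 2 ^ C.logSize 1 := Nat.one_le_two_pow
    have hpos' : 1 ≤ 2 ^ C.logSize C.depth := Nat.one_le_two_pow
    have k4 : s₄.time = s₃.time + 3 := rfl
    simp only [Finset.sum_add_distrib, ← Finset.mul_sum, Finset.sum_const, Finset.card_range,
      smul_eq_mul, WExp.cost]
    omega

end Prover

/-! ### The honest prover as a strategy -/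

section Stream

variable {F : Type u} [AddMonoid F] (C : Circuit)

theorem Circuit.frequency_nil : C.frequency ([] : C.Stream F) = fun _ => 0 := by
  funext p; simp [Circuit.frequency]

theorem Circuit.frequency_concat (σ : C.Stream F) (u : BitVec (C.logSize C.depth) × F)
    (p : BitVec (C.logSize C.depth)) :
    C.frequency (σ ++ [u]) p = C.frequency σ p + if u.1 = p then u.2 else 0 := by
  by_cases h : u.1 = p <;> simp [Circuit.frequency, h]

end Stream

section Prover

variable {F : Type u} [Field F] [DecidableEq F] {E : Env F}
variable {C : Circuit} {S : C.Exceptions}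

/-- The state of a party after the stream. -/
def Party.observe (Q : Party) (E : Env F) (σ : C.Stream F) : State F :=
  σ.foldl (fun s u => Q.update.run E (s.read E u.1.toNat u.2)) (Q.init.run E (State.start F))

theorem Party.observe_nil (Q : Party) (E : Env F) :
    Q.observe E ([] : C.Stream F) = Q.init.run E (State.start F) := rfl

theorem Party.observe_concat (Q : Party) (E : Env F) (σ : C.Stream F)
    (u : BitVec (C.logSize C.depth) × F) :
    Q.observe E (σ ++ [u]) = Q.update.run E ((Q.observe E σ).read E u.1.toNat u.2) := by
  simp [Party.observe]

theorem Party.run_eq (Q : Party) (E : Env F) (σ : C.Stream F) :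
    Q.run E σ = Q.main.run E { Q.observe { E with inbox := fun _ _ => none } σ with
      sent := [], received := 0 } := rfl

omit [Field F] [DecidableEq F] in
theorem State.read_eq (s : State F) (hM : 0 < E.memSize) (i : ℕ) (δ : F) :
    s.read E i δ = ((s.putW 0 0 i).putF 0 0 δ).tick 2 := by
  rw [State.read, State.writeW_eq _ hM, State.writeF_eq _ hM]

theorem prover_observe (h : E.ForProver C S) (σ : C.Stream F) :
    (prover.observe E σ).blocked = false ∧
      (prover.observe E σ).HasValues C (C.frequency σ) C.depth ∧
      (prover.observe E σ).time ≤ 3 + σ.length * 40 := by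
  have hd := C.two_le_depth
  have hdl := h.depth_lt
  induction σ using List.reverseRecOn with
  | nil =>
    have h5 := h.five_lt
    have e1 : (WExp.const 1).eval E (State.start F) = 1 := WExp.eval_const (by omega)
    rw [Party.observe_nil, prover, Cmd.run_setF rfl (by rw [e1, h.memSize]; omega), e1,
      FExp.eval_one]
    refine ⟨rfl, ⟨fun i hi hi' p hp => ?_, ?_, by simp⟩, ?_⟩
    · obtain rfl : i = C.depth := by omega
      rw [C.layer_depth, C.frequency_nil, State.tick_fld, State.putF_fld_ne _ _ _ (by norm_num)]
      rfl
    · simp [State.start]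
    · simp [State.start, WExp.cost, FExp.cost_one]
  | append_singleton σ u ih =>
    obtain ⟨i1, i2, i3⟩ := ih
    rw [Party.observe_concat, State.read_eq _ h.mem_pos]
    set s := prover.observe E σ
    set s' := ((s.putW 0 0 u.1.toNat).putF 0 0 u.2).tick 2
    have hp := h.two_pow_lt (i := C.depth) (by omega) le_rfl
    have hu := u.1.isLt
    have e1 : (wv 0).eval E s' = u.1.toNat := WExp.eval_var h.mem_pos (by simp [s']) (by omega)
    obtain ⟨f1, f2⟩ := h.eval_address e1 (WExp.eval_depth h.answer hdl) (by omega) le_rfl hu le_rfl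
    have hs' : ∀ b, b ≠ 0 → s'.fld b = s.fld b := fun b hb => by
      simp only [s', State.tick_fld, State.putF_fld_ne _ _ _ hb, State.putW_fld]
    rw [prover, Cmd.run_setF (show s'.blocked = false from i1) (by rw [f1]; exact f2), f1,
      FExp.eval_add, FExp.eval_get f1 f2, FExp.eval_var h.mem_pos, hs' 1 (by norm_num)]
    refine ⟨i1, ⟨fun i hi hi' p hp => ?_, ?_, ?_⟩, ?_⟩
    · obtain rfl : i = C.depth := by omega
      have hv : ∀ p < 2 ^ C.logSize C.depth,
          s.fld 1 (p * (C.depth + 1) + C.depth) = C.frequency σ (BitVec.ofNat _ p) := fun p hp => by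
        rw [i2.value _ le_rfl le_rfl p hp, C.layer_depth]
      have hpu : u.1 = BitVec.ofNat _ p ↔ p = u.1.toNat := by
        rw [← BitVec.toNat_inj, BitVec.toNat_ofNat, Nat.mod_eq_of_lt hp, eq_comm]
      rw [C.layer_depth, C.frequency_concat, State.tick_fld, State.putF_fld]
      by_cases hpe : p = u.1.toNat
      · rw [if_pos ⟨rfl, by rw [hpe]⟩, if_pos (hpu.2 hpe), hv _ hu, ← hpe]
        simp [s']
      · rw [if_neg fun hc => hpe (Circuit.address_inj le_rfl le_rfl hc.2).1,
          if_neg fun hc => hpe (hpu.1 hc), hs' 1 (by norm_num), hv p hp, add_zero]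
    · rw [State.tick_fld, State.putF_fld_ne _ _ _ (by norm_num), hs' 12 (by norm_num)]
      exact i2.zero
    · rw [State.tick_fld, State.putF_fld_ne _ _ _ (by norm_num), hs' 12 (by norm_num)]
      exact i2.one
    · have : s'.time = s.time + 2 := rfl
      simp only [State.tick_time, State.putF_time, this, WExp.cost, FExp.cost,
        List.length_append, List.length_cons, List.length_nil]
      omega

/-- The word length `w` is large enough for the prover. -/
structure Circuit.FitsProver (C : Circuit) (w : ℕ) : Prop where
  five_lt : 5 < 2 ^ w
  address_lt : ∀ i, 1 ≤ i → i ≤ C.depth → 2 ^ C.logSize i * (C.depth + 1) + C.depth < 2 ^ w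

variable {w : ℕ} (S) (hw : C.FitsProver w) (σ : C.Stream F) (chal : ℕ → F)
include hw

/-- With the challenges `chal 0, …, chal (m - 1)` as incoming messages, the prover sends its messages
of the rounds up to number `m`. -/
theorem runProver_spec {m : ℕ} (hm : m ≤ C.rounds) :
    (prover.runProver C S w σ ((List.range m).map chal)).sent
        <+: C.messages chal (C.frequency σ) (C.depth - 1) ∧
      (prover.runProver C S w σ ((List.range m).map chal)).sent.length
        = C.numOutputs + 5 * min (m + 1) C.rounds ∧
      (m = C.rounds → (prover.runProver C S w σ ((List.range m).map chal)).time
        ≤ 3 + σ.length * 40 + 12000 * C.size) := by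
  have hd := C.two_le_depth
  set E' : Env F := {
    wordSize := w
    memSize := 2 ^ w
    answer := C.answer S
    inbox := fun _ k => ((List.range m).map chal)[k]?
    coin := fun _ => 0 } with hE'
  set E : Env F := { E' with
    inbox := fun l k => if l.length = C.numOutputs + 5 * (k + 1) then some (chal k) else none }
    with hE
  have hP : E.ForProver C S := ⟨rfl, rfl, hw.five_lt, hw.address_lt⟩
  obtain ⟨a1, a2, a3⟩ := prover_observe (E := { E' with inbox := fun _ _ => none })
    (S := S) ⟨rfl, rfl, hw.five_lt, hw.address_lt⟩ σ
  have hrun : prover.runProver C S w σ ((List.range m).map chal) = prover.run E' σ := rfl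
  rw [hrun, Party.run_eq]
  set s₀ := prover.observe { E' with inbox := fun _ _ => none } σ
  set s : State F := { s₀ with sent := [], received := 0 }
  obtain ⟨b1, b2, b3, b4⟩ := run_prover_main (s := s) hP (chal := chal) (fun _ _ => rfl) a1
    (a2.congr rfl rfl) rfl rfl
  have hlen := C.length_messages chal (C.frequency σ) (C.depth - 1)
  have hr : C.pos (C.depth - 1) + C.logSize (C.depth - 1 + 1) = C.rounds := by
    rw [Circuit.rounds, show C.depth - 1 + 1 = C.depth by omega]
  rw [hr] at hlen
  have b4' : (prover.main.run E s).time ≤ 3 + σ.length * 40 + 12000 * C.size := by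
    have : s.time = s₀.time := rfl
    omega
  rcases Cmd.run_truncated (E := E) (E' := E') ⟨rfl, rfl, rfl⟩ (chal := chal)
    (B := fun k => C.numOutputs + 5 * (k + 1)) (fun _ _ => rfl) (m := m)
    (fun l k => by
      simp only [hE', List.getElem?_map]
      by_cases hk : k < m <;> simp [hk]) rfl prover.main s (Nat.zero_le _) b1
    with ⟨c1, c2⟩ | ⟨c1, c2, c3, c4⟩
  · rw [b3] at c2
    rw [c1, b2]
    exact ⟨List.prefix_rfl, by rw [hlen, min_eq_right (by omega)], fun _ => b4'⟩
  · rw [b3] at c4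
    rw [b2] at c2
    exact ⟨c2, by rw [c3, min_eq_left (by omega)], fun hm' => by omega⟩

theorem strategy_honest {t c : ℕ} (ht : t < C.rounds) (hc : c < 5) :
    prover.strategy C S w σ ((List.range t).map chal) (C.numOutputs + 5 * t + c)
      = C.honest chal (C.frequency σ) t c := by
  obtain ⟨h1, h2, -⟩ := runProver_spec S hw σ chal ht.le
  rw [Party.strategy, Circuit.honest, h1.getD_eq (by rw [h2]; omega)]

theorem strategy_outputs {p : ℕ} (hp : p < C.numOutputs) :
    prover.strategy C S w σ [] p = C.layer (C.frequency σ) 1 p := by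
  obtain ⟨h1, h2, -⟩ := runProver_spec S hw σ (fun _ => 0) (Nat.zero_le _)
  have h3 := C.messages_prefix (fun _ => (0 : F)) (C.frequency σ) (Nat.zero_le (C.depth - 1))
  rw [Party.strategy]
  rw [List.range_zero, List.map_nil] at h1 h2
  rw [← h1.getD_eq (by rw [h2]; omega), h3.getD_eq (by
    rw [C.length_messages]; omega), Circuit.messages, List.getD_append _ _ _ _ (by simpa using hp)]
  simp [List.getD_eq_getElem?_getD, hp]

end Prover

/-! ### Regular wiring functions -/

section Regular

/-- A function of bits that does not change when a bit outside of `J` changes is determined by the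
bits in `J`. -/
theorem eq_of_agree {ι α : Type*} [Fintype ι] [DecidableEq ι] {g : (ι → Bool) → α} {J : Set ι}
    (h : ∀ j ∉ J, ∀ x y, (∀ l, l ≠ j → x l = y l) → g x = g y) {x y : ι → Bool}
    (hxy : ∀ l ∈ J, x l = y l) : g x = g y := by
  have key : ∀ (T : Finset ι) (x : ι → Bool), (∀ l, l ∉ T → x l = y l) →
      (∀ l ∈ J, x l = y l) → g x = g y := by
    intro T
    induction T using Finset.induction_on with
    | empty => exact fun x hx _ => congrArg g (funext fun l => hx l (by simp))
    | insert j T hj ih =>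
      intro x hx hJ
      by_cases hjJ : j ∈ J
      · exact ih x (fun l hl => by
          by_cases hlj : l = j
          · rw [hlj, hJ j hjJ]
          · exact hx l (by simp [hl, hlj])) hJ
      · rw [h j hjJ x (Function.update x j (y j)) fun l hl => by simp [hl]]
        refine ih _ (fun l hl => ?_) fun l hl => ?_ <;> by_cases hlj : l = j
        · simp [hlj]
        · simpa [hlj] using hx l (by simp [hl, hlj])
        · simp [hlj]
        · simpa [hlj] using hJ l hl
  exact key Finset.univ x (by simp) hxy

/-- An output bit is determined by the input bits that it depends on. -/
theorem getLsb_eq_of_agree {v v' : ℕ} {f : BitVec v → BitVec v'} {k : Fin v'} {x y : BitVec v}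
    (h : ∀ j, OutputDependsOn f k j → x.getLsb j = y.getLsb j) :
    (f x).getLsb k = (f y).getLsb k := by
  have e : ∀ x : BitVec v, BitVec.ofFnLE (fun j => x.getLsb j) = x := fun x => by
    apply BitVec.eq_of_getElem_eq
    intro i hi
    simp
  have : (f (BitVec.ofFnLE fun j => x.getLsb j)).getLsb k
      = (f (BitVec.ofFnLE fun j => y.getLsb j)).getLsb k := eq_of_agree (g := fun b => (f (BitVec.ofFnLE b)).getLsb k)
    (J := {j | OutputDependsOn f k j}) (x := fun j => x.getLsb j) (y := fun j => y.getLsb j)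
    (fun j hj x y hxy => by
      by_contra hne
      exact hj ⟨_, _, fun l hl => by simpa using hxy l hl, hne⟩) h
  rwa [e, e] at this

namespace Circuit

variable (C : Circuit) (i : ℕ) (f : Wiring)

open Classical in
/-- For output bit `k` of a wiring function of layer `i` the number `j + 1` if the output bit depends
on input bit `j`, and `0` if it does not depend on any input bit. -/
noncomputable def source (k : ℕ) : ℕ :=
  if h : ∃ (hk : k < C.outWidth i f) (j : Fin (C.logSize i)),
    OutputDependsOn (C.wiring i f) ⟨k, hk⟩ j then (h.choose_spec.choose : ℕ) + 1 else 0

theorem testBit_wire {k : ℕ} (hk : k < C.outWidth i f) (p : ℕ) :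
    (C.wire i f p).testBit k = (C.wiring i f (BitVec.ofNat _ p)).getLsb ⟨k, hk⟩ := rfl

theorem source_le (k : ℕ) : C.source i f k ≤ C.logSize i := by
  unfold source
  split_ifs with h
  · exact h.choose_spec.choose.isLt
  · exact Nat.zero_le _

variable {C i f} {c : ℕ} {T : Finset (Fin (C.logSize i))} (hreg : IsRegularWith c (C.wiring i f) T)
include hreg

theorem source_eq_succ_iff {k j : ℕ} (hk : k < C.outWidth i f) (hj : j < C.logSize i) :
    C.source i f k = j + 1 ↔ OutputDependsOn (C.wiring i f) ⟨k, hk⟩ ⟨j, hj⟩ := by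
  unfold source
  constructor
  · intro h
    split_ifs at h with h'
    have h2 := h'.choose_spec.choose_spec
    rwa [show h'.choose_spec.choose = ⟨j, hj⟩ from Fin.ext (by simpa using h)] at h2
  · intro h
    have h' : ∃ (hk : k < C.outWidth i f) (j : Fin (C.logSize i)),
      OutputDependsOn (C.wiring i f) ⟨k, hk⟩ j := ⟨hk, _, h⟩
    rw [dif_pos h', hreg.depends_le_one _ _ _ h'.choose_spec.choose_spec h]

/-- An output bit of a regular wiring function is determined by its source. -/
theorem testBit_wire_congr {k p p' : ℕ} (hk : k < C.outWidth i f)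
    (h : ∀ j < C.logSize i, C.source i f k = j + 1 → p.testBit j = p'.testBit j) :
    (C.wire i f p).testBit k = (C.wire i f p').testBit k := by
  rw [C.testBit_wire i f hk, C.testBit_wire i f hk]
  refine getLsb_eq_of_agree fun j hj => ?_
  have := h j j.isLt ((source_eq_succ_iff hreg hk j.isLt).2 hj)
  simpa [BitVec.getLsb, BitVec.getLsbD, Nat.testBit_mod_two_pow] using this

theorem source_eq_succ_iff_ne {k j : ℕ} (hk : k < C.outWidth i f) (hj : j < C.logSize i) :
    C.source i f k = j + 1 ↔ (C.wire i f 0).testBit k ≠ (C.wire i f (2 ^ j)).testBit k := by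
  constructor
  · intro h
    obtain ⟨x, y, hxy, hne⟩ := (source_eq_succ_iff hreg hk hj).1 h
    have hb : ∀ z : BitVec (C.logSize i), (C.wiring i f z).getLsb ⟨k, hk⟩
        = (C.wire i f (if z.getLsb ⟨j, hj⟩ then 2 ^ j else 0)).testBit k := by
      intro z
      rw [show (C.wiring i f z).getLsb ⟨k, hk⟩ = (C.wire i f z.toNat).testBit k by
        rw [C.testBit_wire i f hk, BitVec.ofNat_toNat, BitVec.setWidth_eq]]
      refine testBit_wire_congr hreg hk fun j' _ hj' => ?_
      obtain rfl : j = j' := by omega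
      by_cases hz : z.getLsb ⟨j, hj⟩
      · rw [if_pos hz, Nat.testBit_two_pow_self]; exact hz
      · rw [if_neg hz, Nat.zero_testBit]; exact Bool.eq_false_iff.2 hz
    intro heq
    refine hne ?_
    rw [hb, hb]
    split_ifs <;> simp [heq]
  · intro h
    by_contra hne
    refine h (testBit_wire_congr hreg hk fun j' _ hj' => ?_)
    rw [Nat.zero_testBit, Nat.testBit_two_pow_of_ne (by rintro rfl; exact hne hj')]

end Circuit

variable {F : Type u} [Field F]

namespace Circuit

variable (C : Circuit) (i : ℕ) (f : Wiring)

/-- The contribution of the output bits with source `g` to the weight of the image of a bit string,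
if the bit in the source is `b`. -/
noncomputable def sourceWeight (m : ℕ) (x : ℕ → F) (g : ℕ) (b : Bool) : F :=
  ∏ k ∈ Finset.range m, if C.source i f k = g then
    bw (x k) ((C.wire i f (if b then 2 ^ (g - 1) else 0)).testBit k) else 1

variable {C i f} {c : ℕ} {T : Finset (Fin (C.logSize i))} (hreg : IsRegularWith c (C.wiring i f) T)
include hreg

/-- The multilinear extension of a regular wiring function is a product over the input bits, because
every output bit depends on at most one input bit. -/
theorem sum_wt_mul_wt_wire {m : ℕ} (hm : m = C.outWidth i f) (r x : ℕ → F) :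
    ∑ p ∈ Finset.range (2 ^ C.logSize i), wt (C.logSize i) r p * wt m x (C.wire i f p)
      = C.sourceWeight i f m x 0 false * ∏ j ∈ Finset.range (C.logSize i),
          ((1 - r j) * C.sourceWeight i f m x (j + 1) false
            + r j * C.sourceWeight i f m x (j + 1) true) := by
  have key : ∀ p, wt m x (C.wire i f p) = C.sourceWeight i f m x 0 false *
      ∏ j ∈ Finset.range (C.logSize i), C.sourceWeight i f m x (j + 1) (p.testBit j) := by
    intro p
    rw [wt, ← Finset.prod_fiberwise_of_maps_to (t := Finset.range (C.logSize i + 1))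
      (g := C.source i f) (fun k _ => Finset.mem_range.2 (by have := C.source_le i f k; omega)),
      Finset.prod_range_succ', mul_comm]
    congr 1
    · rw [Finset.prod_filter]
      refine Finset.prod_congr rfl fun k hk => ?_
      rw [Finset.mem_range] at hk
      by_cases h : C.source i f k = 0
      · rw [if_pos h, if_pos h, testBit_wire_congr hreg (p' := 0) (by omega) fun j _ hj => by omega]
        rfl
      · rw [if_neg h, if_neg h]
    · refine Finset.prod_congr rfl fun j hj => ?_
      rw [Finset.prod_filter]
      refine Finset.prod_congr rfl fun k hk => ?_
      rw [Finset.mem_range] at hk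
      split_ifs with h1 h2
      · rw [testBit_wire_congr hreg (p' := 2 ^ j) (by omega) fun j' _ hj' => by
          obtain rfl : j = j' := by omega
          rw [h2, Nat.testBit_two_pow_self]]
        rfl
      · rw [testBit_wire_congr hreg (p' := 0) (by omega) fun j' _ hj' => by
          obtain rfl : j = j' := by omega
          rw [Nat.zero_testBit]
          simpa using h2]
      · rfl
  simp only [key]
  have := sum_prod_bits (C.logSize i) fun j b => bw (r j) b * C.sourceWeight i f m x (j + 1) b
  simp only [bw, Bool.false_eq_true, if_false, if_true] at this
  rw [← this, Finset.mul_sum]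
  refine Finset.sum_congr rfl fun p _ => ?_
  rw [Finset.prod_mul_distrib]
  simp only [wt, bw]
  ring

end Circuit

theorem mle_testBit {m j : ℕ} (hj : j < m) (x : ℕ → F) (c : F) :
    mle m x (fun p => if p.testBit j then c else 0) = c * x j := by
  have h1 := sum_prod_bits m fun i b => bw (x i) b * if i = j then (if b then 1 else 0) else 1
  have h2 : ∀ i ∈ Finset.range m, i ≠ j →
      ((bw (x i) false * if i = j then (if false then 1 else 0) else 1)
        + bw (x i) true * if i = j then (if true then 1 else 0) else 1) = 1 := fun i _ hi => by
    simp [bw, hi]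
  rw [Finset.prod_eq_single_of_mem j (Finset.mem_range.2 hj) h2] at h1
  rw [mle, show c * x j = c * (bw (x j) false * (if j = j then (if false then 1 else 0) else 1)
    + bw (x j) true * if j = j then (if true then 1 else 0) else 1) by simp [bw], ← h1,
    Finset.mul_sum]
  refine Finset.sum_congr rfl fun p _ => ?_
  rw [Finset.prod_mul_distrib, Finset.prod_ite_eq', if_pos (Finset.mem_range.2 hj), wt]
  split_ifs <;> ring

/-- The multilinear extension of a regular type function is affine, because the type depends on at
most one input bit. -/
theorem Circuit.mle_typeF {C : Circuit} {i c : ℕ} {T : Finset (Fin (C.logSize i))}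
    (hreg : IsRegularWith c (C.wiring i .type) T) (r : ℕ → F) :
    mle (C.logSize i) r (C.typeF F i) = C.typeF F i 0
      + ∑ j ∈ Finset.range (C.logSize i), (C.typeF F i (2 ^ j) - C.typeF F i 0) * r j := by
  have hw : ∀ p p', (∀ j < C.logSize i, C.source i .type 0 = j + 1 → p.testBit j = p'.testBit j) →
      C.typeF F i p = C.typeF F i p' := by
    intro p p' h
    have h0 := testBit_wire_congr hreg (show 0 < C.outWidth i .type from one_pos) h
    have h1 := C.wire_lt i .type p
    have h2 := C.wire_lt i .type p'
    simp only [Circuit.outWidth] at h1 h2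
    have : C.wire i .type p = C.wire i .type p' := by
      rw [Nat.testBit_zero, Nat.testBit_zero] at h0
      have : C.wire i .type p % 2 = 1 ↔ C.wire i .type p' % 2 = 1 := by simpa using h0
      omega
    simp only [typeF, this]
  rcases Nat.eq_zero_or_pos (C.source i .type 0) with h0 | h0
  · rw [mle_congr (fun _ _ => rfl) fun p _ => hw p 0 fun j _ hj => by omega, mle_const,
      Finset.sum_eq_zero fun j _ => by
        rw [hw (2 ^ j) 0 fun j' _ hj' => by omega, sub_self, zero_mul], add_zero]
  · obtain ⟨j, hj⟩ : ∃ j, C.source i .type 0 = j + 1 := ⟨_, (Nat.succ_pred_eq_of_pos h0).symm⟩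
    have hjm : j < C.logSize i := by have := C.source_le i .type 0; omega
    have e : ∀ p < 2 ^ C.logSize i, C.typeF F i p = C.typeF F i 0
        + if p.testBit j then C.typeF F i (2 ^ j) - C.typeF F i 0 else 0 := by
      intro p _
      split_ifs with h
      · rw [add_sub_cancel]
        exact hw _ _ fun j' _ hj' => by
          obtain rfl : j = j' := by omega
          rw [h, Nat.testBit_two_pow_self]
      · rw [add_zero]
        exact hw _ _ fun j' _ hj' => by
          obtain rfl : j = j' := by omega
          rw [Nat.zero_testBit]; simpa using h
    rw [mle_congr (fun _ _ => rfl) e, mle_add, mle_const, mle_testBit hjm,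
      Finset.sum_eq_single_of_mem j (Finset.mem_range.2 hjm) fun j' _ hj' => by
        rw [hw (2 ^ j') 0 fun j'' _ h'' => by
          obtain rfl : j = j'' := by omega
          rw [Nat.zero_testBit, Nat.testBit_two_pow_of_ne hj'], sub_self, zero_mul]]

end Regular

/-! ### The verifier -/

section Verifier

variable {F : Type u} {E : Env F} {s : State F} {C : Circuit} {S : C.Exceptions} {L : ℕ}

/-- The machine of the verifier has enough memory and long enough words for the circuit; `L` bounds
the logarithms of the sizes of the layers. -/
structure Env.ForVerifier (E : Env F) (C : Circuit) (S : C.Exceptions) (L : ℕ) : Prop where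
  answer : E.answer = C.answer S
  one_le : 1 ≤ L
  logSize_le : ∀ i, 1 ≤ i → i ≤ C.depth → C.logSize i ≤ L
  depth_lt : C.depth < 2 ^ (L + 1)
  memory : L + 7 ≤ E.memSize
  word : 2 ^ (L + 4) ≤ 2 ^ E.wordSize

namespace Env.ForVerifier

variable (h : E.ForVerifier C S L)
include h

theorem mem_pos : 0 < E.memSize := by have := h.memory; omega

theorem bound : L + 16 ≤ 2 ^ E.wordSize ∧ C.depth + 16 ≤ 2 ^ E.wordSize := by
  have h1 := h.word
  have h2 := L.lt_two_pow_self
  have h3 := h.depth_lt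
  have h4 := h.one_le
  rw [pow_succ] at h3
  rw [pow_add] at h1
  omega

theorem two_pow_lt {i : ℕ} (h₁ : 1 ≤ i) (h₂ : i ≤ C.depth) :
    4 * 2 ^ C.logSize i < 2 ^ E.wordSize := by
  have h1 := h.word
  have h2 := Nat.pow_le_pow_right (show 0 < 2 by norm_num) (h.logSize_le i h₁ h₂)
  rw [pow_add] at h1
  have : 0 < 2 ^ L := by positivity
  omega

theorem eval_depth : WExp.depth.eval E s = C.depth :=
  WExp.eval_depth h.answer (by have := h.bound; omega)

theorem eval_logSize {e : WExp} {i : ℕ} (h₁ : 1 ≤ i) (h₂ : i ≤ C.depth) (he : e.eval E s = i) :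
    (WExp.logSize e).eval E s = C.logSize i :=
  WExp.eval_logSize h.answer he (by have := h.bound; have := h.logSize_le i h₁ h₂; omega)

end Env.ForVerifier

/-- Bit `k` of `p`. -/
abbrev WExp.bit (p k : WExp) : WExp := .op .and (.op .shr p k) (.const 1)

theorem WExp.eval_bit (hw : 1 < 2 ^ E.wordSize) {p k : WExp} {x y : ℕ} (hp : p.eval E s = x)
    (hk : k.eval E s = y) : (WExp.bit p k).eval E s = (x.testBit y).toNat := by
  have hx : x < 2 ^ E.wordSize := hp ▸ WExp.eval_lt _ _ _
  have e1 : (WExp.op .shr p k).eval E s = x >>> y := WExp.eval_op hp hk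
    ((Nat.shiftRight_le x y).trans_lt hx)
  have e2 : x >>> y &&& 1 = (x.testBit y).toNat := by
    rw [Nat.and_one_is_mod, Nat.testBit, Nat.one_and_eq_mod_two]
    rcases Nat.mod_two_eq_zero_or_one (x >>> y) with h | h <;> simp [h]
  rw [WExp.eval_op e1 (WExp.eval_const hw) (by
    simp only [WordOp.eval]
    rw [e2]
    exact (Bool.toNat_le _).trans_lt hw)]
  exact e2

variable [Field F]

/-- The first two cells of the field array `12` are `0` and `1`. -/
def State.HasBits (s : State F) : Prop := s.fld 12 0 = 0 ∧ s.fld 12 1 = 1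

/-- The factor of the bit `b` in a weight. -/
abbrev FExp.bw (x : FExp) (b : WExp) : FExp := .get 12 b * x + (1 - .get 12 b) * (1 - x)

theorem FExp.eval_bw (hs : s.HasBits) (hM : 1 < E.memSize) {x : FExp} {b : WExp} {y : F} {β : Bool}
    (hx : x.eval E s = y) (hb : b.eval E s = β.toNat) : (FExp.bw x b).eval E s = _root_.bw y β := by
  have : (FExp.get 12 b).eval E s = if β then 1 else 0 := by
    rw [FExp.eval_get hb ((Bool.toNat_le β).trans_lt hM)]
    cases β
    · exact hs.1
    · exact hs.2
  simp only [FExp.eval_add, FExp.eval_mul, FExp.eval_sub, FExp.eval_one, this, hx, _root_.bw]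
  cases β <;> simp

variable [DecidableEq F]

/-- Multiply the values of `e` in a loop. -/
def Cmd.prodLoop (a i : ℕ) (n : WExp) (e : FExp) : Cmd :=
  .seq (.setF a (.const 0) 1) (.count i n (.setF a (.const 0) (fv a * e)))

/-- Add `e₀` and the values of `e` in a loop. -/
def Cmd.sumLoop (a i : ℕ) (n : WExp) (e₀ e : FExp) : Cmd :=
  .seq (.setF a (.const 0) e₀) (.count i n (.setF a (.const 0) (fv a + e)))

theorem Cmd.run_prodLoop {a i N : ℕ} {n : WExp} {e : FExp} (g : ℕ → F) (hM : 0 < E.memSize)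
    (hb : s.blocked = false)
    (hn : ∀ s' : State F, (∀ b, b ≠ i → s'.word b = s.word b) → n.eval E s' = N)
    (hs : ∀ k < N, ∀ s' : State F, s'.word i 0 = k → (∀ b, b ≠ i → s'.word b = s.word b) →
      (∀ b, b ≠ a → s'.fld b = s.fld b) → e.eval E s' = g k) :
    ((Cmd.prodLoop a i n e).run E s).blocked = false ∧
      ((Cmd.prodLoop a i n e).run E s).fld a 0 = ∏ k ∈ Finset.range N, g k ∧
      ((Cmd.prodLoop a i n e).run E s).time ≤ s.time + (n.cost + 7 + N * (e.cost + 11)) := by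
  have h0 : ∀ s : State F, (WExp.const 0).eval E s = 0 := fun s => WExp.eval_const_zero
  rw [Cmd.prodLoop, Cmd.run_seq, Cmd.run_setF hb (by rwa [h0]), h0, FExp.eval_one]
  set s₁ := (s.putF a 0 1).tick ((WExp.const 0).cost + (1 : FExp).cost + 1) with hs₁
  obtain ⟨g1, g2, g3⟩ := Cmd.run_count_setF (E := E) (s := s₁) (i := i) (a := a) (n := n) (N := N)
    (idx := .const 0) (e := fv a * e) hM hb (hn _ fun b hb => by
      rw [State.putW_word_ne _ _ _ hb]; rfl)
    (fun m q => if q = 0 then ∏ k ∈ Finset.range m, g k else s.fld a q)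
    (by funext q; simp [hs₁])
    (by
      intro k hk s' hk' hw hf hI
      rw [h0]
      refine ⟨hM, fun j => ?_⟩
      rw [FExp.eval_mul, FExp.eval_var hM, hs k hk s' hk' hw fun b hb => by
        rw [hf b hb, hs₁, State.tick_fld, State.putF_fld_ne _ _ _ hb], hI, Finset.prod_range_succ]
      by_cases hj : j = 0 <;> simp [hj])
  refine ⟨g1, by rw [g2]; simp, g3.trans ?_⟩
  have : (WExp.const 0).cost + (fv a * e).cost + 7 = e.cost + 11 := by
    rw [FExp.cost_mul]; simp only [FExp.cost, WExp.cost]; omega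
  rw [this, hs₁]
  simp only [State.tick_time, State.putF_time, WExp.cost, FExp.cost_one]
  omega

theorem Cmd.run_sumLoop {a i N : ℕ} {n : WExp} {e₀ e : FExp} (g : ℕ → F) {x : F}
    (hM : 0 < E.memSize) (hb : s.blocked = false)
    (hn : ∀ s' : State F, (∀ b, b ≠ i → s'.word b = s.word b) → n.eval E s' = N)
    (hx : e₀.eval E s = x)
    (hs : ∀ k < N, ∀ s' : State F, s'.word i 0 = k → (∀ b, b ≠ i → s'.word b = s.word b) →
      (∀ b, b ≠ a → s'.fld b = s.fld b) → e.eval E s' = g k) :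
    ((Cmd.sumLoop a i n e₀ e).run E s).blocked = false ∧
      ((Cmd.sumLoop a i n e₀ e).run E s).fld a 0 = x + ∑ k ∈ Finset.range N, g k ∧
      ((Cmd.sumLoop a i n e₀ e).run E s).time
        ≤ s.time + (n.cost + e₀.cost + 6 + N * (e.cost + 11)) := by
  have h0 : ∀ s : State F, (WExp.const 0).eval E s = 0 := fun s => WExp.eval_const_zero
  rw [Cmd.sumLoop, Cmd.run_seq, Cmd.run_setF hb (by rwa [h0]), h0, hx]
  set s₁ := (s.putF a 0 x).tick ((WExp.const 0).cost + e₀.cost + 1) with hs₁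
  obtain ⟨g1, g2, g3⟩ := Cmd.run_count_setF (E := E) (s := s₁) (i := i) (a := a) (n := n) (N := N)
    (idx := .const 0) (e := fv a + e) hM hb (hn _ fun b hb => by
      rw [State.putW_word_ne _ _ _ hb]; rfl)
    (fun m q => if q = 0 then x + ∑ k ∈ Finset.range m, g k else s.fld a q)
    (by funext q; simp [hs₁])
    (by
      intro k hk s' hk' hw hf hI
      rw [h0]
      refine ⟨hM, fun j => ?_⟩
      rw [FExp.eval_add, FExp.eval_var hM, hs k hk s' hk' hw fun b hb => by
        rw [hf b hb, hs₁, State.tick_fld, State.putF_fld_ne _ _ _ hb], hI, Finset.sum_range_succ]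
      by_cases hj : j = 0 <;> simp [hj, add_assoc])
  refine ⟨g1, by rw [g2]; simp, g3.trans ?_⟩
  have : (WExp.const 0).cost + (fv a + e).cost + 7 = e.cost + 11 := by
    rw [FExp.cost_add]; simp only [FExp.cost, WExp.cost]; omega
  rw [this, hs₁]
  simp only [State.tick_time, State.putF_time, WExp.cost]
  omega

/-! #### The input stream -/

/-- Draw `n` random field elements into a field array. -/
def Cmd.draw (a : ℕ) (n : WExp) : Cmd := .count 2 n (.rand a (wv 2))

theorem Cmd.run_draw {a N : ℕ} {n : WExp} (hM : N ≤ E.memSize) (hM' : 0 < E.memSize)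
    (hb : s.blocked = false) (hn : ∀ s' : State F, n.eval E s' = N) :
    ((Cmd.draw a n).run E s).SameChannels { s with drawn := s.drawn + N } ∧
      (∀ q < N, ((Cmd.draw a n).run E s).fld a q = E.coin (s.drawn + q)) ∧
      ((Cmd.draw a n).run E s).time ≤ s.time + (n.cost + 4 + N * 9) := by
  have hN : N < 2 ^ E.wordSize := hn s ▸ WExp.eval_lt _ _ _
  obtain ⟨g1, ⟨g2, g3⟩, g4⟩ := Cmd.run_count_const (E := E) (s := s) (i := 2) (n := n) (N := N)
    (body := .rand a (wv 2)) hM' (by simp [Cmd.wordArrays]) hb (hn _)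
    (fun j s' => s'.SameChannels { s with drawn := s.drawn + j } ∧
      ∀ q < j, s'.fld a q = E.coin (s.drawn + q)) 3
    ⟨⟨rfl, rfl, rfl, rfl, rfl, rfl⟩, fun q hq => by omega⟩
    (by
      rintro j hj s' hb' hk' hw hf ⟨i1, i2⟩
      have e1 : (wv 2).eval E s' = j := WExp.eval_var hM' hk' (by omega)
      have hd : s'.drawn = s.drawn + j := i1.drawn
      rw [Cmd.run_rand hb' (by rw [e1]; omega), e1, hd]
      refine ⟨hb', le_rfl, ⟨i1.sent, i1.received, ?_, i1.output, i1.rejected, i1.blocked⟩,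
        fun q hq => ?_⟩
      · rfl
      · refine (State.putF_fld s' a j a q _).trans ?_
        split_ifs with hqj
        · rw [hqj.2]
        · exact i2 q (by simp at hqj; omega))
  exact ⟨⟨g2.sent, g2.received, g2.drawn, g2.output, g2.rejected, g2.blocked⟩, g3, g4⟩

/-- What the verifier does before the stream. -/
def Cmd.verifierInit : Cmd := .seq (.setF 12 (.const 1) 1) (.draw 3 (.logSize .depth))

/-- What the verifier does with an update. -/
def Cmd.verifierUpdate : Cmd :=
  .seq (.prodLoop 2 2 (.logSize .depth) (.bw (.get 3 (wv 2)) (.bit (wv 0) (wv 2))))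
    (.setF 1 (.const 0) (fv 1 + fv 0 * fv 2))

/-- The state of the verifier when it has seen the stream `σ`: it has evaluated the multilinear
extension of the input at a random point. -/
structure State.VerifierSaw (s : State F) (E : Env F) (C : Circuit) (σ : C.Stream F) : Prop where
  io : s.SameChannels { State.start F with drawn := C.logSize C.depth }
  bits : s.HasBits
  point : ∀ q < C.logSize C.depth, s.fld 3 q = E.coin q
  value : s.fld 1 0 = mle (C.logSize C.depth) E.coin (C.layer (C.frequency σ) C.depth)

theorem Cmd.run_verifierInit (h : E.ForVerifier C S L) :
    (Cmd.verifierInit.run E (State.start F)).VerifierSaw E C [] ∧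
      (Cmd.verifierInit.run E (State.start F)).time ≤ 20 + 9 * C.logSize C.depth := by
  have hd := C.two_le_depth
  have hM := h.memory
  have hl := h.logSize_le C.depth (by omega) le_rfl
  have hw := h.bound
  have e1 : (WExp.const 1).eval E (State.start F) = 1 := WExp.eval_const (by omega)
  rw [Cmd.verifierInit, Cmd.run_seq, Cmd.run_setF rfl (by rw [e1]; omega), e1, FExp.eval_one]
  set s₁ := ((State.start F).putF 12 1 1).tick ((WExp.const 1).cost + (1 : FExp).cost + 1) with hs₁
  obtain ⟨g1, g2, g3⟩ := Cmd.run_draw (s := s₁) (a := 3) (n := .logSize .depth)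
    (N := C.logSize C.depth) (by omega) h.mem_pos rfl
    (fun s' => h.eval_logSize (by omega) le_rfl h.eval_depth)
  have fr : ∀ b, b ≠ 3 → ((Cmd.draw 3 (.logSize .depth)).run E s₁).fld b = s₁.fld b := fun b hb =>
    Cmd.run_fld E _ s₁ (by simp [Cmd.draw, Cmd.count, Cmd.fldArrays, hb])
  refine ⟨⟨⟨g1.sent, g1.received, ?_, g1.output, g1.rejected, g1.blocked⟩, ⟨?_, ?_⟩,
    fun q hq => ?_, ?_⟩, ?_⟩
  · rw [g1.drawn]; simp [hs₁, State.start]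
  · rw [fr 12 (by norm_num)]; simp [hs₁, State.start]
  · rw [fr 12 (by norm_num)]; simp [hs₁]
  · rw [g2 q hq]; simp [hs₁, State.start]
  · have : C.layer (C.frequency ([] : C.Stream F)) C.depth = fun _ => 0 := by
      funext p; rw [C.layer_depth, C.frequency_nil]
    rw [fr 1 (by norm_num), this, mle_const]
    simp [hs₁, State.start]
  · have : s₁.time = 3 := rfl
    simp only [WExp.cost] at g3
    omega

theorem Cmd.run_verifierUpdate (h : E.ForVerifier C S L) {σ : C.Stream F}
    (hs : s.VerifierSaw E C σ) (u : BitVec (C.logSize C.depth) × F) :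
    (Cmd.verifierUpdate.run E (s.read E u.1.toNat u.2)).VerifierSaw E C (σ ++ [u]) ∧
      (Cmd.verifierUpdate.run E (s.read E u.1.toNat u.2)).time
        ≤ s.time + (40 + 40 * C.logSize C.depth) := by
  have hd := C.two_le_depth
  have hM := h.memory
  have hl := h.logSize_le C.depth (by omega) le_rfl
  have hw := h.bound
  have hp := h.two_pow_lt (i := C.depth) (by omega) le_rfl
  have hu := u.1.isLt
  rw [State.read_eq _ h.mem_pos]
  set s₁ := ((s.putW 0 0 u.1.toNat).putF 0 0 u.2).tick 2 with hs₁
  have f₁ : ∀ b, b ≠ 0 → s₁.fld b = s.fld b := fun b hb => by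
    simp only [hs₁, State.tick_fld, State.putF_fld_ne _ _ _ hb, State.putW_fld]
  have hb₁ : s₁.blocked = false := hs.io.blocked
  rw [Cmd.verifierUpdate, Cmd.run_seq]
  obtain ⟨g1, g2, g3⟩ := Cmd.run_prodLoop (E := E) (s := s₁) (a := 2) (i := 2)
    (n := .logSize .depth) (N := C.logSize C.depth)
    (e := .bw (.get 3 (wv 2)) (.bit (wv 0) (wv 2)))
    (fun j => bw (E.coin j) (u.1.toNat.testBit j)) h.mem_pos hb₁
    (fun s' _ => h.eval_logSize (by omega) le_rfl h.eval_depth)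
    (by
      intro j hj s' hj' hw' hf
      have e1 : (wv 2).eval E s' = j := WExp.eval_var h.mem_pos hj' (by omega)
      have e2 : (wv 0).eval E s' = u.1.toNat :=
        WExp.eval_var h.mem_pos (by rw [hw' 0 (by norm_num)]; simp [hs₁]) (by omega)
      refine FExp.eval_bw ?_ (by omega) ?_ (WExp.eval_bit (by omega) e2 e1)
      · rw [State.HasBits, hf 12 (by norm_num), f₁ 12 (by norm_num)]; exact hs.bits
      · rw [FExp.eval_get e1 (by omega), hf 3 (by norm_num), f₁ 3 (by norm_num), hs.point j hj])
  have fr : ∀ b, b ≠ 2 → ((Cmd.prodLoop 2 2 (.logSize .depth)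
      (.bw (.get 3 (wv 2)) (.bit (wv 0) (wv 2)))).run E s₁).fld b = s₁.fld b := fun b hb =>
    Cmd.run_fld E _ s₁ (by simp [Cmd.prodLoop, Cmd.count, Cmd.fldArrays, hb])
  have io := Cmd.run_quiet E (.prodLoop 2 2 (.logSize .depth)
      (.bw (.get 3 (wv 2)) (.bit (wv 0) (wv 2)))) s₁ rfl
  set s₂ := (Cmd.prodLoop 2 2 (.logSize .depth)
      (.bw (.get 3 (wv 2)) (.bit (wv 0) (wv 2)))).run E s₁
  rw [Cmd.run_setF g1 (by rw [WExp.eval_const_zero]; exact h.mem_pos), WExp.eval_const_zero,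
    FExp.eval_add, FExp.eval_mul, FExp.eval_var h.mem_pos, FExp.eval_var h.mem_pos,
    FExp.eval_var h.mem_pos, g2, fr 1 (by norm_num), fr 0 (by norm_num), f₁ 1 (by norm_num),
    hs.value]
  have fr' : ∀ b, b ≠ 0 → b ≠ 1 → b ≠ 2 → ∀ x t, ((s₂.putF 1 0 x).tick t).fld b = s.fld b :=
    fun b h0 h1 h2 x t => by
      rw [State.tick_fld, State.putF_fld_ne _ _ _ h1, fr b h2, f₁ b h0]
  have io₁ : s₁.SameChannels s := ⟨rfl, rfl, rfl, rfl, rfl, rfl⟩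
  have io₂ := io.trans (io₁.trans hs.io)
  refine ⟨⟨⟨io₂.sent, io₂.received, io₂.drawn, io₂.output, io₂.rejected, io₂.blocked⟩, ?_,
    fun q hq => ?_, ?_⟩, ?_⟩
  · rw [State.HasBits, fr' 12 (by norm_num) (by norm_num) (by norm_num)]; exact hs.bits
  · rw [fr' 3 (by norm_num) (by norm_num) (by norm_num), hs.point q hq]
  · have h0 : s₁.fld 0 0 = u.2 := by simp [hs₁]
    have key : ∀ p < 2 ^ C.logSize C.depth, C.layer (C.frequency (σ ++ [u])) C.depth p
        = C.layer (C.frequency σ) C.depth p + if p = u.1.toNat then u.2 else 0 := by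
      intro p hp
      have hpu : u.1 = BitVec.ofNat _ p ↔ p = u.1.toNat := by
        rw [← BitVec.toNat_inj, BitVec.toNat_ofNat, Nat.mod_eq_of_lt hp, eq_comm]
      rw [C.layer_depth, C.layer_depth, C.frequency_concat]
      simp only [hpu]
    rw [mle_congr (fun _ _ => rfl) key, mle_add, h0]
    simp only [State.tick_fld, State.putF_fld, and_self, if_true, mle, mul_ite, mul_zero]
    rw [Finset.sum_ite_eq', if_pos (Finset.mem_range.2 hu), wt, mul_comm u.2]
  · have : s₁.time = s.time + 2 := rfl
    simp only [FExp.cost_sub, WExp.cost, FExp.cost] at g3 ⊢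
    simp only [State.tick_time, State.putF_time]
    omega

end Verifier

section Verifier

variable {F : Type u} [Field F] [DecidableEq F] {E : Env F} {s : State F}
variable {C : Circuit} {S : C.Exceptions} {L : ℕ}

/-! #### A round of the interaction -/

/-- Receive five field elements into the field array `7`. -/
def Cmd.recv₅ : Cmd := .count 3 (.const 5) (.recv 7 (wv 3))

theorem Cmd.run_recv₅ {P' : Strategy F} (hin : ∀ l k, E.inbox l k = some (P' l k))
    (hM : 5 ≤ E.memSize) (hw : 5 < 2 ^ E.wordSize) (hb : s.blocked = false) :
    (Cmd.recv₅.run E s).SameChannels { s with received := s.received + 5 } ∧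
      (∀ c < 5, (Cmd.recv₅.run E s).fld 7 c = P' s.sent (s.received + c)) ∧
      (Cmd.recv₅.run E s).time ≤ s.time + 50 := by
  obtain ⟨g1, ⟨g2, g3⟩, g4⟩ := Cmd.run_count_const (E := E) (s := s) (i := 3) (n := .const 5) (N := 5)
    (body := .recv 7 (wv 3)) (by omega) (by simp [Cmd.wordArrays]) hb (WExp.eval_const hw)
    (fun j s' => s'.SameChannels { s with received := s.received + j } ∧
      ∀ q < j, s'.fld 7 q = P' s.sent (s.received + q)) 3
    ⟨⟨rfl, rfl, rfl, rfl, rfl, rfl⟩, fun q hq => by omega⟩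
    (by
      rintro j hj s' hb' hk' hw' hf ⟨i1, i2⟩
      have e1 : (wv 3).eval E s' = j := WExp.eval_var (by omega) hk' (by omega)
      have hr : s'.received = s.received + j := i1.received
      have hs : s'.sent = s.sent := i1.sent
      rw [Cmd.run_recv hb' (by rw [e1]; omega) (hin _ _), e1, hr, hs]
      refine ⟨hb', le_rfl, ⟨hs, rfl, i1.drawn, i1.output, i1.rejected, i1.blocked⟩,
        fun q hq => ?_⟩
      refine (State.putF_fld s' 7 j 7 q _).trans ?_
      split_ifs with hqj
      · rw [hqj.2]
      · exact i2 q (by simp at hqj; omega))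
  exact ⟨⟨g2.sent, g2.received, g2.drawn, g2.output, g2.rejected, g2.blocked⟩, g3, by
    simp only [WExp.cost] at g4; exact g4⟩

/-- Check that two field elements are equal. -/
def Cmd.check (x y : FExp) : Cmd := .ifZ (x - y) .skip .reject

theorem Cmd.run_check (hb : s.blocked = false) (x y : FExp) :
    (Cmd.check x y).run E s = { s with
      rejected := s.rejected || decide (x.eval E s ≠ y.eval E s)
      time := s.time + (x.cost + y.cost + 3) } := by
  have e : (x - y).eval E s = 0 ↔ x.eval E s = y.eval E s := by
    rw [FExp.eval_sub, sub_eq_zero]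
  have t : s.time + ((x - y).cost + 1) + 1 = s.time + (x.cost + y.cost + 3) := by
    rw [FExp.cost_sub]; omega
  rw [Cmd.check, Cmd.run_ifZ hb]
  by_cases h : x.eval E s = y.eval E s
  · rw [if_pos (e.2 h), Cmd.run_skip (show (s.tick _).blocked = false from hb), h]
    simp [State.tick, t]
  · rw [if_neg (fun hc => h (e.1 hc)), Cmd.run_reject (show (s.tick _).blocked = false from hb)]
    simp [State.tick, t, h]

/-- The coefficients of the polynomial that the verifier has received. -/
abbrev FExp.received (c : ℕ) : FExp := .get 7 (.const c)

/-- A round: receive a polynomial, check that the claim is `e`, choose the challenge `x` with the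
program `draw`, and send it; the new claim is the value of the polynomial at `x`. -/
def Cmd.round (e : FExp) (draw : Cmd) (x : FExp) : Cmd :=
  .seq .recv₅ (.seq (.check e (fv 8)) (.seq draw (.seq (.send x)
    (.setF 8 (.const 0) (horner FExp.received x)))))

omit [DecidableEq F] in
theorem FExp.eval_horner (c : ℕ → FExp) (x : FExp) :
    (horner c x).eval E s = horner (fun k => (c k).eval E s) (x.eval E s) := rfl

omit [DecidableEq F] in
theorem FExp.eval_endSum (c : ℕ → FExp) :
    (endSum c).eval E s = endSum fun k => (c k).eval E s := rfl

theorem Cmd.run_round {P' : Strategy F} (hin : ∀ l k, E.inbox l k = some (P' l k))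
    (hM : 5 ≤ E.memSize) (hw : 5 < 2 ^ E.wordSize) (hb : s.blocked = false)
    {e x : FExp} {draw : Cmd} {pt j δ : ℕ} {y v : F} (hpt : pt ≠ 7 ∧ pt ≠ 8) (hcost : x.cost ≤ 3)
    (he : ∀ s' : State F, (∀ b, b ≠ 3 → s'.word b = s.word b) →
      (∀ b, b ≠ 7 → s'.fld b = s.fld b) →
      (∀ c < 5, s'.fld 7 c = P' s.sent (s.received + c)) → e.eval E s' = v)
    (hdraw : ∀ s' : State F, s'.blocked = false → s'.drawn = s.drawn →
      (∀ b, b ≠ 3 → s'.word b = s.word b) → (∀ b, b ≠ 7 → s'.fld b = s.fld b) →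
      ∃ τ ≤ 30, draw.run E s' = { s'.putF pt j y with
        drawn := s'.drawn + δ, time := s'.time + τ })
    (hx : ∀ s' : State F, (∀ b, b ≠ 3 → s'.word b = s.word b) → s'.fld pt j = y →
      x.eval E s' = y) :
    ((Cmd.round e draw x).run E s).SameChannels { s with
        sent := s.sent ++ [y], received := s.received + 5, drawn := s.drawn + δ,
        rejected := s.rejected || decide (v ≠ s.fld 8 0) } ∧
      ((Cmd.round e draw x).run E s).fld 8 0
        = horner (fun c => P' s.sent (s.received + c)) y ∧
      (∀ q, ((Cmd.round e draw x).run E s).fld pt q = if q = j then y else s.fld pt q) ∧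
      (∀ b, b ≠ 7 → b ≠ 8 → b ≠ pt → ((Cmd.round e draw x).run E s).fld b = s.fld b) ∧
      (∀ b, b ≠ 3 → ((Cmd.round e draw x).run E s).word b = s.word b) ∧
      ((Cmd.round e draw x).run E s).time ≤ s.time + (e.cost + 150) := by
  have h0 : 0 < E.memSize := by omega
  simp only [Cmd.round, Cmd.run_seq]
  obtain ⟨a1, a2, a3⟩ := Cmd.run_recv₅ hin hM hw hb
  have aW : ∀ b, b ≠ 3 → (Cmd.recv₅.run E s).word b = s.word b := fun b hb =>
    Cmd.run_word E _ s (by simp [Cmd.recv₅, Cmd.count, Cmd.wordArrays, hb])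
  have aF : ∀ b, b ≠ 7 → (Cmd.recv₅.run E s).fld b = s.fld b := fun b hb =>
    Cmd.run_fld E _ s (by simp [Cmd.recv₅, Cmd.count, Cmd.fldArrays, hb])
  set s₁ := Cmd.recv₅.run E s
  have hb₁ : s₁.blocked = false := a1.blocked.trans hb
  rw [Cmd.run_check hb₁, he s₁ aW aF a2, FExp.eval_var h0, aF 8 (by norm_num)]
  set s₂ : State F := { s₁ with
    rejected := s₁.rejected || decide (v ≠ s.fld 8 0)
    time := s₁.time + (e.cost + (fv 8).cost + 3) } with hs₂
  obtain ⟨τ, hτ, hd⟩ := hdraw s₂ hb₁ a1.drawn aW aF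
  rw [hd]
  set s₃ : State F := { s₂.putF pt j y with drawn := s₂.drawn + δ, time := s₂.time + τ } with hs₃
  have cF : ∀ b, b ≠ pt → s₃.fld b = s₁.fld b := fun b hb => State.putF_fld_ne _ _ _ hb
  have cP : ∀ q, s₃.fld pt q = if q = j then y else s₁.fld pt q := fun q =>
    (State.putF_fld s₂ pt j pt q y).trans (by simp only [true_and]; rfl)
  have hev : ∀ s' : State F, s'.word = s₃.word → s'.fld = s₃.fld → x.eval E s' = y :=
    fun s' hw hf => hx s' (fun b hb => by rw [hw]; exact aW b hb) (by rw [hf, cP, if_pos rfl])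
  rw [Cmd.run_send (show s₃.blocked = false from hb₁), hev s₃ rfl rfl]
  set s₄ : State F := { s₃ with sent := s₃.sent ++ [y], time := s₃.time + (x.cost + 1) } with hs₄
  have hrec : ∀ c < 5, (FExp.received c).eval E s₄ = P' s.sent (s.received + c) := fun c hc => by
    rw [FExp.received, FExp.eval_get (WExp.eval_const (by omega)) (by omega),
      show s₄.fld 7 = s₁.fld 7 from cF 7 hpt.1.symm, a2 c hc]
  rw [Cmd.run_setF (show s₄.blocked = false from hb₁) (by rwa [WExp.eval_const_zero]),
    WExp.eval_const_zero, FExp.eval_horner, hev s₄ rfl rfl, horner_congr hrec]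
  refine ⟨⟨?_, a1.received, ?_, a1.output, ?_, a1.blocked⟩, by simp, fun q => ?_,
    fun b h7 h8 hbp => ?_, fun b hb => ?_, ?_⟩
  · show s₁.sent ++ [y] = _
    rw [a1.sent]
  · show s₁.drawn + δ = _
    rw [a1.drawn]
  · show (s₁.rejected || decide (v ≠ s.fld 8 0)) = _
    rw [a1.rejected]
  · rw [State.tick_fld, State.putF_fld_ne _ _ _ hpt.2]
    refine (cP q).trans ?_
    rw [aF pt hpt.1]
  · rw [State.tick_fld, State.putF_fld_ne _ _ _ h8]
    exact (cF b hbp).trans (aF b h7)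
  · rw [State.tick_word, State.putF_word]
    exact aW b hb
  · have t2 : s₂.time = s₁.time + (e.cost + 2 + 3) := rfl
    have t3 : s₃.time = s₂.time + τ := rfl
    have t4 : s₄.time = s₃.time + (x.cost + 1) := rfl
    have t5 : (horner FExp.received x).cost = 4 * x.cost + 18 := by
      simp only [horner, FExp.received, FExp.cost_add, FExp.cost, WExp.cost]
      omega
    simp only [State.tick_time, State.putF_time, WExp.cost]
    omega

/-- Component `c` of the message of the prover in round `t`, if the challenges are `chal 0`,
`chal 1`, …. -/
def Strategy.message (P' : Strategy F) (O : ℕ) (chal : ℕ → F) (t c : ℕ) : F :=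
  P' ((List.range t).map chal) (O + 5 * t + c)

/-- The state of the verifier before round `t`. -/
structure State.AtRound (s : State F) (C : Circuit) (chal : ℕ → F) (out : ℕ → F)
    (msg : ℕ → ℕ → F) (t : ℕ) : Prop where
  blocked : s.blocked = false
  sent : s.sent = (List.range t).map chal
  received : s.received = C.numOutputs + 5 * t
  output : s.output = (List.range C.numOutputs).map out
  claim : s.fld 8 0 = C.claim chal out msg t

/-- A sum-check with `m` rounds. -/
def Cmd.verifierSumCheck (pt : ℕ) (m : WExp) (draw : Cmd) : Cmd :=
  .count 2 m (.round (endSum FExp.received) draw (.get pt (wv 2)))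

theorem Cmd.run_verifierSumCheck (h : E.ForVerifier C S L) {P' : Strategy F}
    (hin : ∀ l k, E.inbox l k = some (P' l k)) {draw : Cmd} {mE : WExp} {pt m δ t₀ : ℕ}
    {chal out : ℕ → F} (hpt : pt ≠ 7 ∧ pt ≠ 8) (hm : m ≤ L) (ht₀ : C.logSize 1 ≤ t₀)
    (hs : s.AtRound C chal out (P'.message C.numOutputs chal) t₀)
    (hmE : ∀ s' : State F, (∀ b, b ≠ 2 → b ≠ 3 → s'.word b = s.word b) → mE.eval E s' = m)
    (hdW : ∀ b ∈ draw.wordArrays, b = 3) (hdF : ∀ b ∈ draw.fldArrays, b = pt)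
    (hdraw : ∀ j < m, ∀ s' : State F, s'.blocked = false → s'.drawn = s.drawn + δ * j →
      s'.word 2 0 = j → (∀ b, b ≠ 2 → b ≠ 3 → s'.word b = s.word b) →
      (∀ b, b ≠ 7 → b ≠ 8 → b ≠ pt → s'.fld b = s.fld b) →
      ∃ τ ≤ 30, draw.run E s' = { s'.putF pt j (shift chal t₀ j) with
        drawn := s'.drawn + δ, time := s'.time + τ }) :
    ((Cmd.verifierSumCheck pt mE draw).run E s).AtRound C chal out
        (P'.message C.numOutputs chal) (t₀ + m) ∧
      ((Cmd.verifierSumCheck pt mE draw).run E s).drawn = s.drawn + δ * m ∧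
      (((Cmd.verifierSumCheck pt mE draw).run E s).rejected = false ↔ s.rejected = false ∧
        ∀ j < m, endSum (P'.message C.numOutputs chal (t₀ + j))
          = C.claim chal out (P'.message C.numOutputs chal) (t₀ + j)) ∧
      (∀ q < m, ((Cmd.verifierSumCheck pt mE draw).run E s).fld pt q = shift chal t₀ q) ∧
      ((Cmd.verifierSumCheck pt mE draw).run E s).time ≤ s.time + (mE.cost + 4 + m * 200) := by
  have h0 := h.mem_pos
  have hM := h.memory
  have hw := h.bound
  have hcost : (endSum FExp.received).cost = 17 := rfl
  have hrec : ∀ (t : ℕ) (s' : State F), s'.sent = (List.range t).map chal →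
      s'.received = C.numOutputs + 5 * t →
      (fun c => P' s'.sent (s'.received + c)) = P'.message C.numOutputs chal t :=
    fun t s' hs hr => by funext c; rw [hs, hr]; rfl
  obtain ⟨g1, ⟨g2, g3, g4, g5⟩, g6⟩ := Cmd.run_count_const (E := E) (s := s) (i := 2) (n := mE) (N := m)
    (body := .round (endSum FExp.received) draw (.get pt (wv 2))) h0
    (by
      simp only [Cmd.round, Cmd.recv₅, Cmd.check, Cmd.count, Cmd.wordArrays, List.mem_append]
      simp
      exact fun hc => absurd (hdW 2 hc) (by norm_num)) hs.blocked
    (hmE _ fun b hb _ => State.putW_word_ne _ _ _ hb)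
    (fun j s' => s'.AtRound C chal out (P'.message C.numOutputs chal) (t₀ + j) ∧
      s'.drawn = s.drawn + δ * j ∧
      (s'.rejected = false ↔ s.rejected = false ∧
        ∀ i < j, endSum (P'.message C.numOutputs chal (t₀ + i))
          = C.claim chal out (P'.message C.numOutputs chal) (t₀ + i)) ∧
      ∀ q < j, s'.fld pt q = shift chal t₀ q) 180
    ⟨⟨hs.blocked, hs.sent, hs.received, hs.output, hs.claim⟩, rfl, by simp, fun q hq => by omega⟩
    (by
      rintro j hj s' hb' hk' hw' hf ⟨⟨i1, i2, i3, i4, i5⟩, i6, i7, i8⟩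
      have i2' : s'.sent = (List.range (t₀ + j)).map chal := i2
      have i3' : s'.received = C.numOutputs + 5 * (t₀ + j) := i3
      have i5' : s'.fld 8 0 = C.claim chal out (P'.message C.numOutputs chal) (t₀ + j) := i5
      have i6' : s'.drawn = s.drawn + δ * j := i6
      have hwj : ∀ s'' : State F, (∀ b, b ≠ 3 → s''.word b = s'.word b) → s''.word 2 0 = j :=
        fun s'' hw => by rw [hw 2 (by norm_num), hk']
      have hws : ∀ b, b ≠ 2 → b ≠ 3 → s'.word b = s.word b := fun b h2 h3 => hw' b h2 (by
        simp only [Cmd.round, Cmd.recv₅, Cmd.check, Cmd.count, Cmd.wordArrays, List.mem_append]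
        simp [h3]
        exact fun hc => h3 (hdW b hc))
      have hfs : ∀ b, b ≠ 7 → b ≠ 8 → b ≠ pt → s'.fld b = s.fld b := fun b h7 h8 hp => hf b (by
        simp only [Cmd.round, Cmd.recv₅, Cmd.check, Cmd.count, Cmd.fldArrays, List.mem_append]
        simp [h7, h8]
        exact fun hc => hp (hdF b hc))
      obtain ⟨a1, a2, a3, a4, a5, a6⟩ := Cmd.run_round (E := E) (s := s') hin (by omega) (by omega) hb'
        (e := endSum FExp.received) (x := .get pt (wv 2)) (draw := draw) (pt := pt) (j := j) (δ := δ)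
        (y := shift chal t₀ j)
        (v := endSum (P'.message C.numOutputs chal (t₀ + j))) hpt le_rfl
        (fun s'' _ _ hm => by
          rw [FExp.eval_endSum, ← hrec _ s' i2' i3']
          refine endSum_congr fun c hc => ?_
          rw [FExp.received, FExp.eval_get (WExp.eval_const (by omega)) (by omega), hm c hc])
        (fun s'' hb hd hw hf => hdraw j hj s'' hb (hd.trans i6') (hwj s'' hw)
          (fun b h2 h3 => (hw b h3).trans (hws b h2 h3))
          (fun b h7 h8 hp => (hf b h7).trans (hfs b h7 h8 hp)))
        (fun s'' hw hp => by
          rw [FExp.eval_get (WExp.eval_var h0 (hwj s'' hw) (by omega)) (by omega), hp])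
      rw [hrec _ s' i2' i3'] at a2
      refine ⟨a1.blocked.trans hb', a6.trans (by rw [hcost]; omega), ⟨a1.blocked.trans hb', ?_, ?_, a1.output.trans i4, ?_⟩, ?_,
        ?_, fun q hq => ?_⟩
      · refine a1.sent.trans ?_
        show s'.sent ++ _ = _
        rw [i2', ← add_assoc, List.range_succ, List.map_append]
        rfl
      · refine a1.received.trans ?_
        show s'.received + 5 = _
        omega
      · rw [← add_assoc, C.claim_succ (by omega)]
        exact a2
      · refine a1.drawn.trans ?_
        show s'.drawn + δ = _
        rw [i6']; ring
      · have : ((Cmd.round (endSum FExp.received) draw (.get pt (wv 2))).run E s').rejected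
            = (s'.rejected || _) := a1.rejected
        show ((Cmd.round _ _ _).run E s').rejected = false ↔ _
        rw [this, Bool.or_eq_false_iff, show (s'.rejected = false ↔ _) from i7, i5']
        simp only [ne_eq, decide_not, Bool.not_eq_false', decide_eq_true_eq]
        rw [and_assoc]
        refine and_congr_right fun _ => ⟨fun ⟨h1, h2⟩ i hi => ?_, fun h1 => ⟨fun i hi => h1 i (by omega),
          h1 j (by omega)⟩⟩
        rcases Nat.lt_or_ge i j with hij | hij
        · exact h1 i hij
        · obtain rfl : i = j := by omega
          exact h2
      · refine (a3 q).trans ?_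
        split_ifs with hqj
        · rw [hqj]
        · exact i8 q (by omega))
  exact ⟨⟨g1, g2.sent, g2.received, g2.output, g2.claim⟩, g3, g4, g5, g6.trans (by omega)⟩

end Verifier

section Multilinear

variable {F : Type u} [Field F]

theorem mle_zero (x T : ℕ → F) : mle 0 x T = T 0 := by simp [mle, wt_zero]

theorem mle_succ (m : ℕ) (x T : ℕ → F) : mle (m + 1) x T
    = mle m x T + x m * (mle m x (fun p => T (p + 2 ^ m)) - mle m x T) := by
  have l : ∑ p ∈ Finset.range (2 ^ m), wt (m + 1) x p * T p = (1 - x m) * mle m x T := by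
    rw [mle, Finset.mul_sum]
    refine Finset.sum_congr rfl fun p hp => ?_
    rw [wt_succ_low x (Finset.mem_range.1 hp)]; ring
  have h : ∑ p ∈ Finset.range (2 ^ m), wt (m + 1) x (p + 2 ^ m) * T (p + 2 ^ m)
      = x m * mle m x fun p => T (p + 2 ^ m) := by
    rw [mle, Finset.mul_sum]
    refine Finset.sum_congr rfl fun p hp => ?_
    rw [wt_succ_high x (Finset.mem_range.1 hp)]; ring
  rw [mle, sum_two_pow_succ, l, h]; ring

end Multilinear

section Verifier

variable {F : Type u} [Field F] [DecidableEq F] {E : Env F} {s : State F}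
variable {C : Circuit} {S : C.Exceptions} {L : ℕ}

/-! #### The multilinear extension of the outputs -/

/-- The height of the stack (word array `5` and field array `13`) is `wv 4`; this is the position
`m` cells below the top. -/
abbrev WExp.top (m : ℕ) : WExp := .op .sub (wv 4) (.const m)

/-- The two topmost levels of the stack are equal. -/
abbrev WExp.mergeable : WExp :=
  .op .mul (.op .lt (.const 1) (wv 4)) (.op .eq (.get 5 (.top 1)) (.get 5 (.top 2)))

/-- Replace the two topmost elements of the stack, of the same level `j`, by an element of level
`j + 1`. -/
def Cmd.merge : Cmd :=
  .seq (.setF 13 (.top 2) (.get 13 (.top 2) + .get 4 (.get 5 (.top 2))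
      * (.get 13 (.top 1) - .get 13 (.top 2))))
    (.seq (.setW 5 (.top 2) (.plus (.get 5 (.top 2)) 1)) (.setW 4 (.const 0) (.top 1)))

/-- Receive an output, and push it to the stack. -/
def Cmd.push : Cmd :=
  .seq (.recv 13 (wv 4)) (.seq (.emit (.get 13 (wv 4)))
    (.seq (.setW 5 (wv 4) (.const 0)) (.setW 4 (.const 0) (.plus (wv 4) 1))))

/-- A step of the evaluation of the multilinear extension of the outputs. The stack holds the values
of the multilinear extensions of aligned blocks of outputs; a block of level `j` has `2 ^ j` outputs.
-/
def Cmd.stackStep : Cmd := .ifW .mergeable .merge .push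

omit [Field F] [DecidableEq F] in
theorem WExp.eval_mergeable (hM : 0 < E.memSize) {h : ℕ} (hw : h + 2 < 2 ^ E.wordSize)
    (hh : s.word 4 0 = h) (hhM : h ≤ E.memSize) (hlt : ∀ i < h, s.word 5 i < 2 ^ E.wordSize) :
    WExp.mergeable.eval E s ≠ 0 ↔ ∃ i, h = i + 2 ∧ s.word 5 (i + 1) = s.word 5 i := by
  have e4 : (wv 4).eval E s = h := WExp.eval_var hM hh (by omega)
  have e1 : (WExp.op .lt (.const 1) (wv 4)).eval E s = if 1 < h then 1 else 0 :=
    WExp.eval_op (o := .lt) (WExp.eval_const (by omega)) e4 (by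
      simp only [WordOp.eval]; split_ifs <;> omega)
  have t : ∀ m ≤ 2, (WExp.top m).eval E s = h - m := fun m hm =>
    WExp.eval_op (o := .sub) e4 (WExp.eval_const (by omega)) (by simp only [WordOp.eval]; omega)
  rcases Nat.lt_or_ge 1 h with h1 | h1
  · obtain ⟨i, rfl⟩ : ∃ i, h = i + 2 := ⟨h - 2, by omega⟩
    have a1 : (WExp.get 5 (.top 1)).eval E s = s.word 5 (i + 1) :=
      WExp.eval_get (t 1 (by norm_num)) (by omega) rfl (hlt _ (by omega))
    have a2 : (WExp.get 5 (.top 2)).eval E s = s.word 5 i :=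
      WExp.eval_get (t 2 (by norm_num)) (by omega) rfl (hlt _ (by omega))
    have a3 : (WExp.op .eq (.get 5 (.top 1)) (.get 5 (.top 2))).eval E s
        = if s.word 5 (i + 1) = s.word 5 i then 1 else 0 :=
      WExp.eval_op (o := .eq) a1 a2 (by simp only [WordOp.eval]; split_ifs <;> omega)
    have a4 : WExp.mergeable.eval E s = if s.word 5 (i + 1) = s.word 5 i then 1 else 0 := by
      rw [WExp.mergeable, WExp.eval_op (o := .mul) e1 a3] <;> simp only [WordOp.eval] <;>
        split_ifs <;> omega
    rw [a4]
    constructor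
    · intro hne
      refine ⟨i, rfl, ?_⟩
      by_contra hc
      simp [hc] at hne
    · rintro ⟨i', hi', he⟩
      obtain rfl : i = i' := by omega
      simp [he]
  · have a4 : WExp.mergeable.eval E s = 0 := by
      rw [WExp.eval, e1, if_neg (by omega)]
      simp [WordOp.eval]
    rw [a4]
    constructor
    · intro hne; exact absurd rfl hne
    · rintro ⟨i, rfl, -⟩; omega

/-- The steps that read a block of `2 ^ m` outputs. The preconditions make sure that the new block is
not merged with an older one too early. -/
theorem Cmd.run_stackStep {P' : Strategy F} (hin : ∀ l k, E.inbox l k = some (P' l k))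
    (hM : 0 < E.memSize) {z : ℕ → F} (m : ℕ) : ∀ (h : ℕ) (s : State F),
    h + m + 3 < 2 ^ E.wordSize → h + m < E.memSize → s.blocked = false → s.word 4 0 = h →
    s.sent = [] → (∀ q < m, s.fld 4 q = z q) → (∀ i < h, s.word 5 i < 2 ^ E.wordSize) →
    (∀ i, h = i + 1 → m ≤ s.word 5 i) → (∀ i, h = i + 2 → s.word 5 (i + 1) ≠ s.word 5 i) →
    let s' := (fun t => Cmd.stackStep.run E t)^[2 * 2 ^ m - 1] s
    s'.SameChannels { s with
        received := s.received + 2 ^ m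
        output := s.output ++ (List.range (2 ^ m)).map fun p => P' [] (s.received + p) } ∧
      s'.word 4 0 = h + 1 ∧ (∀ i < h, s'.word 5 i = s.word 5 i) ∧
      s'.word 5 h = m ∧ (∀ i < h, s'.fld 13 i = s.fld 13 i) ∧
      s'.fld 13 h = mle m z (fun p => P' [] (s.received + p)) ∧
      (∀ b, b ≠ 13 → s'.fld b = s.fld b) ∧ s'.time + 64 ≤ s.time + 100 * 2 ^ m := by
  induction m with
  | zero =>
    intro h s hw hhM hb hh hs hz hlt h1 h2
    have hno : ¬ WExp.mergeable.eval E s ≠ 0 := by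
      rw [WExp.eval_mergeable hM (by omega) hh (by omega) hlt]
      rintro ⟨i, hi, he⟩
      exact h2 i hi he
    have h0 : ∀ s : State F, (WExp.const 0).eval E s = 0 := fun s => WExp.eval_const_zero
    have e4 : ∀ s' : State F, s'.word 4 = s.word 4 → (wv 4).eval E s' = h := fun s' hs' =>
      WExp.eval_var hM (by rw [hs', hh]) (by omega)
    simp only [pow_zero, mul_one, Nat.add_one_sub_one, Function.iterate_one]
    rw [Cmd.stackStep, Cmd.run_ifW hb, if_neg hno]
    set s₁ := s.tick (WExp.mergeable.cost + 1) with hs₁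
    have hbox : E.inbox s₁.sent s₁.received = some (P' [] s.received) := by
      rw [hin, show s₁.sent = [] from hs]; rfl
    simp only [Cmd.push, Cmd.run_seq]
    rw [Cmd.run_recv (show s₁.blocked = false from hb) (by rw [e4 s₁ rfl]; omega) hbox, e4 s₁ rfl]
    set s₂ : State F := { s₁.putF 13 h (P' [] s.received) with
      received := s₁.received + 1, time := s₁.time + ((wv 4).cost + 1) } with hs₂
    have e2 : (FExp.get 13 (wv 4)).eval E s₂ = P' [] s.received := by
      rw [FExp.eval_get (e4 s₂ rfl) (by omega)]; simp [hs₂]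
    rw [Cmd.run_emit (show s₂.blocked = false from hb), e2]
    set s₃ : State F := { s₂ with
      output := s₂.output ++ [P' [] s.received]
      time := s₂.time + ((FExp.get 13 (wv 4)).cost + 1) } with hs₃
    rw [Cmd.run_setW (show s₃.blocked = false from hb) (by rw [e4 s₃ rfl]; omega), e4 s₃ rfl, h0]
    set s₄ := (s₃.putW 5 h 0).tick ((wv 4).cost + (WExp.const 0).cost + 1) with hs₄
    have hw4 : s₄.word 4 = s.word 4 := by
      rw [hs₄, State.tick_word, State.putW_word_ne _ _ _ (by norm_num)]; rfl
    rw [Cmd.run_setW (show s₄.blocked = false from hb) (by rwa [h0]), h0,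
      WExp.eval_plus (e4 s₄ hw4) (by omega)]
    have hw5 : ∀ i, s₄.word 5 i = if i = h then 0 else s.word 5 i := fun i => by
      simp only [hs₄, State.tick_word, State.putW_word, true_and]; rfl
    have hf13 : ∀ i, s₄.fld 13 i = if i = h then P' [] s.received else s.fld 13 i := fun i => by
      simp only [hs₄, State.tick_fld, State.putW_fld]
      refine (State.putF_fld s₁ 13 h 13 i _).trans ?_
      simp only [true_and]; rfl
    refine ⟨⟨rfl, rfl, rfl, ?_, rfl, rfl⟩, by simp, fun i hi => ?_, ?_, fun i hi => ?_, ?_,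
      fun b hb => ?_, ?_⟩
    · simp [hs₄, hs₃, hs₂, hs₁]
    · rw [State.tick_word, State.putW_word_ne _ _ _ (by norm_num), hw5, if_neg (by omega)]
    · rw [State.tick_word, State.putW_word_ne _ _ _ (by norm_num), hw5, if_pos rfl]
    · rw [State.tick_fld, State.putW_fld, hf13, if_neg (by omega)]
    · rw [State.tick_fld, State.putW_fld, hf13, if_pos rfl, mle_zero]; rfl
    · rw [State.tick_fld, State.putW_fld]
      exact State.putF_fld_ne _ _ _ hb
    · simp only [hs₄, hs₃, hs₂, hs₁, State.tick_time, State.putW_time, WExp.cost, FExp.cost]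
      omega
  | succ m ih =>
    intro h s hw hhM hb hh hs hz hlt h1 h2
    have hpos : 0 < 2 ^ m := by positivity
    have hsplit : 2 * 2 ^ (m + 1) - 1 = 1 + ((2 * 2 ^ m - 1) + (2 * 2 ^ m - 1)) := by
      rw [pow_succ]; omega
    simp only [hsplit, Function.iterate_add_apply, Function.iterate_one]
    -- the first half of the block
    obtain ⟨a1, a2, a3, a4, a5, a6, a7, a8⟩ := ih h s (by omega) (by omega) hb hh hs
      (fun q hq => hz q (by omega)) hlt (fun i hi => (Nat.le_succ m).trans (h1 i hi)) h2
    set s₁ := (fun t => Cmd.stackStep.run E t)^[2 * 2 ^ m - 1] s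
    have hr₁ : s₁.received = s.received + 2 ^ m := a1.received
    have ho₁ : s₁.output = s.output ++ (List.range (2 ^ m)).map fun p => P' [] (s.received + p) :=
      a1.output
    -- the second half of the block
    obtain ⟨b1, b2, b3, b4, b5, b6, b7, b8⟩ := ih (h + 1) s₁ (by omega) (by omega)
      (a1.blocked.trans hb) a2 (a1.sent.trans hs)
      (fun q hq => by rw [a7 4 (by norm_num), hz q (by omega)])
      (fun i hi => by
        rcases Nat.lt_or_ge i h with hi' | hi'
        · rw [a3 i hi']; exact hlt i hi'
        · rw [show i = h by omega, a4]; omega)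
      (fun i hi => by rw [show i = h by omega, a4])
      (fun i hi => by
        have := h1 i (by omega)
        rw [show i + 1 = h by omega, a4, a3 i (by omega)]; omega)
    set s₂ := (fun t => Cmd.stackStep.run E t)^[2 * 2 ^ m - 1] s₁
    have hb₂ : s₂.blocked = false := (b1.blocked.trans a1.blocked).trans hb
    -- the two halves are merged
    have l0 : s₂.word 5 h = m := by rw [b3 h (by omega), a4]
    have v0 : s₂.fld 13 h = mle m z (fun p => P' [] (s.received + p)) := by
      rw [b5 h (by omega), a6]
    have hlt₂ : ∀ i < h + 2, s₂.word 5 i < 2 ^ E.wordSize := fun i hi => by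
      rcases Nat.lt_or_ge i h with hi' | hi'
      · rw [b3 i (by omega), a3 i hi']; exact hlt i hi'
      · rcases Nat.lt_or_ge i (h + 1) with hi'' | hi''
        · rw [show i = h by omega, l0]; omega
        · rw [show i = h + 1 by omega, b4]; omega
    have hyes : WExp.mergeable.eval E s₂ ≠ 0 := by
      rw [WExp.eval_mergeable hM (h := h + 2) (by omega) b2 (by omega) hlt₂]
      exact ⟨h, rfl, by rw [b4, l0]⟩
    have h0 : ∀ s : State F, (WExp.const 0).eval E s = 0 := fun s => WExp.eval_const_zero
    have ht : ∀ s' : State F, s'.word 4 0 = h + 2 →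
        (WExp.top 1).eval E s' = h + 1 ∧ (WExp.top 2).eval E s' = h := fun s' hs' => by
      have e4 : (wv 4).eval E s' = h + 2 := WExp.eval_var hM hs' (by omega)
      exact ⟨WExp.eval_op (o := .sub) e4 (WExp.eval_const (by omega))
          (by simp only [WordOp.eval]; omega),
        WExp.eval_op (o := .sub) e4 (WExp.eval_const (by omega))
          (by simp only [WordOp.eval]; omega)⟩
    rw [Cmd.stackStep, Cmd.run_ifW hb₂, if_pos hyes]
    set s₃ := s₂.tick (WExp.mergeable.cost + 1) with hs₃
    simp only [Cmd.merge, Cmd.run_seq]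
    have t3 := ht s₃ b2
    have hl : (WExp.get 5 (.top 2)).eval E s₃ = m :=
      WExp.eval_get t3.2 (by omega) l0 (by omega)
    rw [Cmd.run_setF (show s₃.blocked = false from hb₂) (by rw [t3.2]; omega), t3.2, FExp.eval_add,
      FExp.eval_mul, FExp.eval_sub, FExp.eval_get t3.2 (by omega), FExp.eval_get t3.1 (by omega),
      FExp.eval_get hl (by omega), show s₃.fld 13 h = _ from v0,
      show s₃.fld 13 (h + 1) = _ from b6, show s₃.fld 4 m = z m by
        rw [← hz m (by omega), ← a7 4 (by norm_num), ← b7 4 (by norm_num)]; rfl]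
    set val := mle m z (fun p => P' [] (s.received + p)) + z m *
      (mle m z (fun p => P' [] (s₁.received + p)) - mle m z (fun p => P' [] (s.received + p)))
      with hval
    set s₄ := (s₃.putF 13 h val).tick ((WExp.top 2).cost + (.get 13 (.top 2) + .get 4
      (.get 5 (.top 2)) * (.get 13 (.top 1) - .get 13 (.top 2)) : FExp).cost + 1) with hs₄
    have t4 := ht s₄ b2
    rw [Cmd.run_setW (show s₄.blocked = false from hb₂) (by rw [t4.2]; omega), t4.2,
      WExp.eval_plus (a := m) (WExp.eval_get t4.2 (by omega) l0 (by omega)) (by omega)]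
    set s₅ := (s₄.putW 5 h (m + 1)).tick ((WExp.top 2).cost + ((WExp.get 5 (.top 2)).plus 1).cost + 1)
      with hs₅
    have t5 := ht s₅ (by
      rw [hs₅, State.tick_word, State.putW_word_ne _ _ _ (by norm_num)]; exact b2)
    rw [Cmd.run_setW (show s₅.blocked = false from hb₂) (by rwa [h0]), h0, t5.1]
    have hw5 : ∀ i, s₅.word 5 i = if i = h then m + 1 else s₂.word 5 i := fun i => by
      simp only [hs₅, State.tick_word, State.putW_word, true_and]; rfl
    have hf13 : ∀ i, s₅.fld 13 i = if i = h then val else s₂.fld 13 i := fun i => by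
      simp only [hs₅, hs₄, State.tick_fld, State.putW_fld, State.putF_fld, true_and]; rfl
    refine ⟨⟨b1.sent.trans a1.sent, ?_, b1.drawn.trans a1.drawn, ?_, b1.rejected.trans a1.rejected,
      b1.blocked.trans a1.blocked⟩, by simp, fun i hi => ?_, ?_, fun i hi => ?_, ?_,
      fun b hb => ?_, ?_⟩
    · refine b1.received.trans ?_
      show s₁.received + 2 ^ m = s.received + 2 ^ (m + 1)
      rw [hr₁, pow_succ]; ring
    · refine b1.output.trans ?_
      show s₁.output ++ (List.range (2 ^ m)).map (fun p => P' [] (s₁.received + p))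
        = s.output ++ (List.range (2 ^ (m + 1))).map _
      rw [ho₁, pow_succ, mul_two, List.range_add, List.map_append, List.map_map,
        List.append_assoc, hr₁]
      simp only [Function.comp_def, Nat.add_assoc]
    · rw [State.tick_word, State.putW_word_ne _ _ _ (by norm_num), hw5, if_neg (by omega),
        b3 i (by omega), a3 i hi]
    · rw [State.tick_word, State.putW_word_ne _ _ _ (by norm_num), hw5, if_pos rfl]
    · rw [State.tick_fld, State.putW_fld, hf13, if_neg (by omega), b5 i (by omega), a5 i hi]
    · rw [State.tick_fld, State.putW_fld, hf13, if_pos rfl, hval, mle_succ, hr₁]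
      simp only [Nat.add_assoc, Nat.add_comm (2 ^ m)]
    · rw [State.tick_fld, State.putW_fld]
      exact (State.putF_fld_ne _ _ _ hb).trans ((b7 b hb).trans (a7 b hb))
    · have t3 : s₃.time = s₂.time + 17 := rfl
      have t4 : s₄.time = s₃.time + 29 := rfl
      have t5 : s₅.time = s₄.time + 12 := rfl
      simp only [State.tick_time, State.putW_time, WExp.cost]
      rw [pow_succ]
      omega

end Verifier

section Verifier

variable {F : Type u} [Field F] [DecidableEq F] {E : Env F} {s : State F}
variable {C : Circuit} {S : C.Exceptions} {L : ℕ}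

/-- Receive the outputs, and evaluate their multilinear extension. -/
def Cmd.receiveOutputs : Cmd :=
  .seq (.setW 4 (.const 0) (.const 0))
    (.loop (.op .sub (.twoPow (.plus (.logSize (.const 1)) 1)) (.const 1)) .stackStep)

/-- Send the point at which the multilinear extension of the outputs has been evaluated; a message of
the prover precedes every coordinate. -/
def Cmd.sendPoint : Cmd :=
  .count 2 (.logSize (.const 1)) (.seq .recv₅ (.send (.get 4 (wv 2))))

/-- The interaction up to the first sum-check. -/
def Cmd.verifierOpen : Cmd :=
  .seq (.draw 4 (.logSize (.const 1))) (.seq .receiveOutputs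
    (.seq (.setF 8 (.const 0) (fv 13)) (.seq .sendPoint (.setF 9 (.const 0) 1))))

theorem Cmd.run_receiveOutputs (h : E.ForVerifier C S L) {P' : Strategy F}
    (hin : ∀ l k, E.inbox l k = some (P' l k)) {z : ℕ → F} (hb : s.blocked = false)
    (hs : s.sent = []) (hr : s.received = 0) (hz : ∀ q < C.logSize 1, s.fld 4 q = z q) :
    (Cmd.receiveOutputs.run E s).SameChannels { s with
        received := C.numOutputs
        output := s.output ++ (List.range C.numOutputs).map (P' []) } ∧
      (Cmd.receiveOutputs.run E s).fld 13 0 = mle (C.logSize 1) z (P' []) ∧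
      (∀ b, b ≠ 13 → (Cmd.receiveOutputs.run E s).fld b = s.fld b) ∧
      (Cmd.receiveOutputs.run E s).time ≤ s.time + 100 * C.numOutputs := by
  have hd := C.two_le_depth
  have hM := h.memory
  have hw := h.bound
  have hl := h.logSize_le 1 le_rfl (by omega)
  have hp := h.two_pow_lt (i := 1) le_rfl (by omega)
  have hpos : 0 < 2 ^ C.logSize 1 := by positivity
  have h0 : ∀ s : State F, (WExp.const 0).eval E s = 0 := fun s => WExp.eval_const_zero
  have h1 : ∀ s : State F, (WExp.const 1).eval E s = 1 := fun s => WExp.eval_const (by omega)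
  rw [Cmd.receiveOutputs, Cmd.run_seq, Cmd.run_setW hb (by rw [h0]; exact h.mem_pos), h0]
  set s₁ := (s.putW 4 0 0).tick ((WExp.const 0).cost + (WExp.const 0).cost + 1) with hs₁
  have e1 : (WExp.plus (.logSize (.const 1)) 1).eval E s₁ = C.logSize 1 + 1 :=
    WExp.eval_plus (h.eval_logSize le_rfl (by omega) (h1 s₁)) (by omega)
  have e2 : (WExp.op .sub (.twoPow (.plus (.logSize (.const 1)) 1)) (.const 1)).eval E s₁
      = 2 * 2 ^ C.logSize 1 - 1 := by
    rw [WExp.eval_op (o := .sub) (WExp.eval_twoPow e1 (by rw [pow_succ]; omega)) (h1 s₁)] <;>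
      simp only [WordOp.eval] <;> rw [pow_succ] <;> omega
  rw [Cmd.run_loop (show s₁.blocked = false from hb), e2]
  set s₂ := s₁.tick
    ((WExp.op .sub (.twoPow (.plus (.logSize (.const 1)) 1)) (.const 1)).cost + 1) with hs₂
  obtain ⟨a1, a2, a3, a4, a5, a6, a7, a8⟩ := Cmd.run_stackStep hin h.mem_pos (z := z)
    (C.logSize 1) 0 s₂ (by omega) (by omega) hb (by simp [hs₂, hs₁]) hs
    (fun q hq => by rw [← hz q hq]; rfl) (fun i hi => by omega) (fun i hi => by omega)
    (fun i hi => by omega)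
  have hr₂ : s₂.received = 0 := hr
  simp only [hr₂, zero_add] at a1 a6
  refine ⟨⟨a1.sent, a1.received, a1.drawn, a1.output, a1.rejected, a1.blocked⟩, a6,
    fun b hb => (a7 b hb).trans rfl, ?_⟩
  have t2 : s₂.time = s.time + 14 := rfl
  rw [Circuit.numOutputs]
  omega

theorem Cmd.run_sendPoint (h : E.ForVerifier C S L) {P' : Strategy F}
    (hin : ∀ l k, E.inbox l k = some (P' l k)) {chal : ℕ → F} (hb : s.blocked = false)
    (hs : s.sent = []) (hr : s.received = C.numOutputs)
    (hz : ∀ q < C.logSize 1, s.fld 4 q = chal q) :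
    (Cmd.sendPoint.run E s).SameChannels { s with
        sent := (List.range (C.logSize 1)).map chal
        received := C.numOutputs + 5 * C.logSize 1 } ∧
      (Cmd.sendPoint.run E s).time ≤ s.time + (8 + 70 * C.logSize 1) := by
  have hd := C.two_le_depth
  have hM := h.memory
  have hw := h.bound
  have hl := h.logSize_le 1 le_rfl (by omega)
  have h1 : ∀ s : State F, (WExp.const 1).eval E s = 1 := fun s => WExp.eval_const (by omega)
  obtain ⟨g1, g2, g4⟩ := Cmd.run_count_const (E := E) (s := s) (i := 2)
    (n := .logSize (.const 1)) (N := C.logSize 1)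
    (body := .seq .recv₅ (.send (.get 4 (wv 2)))) h.mem_pos (by decide) hb
    (h.eval_logSize le_rfl (by omega) (h1 _))
    (fun j s' => s'.SameChannels { s with
      sent := (List.range j).map chal, received := C.numOutputs + 5 * j }) 60
    ⟨hs, hr, rfl, rfl, rfl, rfl⟩
    (by
      rintro j hj s' hb' hk' hw' hf i1
      have i1s : s'.sent = (List.range j).map chal := i1.sent
      have i1r : s'.received = C.numOutputs + 5 * j := i1.received
      obtain ⟨a1, a2, a3⟩ := Cmd.run_recv₅ hin (by omega) (by omega) hb'
      have aW : (Cmd.recv₅.run E s').word 2 = s'.word 2 := Cmd.run_word E _ s' (by decide)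
      have aF : (Cmd.recv₅.run E s').fld 4 = s'.fld 4 := Cmd.run_fld E _ s' (by decide)
      rw [Cmd.run_seq]
      set s₁ := Cmd.recv₅.run E s'
      have e2 : (wv 2).eval E s₁ = j := WExp.eval_var h.mem_pos (by rw [aW, hk']) (by omega)
      have e4 : (FExp.get 4 (wv 2)).eval E s₁ = chal j := by
        rw [FExp.eval_get e2 (by omega), aF, hf 4 (by decide), hz j hj]
      rw [Cmd.run_send (a1.blocked.trans hb'), e4]
      refine ⟨a1.blocked.trans hb', ?_, ⟨?_, ?_, a1.drawn.trans i1.drawn, a1.output.trans i1.output,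
        a1.rejected.trans i1.rejected, a1.blocked.trans i1.blocked⟩⟩
      · show s₁.time + 4 ≤ s'.time + 60
        omega
      · show s₁.sent ++ [chal j] = _
        rw [a1.sent, List.range_succ, List.map_append]
        show s'.sent ++ _ = _
        rw [i1s]; rfl
      · refine a1.received.trans ?_
        show s'.received + 5 = _
        rw [i1r]; ring)
  refine ⟨⟨g2.sent, g2.received, g2.drawn, g2.output, g2.rejected, g2.blocked⟩, g4.trans ?_⟩
  simp only [WExp.cost]
  omega

theorem Cmd.run_verifierOpen (h : E.ForVerifier C S L) {P' : Strategy F}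
    (hin : ∀ l k, E.inbox l k = some (P' l k)) {chal : ℕ → F} (hb : s.blocked = false)
    (hs : s.sent = []) (hr : s.received = 0) (ho : s.output = [])
    (hcoin : ∀ t < C.logSize 1, E.coin (s.drawn + t) = chal t) :
    (Cmd.verifierOpen.run E s).AtRound C chal (P' []) (P'.message C.numOutputs chal) (C.logSize 1) ∧
      (Cmd.verifierOpen.run E s).drawn = s.drawn + C.logSize 1 ∧
      (Cmd.verifierOpen.run E s).rejected = s.rejected ∧
      (∀ q < C.logSize 1, (Cmd.verifierOpen.run E s).fld 4 q = chal q) ∧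
      (Cmd.verifierOpen.run E s).fld 9 0 = 1 ∧
      (∀ b ∈ [1, 3, 12], (Cmd.verifierOpen.run E s).fld b = s.fld b) ∧
      (Cmd.verifierOpen.run E s).time ≤ s.time + 200 * C.numOutputs := by
  have hd := C.two_le_depth
  have hM := h.memory
  have hw := h.bound
  have hl := h.logSize_le 1 le_rfl (by omega)
  have h0 : ∀ s : State F, (WExp.const 0).eval E s = 0 := fun s => WExp.eval_const_zero
  have h1 : ∀ s : State F, (WExp.const 1).eval E s = 1 := fun s => WExp.eval_const (by omega)
  simp only [Cmd.verifierOpen, Cmd.run_seq]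
  obtain ⟨a1, a2, a3⟩ := Cmd.run_draw (E := E) (s := s) (a := 4) (n := .logSize (.const 1))
    (N := C.logSize 1) (by omega) h.mem_pos hb (fun s' => h.eval_logSize le_rfl (by omega) (h1 _))
  have aF : ∀ b, b ≠ 4 → ((Cmd.draw 4 (.logSize (.const 1))).run E s).fld b = s.fld b := fun b hb =>
    Cmd.run_fld E _ s (by simp [Cmd.draw, Cmd.count, Cmd.fldArrays, hb])
  set s₁ := (Cmd.draw 4 (.logSize (.const 1))).run E s
  obtain ⟨b1, b2, b3, b4⟩ := Cmd.run_receiveOutputs h hin (s := s₁) (z := chal)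
    (a1.blocked.trans hb) (a1.sent.trans hs) (a1.received.trans hr)
    (fun q hq => by rw [a2 q hq, hcoin q hq])
  set s₂ := Cmd.receiveOutputs.run E s₁
  have hb₂ : s₂.blocked = false := (b1.blocked.trans a1.blocked).trans hb
  rw [Cmd.run_setF hb₂ (by rw [h0]; exact h.mem_pos), h0, FExp.eval_var h.mem_pos, b2]
  set s₃ := (s₂.putF 8 0 (mle (C.logSize 1) chal (P' []))).tick
    ((WExp.const 0).cost + (fv 13).cost + 1) with hs₃
  have cF : ∀ b, b ≠ 8 → s₃.fld b = s₂.fld b := fun b hb => State.putF_fld_ne _ _ _ hb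
  have c4 : ∀ q < C.logSize 1, s₃.fld 4 q = chal q := fun q hq => by
    rw [cF 4 (by norm_num), b3 4 (by norm_num), a2 q hq, hcoin q hq]
  obtain ⟨d1, d2⟩ := Cmd.run_sendPoint h hin (s := s₃) (chal := chal) hb₂
    ((b1.sent.trans a1.sent).trans hs) b1.received c4
  have dF : ∀ b, b ≠ 7 → (Cmd.sendPoint.run E s₃).fld b = s₃.fld b := fun b hb =>
    Cmd.run_fld E _ s₃ (by simp [Cmd.sendPoint, Cmd.recv₅, Cmd.count, Cmd.fldArrays, hb])
  set s₄ := Cmd.sendPoint.run E s₃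
  have hb₄ : s₄.blocked = false := d1.blocked.trans hb₂
  rw [Cmd.run_setF hb₄ (by rw [h0]; exact h.mem_pos), h0, FExp.eval_one]
  have eF : ∀ b, b ≠ 9 → ∀ t, ((s₄.putF 9 0 1).tick t).fld b = s₄.fld b := fun b hb t =>
    State.putF_fld_ne _ _ _ hb
  refine ⟨⟨hb₄, d1.sent, d1.received, ?_, ?_⟩, ?_, ?_, fun q hq => ?_, by simp, fun b hb => ?_, ?_⟩
  · refine (d1.output.trans b1.output).trans ?_
    show s₁.output ++ _ = _
    rw [show s₁.output = [] from a1.output.trans ho, List.nil_append]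
  · rw [eF 8 (by norm_num), dF 8 (by norm_num), Circuit.claim, if_pos rfl]
    simp [hs₃]
  · exact (d1.drawn.trans b1.drawn).trans a1.drawn
  · exact (d1.rejected.trans b1.rejected).trans a1.rejected
  · rw [eF 4 (by norm_num), dF 4 (by norm_num), c4 q hq]
  · simp only [List.mem_cons, List.not_mem_nil, or_false] at hb
    rw [eF b (by omega), dF b (by omega), cF b (by omega), b3 b (by omega), aF b (by omega)]
  · have t3 : s₃.time = s₂.time + 4 := rfl
    have hlt : C.logSize 1 < C.numOutputs := (C.logSize 1).lt_two_pow_self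
    simp only [State.tick_time, State.putF_time, WExp.cost, FExp.cost_one] at a3 ⊢
    omega

end Verifier

section Verifier

variable {F : Type u} {E : Env F} {s : State F}
variable {C : Circuit} {S : C.Exceptions} {L : ℕ}

/-! #### The check between the two sum-checks of a layer -/

theorem Env.ForVerifier.eval_layer (h : E.ForVerifier C S L) {k : ℕ} (hk : k + 1 < C.depth)
    (hw : s.word 1 0 = k) :
    WExp.cur.eval E s = k + 1 ∧ WExp.next.eval E s = k + 2 ∧
      (WExp.logSize .cur).eval E s = C.logSize (k + 1) ∧
      (WExp.logSize .next).eval E s = C.logSize (k + 2) := by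
  have h3 := h.bound
  have e0 : (wv 1).eval E s = k := WExp.eval_var h.mem_pos hw (by omega)
  have e1 : WExp.cur.eval E s = k + 1 := WExp.eval_plus e0 (by omega)
  have e2 : WExp.next.eval E s = k + 2 := WExp.eval_plus e0 (by omega)
  exact ⟨e1, e2, h.eval_logSize (by omega) hk.le e1, h.eval_logSize (by omega) hk e2⟩

variable [Field F]

theorem Env.ForVerifier.eval_type (h : E.ForVerifier C S L) {k p : ℕ} (hk : k + 1 < C.depth)
    (hw : s.word 1 0 = k) (hs : s.HasBits) {e : WExp} (he : e.eval E s = p) :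
    (FExp.get 12 (.wire .type .cur e)).eval E s = C.typeF F (k + 1) p := by
  have h3 := h.bound
  have hM := h.memory
  have k3 := C.wire_lt (k + 1) .type p
  simp only [Circuit.outWidth] at k3
  rw [FExp.eval_get (WExp.eval_wire h.answer (h.eval_layer hk hw).1 he (by omega)) (by omega),
    Circuit.typeF]
  split_ifs with h0
  · rw [h0, hs.1]
  · rw [show C.wire (k + 1) .type p = 1 by omega, hs.2]

variable [DecidableEq F]

/-- The multilinear extension of the equality predicate. -/
def Cmd.equality : Cmd :=
  .prodLoop 10 2 (.logSize .cur)
    ((1 - .get 5 (wv 2)) * (1 - .get 4 (wv 2)) + .get 5 (wv 2) * .get 4 (wv 2))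

/-- The multilinear extension of the type function of the current layer. -/
def Cmd.typeExtension : Cmd :=
  .sumLoop 11 2 (.logSize .cur) (.get 12 (.wire .type .cur (.const 0)))
    ((.get 12 (.wire .type .cur (.twoPow (wv 2))) - .get 12 (.wire .type .cur (.const 0)))
      * .get 5 (wv 2))

/-- The round between the two sum-checks of a layer. -/
def Cmd.verifierMid : Cmd :=
  .seq .equality (.seq .typeExtension
    (.round (gate (fv 9 * fv 10) (fv 11) (.received 0) (.received 1)) (.rand 14 (.const 0)) (fv 14)))

theorem Cmd.run_verifierMid (h : E.ForVerifier C S L) {P' : Strategy F}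
    (hin : ∀ l k, E.inbox l k = some (P' l k)) {k c : ℕ} {T : Finset (Fin (C.logSize (k + 1)))}
    (hreg : IsRegularWith c (C.wiring (k + 1) .type) T) {chal out : ℕ → F} (hk : k + 1 < C.depth)
    (hs : s.AtRound C chal out (P'.message C.numOutputs chal) (C.mid k)) (hw1 : s.word 1 0 = k)
    (hbits : s.HasBits) (hz : ∀ q < C.logSize (k + 1), s.fld 4 q = shift chal (C.pos k) q)
    (hr : ∀ q < C.logSize (k + 1), s.fld 5 q = shift chal (C.start₁ k) q)
    (hsc : s.fld 9 0 = C.scale chal k) (hcoin : E.coin s.drawn = chal (C.mid k)) :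
    (Cmd.verifierMid.run E s).AtRound C chal out (P'.message C.numOutputs chal) (C.pos (k + 1)) ∧
      (Cmd.verifierMid.run E s).drawn = s.drawn + 1 ∧
      ((Cmd.verifierMid.run E s).rejected = false ↔ s.rejected = false ∧
        C.midValue chal k (P'.message C.numOutputs chal (C.mid k) 0)
          (P'.message C.numOutputs chal (C.mid k) 1)
          = C.claim chal out (P'.message C.numOutputs chal) (C.mid k)) ∧
      (Cmd.verifierMid.run E s).fld 14 0 = chal (C.mid k) ∧
      (∀ b ∈ [1, 3, 5, 12], (Cmd.verifierMid.run E s).fld b = s.fld b) ∧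
      (Cmd.verifierMid.run E s).time ≤ s.time + 400 * L := by
  have hM := h.memory
  have hw := h.bound
  have hL := h.one_le
  have hl := h.logSize_le (k + 1) (by omega) hk.le
  have hp := h.two_pow_lt (i := k + 1) (by omega) hk.le
  have hm := C.start₁_add k
  have hm' := C.mid_add_one k
  have hge := C.logSize_one_le_start₁ k
  have hlN : ∀ s' : State F, (∀ b, b ≠ 2 → s'.word b = s.word b) →
      (WExp.logSize .cur).eval E s' = C.logSize (k + 1) := fun s' hs' =>
    (h.eval_layer hk (by rw [hs' 1 (by norm_num), hw1])).2.2.1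
  simp only [Cmd.verifierMid, Cmd.run_seq]
  obtain ⟨a1, a2, a3⟩ := Cmd.run_prodLoop (E := E) (s := s) (a := 10) (i := 2)
    (n := .logSize .cur) (N := C.logSize (k + 1))
    (e := (1 - .get 5 (wv 2)) * (1 - .get 4 (wv 2)) + .get 5 (wv 2) * .get 4 (wv 2))
    (fun j => (1 - shift chal (C.start₁ k) j) * (1 - shift chal (C.pos k) j)
      + shift chal (C.start₁ k) j * shift chal (C.pos k) j) h.mem_pos hs.blocked hlN
    (by
      intro j hj s' hj' _ hf
      have e1 : (wv 2).eval E s' = j := WExp.eval_var h.mem_pos hj' (by omega)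
      simp only [FExp.eval_add, FExp.eval_mul, FExp.eval_sub, FExp.eval_one,
        FExp.eval_get e1 (show j < E.memSize by omega), hf 4 (by norm_num), hf 5 (by norm_num),
        hz j hj, hr j hj])
  rw [← mle_wt] at a2
  have aF : ∀ b, b ≠ 10 → (Cmd.equality.run E s).fld b = s.fld b := fun b hb =>
    Cmd.run_fld E _ s (by simp [Cmd.equality, Cmd.prodLoop, Cmd.count, Cmd.fldArrays, hb])
  have aW : ∀ b, b ≠ 2 → (Cmd.equality.run E s).word b = s.word b := fun b hb =>
    Cmd.run_word E _ s (by simp [Cmd.equality, Cmd.prodLoop, Cmd.count, Cmd.wordArrays, hb])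
  have aQ := Cmd.run_quiet E .equality s (by decide)
  rw [← Cmd.equality] at a1 a2 a3
  set s₁ := Cmd.equality.run E s
  have hbits₁ : ∀ s' : State F, s'.fld 12 = s₁.fld 12 → s'.HasBits := fun s' hs' => by
    rw [State.HasBits, hs', aF 12 (by norm_num)]; exact hbits
  obtain ⟨b1, b2, b3⟩ := Cmd.run_sumLoop (E := E) (s := s₁) (a := 11) (i := 2)
    (n := .logSize .cur) (N := C.logSize (k + 1))
    (e₀ := .get 12 (.wire .type .cur (.const 0)))
    (e := (.get 12 (.wire .type .cur (.twoPow (wv 2))) - .get 12 (.wire .type .cur (.const 0)))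
      * .get 5 (wv 2)) (x := C.typeF F (k + 1) 0)
    (fun j => (C.typeF F (k + 1) (2 ^ j) - C.typeF F (k + 1) 0) * shift chal (C.start₁ k) j)
    h.mem_pos a1 (fun s' hs' => hlN s' fun b hb => (hs' b hb).trans (aW b hb))
    (h.eval_type hk (by rw [aW 1 (by norm_num), hw1]) (hbits₁ s₁ rfl) WExp.eval_const_zero)
    (by
      intro j hj s' hj' hw' hf
      have hj2 := Nat.pow_le_pow_right (show 0 < 2 by norm_num) hj.le
      have e1 : (wv 2).eval E s' = j := WExp.eval_var h.mem_pos hj' (by omega)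
      have hk' : s'.word 1 0 = k := by rw [hw' 1 (by norm_num), aW 1 (by norm_num), hw1]
      have hb' := hbits₁ s' (hf 12 (by norm_num))
      rw [FExp.eval_mul, FExp.eval_sub, h.eval_type hk hk' hb' WExp.eval_const_zero,
        h.eval_type hk hk' hb' (WExp.eval_twoPow e1 (by omega)), FExp.eval_get e1 (by omega),
        hf 5 (by norm_num), aF 5 (by norm_num), hr j hj])
  rw [← Circuit.mle_typeF hreg] at b2
  have bF : ∀ b, b ≠ 11 → (Cmd.typeExtension.run E s₁).fld b = s₁.fld b := fun b hb =>
    Cmd.run_fld E _ s₁ (by simp [Cmd.typeExtension, Cmd.sumLoop, Cmd.count, Cmd.fldArrays, hb])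
  have bQ := Cmd.run_quiet E .typeExtension s₁ (by decide)
  rw [← Cmd.typeExtension] at b1 b2 b3
  set s₂ := Cmd.typeExtension.run E s₁
  have hQ := bQ.trans aQ
  have hrec : (fun c => P' s₂.sent (s₂.received + c)) = P'.message C.numOutputs chal (C.mid k) := by
    funext c
    rw [hQ.sent, hQ.received, hs.sent, hs.received]; rfl
  have hrec' : ∀ c, P' s₂.sent (s₂.received + c) = P'.message C.numOutputs chal (C.mid k) c :=
    congrFun hrec
  obtain ⟨c1, c2, c3, c4, c5, c6⟩ := Cmd.run_round (E := E) (s := s₂) hin (by omega) (by omega) b1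
    (e := gate (fv 9 * fv 10) (fv 11) (.received 0) (.received 1)) (x := fv 14)
    (draw := .rand 14 (.const 0)) (pt := 14) (j := 0) (δ := 1) (y := chal (C.mid k))
    (v := C.midValue chal k (P'.message C.numOutputs chal (C.mid k) 0)
          (P'.message C.numOutputs chal (C.mid k) 1)) (by norm_num) (by decide)
    (fun s' _ hf hm => by
      rw [FExp.eval_gate, FExp.eval_mul, FExp.eval_var h.mem_pos, FExp.eval_var h.mem_pos,
        FExp.eval_var h.mem_pos, hf 9 (by norm_num), hf 10 (by norm_num), hf 11 (by norm_num),
        bF 9 (by norm_num), bF 10 (by norm_num), aF 9 (by norm_num), a2, b2, hsc,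
        FExp.received, FExp.received, FExp.eval_get (WExp.eval_const (by omega)) (by omega),
        FExp.eval_get (WExp.eval_const (by omega)) (by omega), hm 0 (by norm_num),
        hm 1 (by norm_num), hrec', hrec']
      rfl)
    (fun s' hb' hd _ _ => ⟨2, by norm_num, by
      rw [Cmd.run_rand hb' (by rw [WExp.eval_const_zero]; exact h.mem_pos), WExp.eval_const_zero, hd,
        hQ.drawn, hcoin]
      rfl⟩)
    (fun s' _ hp => by rw [FExp.eval_var h.mem_pos, hp])
  have hcl : s₂.fld 8 0 = C.claim chal out (P'.message C.numOutputs chal) (C.mid k) := by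
    rw [bF 8 (by norm_num), aF 8 (by norm_num), hs.claim]
  rw [hrec] at c2
  refine ⟨⟨c1.blocked.trans b1, ?_, ?_, (c1.output.trans hQ.output).trans hs.output, ?_⟩, ?_, ?_, ?_,
    fun b hb => ?_, ?_⟩
  · refine c1.sent.trans ?_
    show s₂.sent ++ _ = _
    rw [hQ.sent, hs.sent, ← hm', List.range_succ, List.map_append]
    rfl
  · refine c1.received.trans ?_
    show s₂.received + 5 = _
    rw [hQ.received, hs.received, ← hm']
    ring
  · rw [c2, ← hm', C.claim_succ (by omega)]
  · refine c1.drawn.trans ?_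
    show s₂.drawn + 1 = _
    rw [hQ.drawn]
  · rw [c1.rejected]
    simp only [hQ.rejected, hcl, Bool.or_eq_false_iff, ne_eq, decide_not, Bool.not_eq_false',
      decide_eq_true_eq]
  · rw [c3, if_pos rfl]
  · simp only [List.mem_cons, List.not_mem_nil, or_false] at hb
    rw [c4 b (by omega) (by omega) (by omega), bF b (by omega), aF b (by omega)]
  · have t1 : (gate (fv 9 * fv 10) (fv 11) (.received 0) (.received 1) : FExp).cost ≤ 40 := by
      decide
    simp only [FExp.cost_sub, WExp.cost,
      FExp.cost] at a3 b3
    omega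

end Verifier

section SortedList

variable {n : ℕ} (T : Finset (Fin n))

theorem Finset.sort_getD_mem {k : ℕ} (hk : k < T.card) :
    ∃ j ∈ T, ((T.sort (· ≤ ·)).map Fin.val).getD k 0 = j := by
  have hl : k < T.sort.length := by simpa using hk
  exact ⟨T.sort[k], (Finset.mem_sort _).1 (List.getElem_mem hl), by
    simp [List.getD_eq_getElem?_getD, List.getElem?_eq_getElem hl]⟩

theorem Finset.exists_sort_getD {j : Fin n} (hj : j ∈ T) :
    ∃ k < T.card, ((T.sort (· ≤ ·)).map Fin.val).getD k 0 = j := by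
  obtain ⟨k, hk, he⟩ := List.getElem_of_mem ((Finset.mem_sort (· ≤ ·)).2 hj)
  exact ⟨k, by simpa using hk, by
    simp [List.getD_eq_getElem?_getD, List.getElem?_eq_getElem hk, he]⟩

end SortedList

section Verifier

variable {F : Type u} {E : Env F} {s : State F}
variable {C : Circuit} {S : C.Exceptions} {L : ℕ}

/-! #### The sources of the output bits of a wiring function -/

/-- The first cells of the word array `6` are `0` or contain the sources of the output bits of a
wiring function of layer `i`; the latter is certain for the output bits in `J`. -/
def State.SourcesOn (s : State F) (C : Circuit) (i : ℕ) (f : Wiring) (J : ℕ → Prop) : Prop :=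
  ∀ k < C.outWidth i f, s.word 6 k = C.source i f k ∨ s.word 6 k = 0 ∧ ¬ J k

theorem State.SourcesOn.congr {s' : State F} {i : ℕ} {f : Wiring} {J J' : ℕ → Prop}
    (h : s.SourcesOn C i f J) (hs : s'.word 6 = s.word 6) (hJ : ∀ k, J' k → J k) :
    s'.SourcesOn C i f J' := fun k hk => by
  rw [hs]
  exact (h k hk).imp id fun ⟨h1, h2⟩ => ⟨h1, fun h3 => h2 (hJ k h3)⟩

theorem State.SourcesOn.put {i k : ℕ} {f : Wiring} {J J' : ℕ → Prop}
    (h : s.SourcesOn C i f J) (hJ : ∀ k', J' k' → J k' ∨ k' = k) :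
    (s.putW 6 k (C.source i f k)).SourcesOn C i f J' := fun k' hk' => by
  rw [State.putW_word]
  by_cases hkk : k' = k
  · subst hkk; simp
  · rw [if_neg (by tauto)]
    exact (h k' hk').imp id fun ⟨h1, h2⟩ => ⟨h1, fun h3 => (hJ k' h3).elim h2 hkk⟩

variable [Field F] [DecidableEq F]

/-- Declare that no output bit has a source. -/
def Cmd.clearSources : Cmd := .count 2 (.logSize .next) (.setW 6 (wv 2) (.const 0))

/-- An output bit that the input bit `wv 2` affects. -/
abbrev WExp.affectedBit (f : Wiring) : WExp := .query (.affected f) .cur (wv 2) (wv 3)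

/-- Write the input bit `wv 2` to the cells of the output bits that it affects, unless it is
exceptional. -/
def Cmd.regularBit (f : Wiring) : Cmd :=
  .count 3 (.query (.numAffected f) .cur (wv 2) (.const 0))
    (.setW 6 (.affectedBit f) (.plus (wv 2) 1))

/-- Find the output bits whose sources are not exceptional. -/
def Cmd.regularSources (f : Wiring) : Cmd := .count 2 (.logSize .cur) (.regularBit f)

/-- An exceptional input bit. -/
abbrev WExp.exceptionalBit (f : Wiring) : WExp := .query (.exception f) .cur (wv 2) (.const 0)

/-- The output bit `wv 3` of the wiring function at `p`. -/
abbrev WExp.outputBit (f : Wiring) (p : WExp) (k : WExp) : WExp := .bit (.wire f .cur p) k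

/-- Write the exceptional input bit number `wv 2` to the cell of the output bit `wv 3`, if the latter
depends on it. -/
def Cmd.compareBit (f : Wiring) : Cmd :=
  .ifW (.op .eq (.outputBit f (.const 0) (wv 3))
      (.outputBit f (.twoPow (.exceptionalBit f)) (wv 3)))
    .skip (.setW 6 (wv 3) (.plus (.exceptionalBit f) 1))

/-- Find the output bits whose sources are exceptional. -/
def Cmd.exceptionalSources (f : Wiring) : Cmd :=
  .count 2 (.query (.numExceptions f) .cur (.const 0) (.const 0))
    (.count 3 (.logSize .next) (.compareBit f))

/-- Find the sources of all output bits. -/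
def Cmd.sources (f : Wiring) : Cmd :=
  .seq .clearSources (.seq (.regularSources f) (.exceptionalSources f))

theorem Cmd.run_clearSources (h : E.ForVerifier C S L) {k : ℕ} {f : Wiring}
    (hf : C.outWidth (k + 1) f = C.logSize (k + 2)) (hk : k + 1 < C.depth) (hb : s.blocked = false)
    (hw1 : s.word 1 0 = k) :
    (Cmd.clearSources.run E s).blocked = false ∧
      (Cmd.clearSources.run E s).SourcesOn C (k + 1) f (fun _ => False) ∧
      (Cmd.clearSources.run E s).time ≤ s.time + 50 * L := by
  have hM := h.memory
  have hw := h.bound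
  have hL := h.one_le
  have hl := h.logSize_le (k + 2) (by omega) hk
  obtain ⟨g1, g2, g3⟩ := Cmd.run_count_const (E := E) (s := s) (i := 2) (n := .logSize .next)
    (N := C.logSize (k + 2)) (body := .setW 6 (wv 2) (.const 0)) h.mem_pos (by decide) hb
    (h.eval_layer hk (by rw [State.putW_word_ne _ _ _ (by norm_num), hw1])).2.2.2
    (fun j s' => ∀ q < j, s'.word 6 q = 0) 4 (fun q hq => by omega)
    (by
      intro j hj s' hb' hj' hw' hf' hI
      have e1 : (wv 2).eval E s' = j := WExp.eval_var h.mem_pos hj' (by omega)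
      rw [Cmd.run_setW hb' (by rw [e1]; omega), e1, WExp.eval_const_zero]
      refine ⟨hb', le_rfl, fun q hq => ?_⟩
      rw [State.forget_word_ne _ (by norm_num), State.tick_word, State.putW_word]
      split_ifs with hqj
      · rfl
      · have := hI q (by simp at hqj; omega)
        rwa [State.forget_word_ne _ (by norm_num)] at this)
  refine ⟨g1, fun q hq => .inr ⟨?_, id⟩, g3.trans ?_⟩
  · have := g2 q (by omega)
    rwa [State.forget_word_ne _ (by norm_num)] at this
  · simp only [WExp.cost]
    omega

theorem Cmd.run_regularSources (h : E.ForVerifier C S L) {k c : ℕ} {f : Wiring}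
    (hreg : IsRegularWith c (C.wiring (k + 1) f) (S (k + 1) f))
    (hf : C.outWidth (k + 1) f = C.logSize (k + 2)) (hk : k + 1 < C.depth) (hb : s.blocked = false)
    (hw1 : s.word 1 0 = k) (hs : s.SourcesOn C (k + 1) f fun _ => False) :
    ((Cmd.regularSources f).run E s).blocked = false ∧
      ((Cmd.regularSources f).run E s).SourcesOn C (k + 1) f
        (fun q => ∃ j : Fin (C.logSize (k + 1)), j ∉ S (k + 1) f ∧ C.source (k + 1) f q = j + 1) ∧
      ((Cmd.regularSources f).run E s).time ≤ s.time + 50 * (c + 1) * L := by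
  have hM := h.memory
  have hw := h.bound
  have hL := h.one_le
  have hl1 := h.logSize_le (k + 1) (by omega) hk.le
  have hl := h.logSize_le (k + 2) (by omega) hk
  obtain ⟨g1, g2, g3⟩ := Cmd.run_count_const (E := E) (s := s) (i := 2) (n := .logSize .cur)
    (N := C.logSize (k + 1)) (body := .regularBit f) h.mem_pos
    (by simp [Cmd.regularBit, Cmd.count, Cmd.wordArrays]) hb
    (h.eval_layer hk (by rw [State.putW_word_ne _ _ _ (by norm_num), hw1])).2.2.1
    (fun j s' => s'.SourcesOn C (k + 1) f fun q => ∃ j' : Fin (C.logSize (k + 1)), (j' : ℕ) < j ∧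
      j' ∉ S (k + 1) f ∧ C.source (k + 1) f q = j' + 1) (20 + 30 * c)
    (hs.congr (State.forget_word_ne _ (by norm_num)) fun q ⟨j', hj', _⟩ => by omega)
    (by
      intro j hj s' hb' hj' hw' hf' hI
      have hk' : s'.word 1 0 = k := by
        rw [hw' 1 (by norm_num) (by simp [Cmd.regularBit, Cmd.count, Cmd.wordArrays]), hw1]
      have hI' : s'.SourcesOn C (k + 1) f _ :=
        hI.congr (State.forget_word_ne _ (by norm_num)).symm fun _ => id
      -- the output bits that the input bit `j` affects
      let A : Finset (Fin (C.outWidth (k + 1) f)) :=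
        if ⟨j, hj⟩ ∈ S (k + 1) f then ∅ else affectedBits (C.wiring (k + 1) f) ⟨j, hj⟩
      have hA : A.card ≤ c := by
        simp only [A]; split_ifs with hjS
        · simp
        · exact hreg.affected_le _ hjS
      have hAw : A.card ≤ C.logSize (k + 2) := by
        have := Finset.card_le_univ A
        simp only [Fintype.card_fin] at this
        omega
      have hmem : ∀ q ∈ A, C.source (k + 1) f q = j + 1 := fun q hq => by
        simp only [A] at hq
        split_ifs at hq with hjS
        · simp at hq
        · exact (C.source_eq_succ_iff hreg q.isLt hj).2 (by simpa [affectedBits] using hq)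
      have q0 : C.answer S (.numAffected f) (k + 1) j 0 = A.card := by
        simp only [Circuit.answer, dif_pos hj, A]; split_ifs <;> simp
      have qa : ∀ a < A.card, C.answer S (.affected f) (k + 1) j a
          = ((A.sort (· ≤ ·)).map Fin.val).getD a 0 := fun a ha => by
        simp only [Circuit.answer, dif_pos hj, A]; split_ifs <;> simp
      have ev : ∀ s'' : State F, s''.word 2 0 = j → s''.word 1 0 = k →
          WExp.cur.eval E s'' = k + 1 ∧ (wv 2).eval E s'' = j := fun s'' h2 h1 =>
        ⟨(h.eval_layer hk h1).1, WExp.eval_var h.mem_pos h2 (by omega)⟩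
      have eN : (WExp.query (.numAffected f) .cur (wv 2) (.const 0)).eval E (s'.putW 3 0 0)
          = A.card := by
        obtain ⟨v1, v2⟩ := ev (s'.putW 3 0 0) (by simpa using hj') (by simpa using hk')
        rw [WExp.eval, v1, v2, WExp.eval_const_zero, h.answer, q0, Nat.mod_eq_of_lt (by omega)]
      obtain ⟨b1, b2, b3⟩ := Cmd.run_count_const (E := E) (s := s') (i := 3)
        (n := .query (.numAffected f) .cur (wv 2) (.const 0)) (N := A.card)
        (body := .setW 6 (.affectedBit f) (.plus (wv 2) 1)) h.mem_pos (by simp [Cmd.wordArrays]) hb'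
        eN (fun a s'' => s''.SourcesOn C (k + 1) f fun q =>
          (∃ j' : Fin (C.logSize (k + 1)), (j' : ℕ) < j ∧
            j' ∉ S (k + 1) f ∧ C.source (k + 1) f q = j' + 1) ∨
          ∃ a' < a, ((A.sort (· ≤ ·)).map Fin.val).getD a' 0 = q) 20
        (hI'.congr (State.forget_word_ne _ (by norm_num)) fun q hq =>
          hq.resolve_right fun ⟨a', ha', _⟩ => by omega)
        (by
          intro a ha s'' hb'' ha'' hw'' hf'' hI''
          obtain ⟨v1, v2⟩ := ev s''
            (by rw [hw'' 2 (by norm_num) (by simp [Cmd.wordArrays]), hj'])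
            (by rw [hw'' 1 (by norm_num) (by simp [Cmd.wordArrays]), hk'])
          have v3 : (wv 3).eval E s'' = a := WExp.eval_var h.mem_pos ha'' (by omega)
          obtain ⟨q, hqA, hq⟩ := A.sort_getD_mem ha
          have v4 : (WExp.affectedBit f).eval E s'' = q := by
            rw [WExp.eval, v1, v2, v3, h.answer, qa a ha, hq,
              Nat.mod_eq_of_lt (by have := q.isLt; omega)]
          have hqlt := q.isLt
          rw [Cmd.run_setW hb'' (by rw [v4]; omega), v4, WExp.eval_plus v2 (by omega),
            ← hmem q hqA]
          refine ⟨hb'', ?_, ?_⟩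
          · simp only [State.tick_time, State.putW_time, WExp.cost]; omega
          · refine ((hI''.congr (State.forget_word_ne _ (by norm_num)).symm fun _ => id).put
              (J' := fun q => (∃ j' : Fin (C.logSize (k + 1)), (j' : ℕ) < j ∧
                j' ∉ S (k + 1) f ∧ C.source (k + 1) f q = j' + 1) ∨
                ∃ a' < a + 1, ((A.sort (· ≤ ·)).map Fin.val).getD a' 0 = q) (k := q) ?_).congr
              (State.forget_word_ne _ (by norm_num)) fun _ => id
            rintro q' (hq' | ⟨a', ha', hq'⟩)
            · exact .inl (.inl hq')
            · rcases Nat.lt_or_ge a' a with haa | haa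
              · exact .inl (.inr ⟨a', haa, hq'⟩)
              · obtain rfl : a' = a := by omega
                exact .inr (by rw [← hq', hq]))
      refine ⟨b1, b3.trans ?_, ?_⟩
      · have : A.card * (20 + 6) ≤ c * 26 := Nat.mul_le_mul_right _ hA
        simp only [WExp.cost]; omega
      · refine (b2.congr (State.forget_word_ne _ (by norm_num)).symm fun _ => id).congr
          ((State.forget_word_ne _ (by norm_num)).trans rfl) ?_
        rintro q ⟨j', hj'', hjS, hq⟩
        rcases Nat.lt_or_ge j' j with hjj | hjj
        · exact .inl ⟨j', hjj, hjS, hq⟩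
        · obtain rfl : j' = ⟨j, hj⟩ := Fin.ext (by simp; omega)
          refine .inr ?_
          by_cases hqw : q < C.outWidth (k + 1) f
          · have : (⟨q, hqw⟩ : Fin _) ∈ A := by
              simp only [A, if_neg hjS]
              simpa [affectedBits] using (C.source_eq_succ_iff hreg hqw hj).1 hq
            obtain ⟨a, ha, he⟩ := A.exists_sort_getD this
            exact ⟨a, ha, he⟩
          · exact absurd hq (by simp [Circuit.source, hqw]))
  refine ⟨g1, (g2.congr (State.forget_word_ne _ (by norm_num)).symm fun _ => id).congr rfl
    fun q ⟨j, hj, hq⟩ => ⟨j, j.isLt, hj, hq⟩, g3.trans ?_⟩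
  have h1 : C.logSize (k + 1) * (20 + 30 * c + 6) ≤ L * (30 * c + 26) :=
    Nat.mul_le_mul hl1 (by omega)
  have h2 : 50 * (c + 1) * L = L * (30 * c + 26) + (20 * (c * L) + 24 * L) := by ring
  have h3 : 0 ≤ c * L := Nat.zero_le _
  simp only [WExp.cost]
  omega

theorem Cmd.run_exceptionalSources (h : E.ForVerifier C S L) {k c : ℕ} {f : Wiring}
    (hreg : IsRegularWith c (C.wiring (k + 1) f) (S (k + 1) f))
    (hf : C.outWidth (k + 1) f = C.logSize (k + 2)) (hk : k + 1 < C.depth) (hb : s.blocked = false)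
    (hw1 : s.word 1 0 = k) (hs : s.SourcesOn C (k + 1) f fun q =>
      ∃ j : Fin (C.logSize (k + 1)), j ∉ S (k + 1) f ∧ C.source (k + 1) f q = j + 1) :
    ((Cmd.exceptionalSources f).run E s).blocked = false ∧
      (∀ q < C.logSize (k + 2),
        ((Cmd.exceptionalSources f).run E s).word 6 q = C.source (k + 1) f q) ∧
      ((Cmd.exceptionalSources f).run E s).time ≤ s.time + 100 * (c + 1) * L := by
  have hM := h.memory
  have hw := h.bound
  have hL := h.one_le
  have hl1 := h.logSize_le (k + 1) (by omega) hk.le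
  have hl := h.logSize_le (k + 2) (by omega) hk
  have hp := h.two_pow_lt (i := k + 1) (by omega) hk.le
  have hp2 := h.two_pow_lt (i := k + 2) (by omega) hk
  set T := S (k + 1) f with hT
  have hTc : T.card ≤ c := hreg.card_le
  have hTw : T.card ≤ C.logSize (k + 1) := by
    have := Finset.card_le_univ T
    simpa only [Fintype.card_fin] using this
  let R : ℕ → Prop := fun q => ∃ j : Fin (C.logSize (k + 1)), j ∉ T ∧ C.source (k + 1) f q = j + 1
  have eN : ∀ s' : State F, s'.word 1 0 = k →
      (WExp.query (.numExceptions f) .cur (.const 0) (.const 0)).eval E s' = T.card :=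
    fun s' h1 => by
      rw [WExp.eval, (h.eval_layer hk h1).1, h.answer, Circuit.answer, ← hT,
        Nat.mod_eq_of_lt (by omega)]
  obtain ⟨g1, g2, g3⟩ := Cmd.run_count_const (E := E) (s := s) (i := 2)
    (n := .query (.numExceptions f) .cur (.const 0) (.const 0)) (N := T.card)
    (body := .count 3 (.logSize .next) (.compareBit f)) h.mem_pos
    (by simp [Cmd.compareBit, Cmd.count, Cmd.wordArrays]) hb
    (eN _ (by rw [State.putW_word_ne _ _ _ (by norm_num), hw1]))
    (fun e s' => s'.SourcesOn C (k + 1) f fun q => R q ∨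
      ∃ e' < e, C.source (k + 1) f q = ((T.sort (· ≤ ·)).map Fin.val).getD e' 0 + 1) (80 * L)
    (hs.congr (State.forget_word_ne _ (by norm_num)) fun q hq =>
      hq.resolve_right fun ⟨e', he', _⟩ => by omega)
    (by
      intro e he s' hb' he' hw' hf' hI
      have hk' : s'.word 1 0 = k := by
        rw [hw' 1 (by norm_num) (by simp [Cmd.compareBit, Cmd.count, Cmd.wordArrays]), hw1]
      have hI' : s'.SourcesOn C (k + 1) f _ :=
        hI.congr (State.forget_word_ne _ (by norm_num)).symm fun _ => id
      obtain ⟨j, hjT, hj⟩ := T.sort_getD_mem he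
      have hjlt := j.isLt
      have hj2 := Nat.pow_le_pow_right (show 0 < 2 by norm_num) hjlt.le
      obtain ⟨b1, b2, b3⟩ := Cmd.run_count_const (E := E) (s := s') (i := 3)
        (n := .logSize .next) (N := C.logSize (k + 2)) (body := .compareBit f) h.mem_pos
        (by simp [Cmd.compareBit, Cmd.wordArrays]) hb'
        (h.eval_layer hk (by rw [State.putW_word_ne _ _ _ (by norm_num), hk'])).2.2.2
        (fun i s'' => s''.SourcesOn C (k + 1) f fun q =>
          (R q ∨ ∃ e' < e, C.source (k + 1) f q = ((T.sort (· ≤ ·)).map Fin.val).getD e' 0 + 1) ∨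
            q < i ∧ C.source (k + 1) f q = j + 1) 60
        (hI'.congr (State.forget_word_ne _ (by norm_num)) fun q hq =>
          hq.resolve_right fun ⟨hq', _⟩ => by omega)
        (by
          intro q hq s'' hb'' hq'' hw'' hf'' hI''
          have hI₂ := hI''.congr (State.forget_word_ne (s := s'') (i := 3) (b := 6) (by norm_num)).symm
            fun _ => id
          have h1 : s''.word 1 0 = k := by
            rw [hw'' 1 (by norm_num) (by simp [Cmd.compareBit, Cmd.wordArrays]), hk']
          have v1 := (h.eval_layer hk h1).1
          have v2 : (wv 2).eval E s'' = e := WExp.eval_var h.mem_pos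
            (by rw [hw'' 2 (by norm_num) (by simp [Cmd.compareBit, Cmd.wordArrays]), he']) (by omega)
          have v3 : (wv 3).eval E s'' = q := WExp.eval_var h.mem_pos hq'' (by omega)
          have v4 : (WExp.exceptionalBit f).eval E s'' = j := by
            rw [WExp.eval, v1, v2, h.answer, Circuit.answer, ← hT, hj, Nat.mod_eq_of_lt (by omega)]
          have hwl : ∀ p, C.wire (k + 1) f p < 2 ^ E.wordSize := fun p => by
            have := C.wire_lt (k + 1) f p
            rw [hf] at this
            omega
          have v5 : (WExp.outputBit f (.const 0) (wv 3)).eval E s''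
              = ((C.wire (k + 1) f 0).testBit q).toNat := WExp.eval_bit (by omega)
            (WExp.eval_wire h.answer v1 WExp.eval_const_zero (hwl _)) v3
          have v6 : (WExp.outputBit f (.twoPow (.exceptionalBit f)) (wv 3)).eval E s''
              = ((C.wire (k + 1) f (2 ^ (j : ℕ))).testBit q).toNat := WExp.eval_bit (by omega)
            (WExp.eval_wire h.answer v1 (WExp.eval_twoPow v4 (by omega)) (hwl _)) v3
          have v7 := WExp.eval_op (o := .eq) v5 v6 (by simp only [WordOp.eval]; split_ifs <;> omega)
          have hiff := C.source_eq_succ_iff_ne hreg (k := q) (by omega) hjlt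
          rw [Cmd.compareBit, Cmd.run_ifW hb'']
          by_cases hsrc : C.source (k + 1) f q = j + 1
          · have hne := hiff.1 hsrc
            rw [if_neg (by
              rw [v7]
              revert hne
              cases (C.wire (k + 1) f 0).testBit q <;>
                cases (C.wire (k + 1) f (2 ^ (j : ℕ))).testBit q <;> simp [WordOp.eval])]
            set s₃ := s''.tick ((WExp.op .eq (.outputBit f (.const 0) (wv 3))
              (.outputBit f (.twoPow (.exceptionalBit f)) (wv 3))).cost + 1) with hs₃
            rw [Cmd.run_setW (show s₃.blocked = false from hb'')
              (by rw [hs₃, WExp.eval_tick, v3]; omega), hs₃, WExp.eval_tick, WExp.eval_tick, v3,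
              WExp.eval_plus v4 (by omega), ← hsrc]
            refine ⟨hb'', ?_, ?_⟩
            · simp only [State.tick_time, State.putW_time, WExp.cost]; omega
            · refine ((hI₂.put (J' := fun q' =>
                  (R q' ∨ ∃ e' < e, C.source (k + 1) f q' = ((T.sort (· ≤ ·)).map Fin.val).getD e' 0 + 1) ∨
                  q' < q + 1 ∧ C.source (k + 1) f q' = j + 1) (k := q) ?_)).congr
                (State.forget_word_ne _ (by norm_num)) fun _ hq' => by rwa [hsrc] at hq'
              rintro q' (hq' | ⟨hq', hqs⟩)
              · exact .inl (.inl hq')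
              · rcases Nat.lt_or_ge q' q with hqq | hqq
                · exact .inl (.inr ⟨hqq, hqs⟩)
                · exact .inr (by omega)
          · have heq := not_ne_iff.1 fun hc => hsrc (hiff.2 hc)
            rw [if_pos (by rw [v7, heq]; simp [WordOp.eval]), Cmd.run_skip (show (s''.tick _).blocked = false from hb'')]
            refine ⟨hb'', ?_, ?_⟩
            · simp only [State.tick_time, WExp.cost]; omega
            · refine hI₂.congr (State.forget_word_ne _ (by norm_num)) ?_
              rintro q' (hq' | ⟨hq', hqs⟩)
              · exact .inl hq'
              · rcases Nat.lt_or_ge q' q with hqq | hqq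
                · exact .inr ⟨hqq, hqs⟩
                · obtain rfl : q' = q := by omega
                  exact absurd hqs hsrc)
      refine ⟨b1, b3.trans ?_, ?_⟩
      · simp only [WExp.cost]; omega
      · refine (b2.congr (State.forget_word_ne _ (by norm_num)).symm fun _ => id).congr
          (State.forget_word_ne _ (by norm_num)) ?_
        rintro q (hq | ⟨e', he', hq⟩)
        · exact .inl (.inl hq)
        · rcases Nat.lt_or_ge e' e with hee | hee
          · exact .inl (.inr ⟨e', hee, hq⟩)
          · obtain rfl : e' = e := by omega
            refine .inr ⟨?_, by rw [hq, hj]⟩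
            by_contra hqw
            exact absurd hq (by simp [Circuit.source, hf, show ¬ q < C.logSize (k + 2) from hqw]))
  refine ⟨g1, fun q hq => ?_, g3.trans ?_⟩
  · rcases g2 q (by omega) with h1 | ⟨h1, h2⟩
    · rwa [State.forget_word_ne _ (by norm_num)] at h1
    · rw [State.forget_word_ne _ (by norm_num)] at h1
      rcases Nat.eq_zero_or_pos (C.source (k + 1) f q) with h0 | h0
      · rw [h0]; exact h1
      · exfalso
        refine h2 ?_
        have hle := C.source_le (k + 1) f q
        let j : Fin (C.logSize (k + 1)) := ⟨C.source (k + 1) f q - 1, by omega⟩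
        have hj : C.source (k + 1) f q = j + 1 := by simp only [j]; omega
        by_cases hjT : j ∈ T
        · obtain ⟨e, he, hej⟩ := T.exists_sort_getD hjT
          exact .inr ⟨e, he, by rw [hej, hj]⟩
        · exact .inl ⟨j, hjT, hj⟩
  · have h1 : T.card * (80 * L + 6) ≤ c * (80 * L + 6) := Nat.mul_le_mul_right _ hTc
    have h2 : 100 * (c + 1) * L = c * (80 * L + 6) + (6 * c * (L - 1) + 14 * c * L + 100 * L) := by
      obtain ⟨L', rfl⟩ : ∃ L', L = L' + 1 := ⟨L - 1, by omega⟩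
      simp only [Nat.add_sub_cancel]; ring
    have h3 : 0 ≤ 6 * c * (L - 1) + 14 * c * L := Nat.zero_le _
    simp only [WExp.cost]
    omega

theorem Cmd.run_sources (h : E.ForVerifier C S L) {k c : ℕ} {f : Wiring}
    (hreg : IsRegularWith c (C.wiring (k + 1) f) (S (k + 1) f))
    (hf : C.outWidth (k + 1) f = C.logSize (k + 2)) (hk : k + 1 < C.depth) (hb : s.blocked = false)
    (hw1 : s.word 1 0 = k) :
    ((Cmd.sources f).run E s).blocked = false ∧
      (∀ q < C.logSize (k + 2), ((Cmd.sources f).run E s).word 6 q = C.source (k + 1) f q) ∧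
      ((Cmd.sources f).run E s).time ≤ s.time + 200 * (c + 1) * L := by
  have fr : ∀ (c : Cmd), 1 ∉ c.wordArrays → ∀ s' : State F, s'.word 1 0 = k →
      (c.run E s').word 1 0 = k := fun c hc s' hs' => by rw [Cmd.run_word E c s' hc, hs']
  simp only [Cmd.sources, Cmd.run_seq]
  obtain ⟨a1, a2, a3⟩ := Cmd.run_clearSources h hf hk hb hw1
  have hw2 := fr .clearSources (by decide) s hw1
  obtain ⟨b1, b2, b3⟩ := Cmd.run_regularSources h hreg hf hk a1 hw2 a2
  have hw3 := fr (.regularSources f) (by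
    simp [Cmd.regularSources, Cmd.regularBit, Cmd.count, Cmd.wordArrays]) _ hw2
  obtain ⟨c1, c2, c3⟩ := Cmd.run_exceptionalSources h hreg hf hk b1 hw3 b2
  refine ⟨c1, c2, ?_⟩
  have : 200 * (c + 1) * L = 50 * (c + 1) * L + 100 * (c + 1) * L + 50 * (c * L) + 50 * L := by ring
  have h3 : 0 ≤ c * L := Nat.zero_le _
  omega

end Verifier

section Verifier

variable {F : Type u} [Field F] [DecidableEq F] {E : Env F} {s : State F}
variable {C : Circuit} {S : C.Exceptions} {L : ℕ}

/-! #### The multilinear extensions of the wiring functions -/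

/-- For every source `g` the weight that the output bits with this source contribute, if the wiring
function `f` is evaluated at `p`. -/
def Cmd.sourceWeights (f : Wiring) (x : ℕ) (p : WExp) : Cmd :=
  .seq (.count 2 (.plus (.logSize .cur) 1) (.setF x (wv 2) 1))
    (.count 2 (.logSize .next) (.setF x (.get 6 (wv 2))
      (.get x (.get 6 (wv 2)) * .bw (.get 6 (wv 2)) (.outputBit f p (wv 2)))))

/-- The source of the output bit `wv 2`, as a bit string in which only the source is set. -/
abbrev WExp.sourceBit : WExp := .twoPow (.op .sub (.get 6 (wv 2)) (.const 1))

/-- Evaluate the multilinear extension of the wiring function `f` at the points in the field arrays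
`5` and `6`. -/
def Cmd.wireExtension (f : Wiring) (a : ℕ) : Cmd :=
  .seq (.sources f) (.seq (.sourceWeights f 15 (.const 0)) (.seq (.sourceWeights f 16 .sourceBit)
    (.seq (.prodLoop 17 2 (.logSize .cur) ((1 - .get 5 (wv 2)) * .get 15 (.plus (wv 2) 1)
        + .get 5 (wv 2) * .get 16 (.plus (wv 2) 1)))
      (.setF a (.const 0) (fv 15 * fv 17)))))

theorem Cmd.run_sourceWeights (h : E.ForVerifier C S L) {k x : ℕ} {f : Wiring} {z : ℕ → F}
    {p : WExp} {b : Bool} (hx : x ≠ 6 ∧ x ≠ 12) (hcost : p.cost ≤ 10)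
    (hf : C.outWidth (k + 1) f = C.logSize (k + 2)) (hk : k + 1 < C.depth) (hb : s.blocked = false)
    (hw1 : s.word 1 0 = k) (hw6 : ∀ q < C.logSize (k + 2), s.word 6 q = C.source (k + 1) f q)
    (hbits : s.HasBits) (hz : ∀ q < C.logSize (k + 2), s.fld 6 q = z q)
    (hp : ∀ q < C.logSize (k + 2), ∀ s' : State F, (∀ b, b ≠ 2 → s'.word b = s.word b) →
      s'.word 2 0 = q → p.eval E s' = if b then 2 ^ (C.source (k + 1) f q - 1) else 0) :
    ((Cmd.sourceWeights f x p).run E s).blocked = false ∧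
      (∀ g ≤ C.logSize (k + 1), ((Cmd.sourceWeights f x p).run E s).fld x g
        = C.sourceWeight (k + 1) f (C.logSize (k + 2)) z g b) ∧
      ((Cmd.sourceWeights f x p).run E s).time ≤ s.time + 200 * L := by
  have hM := h.memory
  have hw := h.bound
  have hL := h.one_le
  have hl1 := h.logSize_le (k + 1) (by omega) hk.le
  have hl := h.logSize_le (k + 2) (by omega) hk
  have hp2 := h.two_pow_lt (i := k + 2) (by omega) hk
  rw [Cmd.sourceWeights, Cmd.run_seq]
  obtain ⟨a1, a2, a3⟩ := Cmd.run_count_setF (E := E) (s := s) (i := 2) (a := x)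
    (n := .plus (.logSize .cur) 1) (N := C.logSize (k + 1) + 1) (idx := wv 2) (e := 1) h.mem_pos hb
    (WExp.eval_plus (h.eval_layer hk
      (by rw [State.putW_word_ne _ _ _ (by norm_num), hw1])).2.2.1 (by omega))
    (fun m g => if g < m then 1 else s.fld x g) (by funext g; simp)
    (by
      intro m hm s' hm' _ _ _
      have e1 : (wv 2).eval E s' = m := WExp.eval_var h.mem_pos hm' (by omega)
      rw [e1]
      refine ⟨by omega, fun g => ?_⟩
      rw [FExp.eval_one]
      split_ifs <;> first | rfl | omega)
  have aF : ∀ b, b ≠ x → ((Cmd.count 2 (.plus (.logSize .cur) 1) (.setF x (wv 2) 1)).run E s).fld b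
      = s.fld b := fun b hb => Cmd.run_fld E _ s (by simp [Cmd.count, Cmd.fldArrays, hb])
  have aW : ∀ b, b ≠ 2 → ((Cmd.count 2 (.plus (.logSize .cur) 1) (.setF x (wv 2) 1)).run E s).word b
      = s.word b := fun b hb => Cmd.run_word E _ s (by simp [Cmd.count, Cmd.wordArrays, hb])
  set s₁ := (Cmd.count 2 (.plus (.logSize .cur) 1) (.setF x (wv 2) 1)).run E s
  have hbits₁ : ∀ s' : State F, s'.fld 12 = s₁.fld 12 → s'.HasBits := fun s' hs' => by
    rw [State.HasBits, hs', aF 12 (Ne.symm hx.2)]; exact hbits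
  obtain ⟨b1, b2, b3⟩ := Cmd.run_count_setF (E := E) (s := s₁) (i := 2) (a := x)
    (n := .logSize .next) (N := C.logSize (k + 2)) (idx := .get 6 (wv 2))
    (e := .get x (.get 6 (wv 2)) * .bw (.get 6 (wv 2)) (.outputBit f p (wv 2))) h.mem_pos a1
    (h.eval_layer hk (by rw [State.putW_word_ne _ _ _ (by norm_num), aW 1 (by norm_num), hw1])).2.2.2
    (fun m g => s₁.fld x g * C.sourceWeight (k + 1) f m z g b) (by
      funext g; simp [Circuit.sourceWeight])
    (by
      intro q hq s' hq' hW hF hA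
      have hW' : ∀ b, b ≠ 2 → s'.word b = s.word b := fun b hb => (hW b hb).trans (aW b hb)
      have hsrc := C.source_le (k + 1) f q
      have e1 : (wv 2).eval E s' = q := WExp.eval_var h.mem_pos hq' (by omega)
      have e2 : (WExp.get 6 (wv 2)).eval E s' = C.source (k + 1) f q :=
        WExp.eval_get e1 (by omega) (by rw [hW' 6 (by norm_num), hw6 q hq]) (by omega)
      have hwl : ∀ p, C.wire (k + 1) f p < 2 ^ E.wordSize := fun p => by
        have := C.wire_lt (k + 1) f p
        rw [hf] at this
        omega
      have e3 : (WExp.outputBit f p (wv 2)).eval E s' = ((C.wire (k + 1) f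
          (if b then 2 ^ (C.source (k + 1) f q - 1) else 0)).testBit q).toNat :=
        WExp.eval_bit (by omega) (WExp.eval_wire h.answer
          (h.eval_layer hk (by rw [hW' 1 (by norm_num), hw1])).1 (hp q hq s' hW' hq') (hwl _)) e1
      have e4 : (FExp.get 6 (wv 2)).eval E s' = z q := by
        rw [FExp.eval_get e1 (by omega), hF 6 (Ne.symm hx.1), aF 6 (Ne.symm hx.1), hz q hq]
      rw [e2]
      refine ⟨by omega, fun g => ?_⟩
      rw [FExp.eval_mul, FExp.eval_bw (hbits₁ s' (hF 12 (Ne.symm hx.2))) (by omega) e4 e3,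
        FExp.eval_get e2 (by omega), hA]
      simp only [Circuit.sourceWeight, Finset.prod_range_succ]
      by_cases hg : g = C.source (k + 1) f q
      · rw [if_pos hg, hg, if_pos rfl, mul_assoc]
      · rw [if_neg hg, if_neg (Ne.symm hg), mul_one])
  refine ⟨b1, fun g hg => ?_, ?_⟩
  · rw [b2, a2]
    simp only [Nat.lt_succ_of_le hg, if_true, one_mul]
  · have c1 : (FExp.get x (.get 6 (wv 2)) * .bw (.get 6 (wv 2)) (.outputBit f p (wv 2))).cost
        ≤ 80 := by
      simp only [FExp.cost_sub, FExp.cost, WExp.cost]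
      omega
    have c2 := Nat.mul_le_mul hl (show (WExp.get 6 (wv 2)).cost + (FExp.get x (.get 6 (wv 2)) *
      .bw (.get 6 (wv 2)) (.outputBit f p (wv 2))).cost + 7 ≤ 90 by
        simp only [WExp.cost]; omega)
    simp only [WExp.cost, FExp.cost_one] at a3 b3 c2
    omega

theorem Cmd.run_wireExtension (h : E.ForVerifier C S L) {k c a : ℕ} {f : Wiring} {r z : ℕ → F}
    (hreg : IsRegularWith c (C.wiring (k + 1) f) (S (k + 1) f))
    (hf : C.outWidth (k + 1) f = C.logSize (k + 2)) (hk : k + 1 < C.depth) (hb : s.blocked = false)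
    (hw1 : s.word 1 0 = k) (hbits : s.HasBits) (hr : ∀ q < C.logSize (k + 1), s.fld 5 q = r q)
    (hz : ∀ q < C.logSize (k + 2), s.fld 6 q = z q) :
    ((Cmd.wireExtension f a).run E s).blocked = false ∧
      ((Cmd.wireExtension f a).run E s).fld a 0 = ∑ p ∈ Finset.range (2 ^ C.logSize (k + 1)),
        wt (C.logSize (k + 1)) r p * wt (C.logSize (k + 2)) z (C.wire (k + 1) f p) ∧
      ((Cmd.wireExtension f a).run E s).time ≤ s.time + 1000 * (c + 1) * L := by
  have hM := h.memory
  have hw := h.bound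
  have hL := h.one_le
  have hl1 := h.logSize_le (k + 1) (by omega) hk.le
  have hl := h.logSize_le (k + 2) (by omega) hk
  have hpw := h.two_pow_lt (i := k + 1) (by omega) hk.le
  simp only [Cmd.wireExtension, Cmd.run_seq]
  obtain ⟨a1, a2, a3⟩ := Cmd.run_sources h hreg hf hk hb hw1
  have aF : ∀ b, ((Cmd.sources f).run E s).fld b = s.fld b := fun b =>
    Cmd.run_fld E _ s (by
      simp [Cmd.sources, Cmd.clearSources, Cmd.regularSources, Cmd.regularBit,
        Cmd.exceptionalSources, Cmd.compareBit, Cmd.count, Cmd.fldArrays])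
  have aW : ((Cmd.sources f).run E s).word 1 = s.word 1 :=
    Cmd.run_word E _ s (by
      simp [Cmd.sources, Cmd.clearSources, Cmd.regularSources, Cmd.regularBit,
        Cmd.exceptionalSources, Cmd.compareBit, Cmd.count, Cmd.wordArrays])
  set s₁ := (Cmd.sources f).run E s
  have wF : ∀ (x : ℕ) (p : WExp) (s' : State F) (b : ℕ), b ≠ x →
      ((Cmd.sourceWeights f x p).run E s').fld b = s'.fld b := fun x p s' b hb =>
    Cmd.run_fld E _ s' (by simp [Cmd.sourceWeights, Cmd.count, Cmd.fldArrays, hb])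
  have wW : ∀ (x : ℕ) (p : WExp) (s' : State F) (b : ℕ), b ≠ 2 →
      ((Cmd.sourceWeights f x p).run E s').word b = s'.word b := fun x p s' b hb =>
    Cmd.run_word E _ s' (by simp [Cmd.sourceWeights, Cmd.count, Cmd.wordArrays, hb])
  obtain ⟨b1, b2, b3⟩ := Cmd.run_sourceWeights h (s := s₁) (x := 15) (f := f) (p := .const 0)
    (b := false) (z := z) (by norm_num) (by norm_num [WExp.cost]) hf hk a1 (by rw [aW, hw1]) a2
    (by rw [State.HasBits, aF]; exact hbits) (fun q hq => by rw [aF, hz q hq])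
    (fun q hq s' _ _ => WExp.eval_const_zero)
  have bF := wF 15 (.const 0) s₁
  have bW := wW 15 (.const 0) s₁
  set s₂ := (Cmd.sourceWeights f 15 (.const 0)).run E s₁
  obtain ⟨c1, c2, c3⟩ := Cmd.run_sourceWeights h (s := s₂) (x := 16) (f := f) (p := .sourceBit)
    (b := true) (z := z) (by norm_num) (by norm_num [WExp.cost]) hf hk b1
    (by rw [bW 1 (by norm_num), aW, hw1]) (fun q hq => by rw [bW 6 (by norm_num), a2 q hq])
    (by rw [State.HasBits, bF 12 (by norm_num), aF]; exact hbits)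
    (fun q hq => by rw [bF 6 (by norm_num), aF, hz q hq])
    (fun q hq s' hW hq' => by
      have hsrc := C.source_le (k + 1) f q
      have hpow := Nat.pow_le_pow_right (show 0 < 2 by norm_num)
        (show C.source (k + 1) f q - 1 ≤ C.logSize (k + 1) by omega)
      have e1 : (wv 2).eval E s' = q := WExp.eval_var h.mem_pos hq' (by omega)
      have e2 : (WExp.get 6 (wv 2)).eval E s' = C.source (k + 1) f q :=
        WExp.eval_get e1 (by omega)
          (by rw [hW 6 (by norm_num), bW 6 (by norm_num), a2 q hq]) (by omega)
      have e3 : (WExp.op .sub (.get 6 (wv 2)) (.const 1)).eval E s' = C.source (k + 1) f q - 1 :=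
        WExp.eval_op (o := .sub) e2 (WExp.eval_const (by omega)) (by simp only [WordOp.eval]; omega)
      exact WExp.eval_twoPow e3 (by omega))
  have cF := wF 16 .sourceBit s₂
  have cW := wW 16 .sourceBit s₂
  set s₃ := (Cmd.sourceWeights f 16 .sourceBit).run E s₂
  obtain ⟨d1, d2, d3⟩ := Cmd.run_prodLoop (E := E) (s := s₃) (a := 17) (i := 2)
    (n := .logSize .cur) (N := C.logSize (k + 1))
    (e := (1 - .get 5 (wv 2)) * .get 15 (.plus (wv 2) 1) + .get 5 (wv 2) * .get 16 (.plus (wv 2) 1))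
    (fun j => (1 - r j) * C.sourceWeight (k + 1) f (C.logSize (k + 2)) z (j + 1) false
            + r j * C.sourceWeight (k + 1) f (C.logSize (k + 2)) z (j + 1) true) h.mem_pos c1
    (fun s' hs' => (h.eval_layer hk (by
      rw [hs' 1 (by norm_num), cW 1 (by norm_num), bW 1 (by norm_num), aW, hw1])).2.2.1)
    (by
      intro j hj s' hj' _ hF
      have e1 : (wv 2).eval E s' = j := WExp.eval_var h.mem_pos hj' (by omega)
      have e2 : (WExp.plus (wv 2) 1).eval E s' = j + 1 := WExp.eval_plus e1 (by omega)
      simp only [FExp.eval_add, FExp.eval_mul, FExp.eval_sub, FExp.eval_one,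
        FExp.eval_get e1 (show j < E.memSize by omega),
        FExp.eval_get e2 (show j + 1 < E.memSize by omega)]
      rw [hF 5 (by norm_num), hF 15 (by norm_num), hF 16 (by norm_num), cF 5 (by norm_num),
        bF 5 (by norm_num), aF, hr j hj, cF 15 (by norm_num), b2 (j + 1) (by omega),
        c2 (j + 1) (by omega)])
  have dF : ∀ b, b ≠ 17 → ((Cmd.prodLoop 17 2 (.logSize .cur)
      ((1 - .get 5 (wv 2)) * .get 15 (.plus (wv 2) 1)
        + .get 5 (wv 2) * .get 16 (.plus (wv 2) 1))).run E s₃).fld b = s₃.fld b := fun b hb =>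
    Cmd.run_fld E _ s₃ (by simp [Cmd.prodLoop, Cmd.count, Cmd.fldArrays, hb])
  set s₄ := (Cmd.prodLoop 17 2 (.logSize .cur) ((1 - .get 5 (wv 2)) * .get 15 (.plus (wv 2) 1)
        + .get 5 (wv 2) * .get 16 (.plus (wv 2) 1))).run E s₃
  rw [Cmd.run_setF d1 (by rw [WExp.eval_const_zero]; exact h.mem_pos), WExp.eval_const_zero,
    FExp.eval_mul, FExp.eval_var h.mem_pos, FExp.eval_var h.mem_pos, d2, dF 15 (by norm_num),
    cF 15 (by norm_num), b2 0 (Nat.zero_le _)]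
  refine ⟨d1, ?_, ?_⟩
  · rw [Circuit.sum_wt_mul_wt_wire hreg hf.symm]
    simp
  · have : 1000 * (c + 1) * L = 200 * (c + 1) * L + 800 * (c * L) + 800 * L := by ring
    have h3 : 0 ≤ c * L := Nat.zero_le _
    simp only [FExp.cost_sub, WExp.cost, FExp.cost] at d3
    have h4 := Nat.mul_le_mul_right 50 hl1
    simp only [State.tick_time, State.putF_time, FExp.cost, WExp.cost]
    omega

end Verifier

section Verifier

variable {F : Type u} [Field F] [DecidableEq F] {E : Env F} {s : State F}
variable {C : Circuit} {S : C.Exceptions} {L : ℕ}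

/-! #### A layer -/

/-- The next coordinate of the point to which the claim on the next layer refers: a random field
element, but at the input layer the coordinate at which the multilinear extension of the input has
been evaluated. -/
def Cmd.nextCoordinate : Cmd :=
  .ifW (.op .eq .next .depth) (.setF 6 (wv 2) (.get 3 (wv 2))) (.rand 6 (wv 2))

/-- The new factor in front of the multilinear extension of the next layer. -/
def Cmd.updateScale : Cmd :=
  .seq (.wireExtension .in₁ 18) (.seq (.wireExtension .in₂ 19)
    (.setF 9 (.const 0) (fv 18 + fv 14 * fv 19)))

/-- Make the new point the current one. -/
def Cmd.copyPoint : Cmd := .count 2 (.logSize .next) (.setF 4 (wv 2) (.get 6 (wv 2)))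

/-- The interaction about layer `wv 1 + 1`. -/
def Cmd.verifierLayer : Cmd :=
  .seq (.verifierSumCheck 5 (.logSize .cur) (.rand 5 (wv 2))) (.seq .verifierMid
    (.seq (.verifierSumCheck 6 (.logSize .next) .nextCoordinate) (.seq .updateScale .copyPoint)))

theorem Cmd.run_updateScale (h : E.ForVerifier C S L) {k c : ℕ} {chal : ℕ → F}
    (hreg : ∀ f, IsRegularWith c (C.wiring (k + 1) f) (S (k + 1) f))
    (hk : k + 1 < C.depth) (hb : s.blocked = false)
    (hw1 : s.word 1 0 = k) (hbits : s.HasBits)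
    (hr : ∀ q < C.logSize (k + 1), s.fld 5 q = shift chal (C.start₁ k) q)
    (hz : ∀ q < C.logSize (k + 2), s.fld 6 q = shift chal (C.pos (k + 1)) q)
    (hm : s.fld 14 0 = chal (C.mid k)) :
    (Cmd.updateScale.run E s).blocked = false ∧
      (Cmd.updateScale.run E s).fld 9 0 = C.scale chal (k + 1) ∧
      (Cmd.updateScale.run E s).time ≤ s.time + 2100 * (c + 1) * L := by
  have hM := h.memory
  have hL := h.one_le
  simp only [Cmd.updateScale, Cmd.run_seq]
  obtain ⟨a1, a2, a3⟩ := Cmd.run_wireExtension h (a := 18) (hreg .in₁) rfl hk hb hw1 hbits hr hz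
  have fF : ∀ (s' : State F) (f : Wiring) (a : ℕ), ∀ b, b ≠ 15 → b ≠ 16 → b ≠ 17 → b ≠ a →
      ((Cmd.wireExtension f a).run E s').fld b = s'.fld b := fun s' f a b h1 h2 h3 h4 =>
    Cmd.run_fld E _ s' (by
      simp [Cmd.wireExtension, Cmd.sources, Cmd.clearSources, Cmd.regularSources, Cmd.regularBit,
        Cmd.exceptionalSources, Cmd.compareBit, Cmd.sourceWeights, Cmd.prodLoop, Cmd.count,
        Cmd.fldArrays, h1, h2, h3, h4])
  have fW : ((Cmd.wireExtension .in₁ 18).run E s).word 1 = s.word 1 :=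
    Cmd.run_word E _ s (by decide)
  have aF := fF s .in₁ 18
  set s₁ := (Cmd.wireExtension .in₁ 18).run E s
  obtain ⟨b1, b2, b3⟩ := Cmd.run_wireExtension h (s := s₁) (a := 19) (r := shift chal (C.start₁ k))
    (z := shift chal (C.pos (k + 1))) (hreg .in₂) rfl hk a1
    (by rw [fW, hw1])
    (by rw [State.HasBits, aF 12 (by norm_num) (by norm_num) (by norm_num) (by norm_num)]
        exact hbits)
    (fun q hq => by
      rw [aF 5 (by norm_num) (by norm_num) (by norm_num) (by norm_num)]; exact hr q hq)
    (fun q hq => by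
      rw [aF 6 (by norm_num) (by norm_num) (by norm_num) (by norm_num)]; exact hz q hq)
  have bF := fF s₁ .in₂ 19
  set s₂ := (Cmd.wireExtension .in₂ 19).run E s₁
  rw [Cmd.run_setF b1 (by rw [WExp.eval_const_zero]; exact h.mem_pos), WExp.eval_const_zero,
    FExp.eval_add, FExp.eval_mul, FExp.eval_var h.mem_pos, FExp.eval_var h.mem_pos,
    FExp.eval_var h.mem_pos, b2,
    bF 18 (by norm_num) (by norm_num) (by norm_num) (by norm_num), a2,
    bF 14 (by norm_num) (by norm_num) (by norm_num) (by norm_num),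
    aF 14 (by norm_num) (by norm_num) (by norm_num) (by norm_num), hm]
  refine ⟨b1, ?_, ?_⟩
  · rw [C.scale_succ, Finset.mul_sum, ← Finset.sum_add_distrib]
    simp only [State.tick_fld, State.putF_fld, and_self, if_true]
    exact Finset.sum_congr rfl fun p _ => by ring
  · have : 2100 * (c + 1) * L
        = 1000 * (c + 1) * L + 1000 * (c + 1) * L + 100 * (c * L) + 100 * L := by ring
    have h3 : 0 ≤ c * L := Nat.zero_le _
    have h4 : (fv 18 + fv 14 * fv 19 : FExp).cost = 8 := rfl
    simp only [State.tick_time, State.putF_time, WExp.cost, h4]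
    omega

theorem Cmd.run_copyPoint (h : E.ForVerifier C S L) {k : ℕ} (hk : k + 1 < C.depth)
    (hb : s.blocked = false) (hw1 : s.word 1 0 = k) :
    (Cmd.copyPoint.run E s).blocked = false ∧
      (∀ q < C.logSize (k + 2), (Cmd.copyPoint.run E s).fld 4 q = s.fld 6 q) ∧
      (Cmd.copyPoint.run E s).time ≤ s.time + 50 * L := by
  have hM := h.memory
  have hw := h.bound
  have hL := h.one_le
  have hl := h.logSize_le (k + 2) (by omega) hk
  obtain ⟨a1, a2, a3⟩ := Cmd.run_count_setF (E := E) (s := s) (i := 2) (a := 4)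
    (n := .logSize .next) (N := C.logSize (k + 2)) (idx := wv 2) (e := .get 6 (wv 2)) h.mem_pos hb
    (h.eval_layer hk (by rw [State.putW_word_ne _ _ _ (by norm_num), hw1])).2.2.2
    (fun m g => if g < m then s.fld 6 g else s.fld 4 g) (by funext g; simp)
    (by
      intro m hm s' hm' _ hF _
      have e1 : (wv 2).eval E s' = m := WExp.eval_var h.mem_pos hm' (by omega)
      rw [e1, FExp.eval_get e1 (by omega), hF 6 (by norm_num)]
      refine ⟨by omega, fun g => ?_⟩
      by_cases hg : g = m
      · rw [if_pos (by omega), if_pos hg, hg]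
      · rw [if_neg hg]
        split_ifs <;> first | rfl | omega)
  refine ⟨a1, fun q hq => ?_, a3.trans ?_⟩
  · refine (congrFun a2 q).trans ?_
    simp only [hq, if_true]
  · simp only [WExp.cost, FExp.cost]
    omega

/-- The state of the verifier before the sum-checks of layer `k + 1`. -/
structure State.VerifierAt (s : State F) (C : Circuit) (chal out : ℕ → F) (msg : ℕ → ℕ → F)
    (k : ℕ) : Prop where
  round : s.AtRound C chal out msg (C.start₁ k)
  point : ∀ q < C.logSize (k + 1), s.fld 4 q = shift chal (C.pos k) q
  scale : s.fld 9 0 = C.scale chal k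
  drawn : k < C.depth - 1 → s.drawn = C.logSize C.depth + C.start₁ k
  checks : s.rejected = false ↔ ∀ k' < k, C.LayerAccepts chal out msg k'

theorem Cmd.run_verifierLayer (h : E.ForVerifier C S L) {P' : Strategy F}
    (hin : ∀ l k, E.inbox l k = some (P' l k)) {k c : ℕ} {chal out : ℕ → F}
    (hreg : ∀ f, IsRegularWith c (C.wiring (k + 1) f) (S (k + 1) f)) (hk : k + 1 < C.depth)
    (hs : s.VerifierAt C chal out (P'.message C.numOutputs chal) k) (hw1 : s.word 1 0 = k)
    (hbits : s.HasBits)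
    (hsaved : ∀ q < C.logSize C.depth, s.fld 3 q = shift chal (C.pos (C.depth - 1)) q)
    (hcoin : ∀ t < C.pos (C.depth - 1), E.coin (C.logSize C.depth + t) = chal t) :
    (Cmd.verifierLayer.run E s).VerifierAt C chal out (P'.message C.numOutputs chal) (k + 1) ∧
      (Cmd.verifierLayer.run E s).time ≤ s.time + 4000 * (c + 1) * L := by
  have hM := h.memory
  have hw := h.bound
  have hL := h.one_le
  have hl1 := h.logSize_le (k + 1) (by omega) hk.le
  have hl := h.logSize_le (k + 2) (by omega) hk
  have hm := C.start₁_add k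
  have hm' := C.mid_add_one k
  have hge := C.logSize_one_le_start₁ k
  have hle := C.pos_mono (show k + 1 ≤ C.depth - 1 by omega)
  have h3 : C.start₁ (k + 1) = C.pos (k + 1) + C.logSize (k + 2) := rfl
  simp only [Cmd.verifierLayer, Cmd.run_seq]
  -- the first sum-check
  obtain ⟨a1, a2, a3, a4, a5⟩ := Cmd.run_verifierSumCheck (s := s) h hin (pt := 5)
    (mE := .logSize .cur) (draw := .rand 5 (wv 2)) (δ := 1) (chal := chal) (out := out)
    (by norm_num) hl1 hge hs.round
    (fun s' hs' => (h.eval_layer hk (by rw [hs' 1 (by norm_num) (by norm_num), hw1])).2.2.1)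
    (by simp [Cmd.wordArrays]) (by simp [Cmd.fldArrays])
    (fun j hj s' hb' hd hj' _ _ => ⟨3, by norm_num, by
      have e1 : (wv 2).eval E s' = j := WExp.eval_var h.mem_pos hj' (by omega)
      rw [Cmd.run_rand hb' (by rw [e1]; omega), e1, hd, hs.drawn (by omega), one_mul, add_assoc,
        hcoin _ (by omega)]
      rfl⟩)
  have aF : ∀ b ∈ [1, 3, 4, 9, 12], ((Cmd.verifierSumCheck 5 (.logSize .cur)
      (.rand 5 (wv 2))).run E s).fld b = s.fld b := fun b hb =>
    Cmd.run_fld E _ s (by revert b; decide)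
  have aW : ((Cmd.verifierSumCheck 5 (.logSize .cur) (.rand 5 (wv 2))).run E s).word 1 = s.word 1 :=
    Cmd.run_word E _ s (by decide)
  set s₁ := (Cmd.verifierSumCheck 5 (.logSize .cur) (.rand 5 (wv 2))).run E s
  rw [hm] at a1
  -- the round between the sum-checks
  obtain ⟨b1, b2, b3, b4, b5, b6⟩ := Cmd.run_verifierMid (s := s₁) h hin (hreg .type) hk a1
    (by rw [aW, hw1]) (by rw [State.HasBits, aF 12 (by decide)]; exact hbits)
    (by rw [aF 4 (by decide)]; exact hs.point) a4 (by rw [aF 9 (by decide)]; exact hs.scale)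
    (by rw [a2, hs.drawn (by omega), ← hcoin _ (show C.mid k < C.pos (C.depth - 1) by omega), ← hm]
        congr 1; omega)
  have bW : (Cmd.verifierMid.run E s₁).word 1 = s₁.word 1 := Cmd.run_word E _ s₁ (by decide)
  set s₂ := Cmd.verifierMid.run E s₁
  have hw₂ : s₂.word 1 0 = k := by rw [bW, aW, hw1]
  have hd₂ : s₂.drawn = C.logSize C.depth + C.pos (k + 1) := by
    rw [b2, a2, hs.drawn (by omega)]; omega
  -- the second sum-check
  have hnext : ∀ s' : State F, s'.word 1 0 = k → (WExp.op .eq .next .depth).eval E s'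
      = if k + 2 = C.depth then 1 else 0 := fun s' hs' =>
    WExp.eval_op (o := .eq) (h.eval_layer hk hs').2.1 h.eval_depth (by
      simp only [WordOp.eval]; split_ifs <;> omega)
  obtain ⟨c1, c2, c3, c4, c5⟩ := Cmd.run_verifierSumCheck (s := s₂) h hin (pt := 6)
    (mE := .logSize .next) (draw := .nextCoordinate) (δ := if k + 2 = C.depth then 0 else 1)
    (chal := chal) (out := out) (by norm_num) hl (show C.logSize 1 ≤ C.pos (k + 1) by omega) b1
    (fun s' hs' => (h.eval_layer hk (by rw [hs' 1 (by norm_num) (by norm_num), hw₂])).2.2.2)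
    (by simp [Cmd.nextCoordinate, Cmd.wordArrays]) (by simp [Cmd.nextCoordinate, Cmd.fldArrays])
    (fun j hj s' hb' hd hj' hW hF => by
      have e1 : (wv 2).eval E s' = j := WExp.eval_var h.mem_pos hj' (by omega)
      have e2 := hnext s' (by rw [hW 1 (by norm_num) (by norm_num), hw₂])
      rw [Cmd.nextCoordinate, Cmd.run_ifW hb', e2]
      by_cases hlast : k + 2 = C.depth
      · rw [if_pos hlast, if_pos hlast, if_pos one_ne_zero]
        refine ⟨16, by norm_num, ?_⟩
        rw [Cmd.run_setF (show (s'.tick _).blocked = false from hb')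
          (by rw [WExp.eval_tick, e1]; omega), WExp.eval_tick, FExp.eval_tick, e1,
          FExp.eval_get e1 (by omega), hF 3 (by norm_num) (by norm_num) (by norm_num),
          b5 3 (by decide), aF 3 (by decide), hsaved j (by rw [← hlast]; exact hj),
          show C.depth - 1 = k + 1 by omega]
        rfl
      · rw [if_neg hlast] at hd ⊢
        rw [if_neg hlast, if_neg (by simp)]
        refine ⟨13, by norm_num, ?_⟩
        have hle' := C.pos_mono (show k + 2 ≤ C.depth - 1 by omega)
        have hm₂ : C.pos (k + 2) = C.pos (k + 1) + (2 * C.logSize (k + 2) + 1) := rfl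
        rw [Cmd.run_rand (show (s'.tick _).blocked = false from hb')
          (by rw [WExp.eval_tick, e1]; omega), WExp.eval_tick, e1,
          show (s'.tick ((WExp.op .eq .next .depth).cost + 1)).drawn = s'.drawn from rfl,
          hd, hd₂, one_mul, add_assoc, hcoin _ (by omega)]
        rfl)
  have cF : ∀ b ∈ [1, 3, 5, 12, 14], ((Cmd.verifierSumCheck 6 (.logSize .next)
      .nextCoordinate).run E s₂).fld b = s₂.fld b := fun b hb =>
    Cmd.run_fld E _ s₂ (by revert b; decide)
  have cW : ((Cmd.verifierSumCheck 6 (.logSize .next) .nextCoordinate).run E s₂).word 1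
      = s₂.word 1 := Cmd.run_word E _ s₂ (by decide)
  set s₃ := (Cmd.verifierSumCheck 6 (.logSize .next) .nextCoordinate).run E s₂
  have hw₃ : s₃.word 1 0 = k := by rw [cW, hw₂]
  -- the factor and the point
  obtain ⟨d1, d2, d3⟩ := Cmd.run_updateScale (s := s₃) (chal := chal) h hreg hk c1.blocked hw₃
    (by rw [State.HasBits, cF 12 (by decide), b5 12 (by decide), aF 12 (by decide)]; exact hbits)
    (by rw [cF 5 (by decide), b5 5 (by decide)]; exact a4) c4
    (by rw [cF 14 (by decide)]; exact b4)
  have dF : ∀ b ∈ [6, 8], (Cmd.updateScale.run E s₃).fld b = s₃.fld b := fun b hb =>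
    Cmd.run_fld E _ s₃ (by revert b; decide)
  have dW : (Cmd.updateScale.run E s₃).word 1 = s₃.word 1 := Cmd.run_word E _ s₃ (by decide)
  have dQ := Cmd.run_quiet E .updateScale s₃ (by decide)
  set s₄ := Cmd.updateScale.run E s₃
  obtain ⟨e1, e2, e3⟩ := Cmd.run_copyPoint (s := s₄) h hk d1 (by rw [dW, hw₃])
  have eF : ∀ b ∈ [8, 9], (Cmd.copyPoint.run E s₄).fld b = s₄.fld b := fun b hb =>
    Cmd.run_fld E _ s₄ (by revert b; decide)
  have eQ := (Cmd.run_quiet E .copyPoint s₄ (by decide)).trans dQ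
  refine ⟨⟨⟨e1, eQ.sent.trans c1.sent, eQ.received.trans c1.received, eQ.output.trans c1.output, ?_⟩,
    fun q hq => ?_, ?_, fun hk' => ?_, ?_⟩, ?_⟩
  · rw [eF 8 (by decide), dF 8 (by decide)]; exact c1.claim
  · rw [e2 q hq, dF 6 (by decide), c4 q hq]
  · rw [eF 9 (by decide), d2]
  · rw [eQ.drawn, c2, hd₂, if_neg (by omega), h3]; ring
  · rw [eQ.rejected, c3, b3, a3, hs.checks]
    constructor
    · rintro ⟨⟨⟨g1, g2⟩, g3⟩, g4⟩ k' hk'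
      rcases Nat.lt_or_ge k' k with hkk | hkk
      · exact g1 k' hkk
      · obtain rfl : k' = k := by omega
        exact ⟨g2, g3, g4⟩
    · intro g
      have := g k (by omega)
      exact ⟨⟨⟨fun k' hk' => g k' (by omega), this.first⟩, this.mid⟩, this.second⟩
  · have t1 : 4000 * (c + 1) * L = 2100 * (c + 1) * L + 1900 * (c * L) + 1900 * L := by ring
    have t2 : 0 ≤ c * L := Nat.zero_le _
    simp only [WExp.cost] at a5 c5
    omega

end Verifier

section Verifier

variable {F : Type u} [Field F] [DecidableEq F] {E : Env F} {s : State F}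
variable {C : Circuit} {S : C.Exceptions} {L : ℕ}

/-! #### The run of the verifier -/

/-- The interaction. -/
def Cmd.verifierMain : Cmd :=
  .seq .verifierOpen (.seq (.count 1 (.op .sub .depth (.const 1)) .verifierLayer)
    (.check (fv 9 * fv 1) (fv 8)))

/-- The verifier. -/
def verifier : Party where
  init := .verifierInit
  update := .verifierUpdate
  main := .verifierMain

set_option maxRecDepth 4000 in
theorem Cmd.run_verifierMain (h : E.ForVerifier C S L) {P' : Strategy F}
    (hin : ∀ l k, E.inbox l k = some (P' l k)) {c : ℕ} {chal : ℕ → F} {a : C.Input F}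
    (hreg : ∀ i, 1 ≤ i → i < C.depth → ∀ f, IsRegularWith c (C.wiring i f) (S i f))
    (hs : s.SameChannels { State.start F with drawn := C.logSize C.depth }) (hbits : s.HasBits)
    (hsaved : ∀ q < C.logSize C.depth, s.fld 3 q = shift chal (C.pos (C.depth - 1)) q)
    (hvalue : s.fld 1 0 = mle (C.logSize C.depth) (shift chal (C.pos (C.depth - 1)))
      (C.layer a C.depth))
    (hcoin : ∀ t < C.pos (C.depth - 1), E.coin (C.logSize C.depth + t) = chal t) :
    (Cmd.verifierMain.run E s).blocked = false ∧
      (Cmd.verifierMain.run E s).sent = (List.range C.rounds).map chal ∧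
      (Cmd.verifierMain.run E s).received = C.numOutputs + 5 * C.rounds ∧
      (Cmd.verifierMain.run E s).output = (List.range C.numOutputs).map (P' []) ∧
      ((Cmd.verifierMain.run E s).rejected = false ↔
        C.Accepts chal a (P' []) (P'.message C.numOutputs chal)) ∧
      (Cmd.verifierMain.run E s).time
        ≤ s.time + 200 * C.numOutputs + 5000 * (c + 1) * (C.depth * L) := by
  have hd := C.two_le_depth
  have hw := h.bound
  have hL := h.one_le
  have hpos1 := C.pos_mono (show 1 ≤ C.depth - 1 by omega)
  have hpos1' : C.pos 1 = 2 * C.logSize 1 + 1 := by simp [Circuit.pos]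
  have hr : C.start₁ (C.depth - 1) = C.rounds := by
    rw [Circuit.start₁, Circuit.rounds, show C.depth - 1 + 1 = C.depth by omega]
  simp only [Cmd.verifierMain, Cmd.run_seq]
  obtain ⟨a1, a2, a3, a4, a5, a6, a7⟩ := Cmd.run_verifierOpen h hin (chal := chal) hs.blocked hs.sent
    hs.received hs.output (fun t ht => by
      rw [show s.drawn = C.logSize C.depth from hs.drawn, hcoin t (by omega)])
  set s₁ := Cmd.verifierOpen.run E s
  have hd₁ : s₁.drawn = C.logSize C.depth + C.logSize 1 := by rw [a2, hs.drawn]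
  have hrej : s₁.rejected = false := a3.trans hs.rejected
  have V₀ : s₁.VerifierAt C chal (P' []) (P'.message C.numOutputs chal) 0 :=
    ⟨by simpa [Circuit.start₁, Circuit.pos] using a1,
      fun q hq => by rw [a4 q hq]; simp [shift, Circuit.pos], by rw [a5, Circuit.scale],
      fun _ => by rw [hd₁]; simp [Circuit.start₁, Circuit.pos], by simp [hrej]⟩
  obtain ⟨b1, b2, b3⟩ := Cmd.run_count_const (E := E) (s := s₁) (i := 1)
    (n := .op .sub .depth (.const 1)) (N := C.depth - 1) (body := .verifierLayer) h.mem_pos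
    (by decide) a1.blocked
    (WExp.eval_op (o := .sub) h.eval_depth (WExp.eval_const (by omega))
      (by simp only [WordOp.eval]; omega))
    (fun k s' => s'.VerifierAt C chal (P' []) (P'.message C.numOutputs chal) k)
    (4000 * (c + 1) * L)
    ⟨⟨V₀.round.blocked, V₀.round.sent, V₀.round.received, V₀.round.output, V₀.round.claim⟩,
      V₀.point, V₀.scale, V₀.drawn, V₀.checks⟩
    (by
      rintro k hk s' hb' hk' _ hf ⟨⟨i1, i2, i3, i4, i5⟩, i6, i7, i8, i9⟩
      obtain ⟨⟨⟨e1, e2, e3, e4, e5⟩, e6, e7, e8, e9⟩, e10⟩ := Cmd.run_verifierLayer (s := s')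
        (chal := chal) (out := P' []) h hin (hreg (k + 1) (by omega) (by omega)) (by omega)
        ⟨⟨i1, i2, i3, i4, i5⟩, i6, i7, i8, i9⟩ hk'
        (by rw [State.HasBits, hf 12 (by decide), a6 12 (by decide)]; exact hbits)
        (by rw [hf 3 (by decide), a6 3 (by decide)]; exact hsaved) hcoin
      exact ⟨e1, e10, ⟨e1, e2, e3, e4, e5⟩, e6, e7, e8, e9⟩)
  have bF : ((Cmd.count 1 (.op .sub .depth (.const 1)) .verifierLayer).run E s₁).fld 1 = s₁.fld 1 :=
    Cmd.run_fld E _ s₁ (by decide)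
  set s₂ := (Cmd.count 1 (.op .sub .depth (.const 1)) .verifierLayer).run E s₁
  have hclaim : s₂.fld 8 0 = C.claim chal (P' []) (P'.message C.numOutputs chal) C.rounds := by
    rw [← hr]; exact b2.round.claim
  have hscale : s₂.fld 9 0 = C.scale chal (C.depth - 1) := b2.scale
  have hsent : s₂.sent = (List.range C.rounds).map chal := by rw [← hr]; exact b2.round.sent
  have hreceived : s₂.received = C.numOutputs + 5 * C.rounds := by
    rw [← hr]; exact b2.round.received
  have hchecks : s₂.rejected = false ↔ _ := b2.checks
  rw [Cmd.run_check b1, FExp.eval_mul, FExp.eval_var h.mem_pos, FExp.eval_var h.mem_pos,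
    FExp.eval_var h.mem_pos, hclaim, hscale, bF, a6 1 (by decide), hvalue]
  refine ⟨b1, hsent, hreceived, b2.round.output, ?_, ?_⟩
  · simp only [Bool.or_eq_false_iff, hchecks, ne_eq, decide_not, Bool.not_eq_false',
      decide_eq_true_eq]
    exact ⟨fun ⟨h1, h2⟩ => ⟨h1, h2⟩, fun h => ⟨h.layer, h.last⟩⟩
  · have t1 : (C.depth - 1) * (4000 * (c + 1) * L + 6) ≤ C.depth * (4000 * (c + 1) * L + 6 * L) :=
      Nat.mul_le_mul (by omega) (by omega)
    have t2 : 5000 * (c + 1) * (C.depth * L) = C.depth * (4000 * (c + 1) * L + 6 * L)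
        + 994 * (C.depth * L) + 1000 * c * (C.depth * L) := by ring
    have t3 : 2 * 1 ≤ C.depth * L := Nat.mul_le_mul hd hL
    have t4 : 0 ≤ 1000 * c * (C.depth * L) := Nat.zero_le _
    have t5 : (fv 9 * fv 1 : FExp).cost = 5 := rfl
    have t6 : (fv 8).cost = 2 := rfl
    simp only [WExp.cost] at b3
    simp only [t5, t6]
    omega

theorem verifier_observe (h : E.ForVerifier C S L) (σ : C.Stream F) :
    (verifier.observe E σ).VerifierSaw E C σ ∧ (verifier.observe E σ).time
      ≤ 20 + 9 * C.logSize C.depth + σ.length * (40 + 40 * C.logSize C.depth) := by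
  induction σ using List.reverseRecOn with
  | nil =>
    obtain ⟨h1, h2⟩ := Cmd.run_verifierInit h
    exact ⟨h1, h2.trans (by simp)⟩
  | append_singleton σ u ih =>
    rw [Party.observe_concat]
    obtain ⟨h1, h2⟩ := Cmd.run_verifierUpdate h ih.1 u
    refine ⟨h1, h2.trans ?_⟩
    have : (σ ++ [u]).length * (40 + 40 * C.logSize C.depth)
        = σ.length * (40 + 40 * C.logSize C.depth) + (40 + 40 * C.logSize C.depth) := by
      rw [List.length_append]; simp only [List.length_cons, List.length_nil]; ring
    have := ih.2
    omega

/-- The challenges that the verifier sends: the coordinates of the point at which it evaluates the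
multilinear extension of the input come last, although it draws them first. -/
def Circuit.challenges (C : Circuit) (coin : ℕ → F) (t : ℕ) : F :=
  if t < C.pos (C.depth - 1) then coin (C.logSize C.depth + t) else coin (t - C.pos (C.depth - 1))

theorem run_verifier (h : E.ForVerifier C S L) {P' : Strategy F}
    (hin : ∀ l k, E.inbox l k = some (P' l k)) {c : ℕ}
    (hreg : ∀ i, 1 ≤ i → i < C.depth → ∀ f, IsRegularWith c (C.wiring i f) (S i f))
    (σ : C.Stream F) :
    (verifier.run E σ).blocked = false ∧
      (verifier.run E σ).sent = (List.range C.rounds).map (C.challenges E.coin) ∧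
      (verifier.run E σ).received = C.numOutputs + 5 * C.rounds ∧
      (verifier.run E σ).output = (List.range C.numOutputs).map (P' []) ∧
      ((verifier.run E σ).rejected = false ↔
        C.Accepts (C.challenges E.coin) (C.frequency σ) (P' [])
          (P'.message C.numOutputs (C.challenges E.coin))) ∧
      (verifier.run E σ).time ≤ 20 + 9 * C.logSize C.depth
        + σ.length * (40 + 40 * C.logSize C.depth)
        + 200 * C.numOutputs + 5000 * (c + 1) * (C.depth * L) := by
  rw [Party.run_eq]
  obtain ⟨⟨a1, a2, a3, a4⟩, a5⟩ := verifier_observe (E := { E with inbox := fun _ _ => none })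
    ⟨h.answer, h.one_le, h.logSize_le, h.depth_lt, h.memory, h.word⟩ σ
  set s₀ := verifier.observe { E with inbox := fun _ _ => none } σ
  set s : State F := { s₀ with sent := [], received := 0 }
  have e : ∀ q, shift (C.challenges E.coin) (C.pos (C.depth - 1)) q = E.coin q := fun q => by
    rw [shift, Circuit.challenges, if_neg (by omega), Nat.add_sub_cancel_left]
  obtain ⟨b1, b2, b3, b4, b5, b6⟩ := Cmd.run_verifierMain (s := s) (a := C.frequency σ)
    (chal := C.challenges E.coin) h hin hreg
    ⟨rfl, rfl, a1.drawn, a1.output, a1.rejected, a1.blocked⟩ a2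
    (fun q hq => by rw [e]; exact a3 q hq)
    (by rw [show shift (C.challenges E.coin) (C.pos (C.depth - 1)) = E.coin from funext e]
        exact a4)
    (fun t ht => by rw [Circuit.challenges, if_pos ht])
  refine ⟨b1, b2, b3, b4, b5, b6.trans ?_⟩
  have : s.time = s₀.time := rfl
  omega

end Verifier

section Soundness

variable {F : Type u} [Field F] [DecidableEq F]

/-! ### Soundness -/

omit [DecidableEq F] in
theorem folds_congr {x y : ℕ → F} (T : ℕ → F) {m : ℕ} (h : ∀ j < m, x j = y j) :
    folds x T m = folds y T m := by
  induction m with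
  | zero => rfl
  | succ m ih => rw [folds, folds, ih fun j hj => h j (by omega), h m (by omega)]

/-- Once the challenges before number `t` have been chosen, at most four choices of challenge number
`t` can make `B` true. -/
def Rare {F : Type u} (B : (ℕ → F) → Prop) (t : ℕ) : Prop :=
  ∀ x : ℕ → F, ∃ Z : Finset F, Z.card ≤ 4 ∧ ∀ y : ℕ → F, (∀ j < t, y j = x j) → B y → y t ∈ Z

omit [Field F] [DecidableEq F] in
/-- A union bound: `T` rare events have probability at most `4 * T / |F|` together. The challenges
`ext R 0, ext R 1, …` are a permutation of the random field elements `R`. -/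
theorem card_rare_le [Fintype F] {N T : ℕ} {e : ℕ → ℕ} (he : ∀ t < T, e t < N)
    (hinj : ∀ t < T, ∀ t' < t, e t' ≠ e t) {B : ℕ → (ℕ → F) → Prop}
    (hB : ∀ t < T, Rare (B t) t) (ext : (Fin N → F) → ℕ → F)
    (hext : ∀ R t, ∀ ht : t < T, ext R t = R ⟨e t, he t ht⟩) (D : Finset (Fin N → F))
    (hD : ∀ R ∈ D, ∃ t < T, B t (ext R)) :
    D.card * Fintype.card F ≤ T * (4 * Fintype.card F ^ N) := by
  classical
  have hD' : D ⊆ (Finset.range T).biUnion fun t => D.filter fun R => B t (ext R) := fun R hR => by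
    obtain ⟨t, ht, hBt⟩ := hD R hR
    simp only [Finset.mem_biUnion, Finset.mem_range, Finset.mem_filter]
    exact ⟨t, ht, hR, hBt⟩
  have key : ∀ t < T, (D.filter fun R => B t (ext R)).card * Fintype.card F
      ≤ 4 * Fintype.card F ^ N := by
    intro t ht
    let j₀ : Fin N := ⟨e t, he t ht⟩
    have h1 := Finset.card_le_mul_card_image (f := fun R (j : {j : Fin N // j ≠ j₀}) => R j)
      (D.filter fun R => B t (ext R)) 4 (by
        intro r hr
        obtain ⟨R₀, -, hR₀⟩ := Finset.mem_image.1 hr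
        obtain ⟨Z, hZ, hmem⟩ := hB t ht (ext R₀)
        refine (Finset.card_le_card_of_injOn (fun R => R j₀) ?_ ?_).trans hZ
        · intro R hR
          simp only [Finset.coe_filter, Finset.mem_filter, Set.mem_ofPred_eq] at hR
          have := hmem (ext R) (fun j hj => by
            rw [hext R j (hj.trans ht), hext R₀ j (hj.trans ht)]
            exact congrFun (hR.2.trans hR₀.symm) ⟨⟨e j, he j (hj.trans ht)⟩, fun hc =>
              hinj t ht j hj (congrArg Fin.val hc)⟩) hR.1.2
          rwa [hext R t ht] at this
        · intro R hR R' hR' heq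
          simp only [Finset.coe_filter, Finset.mem_filter, Set.mem_ofPred_eq] at hR hR'
          funext j
          by_cases hj : j = j₀
          · rw [hj]; exact heq
          · exact congrFun (hR.2.trans hR'.2.symm) ⟨j, hj⟩)
    have h2 := Finset.card_le_univ ((D.filter fun R => B t (ext R)).image
      fun R (j : {j : Fin N // j ≠ j₀}) => R j)
    rw [Fintype.card_fun, Fintype.card_subtype_compl, Fintype.card_fin,
      Fintype.card_subtype_eq] at h2
    have hN : N = N - 1 + 1 := by have := he t ht; omega
    calc _ ≤ 4 * Fintype.card F ^ (N - 1) * Fintype.card F :=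
          Nat.mul_le_mul_right _ (h1.trans (Nat.mul_le_mul_left _ h2))
      _ = 4 * Fintype.card F ^ N := by rw [mul_assoc, ← pow_succ, ← hN]
  calc D.card * Fintype.card F
      ≤ (∑ t ∈ Finset.range T, (D.filter fun R => B t (ext R)).card) * Fintype.card F :=
        Nat.mul_le_mul_right _ ((Finset.card_le_card hD').trans Finset.card_biUnion_le)
    _ = ∑ t ∈ Finset.range T, (D.filter fun R => B t (ext R)).card * Fintype.card F :=
        Finset.sum_mul _ _ _
    _ ≤ ∑ t ∈ Finset.range T, 4 * Fintype.card F ^ N :=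
        Finset.sum_le_sum fun t ht => key t (Finset.mem_range.1 ht)
    _ = _ := by simp

/-- Challenge number `t` hides a deviation of the strategy `P'` from the strategy `P₀`: the difference
between the alleged outputs vanishes when coordinate `t` of the random point is fixed, or different
polynomials agree at the challenge. -/
def Strategy.Lucky (P' P₀ : Strategy F) (C : Circuit) (t : ℕ) (chal : ℕ → F) : Prop :=
  if t < C.logSize 1 then
    (∃ p < 2 ^ (C.logSize 1 - t), folds chal (fun p => P' [] p - P₀ [] p) t p ≠ 0) ∧
      ∀ p < 2 ^ (C.logSize 1 - (t + 1)), folds chal (fun p => P' [] p - P₀ [] p) (t + 1) p = 0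
  else
    (∃ c < 5, P'.message C.numOutputs chal t c ≠ P₀.message C.numOutputs chal t c) ∧
      horner (P'.message C.numOutputs chal t) (chal t)
        = horner (P₀.message C.numOutputs chal t) (chal t)

omit [Field F] [DecidableEq F] in
theorem Strategy.message_congr (P' : Strategy F) (O : ℕ) {x y : ℕ → F} {t : ℕ}
    (h : ∀ j < t, x j = y j) : P'.message O x t = P'.message O y t := by
  funext c
  rw [Strategy.message, Strategy.message,
    List.map_congr_left fun j hj => h j (List.mem_range.1 hj)]

theorem Strategy.rare_lucky [Fintype F] (P' P₀ : Strategy F) (C : Circuit) (t : ℕ) :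
    Rare (P'.Lucky P₀ C t) t := by
  intro x
  by_cases ht : t < C.logSize 1
  · simp only [Strategy.Lucky, if_pos ht]
    set D : ℕ → F := fun p => P' [] p - P₀ [] p
    by_cases hp : ∃ p < 2 ^ (C.logSize 1 - t), folds x D t p ≠ 0
    · obtain ⟨p, hp, hne⟩ := hp
      -- the vanishing entry of the folded table, as a polynomial in the challenge
      let c : ℕ → F := fun k => if k = 0 then folds x D t (2 * (p / 2)) else
        if k = 1 then folds x D t (2 * (p / 2) + 1) - folds x D t (2 * (p / 2)) else 0
      have hc : ∃ k < 5, c k ≠ (0 : ℕ → F) k := by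
        by_contra! hcon
        have h0 : folds x D t (2 * (p / 2)) = 0 := hcon 0 (by norm_num)
        have h1 : folds x D t (2 * (p / 2) + 1) - folds x D t (2 * (p / 2)) = 0 :=
          hcon 1 (by norm_num)
        rw [h0, sub_zero] at h1
        rcases Nat.mod_two_eq_zero_or_one p with h2 | h2
        · exact hne (by rwa [show 2 * (p / 2) = p by omega] at h0)
        · exact hne (by rwa [show 2 * (p / 2) + 1 = p by omega] at h1)
      refine ⟨_, card_horner_eq_le hc, fun y hy hl => ?_⟩
      have := hl.2 (p / 2) (by
        rw [show C.logSize 1 - t = C.logSize 1 - (t + 1) + 1 by omega, pow_succ] at hp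
        omega)
      rw [folds, folds_congr D hy, fold] at this
      simpa [c, horner] using this
    · exact ⟨∅, by simp, fun y hy hl => absurd hl.1 (by rwa [folds_congr D hy])⟩
  · simp only [Strategy.Lucky, if_neg ht]
    by_cases hm : ∃ c < 5, P'.message C.numOutputs x t c ≠ P₀.message C.numOutputs x t c
    · refine ⟨_, card_horner_eq_le hm, fun y hy hl => ?_⟩
      rw [P'.message_congr _ hy, P₀.message_congr _ hy] at hl
      simpa using hl.2
    · refine ⟨∅, by simp, fun y hy hl => absurd hl.1 ?_⟩
      rwa [P'.message_congr _ hy, P₀.message_congr _ hy]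

variable {C : Circuit} {S : C.Exceptions} {w : ℕ}

/-- If the verifier accepts wrong outputs, then a challenge was lucky. -/
theorem exists_lucky (hw : C.FitsProver w) (σ : C.Stream F) {P' : Strategy F} {chal : ℕ → F}
    (hacc : C.Accepts chal (C.frequency σ) (P' []) (P'.message C.numOutputs chal))
    (hne : (List.range C.numOutputs).map (P' []) ≠ C.outputs (C.frequency σ)) :
    ∃ t < C.rounds, P'.Lucky (prover.strategy C S w σ) C t chal := by
  by_contra! hcon
  have hd := C.two_le_depth
  have hr : C.start₁ (C.depth - 1) = C.rounds := by
    rw [Circuit.start₁, Circuit.rounds, show C.depth - 1 + 1 = C.depth by omega]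
  have hr1 := C.logSize_one_le_start₁ (C.depth - 1)
  have hmsg : ∀ t < C.rounds, ∀ c < 5,
      (prover.strategy C S w σ).message C.numOutputs chal t c
        = C.honest chal (C.frequency σ) t c :=
    fun t ht c hc => strategy_honest S hw σ chal ht hc
  have h1 := C.sound_of_accepts chal (C.frequency σ) hacc fun t ht ht' hdev heq => by
    refine hcon t ht' ?_
    rw [Strategy.Lucky, if_neg (by omega)]
    refine ⟨?_, ?_⟩
    · obtain ⟨c, hc, hdev⟩ := hdev
      exact ⟨c, hc, by rwa [hmsg t ht' c hc]⟩
    · rw [heq]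
      exact (horner_congr (hmsg t ht') _).symm
  set D : ℕ → F := fun p => P' [] p - prover.strategy C S w σ [] p with hD
  have hzero : folds chal D (C.logSize 1) 0 = 0 := by
    rw [folds_zero_eq_mle, ← sub_eq_zero.2 h1, mle, mle, mle, ← Finset.sum_sub_distrib]
    refine Finset.sum_congr rfl fun p hp => ?_
    rw [hD]
    simp only
    rw [strategy_outputs S hw σ (Finset.mem_range.1 hp), mul_sub]
  have hall : ∀ t ≤ C.logSize 1, ∃ p < 2 ^ (C.logSize 1 - t), folds chal D t p ≠ 0 := by
    intro t ht
    induction t with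
    | zero =>
      by_contra! h
      refine hne ?_
      rw [C.outputs_eq]
      refine List.map_congr_left fun p hp => ?_
      have hp' : p < C.numOutputs := List.mem_range.1 hp
      have h0 : P' [] p - prover.strategy C S w σ [] p = 0 := h p hp'
      rw [strategy_outputs S hw σ hp'] at h0
      exact sub_eq_zero.1 h0
    | succ t ih =>
      by_contra! h
      refine hcon t (by omega) ?_
      rw [Strategy.Lucky, if_pos (by omega)]
      exact ⟨ih (by omega), h⟩
  obtain ⟨p, hp, hp'⟩ := hall _ le_rfl
  rw [Nat.sub_self, pow_zero, Nat.lt_one_iff] at hp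
  exact hp' (hp ▸ hzero)

end Soundness

section Main

/-! ### Bounds in terms of the logarithm of the size -/

namespace Circuit

variable (C : Circuit)

theorem two_pow_logSize_le {i : ℕ} (h₁ : 1 ≤ i) (h₂ : i ≤ C.depth) : 2 ^ C.logSize i ≤ C.size :=
  Finset.single_le_sum (f := fun i => 2 ^ C.logSize i) (fun _ _ => Nat.zero_le _)
    (Finset.mem_Icc.2 ⟨h₁, h₂⟩)

theorem logSize_le_log {i : ℕ} (h₁ : 1 ≤ i) (h₂ : i ≤ C.depth) :
    C.logSize i ≤ Nat.log 2 C.size := by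
  have := Nat.log_mono_right (b := 2) (C.two_pow_logSize_le h₁ h₂)
  rwa [Nat.log_pow (by norm_num)] at this

theorem one_le_log : 1 ≤ Nat.log 2 C.size :=
  Nat.log_pos (by norm_num) (C.two_le_depth.trans (depth_le_size C))

theorem depth_lt_two_pow_log : C.depth < 2 ^ (Nat.log 2 C.size + 1) :=
  (depth_le_size C).trans_lt (Nat.lt_pow_succ_log_self (by norm_num) _)

theorem rounds_le : C.rounds ≤ 3 * (C.depth * Nat.log 2 C.size) := by
  have hL := C.one_le_log
  have hd := C.two_le_depth
  have key : ∀ k ≤ C.depth - 1, C.pos k ≤ k * (2 * Nat.log 2 C.size + 1) := by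
    intro k hk
    induction k with
    | zero => exact Nat.zero_le _
    | succ k ih =>
      have h1 := ih (by omega)
      have h2 := C.logSize_le_log (i := k + 1) (by omega) (by omega)
      rw [pos, add_mul, one_mul]
      omega
  have h1 := key _ le_rfl
  have h2 := C.logSize_le_log (i := C.depth) (by omega) le_rfl
  obtain ⟨d, hd'⟩ : ∃ d, C.depth = d + 1 := ⟨C.depth - 1, by omega⟩
  have h3 : (C.depth - 1) * (2 * Nat.log 2 C.size + 1) ≤ d * (3 * Nat.log 2 C.size) :=
    Nat.mul_le_mul (by omega) (by omega)
  have h4 : 3 * (C.depth * Nat.log 2 C.size)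
      = d * (3 * Nat.log 2 C.size) + 3 * Nat.log 2 C.size := by rw [hd']; ring
  rw [rounds]
  omega

theorem fitsProver {w : ℕ} (hw : 20 * Nat.log 2 C.size ≤ w) : C.FitsProver w := by
  have hL := C.one_le_log
  have hd := C.depth_lt_two_pow_log
  set L := Nat.log 2 C.size
  refine ⟨?_, fun i h₁ h₂ => ?_⟩
  · have := Nat.pow_le_pow_right (show 0 < 2 by norm_num) (show 3 ≤ w by omega)
    omega
  · have h1 : 2 ^ C.logSize i ≤ 2 ^ L :=
      Nat.pow_le_pow_right (by norm_num) (C.logSize_le_log h₁ h₂)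
    have h2 : 2 ^ C.logSize i * (C.depth + 1) ≤ 2 ^ L * 2 ^ (L + 1) := Nat.mul_le_mul h1 hd
    have h3 : 2 ^ (L + 1) ≤ 2 ^ L * 2 ^ (L + 1) := Nat.le_mul_of_pos_left _ (by positivity)
    have h4 : 2 ^ (2 * L + 2) ≤ 2 ^ w := Nat.pow_le_pow_right (by norm_num) (by omega)
    have h5 : 2 ^ (2 * L + 2) = 2 * (2 ^ L * 2 ^ (L + 1)) := by ring
    omega

theorem forVerifier {F : Type u} {E : Env F} {S : C.Exceptions} (hE : E.answer = C.answer S)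
    (hM : 20 * Nat.log 2 C.size ≤ E.memSize) (hw : 20 * Nat.log 2 C.size ≤ E.wordSize) :
    E.ForVerifier C S (Nat.log 2 C.size) := by
  have hL := C.one_le_log
  exact ⟨hE, hL, fun i h₁ h₂ => C.logSize_le_log h₁ h₂, C.depth_lt_two_pow_log, by omega,
    Nat.pow_le_pow_right (by norm_num) (by omega)⟩

/-- For `n = 1` the number `n` is not bounded in terms of `n * log n`. -/
theorem numInputs_le :
    C.numInputs ≤ C.numInputs * C.logSize C.depth + C.depth * Nat.log 2 C.size := by
  have hd := C.two_le_depth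
  have hL := Nat.mul_le_mul hd C.one_le_log
  rcases Nat.eq_zero_or_pos (C.logSize C.depth) with h0 | h0
  · have : C.numInputs = 1 := by rw [numInputs, h0, pow_zero]
    omega
  · exact (Nat.le_mul_of_pos_right _ h0).trans (Nat.le_add_right _ _)

end Circuit

theorem verifierTime_le {c l n b O D : ℕ} (hl : l ≤ c * n) (hn : n ≤ n * b + D) (hb : b ≤ D)
    (hD : 2 ≤ D) : 20 + 9 * b + l * (40 + 40 * b) + 200 * O + 5000 * (c + 1) * D
      ≤ 20000 * (c + 1) * (n * b + O + D) := by
  have k1 : l * (40 + 40 * b) ≤ c * (80 * (n * b) + 40 * D) := by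
    refine (Nat.mul_le_mul_right _ hl).trans ?_
    rw [show c * n * (40 + 40 * b) = c * (40 * n + 40 * (n * b)) by ring]
    exact Nat.mul_le_mul_left _ (by omega)
  have k2 : 20000 * (c + 1) * (n * b + O + D)
      = 20000 * (n * b) + 20000 * O + 20000 * D
        + 20000 * (c * (n * b)) + 20000 * (c * O) + 20000 * (c * D) := by ring
  have k3 : c * (80 * (n * b) + 40 * D) = 80 * (c * (n * b)) + 40 * (c * D) := by ring
  have k4 : 5000 * (c + 1) * D = 5000 * D + 5000 * (c * D) := by ring
  omega

open Classical in
theorem IsValidProtocol.of_card {X Ω T Y : Type*} [Fintype Ω] [Nonempty Ω] {f : X → Y}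
    {out : X → Ω → T → Option Y} {P : X → T} (complete : ∀ x R, out x R (P x) = some (f x))
    (sound : ∀ x P' (D : Finset Ω), (∀ R ∈ D, out x R P' ≠ some (f x) ∧ out x R P' ≠ none) →
      D.card * 3 ≤ Fintype.card Ω) : IsValidProtocol f out P where
  complete := complete
  sound x P' := by
    have hpos : 0 < Fintype.card Ω := Fintype.card_pos
    rw [div_le_div_iff₀ (by positivity) (by norm_num), one_mul]
    exact_mod_cast sound x P' _ fun R hR => (Finset.mem_filter.1 hR).2

end Main

theorem theorem1 (c : ℕ) :
    ∃ (K : ℕ) (V P : Party),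
      ∀ (F : Type u) [Field F] [Fintype F] [DecidableEq F] (C : Circuit) (S : C.Exceptions),
        (∀ i, 1 ≤ i → i < C.depth → ∀ f, IsRegularWith c (C.wiring i f) (S i f)) →
        (C.dissimilarLayers c).card ≤ c →
        K * (C.depth * Nat.log 2 C.size) ≤ Fintype.card F →
        ∀ w, K * Nat.log 2 C.size ≤ w →
          let verifierTime := K * (C.numInputs * Nat.log 2 C.numInputs + C.numOutputs
            + C.depth * Nat.log 2 C.size)
          let verifierSpace := K * Nat.log 2 C.size
          let communication := C.numOutputs + K * (C.depth * Nat.log 2 C.size)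
          let proverTime := K * C.size
          let X := {σ : C.Stream F // σ.length ≤ c * C.numInputs}
          let verify := fun (σ : X) (R : Fin verifierTime → F) (P' : Strategy F) =>
            V.runVerifier C S w verifierSpace σ.1 R P'
          let prove := fun (σ : X) => P.strategy C S w σ.1
          IsValidProtocol (fun σ : X => C.outputs (C.frequency σ.1))
              (fun σ R P' => (verify σ R P').outcome) prove ∧
            ∀ (σ : X) (R : Fin verifierTime → F),
              (∀ P' : Strategy F, (verify σ R P').time ≤ verifierTime ∧
                (verify σ R P').sent.length + (verify σ R P').received ≤ communication) ∧
              (verify σ R (prove σ)).sent.length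
                + (P.runProver C S w σ.1 (verify σ R (prove σ)).sent).sent.length
                ≤ communication ∧
              (P.runProver C S w σ.1 (verify σ R (prove σ)).sent).time ≤ proverTime := by
  refine ⟨20000 * (c + 1), verifier, prover, ?_⟩
  intro F _ _ _ C S hreg _ hF w hw verifierTime verifierSpace communication proverTime X verify prove
  have hd := C.two_le_depth
  have hL := C.one_le_log
  have hT := C.rounds_le
  have hn : Nat.log 2 C.numInputs = C.logSize C.depth := Nat.log_pow (by norm_num) _
  have hsd := C.logSize_le_log (i := C.depth) (by omega) le_rfl
  have hni : C.numInputs ≤ C.size := C.two_pow_logSize_le (by omega) le_rfl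
  set L := Nat.log 2 C.size
  have hsd_le : C.logSize C.depth ≤ C.depth * L :=
    hsd.trans (Nat.le_mul_of_pos_left _ (by omega))
  have hdL : 2 * L ≤ C.depth * L := Nat.mul_le_mul_right _ hd
  have hKL : 20 * L ≤ 20000 * (c + 1) * L := Nat.mul_le_mul_right _ (by omega)
  have hKdL : 36 * (C.depth * L) ≤ 20000 * (c + 1) * (C.depth * L) :=
    Nat.mul_le_mul_right _ (by omega)
  have hfit : C.FitsProver w := C.fitsProver (hKL.trans hw)
  have hTV : C.rounds ≤ verifierTime := by
    have : 20000 * (c + 1) * (C.depth * L) ≤ verifierTime :=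
      Nat.mul_le_mul_left _ (Nat.le_add_left _ _)
    omega
  let coin : (Fin verifierTime → F) → ℕ → F := fun R k => if h : k < verifierTime then R ⟨k, h⟩ else 0
  have hV : ∀ (σ : X) (R : Fin verifierTime → F) (P' : Strategy F), _ := fun σ R P' =>
    run_verifier (C := C) (S := S) (L := L) (E := {
      wordSize := w
      memSize := verifierSpace
      answer := C.answer S
      inbox := fun sent k => some (P' sent k)
      coin := coin R }) (C.forVerifier rfl hKL (hKL.trans hw)) (fun _ _ => rfl) hreg σ.1
  have hout : ∀ (σ : X) (R : Fin verifierTime → F) (P' : Strategy F), (verify σ R P').outcome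
      = if (verify σ R P').rejected then none else some ((List.range C.numOutputs).map (P' [])) := by
    intro σ R P'
    obtain ⟨h1, -, -, h4, -, -⟩ := hV σ R P'
    have h1' : (verify σ R P').blocked = false := h1
    have h4' : (verify σ R P').output = _ := h4
    rw [State.outcome, h1', h4', Bool.or_false]
  refine ⟨.of_card (fun σ R => ?_) fun σ P' D hD => ?_, fun σ R => ⟨fun P' => ?_, ?_⟩⟩
  · have hacc := C.accepts_honest (C.challenges (coin R)) (C.frequency σ.1)
      (msg := (prove σ).message C.numOutputs (C.challenges (coin R)))
      (fun t ht c hc => strategy_honest S hfit σ.1 _ ht hc) (prove σ [])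
      fun p hp => strategy_outputs S hfit σ.1 hp
    have hrej : (verify σ R (prove σ)).rejected = false :=
      (hV σ R (prove σ)).2.2.2.2.1.2 hacc
    simp only [hout, hrej, Bool.false_eq_true, if_false, C.outputs_eq]
    exact congrArg some (List.map_congr_left fun p hp =>
      strategy_outputs S hfit σ.1 (List.mem_range.1 hp))
  · -- the number of the random field element that becomes challenge number `t`
    let e : ℕ → ℕ := fun t =>
      if t < C.pos (C.depth - 1) then C.logSize C.depth + t else t - C.pos (C.depth - 1)
    have he : ∀ t < C.rounds, e t < C.rounds := fun t ht => by
      simp only [e, Circuit.rounds] at ht ⊢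
      split_ifs <;> omega
    have hinj : ∀ t < C.rounds, ∀ t' < t, e t' ≠ e t := fun t ht t' ht' => by
      simp only [e, Circuit.rounds] at ht ⊢
      split_ifs <;> omega
    have hext : ∀ R t, ∀ ht : t < C.rounds,
        C.challenges (coin R) t = R ⟨e t, (he t ht).trans_le hTV⟩ := fun R t ht => by
      have h1 : C.challenges (coin R) t = coin R (e t) := by
        simp only [Circuit.challenges, e]
        split_ifs <;> rfl
      rw [h1]
      exact dif_pos ((he t ht).trans_le hTV)
    have key := card_rare_le (fun t ht => (he t ht).trans_le hTV) hinj
      (fun t _ => P'.rare_lucky (prove σ) C t) (fun R => C.challenges (coin R)) hext D (by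
        intro R hR
        obtain ⟨h1, h2⟩ := hD R hR
        rw [hout] at h1 h2
        have hrej : (verify σ R P').rejected = false := by
          by_contra hc
          exact h2 (if_pos (by simpa using hc))
        rw [if_neg (by simp [hrej])] at h1
        exact exists_lucky hfit σ.1 ((hV σ R P').2.2.2.2.1.1 hrej)
          fun hc => h1 (congrArg some hc))
    rw [Fintype.card_fun, Fintype.card_fin]
    refine Nat.le_of_mul_le_mul_right ?_ (Fintype.card_pos (α := F))
    calc D.card * 3 * Fintype.card F = D.card * Fintype.card F * 3 := by ring
      _ ≤ C.rounds * (4 * Fintype.card F ^ verifierTime) * 3 := Nat.mul_le_mul_right _ key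
      _ = Fintype.card F ^ verifierTime * (12 * C.rounds) := by ring
      _ ≤ Fintype.card F ^ verifierTime * Fintype.card F := Nat.mul_le_mul_left _ (by omega)
  · obtain ⟨-, h2, h3, -, -, h6⟩ := hV σ R P'
    refine ⟨h6.trans ?_, ?_⟩
    · show _ ≤ 20000 * (c + 1) * (C.numInputs * Nat.log 2 C.numInputs + C.numOutputs
        + C.depth * L)
      rw [hn]
      exact verifierTime_le σ.2 C.numInputs_le hsd_le (by omega)
    · show (verifier.run _ _).sent.length + (verifier.run _ _).received
        ≤ C.numOutputs + 20000 * (c + 1) * (C.depth * L)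
      rw [h2, h3, List.length_map, List.length_range]
      omega
  · have h2 : (verify σ R (prove σ)).sent = (List.range C.rounds).map (C.challenges (coin R)) :=
      (hV σ R (prove σ)).2.1
    obtain ⟨-, g2, g3⟩ := runProver_spec S hfit σ.1 (C.challenges (coin R)) (le_refl C.rounds)
    rw [h2, g2, List.length_map, List.length_range, min_eq_right (Nat.le_succ _)]
    refine ⟨?_, (g3 rfl).trans ?_⟩
    · show _ ≤ C.numOutputs + 20000 * (c + 1) * (C.depth * L)
      omega
    · show _ ≤ 20000 * (c + 1) * C.size
      have k1 : σ.1.length * 40 ≤ c * C.size * 40 :=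
        Nat.mul_le_mul_right _ (σ.2.trans (Nat.mul_le_mul_left _ hni))
      have k2 : 20000 * (c + 1) * C.size
          = c * C.size * 40 + 19960 * (c * C.size) + 20000 * C.size := by ring
      have k3 : 1 ≤ C.numInputs := Nat.one_le_two_pow
      omega
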